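/- Let $n\ge 1$ and $Q=(-1,1)\times\mathbb R^n$; indices $i,j$ run over $0,\dots,n$ with $x_0=t$. Let $g^{ij}$ be real functions on $\mathbb R^{1+n}$ with $g^{ij}=g^{ji}$, $g^{00}=1$, uniformly of signature $(1,n)$, i.e. for some $c>0$ $$\Big(\sum_{j\ge1} g^{0j}\xi_j\Big)^2-\sum_{i,j\ge 1}g^{ij}\xi_i\xi_j\ \ge\ c|\xi|^2\qquad\text{everywhere, for all }\xi\in\mathbb R^n,$$ bounded and Lipschitz, with $\partial^2 g^{ij}\in L^2_tL^\infty_x$ (distributional derivatives). Let $\phi\in C^\infty(\mathbb R)$ be real, supported in $[\frac12,2]$, with $\sum_{k\in\mathbb Z}\phi(2^{-k}r)=1$ for $r>0$. Let $\lambda,\mu,d$ denote dyadic numbers $1,2,4,\dots$. Put $S_\lambda(\xi)=\phi(|\xi|/\lambda)$ for $\lambda>1$, $S_1=1-\sum_{\lambda>1}S_\lambda$, and let $S_\lambda=S_\lambda(D_x)$ be the corresponding spatial Fourier multipliers. Let $g^{ij}_{<\sqrt\lambda}=\sum_\mu S_\mu(D_t,D_x)g^{ij}$, where the sum is over dyadic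 $1\le\mu\le\sqrt\lambda/2$ with $\mu=1$ always included and $S_\mu(D_t,D_x)$ has the same radial symbol in the space-time frequency $(\tau,\xi)$; put $\Box_\lambda=\sum_{i,j} g^{ij}_{<\sqrt\lambda}\partial_i\partial_j$. All functions are complex valued, $L^2=L^2(Q)$, $L^2H^\sigma=L^2((-1,1);H^\sigma(\mathbb R^n))$, and $\Box_\lambda$ acts in the sense of distributions on $Q$. For $s,\theta\in\mathbb R$ and $v,\Box_\lambda v\in L^2$ let $$\|v\|_{X^{s,\theta}_{\lambda,d}}^2=\lambda^{2s}d^{2\theta}\|v\|_{L^2}^2+\lambda^{2s-2}d^{2\theta-2}\|\Box_\lambda v\|_{L^2}^2 .$$ For $0<\theta<1$, $X^{s,\theta}$ is the space of $u\in L^2H^s$ for which $$\|u\|_{X^{s,\theta}}^2=\inf\Big\{\sum_{\lambda\ge1}\sum_{d\le\lambda}\|u_{\lambda,d}\|^2_{X^{s,\theta}_{\lambda,d}}\ :\ u=\sum_{\lambda\ge1}\sum_{d\le\lambda}S_\lambda u_{\lambda,d}\Big\}$$ is finite, and $X^{s-1,\theta-1}$ is the space of distributions $f$ on $Q$ for which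 $$\|f\|_{X^{s-1,\theta-1}}^2=\inf\Big\{\|f_0\|_{L^2H^{s-1}}^2+\sum_{\lambda\ge1}\sum_{d\le\lambda}\|f_{\lambda,d}\|^2_{X^{s,\theta}_{\lambda,d}}\ :\ f=f_0+\sum_{\lambda\ge1}\sum_{d\le\lambda}\Box_\lambda S_\lambda f_{\lambda,d}\Big\}$$ is finite (the sums converging in the sense of distributions). The space $X^{s,\theta}+L^2H^{s+\theta}$ carries the norm $\inf\{\|u_1\|_{X^{s,\theta}}+\|u_2\|_{L^2H^{s+\theta}}:u=u_1+u_2\}$. **Lemma (duality).** Let $s\in\mathbb R$ and $0<\theta<\frac12$. Then $$X^{-s,-\theta}=(X^{s,\theta}+L^2H^{s+\theta})'$$ with respect to the pairing $\int_Q u f\,dx\,dt$ and with equivalent norms. That is, $C_c^\infty(Q)\subset X^{s,\theta}+L^2H^{s+\theta}$, and there is a linear bijection $f\mapsto T_f$ from $X^{-s,-\theta}$ onto the space of bounded linear functionals on $X^{s,\theta}+L^2H^{s+\theta}$ such that $T_f(\psi)=\langle f,\psi\rangle$ for every test function $\psi\in C_c^\infty(Q)$, and, with a constant $C$ that does not depend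 on $f$, $$C^{-1}\|f\|_{X^{-s,-\theta}}\le\|T_f\|\le C\|f\|_{X^{-s,-\theta}} .$$ -/

import Mathlib

open MeasureTheory Set TopologicalSpace
open scoped ENNReal NNReal Distributions FourierTransform ContDiff

noncomputable section

namespace WaveX

/-! ### Space-time, test functions, wave coefficients -/

/-- The spatial domain `ℝⁿ`. -/
abbrev Sp (n : ℕ) : Type := EuclideanSpace ℝ (Fin n)

/-- Space-time `ℝ × ℝⁿ`, with points `(t, x)`. -/
abbrev ST (n : ℕ) : Type := ℝ × Sp n

/-- The slab `(-1, 1) × ℝⁿ` on which all functions and distributions `u` live. -/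
def slab (n : ℕ) : Opens (ST n) :=
  ⟨Ioo (-1 : ℝ) 1 ×ˢ univ, isOpen_Ioo.prod isOpen_univ⟩

/-- Lebesgue measure on the slab. -/
def slabMeasure (n : ℕ) : Measure (ST n) := volume.restrict (slab n : Set (ST n))

/-- `L² = L²((-1, 1) × ℝⁿ; ℂ)`. -/
abbrev L2 (n : ℕ) : Type := Lp ℂ 2 (slabMeasure n)

/-- The coordinate directions of space-time; index `0` is time. -/
def dir {n : ℕ} (i : Fin (n + 1)) : ST n :=
  Fin.cases (1, 0) (fun j : Fin n => (0, EuclideanSpace.single j 1)) i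

/-- The partial derivative `∂_i f`. -/
def pd {n : ℕ} {F : Type} [NormedAddCommGroup F] [NormedSpace ℝ F]
    (i : Fin (n + 1)) (f : ST n → F) (z : ST n) : F :=
  fderiv ℝ f z (dir i)

/-- `h = ∂_a ∂_b f` in the sense of distributions on `ℝ × ℝⁿ`. -/
def IsWeakSecondDeriv {n : ℕ} (a b : Fin (n + 1)) (f h : ST n → ℝ) : Prop :=
  ∀ ψ : ST n → ℝ, ContDiff ℝ ∞ ψ → HasCompactSupport ψ →
    ∫ z, f z * pd a (pd b ψ) z = ∫ z, h z * ψ z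

/-- The hypotheses on the coefficients `g^{ij}` (`0 ≤ i, j ≤ n`): symmetric, `g^{00} = 1`,
uniformly of signature `(1, n)`, bounded, Lipschitz, with `∂² g ∈ L²_t L^∞_x`. -/
structure Admissible {n : ℕ} (g : Fin (n + 1) → Fin (n + 1) → ST n → ℝ) : Prop where
  symm : ∀ i j z, g i j z = g j i z
  time : ∀ z, g 0 0 z = 1
  /-- As `g^{00} = 1`, one has
  `g^{ij} ζ_i ζ_j = (ζ_0 + g^{0j} ξ_j)² - ((g^{0j} ξ_j)² - g^{ij} ξ_i ξ_j)` for `ζ = (ζ_0, ξ)`: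
  the signature is `(1, n)` iff the second form is positive definite on `ℝⁿ`. -/
  hyperbolic : ∃ c : ℝ, 0 < c ∧ ∀ (z : ST n) (ξ : Sp n),
    c * ‖ξ‖ ^ 2 ≤ (∑ j : Fin n, g 0 j.succ z * ξ j) ^ 2
      - ∑ i : Fin n, ∑ j : Fin n, g i.succ j.succ z * ξ i * ξ j
  bounded : ∃ B : ℝ, ∀ i j z, |g i j z| ≤ B
  lipschitz : ∃ K : ℝ≥0, ∀ i j, LipschitzWith K (g i j)
  second : ∀ i j a b, ∃ h : ST n → ℝ, Measurable h ∧ IsWeakSecondDeriv a b (g i j) h ∧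
    ∫⁻ t : ℝ, (eLpNorm (fun x : Sp n => h (t, x)) ⊤ volume) ^ 2 < ⊤

/-! ### Littlewood-Paley multipliers -/

/-- A radial profile `φ` of a dyadic partition of unity. -/
structure IsLPProfile (φ : ℝ → ℝ) : Prop where
  smooth : ContDiff ℝ ∞ φ
  supp : Function.support φ ⊆ Icc (1 / 2) 2
  sum_one : ∀ r : ℝ, 0 < r → HasSum (fun j : ℤ => φ ((2 : ℝ) ^ (-j) * r)) 1

/-- The symbol of `S_λ`, `λ = 2 ^ k`, as a function of the length `r` of the frequency variable:
`φ (r / λ)` for `λ > 1`, and `1 - ∑_{μ > 1} φ (r / μ)` for `λ = 1`. -/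
def lpSymbol (φ : ℝ → ℝ) : ℕ → ℝ → ℝ
  | 0, r => 1 - ∑' k : ℕ, φ (r / 2 ^ (k + 1))
  | k + 1, r => φ (r / 2 ^ (k + 1))

/-- The convolution kernel of `m(|D|)`, `D = -i ∂`. (The factor `2π` converts the frequency
variable of Mathlib's Fourier transform, with phase `e^{2πi⟨x, η⟩}`, into `ξ = 2πη`.) -/
def radialKernel {V : Type} [NormedAddCommGroup V] [InnerProductSpace ℝ V] [FiniteDimensional ℝ V]
    [MeasurableSpace V] [BorelSpace V] (m : ℝ → ℝ) (x : V) : ℂ :=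
  𝓕⁻ (fun η : V => (m (2 * Real.pi * ‖η‖) : ℂ)) x

/-- `S_λ(D_x) v`, `λ = 2 ^ k`: the spatial Littlewood-Paley projection. -/
def lpProj {n : ℕ} (φ : ℝ → ℝ) (k : ℕ) (v : ST n → ℂ) (z : ST n) : ℂ :=
  ∫ y : Sp n, radialKernel (lpSymbol φ k) y * v (z.1, z.2 - y)

/-- The symbol of `S_{<√λ}`, `λ = 2 ^ k`: the sum of the symbols of `S_μ` over the dyadic
`1 ≤ μ ≤ √λ / 2`, where `μ = 1` is always included. -/
def truncSymbol (φ : ℝ → ℝ) (k : ℕ) (r : ℝ) : ℝ :=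
  ∑ j ∈ Finset.range (max 1 (k / 2)), lpSymbol φ j r

/-- `g_{<√λ} = S_{<√λ}(D_x, D_t) g`, `λ = 2 ^ k`: the space-time truncation of a coefficient. -/
def trunc {n : ℕ} (φ : ℝ → ℝ) (k : ℕ) (g : ST n → ℝ) (z : ST n) : ℂ :=
  ∫ w : ST n, radialKernel (truncSymbol φ k) (WithLp.toLp 2 w : WithLp 2 (ℝ × Sp n)) *
    (g (z - w) : ℂ)

/-! ### The operators `□_{g_{<√λ}}` -/

/-- The transpose of `□_{g_{<√λ}} = g^{ij}_{<√λ} ∂_i ∂_j`, applied to a test function: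
`∑_{i,j} ∂_i ∂_j (g^{ij}_{<√λ} ψ)`. -/
def boxT {n : ℕ} (φ : ℝ → ℝ) (g : Fin (n + 1) → Fin (n + 1) → ST n → ℝ) (k : ℕ)
    (ψ : ST n → ℝ) (z : ST n) : ℂ :=
  ∑ i, ∑ j, pd i (pd j (fun w => trunc φ k (g i j) w * (ψ w : ℂ))) z

/-- `□_{g_{<√λ}} v = F` in the sense of distributions on the slab, with `v, F ∈ L²`, `λ = 2 ^ k`. -/
def HasWeakBox {n : ℕ} (φ : ℝ → ℝ) (g : Fin (n + 1) → Fin (n + 1) → ST n → ℝ) (k : ℕ)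
    (v F : L2 n) : Prop :=
  ∀ ψ : 𝓓(slab n, ℝ),
    ∫ z, v z * boxT φ g k ψ z ∂(slabMeasure n) = ∫ z, F z * (ψ z : ℂ) ∂(slabMeasure n)

/-! ### The norms

All norms are functions on the distributions on the slab with values in `[0, ∞]`; the value is
`∞` (infimum over the empty set) off the space. -/

/-- The norm of `L² H^σ = L²((-1, 1); H^σ(ℝⁿ))`: `u` has norm `‖W‖_{L²}` if its spatial Fourier
transform is the function `(1 + |ξ|²)^{-σ/2} W`, i.e. if
`⟨u, ψ⟩ = ∫ (1 + |ξ|²)^{-σ/2} W(t, η) (𝓕_x⁻¹ ψ)(t, η) dt dη` for all test functions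
(with `ξ = 2πη`). -/
def normL2H {n : ℕ} (σ : ℝ) (u : 𝓓'(slab n, ℂ)) : ℝ≥0∞ :=
  ⨅ (W : L2 n) (_ : ∀ ψ : 𝓓(slab n, ℝ), u ψ =
      ∫ z, (((1 + (2 * Real.pi * ‖z.2‖) ^ 2) ^ (-σ / 2) : ℝ) : ℂ)
      * W z * 𝓕⁻ (fun y : Sp n => (ψ (z.1, y) : ℂ)) z.2 ∂(slabMeasure n)), ‖W‖ₑ

/-- `‖v‖²` in `X^{s,θ}_{λ,d}` for `λ = 2 ^ k`, `d = 2 ^ j`, where `F = □_{g_{<√λ}} v`. -/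
def pieceSq {n : ℕ} (s θ : ℝ) (k j : ℕ) (v F : L2 n) : ℝ≥0∞ :=
  ENNReal.ofReal (((2 : ℝ) ^ k) ^ (2 * s) * ((2 : ℝ) ^ j) ^ (2 * θ) * ‖v‖ ^ 2
    + ((2 : ℝ) ^ k) ^ (2 * s - 2) * ((2 : ℝ) ^ j) ^ (2 * θ - 2) * ‖F‖ ^ 2)

/-- `∑_{λ ≥ 1} ∑_{1 ≤ d ≤ λ} ‖v_{λ,d}‖²` in `X^{s,θ}_{λ,d}`, over dyadic `λ = 2 ^ k`, `d = 2 ^ j`,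
where `F_{λ,d} = □_{g_{<√λ}} v_{λ,d}`. -/
def totalSq {n : ℕ} (s θ : ℝ) (v F : ℕ → ℕ → L2 n) : ℝ≥0∞ :=
  ∑' k : ℕ, ∑ j ∈ Finset.range (k + 1), pieceSq s θ k j (v k j) (F k j)

/-- The norm of `X^{s,θ}`, for `0 < θ < 1`: the infimum over all decompositions
`u = ∑_λ ∑_{d ≤ λ} S_λ v_{λ,d}`. -/
def normXPos {n : ℕ} (φ : ℝ → ℝ) (g : Fin (n + 1) → Fin (n + 1) → ST n → ℝ) (s θ : ℝ)
    (u : 𝓓'(slab n, ℂ)) : ℝ≥0∞ :=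
  (⨅ (v : ℕ → ℕ → L2 n) (F : ℕ → ℕ → L2 n)
    (_ : normL2H s u < ⊤)
    (_ : ∀ k j, j ≤ k → HasWeakBox φ g k (v k j) (F k j))
    (_ : ∀ ψ : 𝓓(slab n, ℝ), HasSum (fun k : ℕ => ∑ j ∈ Finset.range (k + 1),
      ∫ z, lpProj φ k (v k j) z * (ψ z : ℂ) ∂(slabMeasure n)) (u ψ)),
    totalSq s θ v F) ^ (1 / 2 : ℝ)

/-- The norm of `X^{σ,ϑ}`, for `-1 < ϑ < 0`: with `s = σ + 1` and `θ = ϑ + 1`, the infimum over all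
decompositions `f = f₀ + ∑_λ ∑_{d ≤ λ} □_{g_{<√λ}} S_λ f_{λ,d}` of
`(‖f₀‖² + ∑ ‖f_{λ,d}‖²)^{1/2}`, with `f₀` measured in `L² H^σ` and `f_{λ,d}` in `X^{s,θ}_{λ,d}`. -/
def normXNeg {n : ℕ} (φ : ℝ → ℝ) (g : Fin (n + 1) → Fin (n + 1) → ST n → ℝ) (σ ϑ : ℝ)
    (f : 𝓓'(slab n, ℂ)) : ℝ≥0∞ :=
  (⨅ (f₀ : 𝓓'(slab n, ℂ)) (v : ℕ → ℕ → L2 n) (F : ℕ → ℕ → L2 n)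
    (_ : ∀ k j, j ≤ k → HasWeakBox φ g k (v k j) (F k j))
    (_ : ∀ ψ : 𝓓(slab n, ℝ), HasSum (fun k : ℕ => ∑ j ∈ Finset.range (k + 1),
      ∫ z, lpProj φ k (v k j) z * boxT φ g k ψ z ∂(slabMeasure n)) (f ψ - f₀ ψ)),
    normL2H σ f₀ ^ 2 + totalSq (σ + 1) (ϑ + 1) v F) ^ (1 / 2 : ℝ)

/-- The norm of `X^{s,θ} + L² H^{s+θ}`. -/
def normSum {n : ℕ} (φ : ℝ → ℝ) (g : Fin (n + 1) → Fin (n + 1) → ST n → ℝ) (s θ : ℝ)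
    (u : 𝓓'(slab n, ℂ)) : ℝ≥0∞ :=
  ⨅ (u₁ : 𝓓'(slab n, ℂ)) (u₂ : 𝓓'(slab n, ℂ)) (_ : u = u₁ + u₂),
    normXPos φ g s θ u₁ + normL2H (s + θ) u₂

/-! ### The spaces and the dual -/

/-- The space of distributions of finite norm `N`. For the norms above the set `{u | N u < ∞}` is
already a linear subspace, and it is its own span. -/
def finiteSpace {n : ℕ} (N : 𝓓'(slab n, ℂ) → ℝ≥0∞) : Submodule ℂ 𝓓'(slab n, ℂ) :=
  Submodule.span ℂ {u | N u < ⊤}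

/-- The space `X^{σ,ϑ}`, `-1 < ϑ < 0`. -/
abbrev XNeg {n : ℕ} (φ : ℝ → ℝ) (g : Fin (n + 1) → Fin (n + 1) → ST n → ℝ) (σ ϑ : ℝ) :
    Submodule ℂ 𝓓'(slab n, ℂ) :=
  finiteSpace (normXNeg φ g σ ϑ)

/-- The space `X^{s,θ} + L² H^{s+θ}`, `0 < θ < 1`. -/
abbrev XSum {n : ℕ} (φ : ℝ → ℝ) (g : Fin (n + 1) → Fin (n + 1) → ST n → ℝ) (s θ : ℝ) :
    Submodule ℂ 𝓓'(slab n, ℂ) :=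
  finiteSpace (normSum φ g s θ)

/-- The bounded linear functionals on a space of distributions with norm `N`. -/
def boundedDual {n : ℕ} (N : 𝓓'(slab n, ℂ) → ℝ≥0∞) (Y : Submodule ℂ 𝓓'(slab n, ℂ)) :
    Submodule ℂ (Y →ₗ[ℂ] ℂ) where
  carrier := {T | ∃ M : ℝ≥0, ∀ u : Y, ‖T u‖ₑ ≤ M * N u}
  zero_mem' := ⟨0, fun u => by simp⟩
  add_mem' := by
    rintro T T' ⟨M, hM⟩ ⟨M', hM'⟩
    refine ⟨M + M', fun u => ?_⟩
    calc ‖(T + T') u‖ₑ ≤ ‖T u‖ₑ + ‖T' u‖ₑ := enorm_add_le _ _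
      _ ≤ M * N u + M' * N u := add_le_add (hM u) (hM' u)
      _ = ((M + M' : ℝ≥0) : ℝ≥0∞) * N u := by rw [ENNReal.coe_add, add_mul]
  smul_mem' := by
    rintro c T ⟨M, hM⟩
    refine ⟨‖c‖₊ * M, fun u => ?_⟩
    calc ‖(c • T) u‖ₑ = ‖c‖ₑ * ‖T u‖ₑ := by simp [enorm_mul]
      _ ≤ ‖c‖ₑ * (M * N u) := by gcongr; exact hM u
      _ = ((‖c‖₊ * M : ℝ≥0) : ℝ≥0∞) * N u := by
        rw [ENNReal.coe_mul, mul_assoc]; rfl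

/-- The norm of a functional. -/
def dualNorm {n : ℕ} (N : 𝓓'(slab n, ℂ) → ℝ≥0∞) {Y : Submodule ℂ 𝓓'(slab n, ℂ)}
    (T : Y →ₗ[ℂ] ℂ) : ℝ≥0∞ :=
  ⨅ (M : ℝ≥0) (_ : ∀ u : Y, ‖T u‖ₑ ≤ M * N u), (M : ℝ≥0∞)

end WaveX

end

noncomputable section

namespace WaveX

open Filter Topology LineDeriv
open scoped SchwartzMap
open Finset (sum_congr mul_sum sum_le_sum sum_nonneg sum_add_distrib mem_filter single_le_sum
  sum_sub_distrib sum_comm sum_le_card_nsmul mem_range_succ_iff sum_eq_zero sum_range_succ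
  abs_sum_le_sum_abs sum_insert sum_mul sum_filter)
open Real (norm_of_nonneg sq_sqrt rpow_neg rpow_add sqrt rpow_natCast sqrt_sq rpow_mul sqrt_mul
  sqrt_nonneg rpow_one pi_pos norm_eq_abs sqrt_eq_rpow)
open Complex (I norm_real ofReal_mul exp ofReal_zero conj_ofReal conj_I real_smul I_sq ofReal_add)
open ENNReal (ofReal ofReal_le_ofReal ofReal_toReal)

variable {n : ℕ}

local notation "Λ" => Fin (n + 1)
local notation "𝓣" => 𝓓(slab n, ℝ)
local notation "𝓣'" => 𝓓'(slab n, ℂ)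
local notation "𝓣ᶜ" => 𝓓(slab n, ℂ)
local notation "mul_le_l" => mul_le_mul_of_nonneg_left
local notation "mul_le_r" => mul_le_mul_of_nonneg_right
local notation "✓" => by first | positivity | omega | linarith | norm_num
local notation "ϖ" => slabMeasure n
local notation "𝟚" => (2 : ℝ)
local notation "π" => Real.pi
local notation:max "ℭ" b:max => fun z => ((b z : ℝ) : ℂ)
local notation:max "ℭₜ" a:max => fun z : ST n => ((a (Prod.fst z) : ℝ) : ℂ)

variable {φ : ℝ → ℝ} (h : IsLPProfile φ)

theorem slabMeasure_eq : ϖ =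
    ((volume : Measure ℝ).restrict (Ioo (-1) 1)).prod (volume) := by
  have : volume = (volume : Measure ℝ).prod (volume : Measure (Sp n)) := rfl
  rw [slabMeasure, this]
  change (Measure.prod _ _).restrict (Ioo (-1) 1 ×ˢ univ) = _
  rw [← Measure.prod_restrict, Measure.restrict_univ]

theorem measurableSet_slab : MeasurableSet (slab n : Set (ST n)) := (slab n).isOpen.measurableSet

instance : IsLocallyFiniteMeasure ϖ := by
  unfold slabMeasure; infer_instance

instance : SFinite ϖ := by
  unfold slabMeasure; infer_instance

instance : SigmaFinite ϖ := by
  unfold slabMeasure; infer_instance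

def bil : L2 n →L[ℂ] L2 n →L[ℂ] ℂ :=
  (ContinuousLinearMap.mul ℂ ℂ).lpPairing ϖ 2 2

theorem bil_eq (u w) : bil u w = ∫ z, u z * w z ∂ϖ := by
  simp [bil, ContinuousLinearMap.lpPairing_eq_integral]

theorem bil_comm (u w : L2 n) : bil u w = bil w u := by
  simp [bil_eq, mul_comm]

def cj (u : L2 n) : L2 n := (Complex.conjCLE : ℂ →L[ℝ] ℂ).compLp u

theorem coeFn_cj (u) : cj u =ᵐ[ϖ] fun z => (starRingEnd ℂ) (u z) := by
  filter_upwards [(Complex.conjCLE : ℂ →L[ℝ] ℂ).coeFn_compLp u] with z hz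
  rw [cj, hz]; simp

theorem inner_eq_bil (u w : L2 n) : inner ℂ u w = bil (cj u) w := by
  rw [L2.inner_def, bil_eq]
  refine integral_congr_ae ?_
  filter_upwards [coeFn_cj u] with z hz
  rw [hz]; simp [mul_comm]

theorem cj_cj (u : L2 n) : cj (cj u) = u := by
  refine Lp.ext ?_
  filter_upwards [coeFn_cj u, coeFn_cj (cj u)] with z h1 h2
  rw [h2, h1]; simp

theorem norm_cj (u : L2 n) : ‖cj u‖ = ‖u‖ := by
  rw [Lp.norm_def, Lp.norm_def]
  congr 1
  refine eLpNorm_congr_norm_ae ?_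
  filter_upwards [coeFn_cj u] with z h1
  rw [h1]; simp

theorem bil_eq_inner (u w : L2 n) : bil u w = inner ℂ (cj u) w := by
  rw [inner_eq_bil, cj_cj]

theorem norm_bil_le (u w : L2 n) : ‖bil u w‖ ≤ ‖u‖ * ‖w‖ := by
  rw [bil_eq_inner, ← norm_cj u]
  exact norm_inner_le_norm _ _

theorem bil_cj_self (u : L2 n) : bil (cj u) u = (‖u‖ ^ 2 : ℝ) := by
  rw [← inner_eq_bil, inner_self_eq_norm_sq_to_K]; simp

theorem cj_add (u w : L2 n) : cj (u + w) = cj u + cj w := by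
  refine Lp.ext ?_
  filter_upwards [coeFn_cj u, coeFn_cj w, coeFn_cj (u + w), Lp.coeFn_add u w,
    Lp.coeFn_add (cj u) (cj w)] with z h1 h2 h3 h4 h5
  rw [h3, h5, h4, Pi.add_apply, Pi.add_apply, h1, h2, map_add]

theorem cj_sub (u w : L2 n) : cj (u - w) = cj u - cj w := by
  refine Lp.ext ?_
  filter_upwards [coeFn_cj u, coeFn_cj w, coeFn_cj (u - w), Lp.coeFn_sub u w,
    Lp.coeFn_sub (cj u) (cj w)] with z h1 h2 h3 h4 h5
  rw [h3, h5, h4, Pi.sub_apply, Pi.sub_apply, h1, h2, map_sub]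

theorem cj_smul (c) (u : L2 n) : cj (c • u) = (starRingEnd ℂ c) • cj u := by
  refine Lp.ext ?_
  filter_upwards [coeFn_cj u, coeFn_cj (c • u), Lp.coeFn_smul c u,
    Lp.coeFn_smul (starRingEnd ℂ c) (cj u)] with z h1 h2 h3 h4
  rw [h2, h4, h3, Pi.smul_apply, Pi.smul_apply, h1]; simp

theorem norm_le_of_bil_le {u : L2 n} {C} (hC : 0 ≤ C) (h : ∀ w, ‖bil u w‖ ≤ C * ‖w‖) :
    ‖u‖ ≤ C := by
  have := h (cj u)
  rw [bil_comm, bil_cj_self, norm_cj] at this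
  rw [norm_real, norm_of_nonneg ✓] at this
  by_cases h0 : ‖u‖ = 0
  · rw [h0]; exact hC
  · have h1 : 0 < ‖u‖ := lt_of_le_of_ne (norm_nonneg _) (Ne.symm h0)
    nlinarith

theorem eq_of_bil_eq {u w : L2 n} (h : ∀ v, bil u v = bil w v) : u = w := by
  have : ‖u - w‖ ≤ 0 := norm_le_of_bil_le le_rfl fun v => by simp [h v]
  exact sub_eq_zero.1 (norm_le_zero_iff.1 this)

theorem exists_bil_eq (T : L2 n →L[ℂ] ℂ) : ∃ q : L2 n, ‖q‖ = ‖T‖ ∧ ∀ w, T w = bil q w := by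
  refine ⟨cj ((InnerProductSpace.toDual ℂ (L2 n)).symm T), ?_, fun w => ?_⟩
  · rw [norm_cj, LinearIsometryEquiv.norm_map]
  · rw [← inner_eq_bil, InnerProductSpace.toDual_symm_apply]

theorem memLp_testC (f : 𝓣ᶜ) : MemLp f 2 ϖ :=
  f.continuous.memLp_of_hasCompactSupport f.hasCompactSupport

def tstC : 𝓣ᶜ →ₗ[ℂ] L2 n where
  toFun f := (memLp_testC f).toLp f
  map_add' f g := by
    rw [← MemLp.toLp_add]; rfl
  map_smul' c f := by
    rw [RingHom.id_apply, ← MemLp.toLp_const_smul]; rfl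

theorem coeFn_tstC (f : 𝓣ᶜ) : tstC f =ᵐ[ϖ] f := (memLp_testC f).coeFn_toLp

def toC : 𝓣 →L[ℝ] 𝓣ᶜ := TestFunction.postcompCLM Complex.ofRealCLM

@[simp] theorem toC_apply (ψ : 𝓣) (z : ST n) : toC ψ z = (ψ z : ℂ) := by
  simp [toC]

def tst : 𝓣 →ₗ[ℝ] L2 n := (tstC.restrictScalars ℝ).comp toC.toLinearMap

theorem coeFn_tst (ψ) : tst ψ =ᵐ[ϖ] fun z => (ψ z) := by
  filter_upwards [coeFn_tstC (toC ψ)] with z hz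
  change (tstC (toC ψ)) z = _
  rw [hz, toC_apply]

theorem bil_tst (u) (ψ) :
    bil u (tst ψ) = ∫ z, u z * (ψ z) ∂ϖ := by
  rw [bil_eq]
  refine integral_congr_ae ?_
  filter_upwards [coeFn_tst ψ] with z hz
  rw [hz]

theorem eq_zero_of_bil_tst {u} (h : ∀ ψ : 𝓣, bil u (tst ψ) = 0) : u = 0 := by
  have hu : LocallyIntegrableOn u (slab n) ϖ :=
    (MemLp.locallyIntegrable (Lp.memLp u) ✓).locallyIntegrableOn _
  have := (slab n).isOpen.ae_eq_zero_of_integral_contDiff_smul_eq_zero hu fun g hg hc hs => by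
    have := h ⟨g, by simpa using hg, hc, hs⟩
    rw [bil_tst] at this
    rw [← this]
    refine integral_congr_ae (.of_forall fun z => ?_)
    change (g z) * _ = _ * (g z : ℂ)
    ring
  refine Lp.ext ?_
  have h2 : ∀ᵐ z ∂ϖ, z ∈ (slab n) :=
    ae_restrict_mem measurableSet_slab
  filter_upwards [this, h2, Lp.coeFn_zero ℂ 2 ϖ] with z h1 h2 h3
  rw [h1 h2, h3, Pi.zero_apply]

theorem eq_of_bil_tst {u w : L2 n} (h : ∀ ψ : 𝓣, bil u (tst ψ) = bil w (tst ψ)) :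
    u = w :=
  sub_eq_zero.1 (eq_zero_of_bil_tst fun ψ => by simp [h ψ])

theorem dense_span_tst : (Submodule.span ℂ (range (tst (n := n)))).topologicalClosure = ⊤ := by
  rw [Submodule.topologicalClosure_eq_top_iff, Submodule.eq_bot_iff]
  intro u hu
  have : cj u = 0 := eq_zero_of_bil_tst fun ψ => by
    rw [← inner_eq_bil]
    exact inner_eq_zero_symm.1 (hu _ (Submodule.subset_span ⟨ψ, rfl⟩))
  rw [← cj_cj u, this, ← zero_smul ℂ (0 : L2 n), cj_smul]; simp

theorem denseRange_tstC : DenseRange (tstC (n := n)) := by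
  have h : Submodule.span ℂ (range (tst)) ≤ LinearMap.range (tstC (n := n)) := by
    rw [Submodule.span_le]
    rintro _ ⟨ψ, rfl⟩
    exact ⟨toC ψ, rfl⟩
  have h2 := Submodule.topologicalClosure_mono h
  rw [dense_span_tst, top_le_iff] at h2
  rw [DenseRange, ← LinearMap.coe_range, Submodule.dense_iff_topologicalClosure_eq_top]
  exact h2

theorem eq_of_bil_tstC {u w : L2 n} (h : ∀ f : 𝓣ᶜ, bil u (tstC f) = bil w (tstC f)) :
    u = w :=
  eq_of_bil_tst fun ψ => h (toC ψ)

theorem exists_of_bound {T : 𝓣ᶜ →ₗ[ℂ] ℂ} {C}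
    (h : ∀ f, ‖T f‖ ≤ C * ‖tstC f‖) (hC : 0 ≤ C) :
    ∃ q : L2 n, ‖q‖ ≤ C ∧ ∀ f, T f = bil q (tstC f) := by
  obtain ⟨q, hq, hq'⟩ := exists_bil_eq (T.extendOfNorm tstC)
  refine ⟨q, ?_, fun f => ?_⟩
  · rw [hq]; exact LinearMap.opNorm_extendOfNorm_le denseRange_tstC hC h
  · rw [← hq', LinearMap.extendOfNorm_eq denseRange_tstC ⟨C, h⟩]

def BM (Θ : ST n → ℂ) : Prop := Measurable Θ ∧ ∃ C : ℝ, ∀ z, ‖Θ z‖ ≤ C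

theorem BM.mul {Θ Θ' : ST n → ℂ} (h : BM Θ) (h' : BM Θ') : BM (fun z => Θ z * Θ' z) := by
  obtain ⟨m, C, hC⟩ := h
  obtain ⟨m', C', hC'⟩ := h'
  refine ⟨m.mul m', C * C', fun z => ?_⟩
  rw [norm_mul]
  exact mul_le_mul (hC z) (hC' z) (norm_nonneg _) ((norm_nonneg _).trans (hC z))

theorem BM.add {Θ Θ' : ST n → ℂ} (h : BM Θ) (h' : BM Θ') : BM (fun z => Θ z + Θ' z) := by
  obtain ⟨m, C, hC⟩ := h
  obtain ⟨m', C', hC'⟩ := h'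
  exact ⟨m.add m', C + C', fun z => norm_add_le_of_le (hC z) (hC' z)⟩

theorem BM.neg {Θ : ST n → ℂ} (h : BM Θ) : BM (fun z => -Θ z) := by
  obtain ⟨m, C, hC⟩ := h
  exact ⟨m.neg, C, fun z => by rw [norm_neg]; exact hC z⟩

theorem BM.sub {Θ Θ' : ST n → ℂ} (h : BM Θ) (h' : BM Θ') : BM (fun z => Θ z - Θ' z) := by
  simpa only [sub_eq_add_neg] using h.add h'.neg

theorem BM.const (c : ℂ) : BM (fun _ : ST n => c) := ⟨measurable_const, ‖c‖, fun _ => le_rfl⟩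

theorem BM.conj {Θ : ST n → ℂ} (h : BM Θ) : BM (fun z => starRingEnd ℂ (Θ z)) := by
  obtain ⟨m, C, hC⟩ := h
  exact ⟨Complex.continuous_conj.measurable.comp m, C, fun z => by simpa using hC z⟩

theorem BM.memLp {Θ} (h : BM Θ) (v : L2 n) :
    MemLp (fun z => Θ z * v z) 2 ϖ := by
  obtain ⟨m, C, hC⟩ := h
  refine MemLp.of_le_mul (c := C) (Lp.memLp v)
    (m.aestronglyMeasurable.mul (Lp.memLp v).1) (.of_forall fun z => ?_)
  rw [norm_mul]
  exact mul_le_r (hC z) (norm_nonneg _)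

open Classical in
def mulOp (Θ : ST n → ℂ) : L2 n →L[ℂ] L2 n :=
  if h : BM Θ then
    LinearMap.mkContinuous
      { toFun := fun v => (h.memLp v).toLp _
        map_add' := fun v w => by
          rw [← MemLp.toLp_add]
          refine MemLp.toLp_congr _ _ ?_
          filter_upwards [Lp.coeFn_add v w] with z hz
          rw [hz]; simp [mul_add]
        map_smul' := fun c v => by
          rw [RingHom.id_apply, ← MemLp.toLp_const_smul]
          refine MemLp.toLp_congr _ _ ?_
          filter_upwards [Lp.coeFn_smul c v] with z hz
          rw [hz]; simp; ring }
      h.2.choose fun v => by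
        refine Lp.norm_le_mul_norm_of_ae_le_mul ?_
        filter_upwards [(h.memLp v).coeFn_toLp] with z hz
        change ‖((h.memLp v).toLp _) z‖ ≤ _
        rw [hz, norm_mul]
        exact mul_le_r (h.2.choose_spec z) (norm_nonneg _)
  else 0

theorem coeFn_mulOp {Θ} (h : BM Θ) (v) :
    mulOp Θ v =ᵐ[ϖ] fun z => Θ z * v z := by
  rw [mulOp, dif_pos h]
  exact (h.memLp v).coeFn_toLp

theorem norm_mulOp_le_of_ae {Θ} (h : BM Θ) {C} {v w : L2 n}
    (hC : ∀ᵐ z ∂ϖ, ‖Θ z * v z‖ ≤ C * ‖w z‖) : ‖mulOp Θ v‖ ≤ C * ‖w‖ := by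
  refine Lp.norm_le_mul_norm_of_ae_le_mul ?_
  filter_upwards [coeFn_mulOp h v, hC] with z hz hC
  rw [hz]; exact hC

theorem norm_mulOp_le {Θ} (h : BM Θ) {C} (hC : ∀ z, ‖Θ z‖ ≤ C) (v : L2 n) :
    ‖mulOp Θ v‖ ≤ C * ‖v‖ :=
  norm_mulOp_le_of_ae h (.of_forall fun z => by
    rw [norm_mul]; exact mul_le_r (hC z) (norm_nonneg _))

theorem mulOp_mulOp {Θ Θ'} (h : BM Θ) (h' : BM Θ') (v : L2 n) :
    mulOp Θ (mulOp Θ' v) = mulOp (fun z => Θ z * Θ' z) v := by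
  refine Lp.ext ?_
  filter_upwards [coeFn_mulOp h (mulOp Θ' v), coeFn_mulOp h' v, coeFn_mulOp (h.mul h') v]
    with z h1 h2 h3
  rw [h1, h2, h3, mul_assoc]

theorem mulOp_comm {Θ Θ' : ST n → ℂ} (h : BM Θ) (h' : BM Θ') (v) :
    mulOp Θ (mulOp Θ' v) = mulOp Θ' (mulOp Θ v) := by
  rw [mulOp_mulOp h h', mulOp_mulOp h' h]
  simp [mul_comm]

theorem mulOp_add {Θ Θ'} (h : BM Θ) (h' : BM Θ') (v : L2 n) :
    mulOp (fun z => Θ z + Θ' z) v = mulOp Θ v + mulOp Θ' v := by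
  refine Lp.ext ?_
  filter_upwards [coeFn_mulOp h v, coeFn_mulOp h' v, coeFn_mulOp (h.add h') v,
    Lp.coeFn_add (mulOp Θ v) (mulOp Θ' v)] with z h1 h2 h3 h4
  rw [h3, h4, Pi.add_apply, h1, h2, add_mul]

theorem mulOp_sub {Θ Θ'} (h : BM Θ) (h' : BM Θ') (v : L2 n) :
    mulOp (fun z => Θ z - Θ' z) v = mulOp Θ v - mulOp Θ' v := by
  refine Lp.ext ?_
  filter_upwards [coeFn_mulOp h v, coeFn_mulOp h' v, coeFn_mulOp (h.sub h') v,
    Lp.coeFn_sub (mulOp Θ v) (mulOp Θ' v)] with z h1 h2 h3 h4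
  rw [h3, h4, Pi.sub_apply, h1, h2, sub_mul]

theorem mulOp_const (c) (v : L2 n) : mulOp (fun _ => c) v = c • v := by
  refine Lp.ext ?_
  filter_upwards [coeFn_mulOp (BM.const c) v, Lp.coeFn_smul c v] with z h1 h2
  rw [h1, h2]; simp

theorem bil_mulOp {Θ} (h : BM Θ) (u w : L2 n) :
    bil (mulOp Θ u) w = bil u (mulOp Θ w) := by
  rw [bil_eq, bil_eq]
  refine integral_congr_ae ?_
  filter_upwards [coeFn_mulOp h u, coeFn_mulOp h w] with z h1 h2
  rw [h1, h2]; ring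

theorem bil_mulOp_eq {Θ} (h : BM Θ) (u w) :
    bil u (mulOp Θ w) = ∫ z, Θ z * (u z * w z) ∂ϖ := by
  rw [bil_eq]
  refine integral_congr_ae ?_
  filter_upwards [coeFn_mulOp h w] with z h2
  rw [h2]; ring

theorem cj_mulOp {Θ} (h : BM Θ) (u : L2 n) :
    cj (mulOp Θ u) = mulOp (fun z => starRingEnd ℂ (Θ z)) (cj u) := by
  refine Lp.ext ?_
  filter_upwards [coeFn_mulOp h u, coeFn_cj (mulOp Θ u), coeFn_mulOp h.conj (cj u), coeFn_cj u]
    with z h1 h2 h3 h4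
  rw [h2, h3, h1, h4, map_mul]

def dd (i : Λ) (ψ : 𝓣) : 𝓣 := ∂_{(dir i : ST n)} ψ

theorem dd_apply (i) (ψ) (z : ST n) : dd i ψ z = pd i ψ z := by
  change TestFunction.lineDerivCLM ℝ (dir i) ψ z = _
  rw [TestFunction.lineDerivCLM_apply_of_le (by simp)]
  exact (ψ.contDiff.differentiable (by simp)).differentiableAt.lineDeriv_eq_fderiv

def WD (i : Λ) (w w' : L2 n) : Prop :=
  ∀ ψ : 𝓣, bil w (tst (dd i ψ)) = - bil w' (tst ψ)

theorem WD.unique {i} {w w' w'' : L2 n} (h : WD i w w') (h' : WD i w w'') :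
    w' = w'' :=
  eq_of_bil_tst fun ψ => neg_injective (by rw [← h ψ, ← h' ψ])

theorem WD.add {i : Λ} {w w' v v'} (h : WD i w w') (h' : WD i v v') :
    WD i (w + v) (w' + v') := fun ψ => by
  simp [map_add, add_apply, h ψ, h' ψ]; ring

theorem WD.sub {i : Λ} {w w' v v'} (h : WD i w w') (h' : WD i v v') :
    WD i (w - v) (w' - v') := fun ψ => by
  simp [map_sub, sub_apply, h ψ, h' ψ]; ring

theorem WD.smul {i : Λ} {w w'} (c : ℂ) (h : WD i w w') :
    WD i (c • w) (c • w') := fun ψ => by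
  simp [map_smul, smul_apply, h ψ, smul_neg]

theorem WD.zero {i} : WD i (0 : L2 n) 0 := fun ψ => by simp

theorem WD.sum {i} {ι} (s) {w w' : ι → L2 n}
    (h : ∀ a ∈ s, WD i (w a) (w' a)) : WD i (∑ a ∈ s, w a) (∑ a ∈ s, w' a) := fun ψ => by
  simp [map_sum, sum_apply, ← Finset.sum_neg_distrib]
  exact sum_congr rfl fun a ha => h a ha ψ

theorem cj_tst (ψ : 𝓣) : cj (tst ψ) = tst ψ := by
  refine Lp.ext ?_
  filter_upwards [coeFn_cj (tst ψ), coeFn_tst ψ] with z h1 h2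
  rw [h1, h2]; simp

theorem bil_cj_cj (u w : L2 n) : bil (cj u) (cj w) = starRingEnd ℂ (bil u w) := by
  rw [← inner_eq_bil, ← inner_conj_symm, inner_eq_bil, cj_cj, bil_comm]

theorem WD.cj {i} {w w' : L2 n} (h : WD i w w') : WD i (cj w) (cj w') := fun ψ => by
  rw [← cj_tst (dd i ψ), ← cj_tst ψ, bil_cj_cj, bil_cj_cj, h ψ, map_neg]

section

theorem isometry_prodMk (t : ℝ) : Isometry (fun y : Sp n => (t, y)) :=
  Isometry.of_dist_eq fun y y' => by simp [Prod.dist_eq]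

def slc (f : 𝓣ᶜ) (t : ℝ) : 𝓢(Sp n, ℂ) :=
  HasCompactSupport.toSchwartzMap (f := fun y : Sp n => f (t, y))
    (f.hasCompactSupport.comp_isClosedEmbedding
      (g := fun y : Sp n => (t, y)) (isometry_prodMk t).isClosedEmbedding)
    (f.contDiff.comp (by fun_prop))

theorem slc_apply (f) (t) (y : Sp n) : slc f t y = f (t, y) := rfl

def pFi (f : 𝓣ᶜ) (z : ST n) : ℂ := 𝓕⁻ (fun y : Sp n => f (z.1, y)) z.2

theorem pFi_eq (f) (t) (η : Sp n) : pFi f (t, η) = (𝓕⁻ (slc f t)) η := by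
  rw [SchwartzMap.fourierInv_coe]; rfl

theorem measurable_pFi (f : 𝓣ᶜ) : StronglyMeasurable (pFi f) := by
  have : pFi f = fun z => ∫ v : Sp n,
      exp (↑(2 * π * inner ℝ v z.2) * I) • f (z.1, v) := by
    ext z; rw [pFi, Real.fourierInv_eq']
  rw [this]
  refine StronglyMeasurable.integral_prod_right (f := fun (z : ST n) v =>
      exp (↑(2 * π * inner ℝ v z.2) * I) • f (z.1, v)) ?_
  have := f.continuous
  refine Continuous.stronglyMeasurable ?_
  fun_prop

theorem integral_norm_sq_slice (f : 𝓣ᶜ) (t) :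
    ∫ η, ‖pFi f (t, η)‖ ^ 2 = ∫ y, ‖f (t, y)‖ ^ 2 := by
  simp [pFi_eq]
  have := SchwartzMap.integral_norm_sq_fourier (𝓕⁻ (slc f t))
  rw [FourierTransform.fourier_fourierInv_eq] at this
  exact this.symm

theorem integrable_sq_test (f : 𝓣ᶜ) :
    Integrable (fun z => ‖f z‖ ^ 2) ϖ :=
  (memLp_two_iff_integrable_sq_norm (memLp_testC f).1).1 (memLp_testC f)

theorem integrable_sq_pFi (f : 𝓣ᶜ) :
    Integrable (fun z => ‖pFi f z‖ ^ 2) ϖ := by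
  have h := integrable_sq_test f
  rw [slabMeasure_eq] at h ⊢
  have hm : AEStronglyMeasurable (fun z => ‖pFi f z‖ ^ 2)
      ((volume.restrict (Ioo (-1) 1)).prod volume) :=
    ((measurable_pFi f).norm.pow 2).aestronglyMeasurable
  rw [integrable_prod_iff hm]
  refine ⟨.of_forall fun t => ?_, ?_⟩
  · simp [pFi_eq]
    have := ((𝓕⁻ (slc f t)).memLp 2 volume)
    exact (memLp_two_iff_integrable_sq_norm this.1).1 this
  · have h2 := (integrable_prod_iff h.1).1 h
    refine h2.2.congr (.of_forall fun t => ?_)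
    have := integral_norm_sq_slice f t
    simpa using this.symm

theorem memLp_pFi (f : 𝓣ᶜ) : MemLp (pFi f) 2 ϖ :=
  (memLp_two_iff_integrable_sq_norm (measurable_pFi f).aestronglyMeasurable).2
    (integrable_sq_pFi f)

theorem slc_add (f g : 𝓣ᶜ) (t : ℝ) : slc (f + g) t = slc f t + slc g t := by
  ext y; simp [slc_apply]

theorem slc_smul (c : ℂ) (f : 𝓣ᶜ) (t) : slc (c • f) t = c • slc f t := by
  ext y; simp [slc_apply]

def pFiL : 𝓣ᶜ →ₗ[ℂ] L2 n where
  toFun f := (memLp_pFi f).toLp _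
  map_add' f g := by
    rw [← MemLp.toLp_add]
    refine MemLp.toLp_congr _ _ (.of_forall fun z => ?_)
    obtain ⟨t, η⟩ := z
    simp only [Pi.add_apply, pFi_eq, slc_add, FourierTransform.fourierInv_add]
    simp
  map_smul' c f := by
    rw [RingHom.id_apply, ← MemLp.toLp_const_smul]
    refine MemLp.toLp_congr _ _ (.of_forall fun z => ?_)
    obtain ⟨t, η⟩ := z
    simp only [Pi.smul_apply, pFi_eq, slc_smul, FourierTransform.fourierInv_smul]
    simp

theorem coeFn_pFiL (f) : pFiL f =ᵐ[ϖ] pFi f := (memLp_pFi f).coeFn_toLp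

theorem norm_sq_eq (u : L2 n) : ‖u‖ ^ 2 = ∫ z, ‖u z‖ ^ 2 ∂ϖ := by
  have h := bil_cj_self u
  rw [bil_eq] at h
  have h2 : ∫ z, cj u z * u z ∂ϖ = ∫ z, ((‖u z‖ ^ 2 : ℝ) : ℂ) ∂ϖ := by
    refine integral_congr_ae ?_
    filter_upwards [coeFn_cj u] with z hz
    rw [hz, mul_comm, Complex.mul_conj, Complex.normSq_eq_norm_sq]
  rw [h2, integral_complex_ofReal] at h
  exact_mod_cast h.symm

theorem norm_pFiL (f : 𝓣ᶜ) : ‖pFiL f‖ = ‖tstC f‖ := by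
  have : ‖pFiL f‖ ^ 2 = ‖tstC f‖ ^ 2 := by
    rw [norm_sq_eq, norm_sq_eq]
    have h1 : ∫ z, ‖pFiL f z‖ ^ 2 ∂ϖ = ∫ z, ‖pFi f z‖ ^ 2 ∂ϖ :=
      integral_congr_ae (by filter_upwards [coeFn_pFiL f] with z hz; rw [hz])
    have h2 : ∫ z, ‖tstC f z‖ ^ 2 ∂ϖ = ∫ z, ‖f z‖ ^ 2 ∂ϖ :=
      integral_congr_ae (by filter_upwards [coeFn_tstC f] with z hz; rw [hz])
    have i1 := integrable_sq_pFi f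
    have i2 := integrable_sq_test f
    rw [h1, h2]
    rw [slabMeasure_eq] at i1 i2 ⊢
    rw [integral_prod _ i1, integral_prod _ i2]
    simp only [integral_norm_sq_slice]
  exact (sq_eq_sq₀ (norm_nonneg _) (norm_nonneg _)).1 this

def U0 : L2 n →L[ℂ] L2 n := pFiL.extendOfNorm tstC

theorem U0_tstC (f : 𝓣ᶜ) : U0 (tstC f) = pFiL f :=
  LinearMap.extendOfNorm_eq denseRange_tstC ⟨1, fun f => by rw [norm_pFiL, one_mul]⟩ f

theorem norm_U0 (u : L2 n) : ‖U0 u‖ = ‖u‖ := by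
  refine denseRange_tstC.induction_on u
    (isClosed_eq (by fun_prop) (by fun_prop)) fun f => ?_
  rw [U0_tstC, norm_pFiL]

theorem inner_U0 (u w : L2 n) : inner ℂ (U0 u) (U0 w) = inner ℂ u w :=
  LinearIsometry.inner_map_map (⟨U0.toLinearMap, norm_U0⟩) u w

theorem integrable_mul_L2 (u w : L2 n) : Integrable (fun z => u z * w z) ϖ :=
  MemLp.integrable_mul (Lp.memLp u) (Lp.memLp w)

theorem bil_mulOp_time_test {a : ℝ → ℂ} (ha : BM (fun z : ST n => a z.1)) (f g : 𝓣ᶜ) :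
    bil (U0 (tstC f)) (mulOp (fun z => a z.1) (tstC g)) =
      bil (tstC f) (mulOp (fun z => a z.1) (U0 (tstC g))) := by
  have e1 : ∫ z, a z.1 * (U0 (tstC f) z * tstC g z) ∂ϖ =
      ∫ z, a z.1 * (pFi f z * g z) ∂ϖ := integral_congr_ae (by
    rw [U0_tstC]
    filter_upwards [coeFn_pFiL f, coeFn_tstC g] with z h1 h2
    rw [h1, h2])
  have e2 : ∫ z, a z.1 * (tstC f z * U0 (tstC g) z) ∂ϖ =
      ∫ z, a z.1 * (f z * pFi g z) ∂ϖ := integral_congr_ae (by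
    rw [U0_tstC]
    filter_upwards [coeFn_pFiL g, coeFn_tstC f] with z h1 h2
    rw [h1, h2])
  obtain ⟨hm, C, hC⟩ := ha
  have i1 : Integrable (fun z => a z.1 * (pFi f z * g z)) ϖ :=
    ((memLp_pFi f).integrable_mul (memLp_testC g)).bdd_mul hm.aestronglyMeasurable
      (.of_forall fun z => hC z)
  have i2 : Integrable (fun z => a z.1 * (f z * pFi g z)) ϖ :=
    ((memLp_testC f).integrable_mul (memLp_pFi g)).bdd_mul hm.aestronglyMeasurable
      (.of_forall fun z => hC z)
  rw [bil_mulOp_eq ⟨hm, C, hC⟩, bil_mulOp_eq ⟨hm, C, hC⟩, e1, e2]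
  rw [slabMeasure_eq] at i1 i2 ⊢
  rw [integral_prod _ i1, integral_prod _ i2]
  congr 1
  ext t
  simp only [integral_const_mul]
  congr 1
  have := SchwartzMap.integral_fourierInv_mul_eq (slc f t) (slc g t)
  simpa only [pFi_eq, slc_apply] using this

theorem bil_U0 (u w : L2 n) : bil (U0 u) w = bil u (U0 w) := by
  refine denseRange_tstC.induction_on₂ (p := fun u w => bil (U0 u) w = bil u (U0 w))
    (isClosed_eq (by fun_prop) (by fun_prop)) (fun f g => ?_) u w
  simpa only [mulOp_const, one_smul] using bil_mulOp_time_test (a := fun _ => 1) (BM.const 1) f g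

theorem U0_mulOp_time {a : ℝ → ℂ} (ha : BM (fun z : ST n => a z.1)) (u : L2 n) :
    U0 (mulOp (fun z => a z.1) u) = mulOp (fun z => a z.1) (U0 u) := by
  refine denseRange_tstC.induction_on
    (p := fun u => U0 (mulOp (fun z => a z.1) u) = mulOp (fun z => a z.1) (U0 u)) u
    (isClosed_eq (by fun_prop) (by fun_prop)) fun g => eq_of_bil_tstC fun f => ?_
  rw [bil_U0, bil_comm _ (tstC f), ← bil_mulOp_time_test ha f g, bil_comm]

def U1 : L2 n →L[ℂ] L2 n :=
  LinearMap.mkContinuous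
    { toFun := fun u => cj (U0 (cj u))
      map_add' := fun u w => by rw [cj_add, map_add, cj_add]
      map_smul' := fun c u => by rw [cj_smul, map_smul, cj_smul]; simp }
    1 fun u => by
      change ‖cj (U0 (cj u))‖ ≤ _
      rw [norm_cj, norm_U0, norm_cj, one_mul]

theorem U1_eq (u : L2 n) : U1 u = cj (U0 (cj u)) := rfl

theorem norm_U1 (u : L2 n) : ‖U1 u‖ = ‖u‖ := by rw [U1_eq, norm_cj, norm_U0, norm_cj]

theorem cj_U1 (u : L2 n) : cj (U1 u) = U0 (cj u) := by rw [U1_eq, cj_cj]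

theorem cj_U0 (u : L2 n) : cj (U0 u) = U1 (cj u) := by rw [U1_eq, cj_cj]

@[simp] theorem U0_U1 (u : L2 n) : U0 (U1 u) = u := eq_of_bil_eq fun v => by
  rw [bil_U0, U1_eq, ← inner_eq_bil, inner_U0, inner_eq_bil, cj_cj]

@[simp] theorem U1_U0 (u : L2 n) : U1 (U0 u) = u := by
  have := U0_U1 (cj u)
  rw [U1_eq, cj_cj] at this
  rw [U1_eq, this, cj_cj]

theorem bil_U1 (u w : L2 n) : bil (U1 u) w = bil u (U1 w) := by
  conv_lhs => rw [← U0_U1 w, ← bil_U0, U0_U1]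

theorem bil_U1_U0 (u w : L2 n) : bil (U1 u) (U0 w) = bil u w := by
  rw [bil_U1, U1_U0]

theorem U1_mulOp_time {a : ℝ → ℂ} (ha : BM (fun z : ST n => a z.1)) (u : L2 n) :
    U1 (mulOp (fun z => a z.1) u) = mulOp (fun z => a z.1) (U1 u) := by
  conv_lhs => rw [← U0_U1 u, ← U0_mulOp_time ha, U1_U0]

theorem mp_space {T : Sp n → Sp n} (hT : MeasurePreserving T volume volume) :
    MeasurePreserving (fun z : ST n => (z.1, T z.2)) ϖ ϖ := by
  rw [slabMeasure_eq]
  exact (MeasurePreserving.id _).prod hT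

theorem mp_neg : MeasurePreserving (fun z : ST n => (z.1, -z.2)) ϖ ϖ :=
  mp_space (Measure.measurePreserving_neg _)

theorem mp_sub (y : Sp n) :
    MeasurePreserving (fun z : ST n => (z.1, z.2 - y)) ϖ ϖ :=
  mp_space (measurePreserving_sub_right _ y)

def refl : L2 n →ₗᵢ[ℂ] L2 n := Lp.compMeasurePreservingₗᵢ ℂ _ mp_neg

theorem coeFn_refl (u : L2 n) : refl u =ᵐ[ϖ] fun z => u (z.1, -z.2) :=
  Lp.coeFn_compMeasurePreserving u mp_neg

def tr (y : Sp n) : L2 n →ₗᵢ[ℂ] L2 n := Lp.compMeasurePreservingₗᵢ ℂ _ (mp_sub y)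

theorem coeFn_tr (y : Sp n) (u : L2 n) : tr y u =ᵐ[ϖ] fun z => u (z.1, z.2 - y) :=
  Lp.coeFn_compMeasurePreserving u (mp_sub y)

theorem U1_tstC_ae (f : 𝓣ᶜ) :
    U1 (tstC f) =ᵐ[ϖ] fun z => (𝓕 (slc f z.1)) z.2 := by
  let g : 𝓣ᶜ := TestFunction.postcompCLM (𝕜 := ℝ) Complex.conjCLE f
  have hg : cj (tstC f) = tstC g := by
    refine Lp.ext ?_
    filter_upwards [coeFn_cj (tstC f), coeFn_tstC f, coeFn_tstC g] with z h1 h2 h3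
    rw [h1, h2, h3]; simp [g]
  rw [U1_eq, hg, U0_tstC]
  filter_upwards [coeFn_cj (pFiL g), coeFn_pFiL g] with z h1 h2
  rw [h1, h2, pFi, Real.fourierInv_eq', ← integral_conj, SchwartzMap.fourier_coe, Real.fourier_eq']
  congr 1
  ext v
  simp only [smul_eq_mul, map_mul, ← Complex.exp_conj, conj_I, conj_ofReal]
  congr 1
  · congr 1; push_cast; ring
  · simp [g, slc_apply]

theorem U1_eq_refl (u : L2 n) : U1 u = refl (U0 u) := by
  refine denseRange_tstC.induction_on u
    (isClosed_eq (by fun_prop) (by fun_prop)) fun f => Lp.ext ?_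
  rw [U0_tstC]
  filter_upwards [U1_tstC_ae f, coeFn_refl (pFiL f), mp_neg.quasiMeasurePreserving.ae_eq_comp (coeFn_pFiL f)] with z h2 h3 h4
  rw [h2, h3]
  change _ = (pFiL f ∘ fun z : ST n => (z.1, -z.2)) z
  rw [h4]
  change _ = pFi f (z.1, -z.2)
  rw [pFi_eq, SchwartzMap.fourier_coe, SchwartzMap.fourierInv_coe, Real.fourierInv_eq_fourier_neg,
    neg_neg]

def chr (y : Sp n) (z : ST n) : ℂ := exp ((2 * π * inner ℝ y z.2 : ℝ) * I)

theorem norm_chr (y : Sp n) (z : ST n) : ‖chr y z‖ = 1 := Complex.norm_exp_ofReal_mul_I _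

theorem continuous_chr : Continuous (Function.uncurry (chr (n := n))) := by
  unfold chr Function.uncurry; fun_prop

theorem BM_chr (y : Sp n) : BM (chr y) :=
  ⟨(by unfold chr; fun_prop : Continuous (chr y)).measurable, 1, fun z => (norm_chr y z).le⟩

section translation

variable {F : Type} [NormedAddCommGroup F] [NormedSpace ℝ F]

theorem contDiff_comp_sub (f : 𝓓(slab n, F)) (w) :
    ContDiff ℝ ∞ (fun z : ST n => f (z - w)) :=
  ContDiff.comp f.contDiff (contDiff_id.sub contDiff_const)

theorem hasCompactSupport_comp_sub (f : 𝓓(slab n, F)) (w) :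
    HasCompactSupport (fun z : ST n => f (z - w)) :=
  HasCompactSupport.comp_homeomorph f.hasCompactSupport (Homeomorph.subRight w)

theorem tsupport_comp_sub (f : 𝓓(slab n, F)) (w) :
    tsupport (fun z : ST n => f (z - ((0 : ℝ), w))) ⊆ slab n := by
  have : tsupport (fun z => f (z - (0, w))) ⊆
      (fun z => z - (0, w)) ⁻¹' tsupport f :=
    tsupport_comp_subset_preimage (g := f)
      (continuous_id.sub continuous_const)
  intro z hz
  have := f.tsupport_subset (this hz)
  change (z - (0, w)).1 ∈ Ioo (-1) 1 ∧ _ at this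
  refine ⟨?_, trivial⟩
  simpa using this.1

def trT (y : Sp n) (f : 𝓓(slab n, F)) : 𝓓(slab n, F) :=
  ⟨fun z => f (z - ((0 : ℝ), y)), contDiff_comp_sub f _, hasCompactSupport_comp_sub f _,
    tsupport_comp_sub f y⟩

theorem trT_apply (y : Sp n) (f : 𝓓(slab n, F)) (z) : trT y f z = f (z.1, z.2 - y) := by
  have : z - (0, y) = (z.1, z.2 - y) := by ext1 <;> simp
  change f (z - (0, y)) = _
  rw [this]

end translation

theorem tr_tstC (y : Sp n) (f : 𝓣ᶜ) : tr y (tstC f) = tstC (trT y f) := by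
  refine Lp.ext ?_
  filter_upwards [coeFn_tr y (tstC f), (mp_sub y).quasiMeasurePreserving.ae_eq_comp (coeFn_tstC f),
    coeFn_tstC (trT y f)] with z h1 h2 h3
  rw [h1, h3, trT_apply]
  exact h2

theorem tr_tst (y : Sp n) (ψ : 𝓣) : tr y (tst ψ) = tst (trT y ψ) := by
  refine Lp.ext ?_
  filter_upwards [coeFn_tr y (tst ψ), (mp_sub y).quasiMeasurePreserving.ae_eq_comp (coeFn_tst ψ),
    coeFn_tst (trT y ψ)] with z h1 h2 h3
  rw [h1, h3, trT_apply]
  exact h2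

theorem dd_trT (i : Λ) (y) (ψ) :
    dd i (trT y ψ) = trT y (dd i ψ) := by
  ext z
  have h : ⇑(trT y ψ) = fun z => ψ (z - (0, y)) := rfl
  rw [dd_apply]
  change _ = dd i ψ (z - (0, y))
  rw [dd_apply, pd, pd, h, fderiv_comp_sub]

theorem bil_tr (y : Sp n) (u w) : bil (tr y u) (tr y w) = bil u w := by
  rw [bil_eq, bil_eq, ← (mp_sub y).integral_comp' (f := MeasurableEquiv.prodCongr (MeasurableEquiv.refl ℝ) (MeasurableEquiv.subRight y)) (g := fun z => u z * w z)]
  refine integral_congr_ae ?_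
  filter_upwards [coeFn_tr y u, coeFn_tr y w] with z h1 h2
  rw [h1, h2]; rfl

theorem U1_tr (y : Sp n) (u : L2 n) : U1 (tr y u) = mulOp (chr (-y)) (U1 u) := by
  refine denseRange_tstC.induction_on (p := fun u => U1 (tr y u) = mulOp (chr (-y)) (U1 u)) u
    (isClosed_eq (by fun_prop) (by fun_prop)) fun f => Lp.ext ?_
  rw [tr_tstC]
  filter_upwards [U1_tstC_ae f, U1_tstC_ae (trT y f), coeFn_mulOp (BM_chr (-y)) (U1 (tstC f))]
    with z h1 h2 h3
  rw [h2, h3, h1, SchwartzMap.fourier_coe, SchwartzMap.fourier_coe]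
  have := congrFun (VectorFourier.fourierIntegral_comp_add_right Real.fourierChar volume
    (innerₗ (Sp n)) (slc f z.1) (-y)) z.2
  change VectorFourier.fourierIntegral Real.fourierChar volume (innerₗ (Sp n))
    (slc (trT y f) z.1) z.2 = chr (-y) z * VectorFourier.fourierIntegral Real.fourierChar volume
      (innerₗ (Sp n)) (slc f z.1) z.2
  have e : (slc f z.1 ∘ fun v => v + -y) = slc (trT y f) z.1 := by
    ext v; simp [slc_apply, trT_apply, sub_eq_add_neg]
  rw [← e, this, Circle.smul_def, Real.fourierChar_apply, smul_eq_mul]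
  rfl

theorem cj_tr (y : Sp n) (u : L2 n) : cj (tr y u) = tr y (cj u) := by
  refine Lp.ext ?_
  filter_upwards [coeFn_cj (tr y u), coeFn_tr y u, coeFn_tr y (cj u),
    (mp_sub y).quasiMeasurePreserving.ae_eq_comp (coeFn_cj u)] with z h1 h2 h3 h4
  rw [h1, h2, h3]
  exact h4.symm

theorem U0_tr (y : Sp n) (u) : U0 (tr y u) = mulOp (chr y) (U0 u) := by
  have h : (fun z => starRingEnd ℂ (chr (-y) z)) = chr y := by
    ext z
    simp only [chr, ← Complex.exp_conj, map_mul, conj_I, conj_ofReal]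
    congr 1; simp
  rw [← cj_cj (U0 (tr y u)), cj_U0, cj_tr, U1_tr, cj_mulOp (BM_chr _), h, cj_U1, cj_cj]

theorem U1_mulOp_chr (y : Sp n) (u : L2 n) : U1 (mulOp (chr y) u) = tr y (U1 u) := by
  have := congrArg U1 (U0_tr y (U1 u))
  rwa [U1_U0, U0_U1, eq_comm] at this

theorem U1_tst_dd (j) (ψ) : U1 (tst (dd j.succ ψ)) =ᵐ[ϖ]
    fun z => (2 * π * I) * (z.2 j : ℂ) * U1 (tst ψ) z := by
  filter_upwards [U1_tstC_ae (toC ψ), U1_tstC_ae (toC (dd j.succ ψ))] with z h1 h2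
  change U1 (tstC (toC (dd j.succ ψ))) z = _ * _ * U1 (tstC (toC ψ)) z
  rw [h1, h2]
  have e : slc (toC (dd j.succ ψ)) z.1 =
      ∂_{(EuclideanSpace.single j 1 : Sp n)} (slc (toC ψ) z.1) := by
    ext y
    rw [slc_apply, toC_apply, dd_apply, SchwartzMap.lineDerivOp_apply_eq_fderiv]
    have hd : HasFDerivAt ψ (fderiv ℝ ψ (z.1, y)) (z.1, y) :=
      (ψ.contDiff.differentiable (by simp)).differentiableAt.hasFDerivAt
    have h3 : HasFDerivAt (fun y => ψ (z.1, y))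
        ((fderiv ℝ ψ (z.1, y)).comp (ContinuousLinearMap.inr ℝ ℝ (Sp n))) y :=
      hd.comp y (hasFDerivAt_prodMk_right z.1 y)
    have h4 : HasFDerivAt (slc (toC ψ) z.1) (Complex.ofRealCLM.comp
        ((fderiv ℝ ψ (z.1, y)).comp (ContinuousLinearMap.inr ℝ ℝ (Sp n)))) y := by
      have := Complex.ofRealCLM.hasFDerivAt.comp y h3
      refine this.congr_of_eventuallyEq (.of_forall fun x => ?_)
      simp [slc_apply]
    rw [h4.fderiv]
    simp [pd, dir]
  rw [e, SchwartzMap.fourier_lineDerivOp_eq, smul_apply, SchwartzMap.smulLeftCLM_apply_apply (by fun_prop)]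
  have : inner ℝ z.2 (EuclideanSpace.single j 1) = z.2 j := by
    rw [EuclideanSpace.inner_single_right]; simp
  rw [this]
  simp [mul_assoc]

end

theorem refl_refl (u : L2 n) : refl (refl u) = u := by
  refine Lp.ext ?_
  filter_upwards [coeFn_refl (refl u),
    mp_neg.quasiMeasurePreserving.ae_eq_comp (coeFn_refl u)] with z h1 h2
  rw [h1]
  refine Eq.trans h2 ?_
  simp

theorem bil_refl (u w : L2 n) : bil (refl u) w = bil u (refl w) := by
  have key : ∀ u w : L2 n, bil (refl u) (refl w) = bil u w := fun u w => by
    rw [bil_eq, bil_eq, ← mp_neg.integral_comp' (f := MeasurableEquiv.prodCongr (MeasurableEquiv.refl ℝ) (MeasurableEquiv.neg (Sp n))) (g := fun z => u z * w z)]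
    refine integral_congr_ae ?_
    filter_upwards [coeFn_refl u, coeFn_refl w] with z h1 h2
    rw [h1, h2]; rfl
  rw [← key u (refl w), refl_refl]

theorem U0_refl (u : L2 n) : U0 (refl u) = U1 u := eq_of_bil_eq fun v => by
  rw [bil_U0, bil_refl, ← U1_eq_refl, bil_U1]

theorem U0_eq_refl (u : L2 n) : U0 u = refl (U1 u) := by
  rw [U1_eq_refl, refl_refl]

def BMs (m : Sp n → ℂ) : Prop := Measurable m ∧ ∃ C : ℝ, ∀ η, ‖m η‖ ≤ C

theorem BMs.bm {m} (h : BMs m) : BM (fun z : ST n => m z.2) :=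
  ⟨h.1.comp measurable_snd, h.2.choose, fun z => h.2.choose_spec z.2⟩

theorem BMs.mul {m m' : Sp n → ℂ} (h : BMs m) (h' : BMs m') : BMs (fun η => m η * m' η) := by
  obtain ⟨M, C, hC⟩ := h
  obtain ⟨M', C', hC'⟩ := h'
  refine ⟨M.mul M', C * C', fun z => ?_⟩
  rw [norm_mul]
  exact mul_le_mul (hC z) (hC' z) (norm_nonneg _) ((norm_nonneg _).trans (hC z))

theorem BMs.sub {m m' : Sp n → ℂ} (h : BMs m) (h' : BMs m') : BMs (fun η => m η - m' η) := by
  obtain ⟨M, C, hC⟩ := h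
  obtain ⟨M', C', hC'⟩ := h'
  exact ⟨M.sub M', C + C', fun z => norm_sub_le_of_le (hC z) (hC' z)⟩

theorem BMs.const (c) : BMs (fun _ : Sp n => c) := ⟨measurable_const, ‖c‖, fun _ => le_rfl⟩

theorem BMs.neg_arg {m : Sp n → ℂ} (h : BMs m) : BMs (fun η => m (-η)) :=
  ⟨h.1.comp measurable_neg, h.2.choose, fun η => h.2.choose_spec _⟩

def Mult (m : Sp n → ℂ) : L2 n →L[ℂ] L2 n := U0.comp ((mulOp fun z => m z.2).comp U1)

theorem Mult_apply (m) (u : L2 n) : Mult m u = U0 (mulOp (fun z => m z.2) (U1 u)) := rfl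

theorem U1_Mult (m) (u : L2 n) : U1 (Mult m u) = mulOp (fun z => m z.2) (U1 u) := by
  rw [Mult_apply, U1_U0]

theorem norm_Mult_le {m} (h : BMs m) {C} (hC : ∀ η, ‖m η‖ ≤ C) (u : L2 n) :
    ‖Mult m u‖ ≤ C * ‖u‖ := by
  rw [Mult_apply, norm_U0]
  exact (norm_mulOp_le h.bm (fun z => hC z.2) _).trans_eq (by rw [norm_U1])

theorem Mult_Mult {m m'} (h : BMs m) (h' : BMs m') (u : L2 n) :
    Mult m (Mult m' u) = Mult (fun η => m η * m' η) u := by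
  rw [Mult_apply, U1_Mult, mulOp_mulOp h.bm h'.bm]; rfl

theorem Mult_sub {m m' : Sp n → ℂ} (h : BMs m) (h' : BMs m') (u) :
    Mult (fun η => m η - m' η) u = Mult m u - Mult m' u := by
  simp [Mult_apply, mulOp_sub h.bm h'.bm, map_sub]

theorem Mult_const (c) (u : L2 n) : Mult (fun _ => c) u = c • u := by
  rw [Mult_apply, mulOp_const, map_smul, U0_U1]

theorem Mult_const_mul {m} (h : BMs m) (c) (u : L2 n) :
    Mult (fun η => c * m η) u = c • Mult m u := by
  rw [← Mult_Mult (BMs.const c) h, Mult_const]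

theorem Mult_comm {m m' : Sp n → ℂ} (h : BMs m) (h' : BMs m') (u) :
    Mult m (Mult m' u) = Mult m' (Mult m u) := by
  rw [Mult_Mult h h', Mult_Mult h' h]; simp [mul_comm]

theorem Mult_mulOp_time {m : Sp n → ℂ} (h : BMs m) {a : ℝ → ℂ} (ha : BM (fun z : ST n => a z.1))
    (u) : Mult m (mulOp (fun z => a z.1) u) = mulOp (fun z => a z.1) (Mult m u) := by
  rw [Mult_apply, U1_mulOp_time ha, mulOp_comm h.bm ha, U0_mulOp_time ha, Mult_apply]

theorem bil_Mult {m} (h : BMs m) (u w : L2 n) :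
    bil (Mult m u) w = bil u (Mult (fun η => m (-η)) w) := by
  have hr : ∀ v : L2 n, refl (mulOp (fun z => m z.2) v) = mulOp (fun z => m (-z.2)) (refl v) :=
    fun v => by
      refine Lp.ext ?_
      filter_upwards [coeFn_refl (mulOp (fun z => m z.2) v), coeFn_mulOp h.neg_arg.bm (refl v),
        coeFn_refl v, mp_neg.quasiMeasurePreserving.ae_eq_comp (coeFn_mulOp h.bm v)] with z a b c d
      rw [a, b, c]
      exact d
  rw [Mult_apply, bil_U0, bil_mulOp h.bm, bil_U1, Mult_apply, U1_eq_refl w, ← hr, U0_refl]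

theorem bil_U0_ae {u w : L2 n} : bil u w = ∫ z, U1 u z * U0 w z ∂ϖ := by
  rw [← bil_U1_U0, bil_eq]

theorem bil_chr_eq_zero {p q : Sp n → ℂ} (hp : BMs p) (hq : BMs q) {a : ℝ → ℂ}
    (ha : BM (fun z : ST n => a z.1)) (ξ) (h : ∀ η, q (η - ξ) * p (-η) = 0) (u w) :
    bil (mulOp (fun z => a z.1) (mulOp (chr ξ) (Mult q u))) (Mult p w) = 0 := by
  rw [bil_U0_ae, U1_mulOp_time ha, U1_mulOp_chr, U1_Mult, U0_eq_refl, U1_Mult]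
  refine integral_eq_zero_of_ae ?_
  filter_upwards [coeFn_mulOp ha (tr ξ (mulOp (fun z => q z.2) (U1 u))),
    coeFn_tr ξ (mulOp (fun z => q z.2) (U1 u)),
    (mp_sub ξ).quasiMeasurePreserving.ae_eq_comp (coeFn_mulOp hq.bm (U1 u)),
    coeFn_refl (mulOp (fun z => p z.2) (U1 w)),
    mp_neg.quasiMeasurePreserving.ae_eq_comp (coeFn_mulOp hp.bm (U1 w))] with z h1 h2 h3 h4 h5
  have h3' : (mulOp (fun z => q z.2) (U1 u)) (z.1, z.2 - ξ) =
    q (z.2 - ξ) * U1 u (z.1, z.2 - ξ) := h3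
  have h5' : (mulOp (fun z => p z.2) (U1 w)) (z.1, -z.2) = p (-z.2) * U1 w (z.1, -z.2) := h5
  rw [h1, h2, h3', h4, h5']
  calc _ = (q (z.2 - ξ) * p (-z.2)) * (a z.1 * U1 u (z.1, z.2 - ξ) * U1 w (z.1, -z.2)) := by ring
    _ = _ := by rw [h, zero_mul]; rfl

theorem bil_Mult_eq_integral {K m : Sp n → ℂ} (hK : Integrable K) (hm : BMs m)
    (hKm : ∀ η, m η = 𝓕 K η) (u w) :
    bil (Mult m u) w = ∫ y, K y * bil (tr y u) w := by
  have h1 : ∀ y, bil (tr y u) w = ∫ z, chr (-y) z * (U1 u z * U0 w z) ∂ϖ := by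
    intro y
    rw [bil_U0_ae, U1_tr]
    refine integral_congr_ae ?_
    filter_upwards [coeFn_mulOp (BM_chr (-y)) (U1 u)] with z hz
    rw [hz]; ring
  have h2 : bil (Mult m u) w = ∫ z, m z.2 * (U1 u z * U0 w z) ∂ϖ := by
    rw [bil_U0_ae, U1_Mult]
    refine integral_congr_ae ?_
    filter_upwards [coeFn_mulOp hm.bm (U1 u)] with z hz
    rw [hz]; ring
  have hi : Integrable (fun p => K p.1 * (chr (-p.1) p.2 * (U1 u p.2 * U0 w p.2)))
      (volume.prod ϖ) := by
    have hc : Continuous (fun p : Sp n × ST n => chr (-p.1) p.2) := by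
      unfold chr; fun_prop
    refine ((Integrable.mul_prod hK (integrable_mul_L2 (U1 u) (U0 w))).bdd_mul hc.aestronglyMeasurable
      (.of_forall fun p => (norm_chr _ _).le)).congr (.of_forall fun p => ?_)
    change chr (-p.1) p.2 * (K p.1 * _) = _
    ring
  simp [h1, h2, ← integral_const_mul]
  rw [integral_integral_swap hi]
  refine integral_congr_ae (.of_forall fun z => ?_)
  change m z.2 * _ = ∫ y, K y * (chr (-y) z * (U1 u z * U0 w z))
  rw [hKm, Real.fourier_eq', ← integral_mul_const]
  refine integral_congr_ae (.of_forall fun y => ?_)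
  simp only [chr, inner_neg_left, smul_eq_mul]
  rw [show -2 * π * inner ℝ y z.2 = 2 * π * -inner ℝ y z.2 by ring]
  ring

theorem bil_tr_left (y) (u w : L2 n) : bil (tr y u) w = bil u (tr (-y) w) := by
  have : tr y (tr (-y) w) = w := by
    refine Lp.ext ?_
    filter_upwards [coeFn_tr y (tr (-y) w),
      (mp_sub y).quasiMeasurePreserving.ae_eq_comp (coeFn_tr (-y) w)] with z h1 h2
    rw [h1]
    refine Eq.trans h2 ?_
    simp
  conv_lhs => rw [← this, bil_tr]

theorem norm_bil_tr_le (y) (u w : L2 n) : ‖bil (tr y u) w‖ ≤ ‖u‖ * ‖w‖ :=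
  (norm_bil_le _ _).trans_eq (by rw [LinearIsometry.norm_map])

theorem integral_conv_mul {K} (hK : Integrable K) (hKm : Measurable K) (u w) :
    ∫ z, (∫ y, K y * u (z.1, z.2 - y)) * w z ∂ϖ =
      ∫ y, K y * bil (tr y u) w := by
  have h1 : ∀ y, bil (tr y u) w = ∫ z, u (z.1, z.2 - y) * w z ∂ϖ := by
    intro y
    rw [bil_eq]
    refine integral_congr_ae ?_
    filter_upwards [coeFn_tr y u] with z hz
    rw [hz]
  have hmeas : Measurable (fun p : Sp n × ST n => K p.1 * (u (p.2.1, p.2.2 - p.1) * w p.2)) := by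
    exact (hKm.comp measurable_fst).mul ((((Lp.stronglyMeasurable u).measurable).comp (by fun_prop)).mul (((Lp.stronglyMeasurable w).measurable).comp (by fun_prop)))
  have hint : ∀ y, Integrable (fun z => u (z.1, z.2 - y) * w z) ϖ := fun y =>
    (integrable_mul_L2 (tr y u) w).congr (by filter_upwards [coeFn_tr y u] with z hz; rw [hz])
  have hi : Integrable (fun p => K p.1 * (u (p.2.1, p.2.2 - p.1) * w p.2))
      (volume.prod ϖ) := by
    rw [integrable_prod_iff hmeas.aestronglyMeasurable]
    refine ⟨.of_forall fun y => (hint y).const_mul (K y), Integrable.mono' (g := fun y => ‖K y‖ * (‖u‖ * ‖w‖)) (hK.norm.mul_const _) hmeas.norm.stronglyMeasurable.integral_prod_right'.aestronglyMeasurable (.of_forall fun y => ?_)⟩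
    rw [norm_of_nonneg (integral_nonneg fun _ => norm_nonneg _)]
    simp [norm_mul, integral_const_mul]
    refine mul_le_l ?_ (norm_nonneg _)
    -- absolute values are handled by replacing both factors by their moduli
    have hA : ∀ v : L2 n, ∃ v' : L2 n, ‖v'‖ = ‖v‖ ∧ ∀ᵐ z ∂ϖ, v' z = (‖v z‖) := by
      intro v
      have hv : MemLp (fun z => ((‖v z‖) : ℂ)) 2 ϖ := (Lp.memLp v).norm.ofReal
      refine ⟨hv.toLp _, ?_, hv.coeFn_toLp⟩
      rw [Lp.norm_toLp, Lp.norm_def]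
      congr 1
      exact eLpNorm_congr_norm_ae (.of_forall fun z => by simp)
    obtain ⟨u', hu', hu''⟩ := hA u
    obtain ⟨w', hw', hw''⟩ := hA w
    have : bil (tr y u') w' = ((∫ z, ‖u (z.1, z.2 - y)‖ * ‖w z‖ ∂ϖ : ℝ) : ℂ) := by
      rw [bil_eq, ← integral_complex_ofReal]
      refine integral_congr_ae ?_
      filter_upwards [coeFn_tr y u', (mp_sub y).quasiMeasurePreserving.ae hu'', hw''] with z a b c
      rw [a, b, c]; push_cast; rfl
    have h3 := norm_bil_tr_le y u' w'
    rw [this, hu', hw', norm_real, norm_of_nonneg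
      (integral_nonneg fun _ => by positivity)] at h3
    exact h3
  simp [h1, ← integral_const_mul]
  rw [integral_integral_swap hi]
  refine integral_congr_ae (.of_forall fun z => ?_)
  simp [← integral_mul_const, mul_assoc]

def scs (a : 𝓢(Sp n, ℂ)) (k : ℕ) (η : Sp n) : ℂ := a ((𝟚 ^ k)⁻¹ • η)

def Mop (a : 𝓢(Sp n, ℂ)) (k : ℕ) : L2 n →L[ℂ] L2 n := Mult (scs a k)

def ker (a : 𝓢(Sp n, ℂ)) (k : ℕ) (y : Sp n) : ℂ :=
  (((𝟚 ^ k) ^ n : ℝ) : ℂ) * (𝓕⁻ a) (𝟚 ^ k • y)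

theorem exists_bound_schwartz {V} [NormedAddCommGroup V] [NormedSpace ℝ V]
    {F} [NormedAddCommGroup F] [NormedSpace ℝ F] (a : 𝓢(V, F)) :
    ∃ C : ℝ, 0 ≤ C ∧ ∀ η, ‖a η‖ ≤ C := by
  obtain ⟨C, hC⟩ := a.decay 0 0
  refine ⟨C, hC.1.le, fun η => ?_⟩
  simpa using hC.2 η

theorem BMs_scs (a : 𝓢(Sp n, ℂ)) (k : ℕ) : BMs (scs a k) := by
  obtain ⟨C, _, hC⟩ := exists_bound_schwartz a
  exact ⟨(a.continuous.comp (continuous_const_smul _)).measurable, C, fun η => hC _⟩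

theorem exists_norm_Mop_le (a : 𝓢(Sp n, ℂ)) :
    ∃ C : ℝ, 0 ≤ C ∧ ∀ k u, ‖Mop a k u‖ ≤ C * ‖u‖ := by
  obtain ⟨C, h0, hC⟩ := exists_bound_schwartz a
  exact ⟨C, h0, fun k u => norm_Mult_le (BMs_scs a k) (fun η => hC _) u⟩

theorem continuous_ker (a : 𝓢(Sp n, ℂ)) (k : ℕ) : Continuous (ker a k) :=
  continuous_const.mul ((𝓕⁻ a).continuous.comp (continuous_const_smul _))

theorem integrable_ker (a : 𝓢(Sp n, ℂ)) (k) : Integrable (ker a k) :=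
  ((𝓕⁻ a).integrable.comp_smul ✓).const_mul _

theorem fourier_ker (a) (k) (η : Sp n) : scs a k η = 𝓕 (ker a k) η := by
  rw [Real.fourier_eq']
  have h := Measure.integral_comp_smul volume (fun v =>
    exp (↑(-2 * π * inner ℝ ((𝟚 ^ k)⁻¹ • v) η) * I) •
      (((𝟚 ^ k) ^ n : ℝ) : ℂ) * (𝓕⁻ a) v) (𝟚 ^ k)
  have e : ∫ v : Sp n, exp (↑(-2 * π * inner ℝ v η) * I) • ker a k v =
    ∫ v : Sp n, exp (↑(-2 * π * inner ℝ ((𝟚 ^ k)⁻¹ • 𝟚 ^ k • v) η)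
      * I) • (((𝟚 ^ k) ^ n : ℝ) : ℂ) * (𝓕⁻ a) (𝟚 ^ k • v) := by
    refine integral_congr_ae (.of_forall fun v => ?_)
    simp [inv_smul_smul₀ (by positivity : (0 : ℝ) < 2 ^ k).ne', ker, smul_eq_mul, mul_assoc]
  rw [e, h]
  have e2 : a ((𝟚 ^ k)⁻¹ • η) = (𝓕 (𝓕⁻ a)) ((𝟚 ^ k)⁻¹ • η) := by
    rw [FourierTransform.fourier_fourierInv_eq]
  rw [scs, e2, SchwartzMap.fourier_coe, Real.fourier_eq', finrank_euclideanSpace_fin, abs_of_pos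
    ✓, ← integral_smul]
  refine integral_congr_ae (.of_forall fun v => ?_)
  have e3 : inner ℝ v (((𝟚 ^ k)⁻¹) • η) = inner ℝ (((𝟚 ^ k)⁻¹) • v) η := by
    rw [real_inner_smul_left, real_inner_smul_right]
  simp [e3, smul_eq_mul, real_smul]
  have hc : (((𝟚 ^ k) ^ n : ℝ) : ℂ) ≠ 0 := by
    exact_mod_cast (by positivity : ((𝟚 ^ k) ^ n : ℝ) ≠ 0)
  push_cast at hc ⊢
  field_simp

theorem bil_Mop (a : 𝓢(Sp n, ℂ)) (k : ℕ) (u w : L2 n) :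
    bil (Mop a k u) w = ∫ y, ker a k y * bil (tr y u) w :=
  bil_Mult_eq_integral (integrable_ker a k) (BMs_scs a k) (fourier_ker a k) u w

theorem integrable_ker_mul_bil (a) (k) (u w : L2 n) :
    Integrable (fun y => ker a k y * bil (tr y u) w) := by
  have hc : Continuous fun y => tr y u := by
    have := Continuous.compMeasurePreservingLp
      (f := fun _ => u)
      (g := fun y => (⟨fun z => (z.1, z.2 - y), by fun_prop⟩ : C(ST n, ST n)))
      continuous_const (ContinuousMap.continuous_of_continuous_uncurry _ (by
        change Continuous fun p : Sp n × ST n => (p.2.1, p.2.2 - p.1)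
        fun_prop)) (fun y => mp_sub y) ✓
    exact this
  exact (integrable_ker a k).mul_bdd (by fun_prop : Continuous fun y => bil (tr y u) w).aestronglyMeasurable
    (.of_forall fun y => norm_bil_tr_le y u w)

theorem exists_moment_ker (a : 𝓢(Sp n, ℂ)) : ∃ C : ℝ, 0 ≤ C ∧ ∀ k,
    Integrable (fun y => ‖ker a k y‖ * ‖y‖) ∧ ∫ y, ‖ker a k y‖ * ‖y‖ ≤ C * (𝟚 ^ k)⁻¹ := by
  have hi : Integrable (fun y => ‖(𝓕⁻ a) y‖ * ‖y‖) := by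
    have := (𝓕⁻ a).integrable_pow_mul volume 1
    simpa [mul_comm] using this
  refine ⟨∫ y, ‖(𝓕⁻ a) y‖ * ‖y‖, integral_nonneg fun _ => by positivity, fun k => ?_⟩
  have h0 : (0 : ℝ) < 2 ^ k := by positivity
  have e : (fun y => ‖ker a k y‖ * ‖y‖) = fun y => (𝟚 ^ k) ^ n * (𝟚 ^ k)⁻¹ *
      (‖(𝓕⁻ a) (𝟚 ^ k • y)‖ * ‖𝟚 ^ k • y‖) := by
    ext y
    rw [ker, norm_mul, norm_smul, norm_real, norm_of_nonneg ✓,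
      norm_of_nonneg h0.le]
    field_simp
  rw [e]
  refine ⟨(hi.comp_smul h0.ne').const_mul _, ?_⟩
  have e2 := Measure.integral_comp_smul volume
    (fun y => ‖(𝓕⁻ a) y‖ * ‖y‖) (𝟚 ^ k)
  beta_reduce at e2
  rw [integral_const_mul, e2, finrank_euclideanSpace_fin, abs_of_pos ✓, smul_eq_mul]
  apply le_of_eq
  field_simp

theorem exists_commutator_le (a : 𝓢(Sp n, ℂ)) : ∃ C : ℝ, 0 ≤ C ∧ ∀ k (Θ)
    (L), 0 ≤ L → BM Θ → (∀ t x y, ‖Θ (t, x - y) - Θ (t, x)‖ ≤ L * ‖y‖) → ∀ u,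
    ‖Mop a k (mulOp Θ u) - mulOp Θ (Mop a k u)‖ ≤ C * L * (𝟚 ^ k)⁻¹ * ‖u‖ := by
  obtain ⟨C, hC0, hC⟩ := exists_moment_ker a
  refine ⟨C, hC0, fun k Θ L hL0 hΘ hL u => norm_le_of_bil_le ✓ fun w => ?_⟩
  have h1 : ∀ y, tr y (mulOp Θ u) - mulOp Θ (tr y u) =
      mulOp (fun z => Θ (z.1, z.2 - y) - Θ z) (tr y u) := fun y => by
    have hb : BM (fun z => Θ (z.1, z.2 - y)) :=
      ⟨hΘ.1.comp (by fun_prop), hΘ.2.choose, fun z => hΘ.2.choose_spec _⟩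
    rw [mulOp_sub hb hΘ]
    congr 1
    refine Lp.ext ?_
    filter_upwards [coeFn_tr y (mulOp Θ u), coeFn_mulOp hb (tr y u), coeFn_tr y u,
      (mp_sub y).quasiMeasurePreserving.ae_eq_comp (coeFn_mulOp hΘ u)] with z a b c d
    rw [a, b, c]
    exact d
  have h2 : ∀ y, ‖tr y (mulOp Θ u) - mulOp Θ (tr y u)‖ ≤ L * ‖y‖ * ‖u‖ := fun y => by
    have hb : BM (fun z => Θ (z.1, z.2 - y) - Θ z) :=
      BM.sub ⟨hΘ.1.comp (by fun_prop), hΘ.2.choose, fun z => hΘ.2.choose_spec _⟩ hΘ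
    rw [h1]
    refine (norm_mulOp_le hb (fun z => hL z.1 z.2 y) _).trans_eq ?_
    rw [LinearIsometry.norm_map]
  have h3 : bil (Mop a k (mulOp Θ u) - mulOp Θ (Mop a k u)) w =
      ∫ y, ker a k y * bil (tr y (mulOp Θ u) - mulOp Θ (tr y u)) w := by
    have i1 : ∀ v v' : L2 n, Integrable (fun y => ker a k y * bil (tr y v) v') := fun v v' =>
      integrable_ker_mul_bil a k v v'
    rw [map_sub, sub_apply, bil_mulOp hΘ, bil_Mop, bil_Mop,
      ← integral_sub (i1 _ _) (i1 _ _)]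
    refine integral_congr_ae (.of_forall fun y => ?_)
    simp [map_sub, sub_apply, bil_mulOp hΘ, mul_sub]
  obtain ⟨i2, hk⟩ := hC k
  rw [h3]
  calc _ ≤ ∫ y, ‖ker a k y‖ * ‖y‖ * (L * ‖u‖ * ‖w‖) := by
        refine norm_integral_le_of_norm_le (i2.mul_const _) (.of_forall fun y => ?_)
        rw [norm_mul, mul_assoc]
        refine mul_le_l ((norm_bil_le _ _).trans ((mul_le_r (h2 y) (norm_nonneg _)).trans_eq ?_)) (norm_nonneg _)
        ring
    _ = (∫ y, ‖ker a k y‖ * ‖y‖) * (L * ‖u‖ * ‖w‖) := integral_mul_const _ _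
    _ ≤ C * (𝟚 ^ k)⁻¹ * (L * ‖u‖ * ‖w‖) :=
        mul_le_r hk ✓
    _ = _ := by ring

theorem WD_Mop {i} {w w'} (h : WD i w w') (a : 𝓢(Sp n, ℂ)) (k) :
    WD i (Mop a k w) (Mop a k w') := fun ψ => by
  rw [bil_Mop, bil_Mop, ← integral_neg]
  refine integral_congr_ae (.of_forall fun y => ?_)
  simp [bil_tr_left, tr_tst, ← dd_trT]
  rw [h, mul_neg]

theorem U0_tst_dd (j : Fin n) (ψ) : U0 (tst (dd j.succ ψ)) =ᵐ[ϖ]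
    fun z => -((2 * π * I) * (z.2 j : ℂ)) * U0 (tst ψ) z := by
  have h : ∀ ψ : 𝓣, U0 (tst ψ) = cj (U1 (tst ψ)) := fun ψ => by rw [cj_U1, cj_tst]
  rw [h, h]
  filter_upwards [U1_tst_dd j ψ, coeFn_cj (U1 (tst ψ)), coeFn_cj (U1 (tst (dd j.succ ψ)))]
    with z h1 h2 h3
  rw [h2, h3, h1]
  simp only [map_mul, conj_I, conj_ofReal, map_ofNat]
  ring

theorem WD_Mult {m} (j) (h : BMs m)
    (h' : BMs (fun η => (2 * π * I) * (η j) * m η)) (u : L2 n) :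
    WD j.succ (Mult m u) (Mult (fun η => (2 * π * I) * (η j) * m η) u) :=
  fun ψ => by
    rw [bil_U0_ae, bil_U0_ae, U1_Mult, U1_Mult, ← integral_neg]
    refine integral_congr_ae ?_
    filter_upwards [coeFn_mulOp h.bm (U1 u), coeFn_mulOp h'.bm (U1 u), U0_tst_dd j ψ] with z a b c
    rw [a, b, c]; ring

theorem temperate_coord (j : Fin n) :
    (fun η : Sp n => (2 * π * I) * (η j)).HasTemperateGrowth :=
  (Function.HasTemperateGrowth.const (2 * π * I)).mul
    (Complex.ofRealCLM.comp (EuclideanSpace.proj j)).hasTemperateGrowth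

def dS (j : Fin n) (a : 𝓢(Sp n, ℂ)) : 𝓢(Sp n, ℂ) :=
  SchwartzMap.smulLeftCLM ℂ (fun η : Sp n => (2 * π * I) * (η j : ℂ)) a

theorem dS_apply (j : Fin n) (a) (η) :
    dS j a η = (2 * π * I) * (η j) * a η := by
  rw [dS, SchwartzMap.smulLeftCLM_apply_apply (temperate_coord j), smul_eq_mul]

theorem scs_dS (j) (a) (k) (η : Sp n) :
    ((𝟚 ^ k : ℝ) : ℂ) * scs (dS j a) k η = (2 * π * I) * (η j) * scs a k η := by
  have h0 : ((𝟚 ^ k) : ℂ) ≠ 0 := by exact_mod_cast (by positivity : (𝟚 ^ k) ≠ 0)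
  rw [scs, dS_apply, scs]
  simp [PiLp.smul_apply, smul_eq_mul]
  push_cast at h0 ⊢
  field_simp

theorem WD_space (j) (a) (k) (u : L2 n) :
    WD j.succ (Mop a k u) (((𝟚 ^ k : ℝ) : ℂ) • Mop (dS j a) k u) := by
  have e : (fun η => (2 * π * I) * (η j) * scs a k η) =
      fun η => ((𝟚 ^ k : ℝ) : ℂ) * scs (dS j a) k η := by
    ext η; rw [scs_dS]
  have hb : BMs (fun η => (2 * π * I) * (η j) * scs a k η) := by
    rw [e]; exact (BMs.const _).mul (BMs_scs _ _)
  have := WD_Mult j (BMs_scs a k) hb u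
  rw [e, Mult_const_mul (BMs_scs _ _)] at this
  exact this

theorem Mop_deriv {j : Fin n} {w w'} (h : WD j.succ w w') (a)
    (k) : Mop a k w' = ((𝟚 ^ k : ℝ) : ℂ) • Mop (dS j a) k w :=
  (WD_Mop h a k).unique (WD_space j a k w)

def reT : 𝓣ᶜ →L[ℝ] 𝓣 := TestFunction.postcompCLM Complex.reCLM

def imT : 𝓣ᶜ →L[ℝ] 𝓣 := TestFunction.postcompCLM Complex.imCLM

@[simp] theorem reT_apply (f : 𝓣ᶜ) (z : ST n) : reT f z = (f z).re := by simp [reT]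

@[simp] theorem imT_apply (f : 𝓣ᶜ) (z : ST n) : imT f z = (f z).im := by simp [imT]

theorem tstC_eq (f : 𝓣ᶜ) : tstC f = tst (reT f) + I • tst (imT f) := by
  refine Lp.ext ?_
  filter_upwards [coeFn_tstC f, coeFn_tst (reT f), coeFn_tst (imT f),
    Lp.coeFn_add (tst (reT f)) (I • tst (imT f)),
    Lp.coeFn_smul I (tst (imT f))] with z h1 h2 h3 h4 h5
  rw [h1, h4, Pi.add_apply, h5, Pi.smul_apply, h2, h3, reT_apply, imT_apply, smul_eq_mul, mul_comm]
  exact (Complex.re_add_im _).symm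

theorem norm_tst_reT_le (f : 𝓣ᶜ) : ‖tst (reT f)‖ ≤ ‖tstC f‖ := by
  refine Lp.norm_le_norm_of_ae_le ?_
  filter_upwards [coeFn_tstC f, coeFn_tst (reT f)] with z h1 h2
  rw [h1, h2, reT_apply, norm_real]
  exact Complex.abs_re_le_norm _

theorem norm_tst_imT_le (f : 𝓣ᶜ) : ‖tst (imT f)‖ ≤ ‖tstC f‖ := by
  refine Lp.norm_le_norm_of_ae_le ?_
  filter_upwards [coeFn_tstC f, coeFn_tst (imT f)] with z h1 h2
  rw [h1, h2, imT_apply, norm_real]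
  exact Complex.abs_im_le_norm _

theorem exists_of_bound_real {T : 𝓣 →ₗ[ℝ] ℂ} {C}
    (h : ∀ ψ, ‖T ψ‖ ≤ C * ‖tst ψ‖) (hC : 0 ≤ C) :
    ∃ q : L2 n, ‖q‖ ≤ 2 * C ∧ ∀ ψ, T ψ = bil q (tst ψ) := by
  let T' : 𝓣ᶜ →ₗ[ℂ] ℂ :=
    { toFun := fun f => T (reT f) + I * T (imT f)
      map_add' := fun f g => by simp [map_add]; ring
      map_smul' := fun c f => by
        rw [(by ext z; simp : reT (c • f) = c.re • reT f - c.im • imT f), (by ext z; simp : imT (c • f) = c.re • imT f + c.im • reT f)]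
        simp [map_sub, map_add, map_smul, real_smul, RingHom.id_apply, smul_eq_mul]
        conv_rhs => rw [← Complex.re_add_im c]
        linear_combination (-c.im * T (imT f) : ℂ) * I_sq }
  have hT' : ∀ f, ‖T' f‖ ≤ 2 * C * ‖tstC f‖ := fun f => by
    calc ‖T' f‖ ≤ ‖T (reT f)‖ + ‖I * T (imT f)‖ := norm_add_le _ _
      _ ≤ C * ‖tstC f‖ + C * ‖tstC f‖ := by
        rw [norm_mul, Complex.norm_I, one_mul]
        exact add_le_add
          ((h _).trans (mul_le_l (norm_tst_reT_le f) hC))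
          ((h _).trans (mul_le_l (norm_tst_imT_le f) hC))
      _ = _ := by ring
  obtain ⟨q, hq, hq'⟩ := exists_of_bound hT' ✓
  refine ⟨q, hq, fun ψ => ?_⟩
  have := hq' (toC ψ)
  change T (reT (toC ψ)) + I * T (imT (toC ψ)) = bil q (tst ψ) at this
  rwa [(by ext z; simp : reT (toC ψ) = ψ), (by ext z; simp : imT (toC ψ) = 0), map_zero, mul_zero, add_zero] at this

open Classical in
def mulT (b : ST n → ℝ) (ψ : 𝓣) : 𝓣 :=
  if h : ContDiff ℝ ∞ b then
    ⟨fun z => b z * ψ z, h.mul (by simpa using ψ.contDiff), ψ.hasCompactSupport.mul_left,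
      (closure_mono (Function.support_mul_subset_right _ _)).trans ψ.tsupport_subset⟩
  else 0

theorem mulT_apply {b} (h : ContDiff ℝ ∞ b) (ψ) (z : ST n) :
    mulT b ψ z = b z * ψ z := by
  rw [mulT, dif_pos h]; rfl

theorem tst_mulT {b} (h : ContDiff ℝ ∞ b) (hb : BM (ℭ b))
    (ψ : 𝓣) : tst (mulT b ψ) = mulOp (ℭ b) (tst ψ) := by
  refine Lp.ext ?_
  filter_upwards [coeFn_mulOp hb (tst ψ), coeFn_tst ψ, coeFn_tst (mulT b ψ)] with z h1 h2 h3
  rw [h1, h2, h3, mulT_apply h]; simp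

theorem dd_mulT {b} (h : ContDiff ℝ ∞ b) (i) (ψ : 𝓣) (z) :
    dd i (mulT b ψ) z = pd i b z * ψ z + b z * dd i ψ z := by
  rw [dd_apply, dd_apply, pd, funext (mulT_apply h ψ), fderiv_fun_mul (h.differentiable (by simp)).differentiableAt
    (ψ.contDiff.differentiable (by simp)).differentiableAt]
  simp [pd]; ring

theorem WD.mulOp {b} (h : ContDiff ℝ ∞ b) (hb : BM (ℭ b))
    {i} (hb' : BM (ℭ (pd i b))) {w w' : L2 n} (hw : WD i w w') :
    WD i (mulOp (ℭ b) w)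
      (mulOp (ℭ (pd i b)) w + mulOp (ℭ b) w') := fun ψ => by
  have e : tst (dd i (mulT b ψ)) = WaveX.mulOp (ℭ (pd i b)) (tst ψ)
      + WaveX.mulOp (ℭ b) (tst (dd i ψ)) := by
    refine Lp.ext ?_
    filter_upwards [coeFn_mulOp hb' (tst ψ), coeFn_tst ψ, coeFn_tst (dd i (mulT b ψ)),
      coeFn_mulOp hb (tst (dd i ψ)), coeFn_tst (dd i ψ), Lp.coeFn_add (WaveX.mulOp (ℭ (pd i b)) (tst ψ)) (WaveX.mulOp (ℭ b) (tst (dd i ψ)))]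
      with z h1 h2 h3 h4 h5 h6
    rw [h6, Pi.add_apply, h1, h4, h5, h2, h3, dd_mulT h]; simp
  have := hw (mulT b ψ)
  rw [e, tst_mulT h hb, map_add] at this
  rw [bil_mulOp hb, map_add, add_apply, bil_mulOp hb', bil_mulOp hb]
  linear_combination this

instance : (volume : Measure (ST n)).IsAddHaarMeasure :=
  inferInstanceAs ((volume : Measure ℝ).prod (volume : Measure (Sp n))).IsAddHaarMeasure


def ttFun (s : ℝ) (u : ST n → ℂ) (z : ST n) : ℂ :=
  (slab n : Set (ST n)).indicator u (z - (s, 0))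

theorem mp_time (s : ℝ) : MeasurePreserving (fun z : ST n => z - (s, 0)) :=
  measurePreserving_sub_right volume _

theorem memLp_ttFun (s) (u : L2 n) : MemLp (ttFun s u) 2 ϖ := by
  have h1 : MemLp ((slab n : Set (ST n)).indicator u) 2 volume :=
    (memLp_indicator_iff_restrict measurableSet_slab).2 (Lp.memLp u)
  exact (h1.comp_measurePreserving (mp_time s)).restrict _

theorem norm_toLp_ttFun_le (s) (u : L2 n) : ‖(memLp_ttFun s u).toLp _‖ ≤ ‖u‖ := by
  rw [Lp.norm_toLp, Lp.norm_def]
  refine ENNReal.toReal_mono (Lp.eLpNorm_ne_top u) ?_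
  have h1 : MemLp ((slab n : Set (ST n)).indicator u) 2 volume :=
    (memLp_indicator_iff_restrict measurableSet_slab).2 (Lp.memLp u)
  calc eLpNorm (ttFun s u) 2 ϖ ≤ eLpNorm (ttFun s u) 2 volume :=
        eLpNorm_mono_measure _ Measure.restrict_le_self
    _ = eLpNorm ((slab n : Set (ST n)).indicator u) 2 volume :=
        eLpNorm_comp_measurePreserving h1.1 (mp_time s)
    _ = eLpNorm u 2 ϖ := eLpNorm_indicator_eq_eLpNorm_restrict measurableSet_slab

theorem ttFun_ae_congr (s) {u w} (h : u =ᵐ[ϖ] w) :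
    ttFun s u =ᵐ[ϖ] ttFun s w := by
  have h1 : (slab n : Set (ST n)).indicator u =ᵐ[volume] (slab n : Set (ST n)).indicator w :=
    (ae_eq_restrict_iff_indicator_ae_eq measurableSet_slab).1 h
  exact ae_restrict_of_ae ((mp_time s).quasiMeasurePreserving.ae_eq_comp h1)

def tt (s : ℝ) : L2 n →L[ℂ] L2 n :=
  LinearMap.mkContinuous
    { toFun := fun u => (memLp_ttFun s u).toLp _
      map_add' := fun u w => by
        rw [← MemLp.toLp_add]
        refine MemLp.toLp_congr _ _ ((ttFun_ae_congr s (Lp.coeFn_add u w)).trans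
          (.of_forall fun z => ?_))
        simp [ttFun, indicator_add']
      map_smul' := fun c u => by
        rw [RingHom.id_apply, ← MemLp.toLp_const_smul]
        refine MemLp.toLp_congr _ _ ((ttFun_ae_congr s (Lp.coeFn_smul c u)).trans
          (.of_forall fun z => ?_))
        simp only [ttFun, Pi.smul_apply, indicator]
        split_ifs <;> simp }
    1 fun u => by rw [one_mul]; exact norm_toLp_ttFun_le s u

theorem coeFn_tt (s) (u) : tt s u =ᵐ[ϖ] ttFun s u :=
  (memLp_ttFun s u).coeFn_toLp

theorem norm_tt_le (s : ℝ) (u : L2 n) : ‖tt s u‖ ≤ ‖u‖ := norm_toLp_ttFun_le s u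

theorem bil_tt (s) (u w : L2 n) : bil (tt s u) w = bil u (tt (-s) w) := by
  have e (p : ST n → ℂ) : ∫ z, p z ∂ϖ =
      ∫ z, (slab n : Set (ST n)).indicator p z := (integral_indicator measurableSet_slab).symm
  rw [bil_eq, bil_eq, integral_congr_ae
    (by filter_upwards [coeFn_tt s u] with z h; rw [h]), integral_congr_ae
    (f := fun z => u z * tt (-s) w z)
    (by filter_upwards [coeFn_tt (-s) w] with z h; rw [h]), e, e,
    ← integral_sub_right_eq_self ((slab n : Set (ST n)).indicator
      fun z => u z * ttFun (-s) w z) ((s, 0) : ST n)]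
  refine integral_congr_ae (.of_forall fun z => ?_)
  have h0 : z - (s, 0) - (-s, 0) = z := by ext1 <;> simp
  simp [ttFun, indicator, h0]
  split_ifs <;> simp_all


theorem tt_tst_ae (s) (ψ) :
    tt s (tst ψ) =ᵐ[ϖ] fun z => (ψ (z - (s, 0)) : ℂ) := by
  refine (coeFn_tt s _).trans ((ttFun_ae_congr s (coeFn_tst ψ)).trans (.of_forall fun z => ?_))
  simp only [ttFun, indicator]
  split_ifs with h
  · rfl
  · rw [image_eq_zero_of_notMem_tsupport fun h' => h (ψ.tsupport_subset h')]; simp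

theorem tt_zero_tst (ψ : 𝓣) : tt 0 (tst ψ) = tst ψ := by
  refine Lp.ext ?_
  filter_upwards [tt_tst_ae 0 ψ, coeFn_tst ψ] with z h1 h2
  have h0 : z - (0, 0) = z := by ext1 <;> simp
  rw [h1, h2, h0]

theorem hasDerivAt_comp_time (f) (z : ST n) (s) :
    HasDerivAt (fun s : ℝ => (f (z - (s, 0)) : ℂ)) (-(dd 0 f (z - (s, 0)) : ℂ)) s := by
  have h2 : HasDerivAt (fun s => z - (s, 0)) (-(1, 0)) s := by
    have := ((hasDerivAt_id s).prodMk (hasDerivAt_const s 0)).const_sub z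
    simpa using this
  have h3 := (((f.contDiff.differentiable (by simp)).differentiableAt (x := z - (s, 0)).hasFDerivAt).comp_hasDerivAt s h2).ofReal_comp
  rw [dd_apply, pd, map_neg, Complex.ofReal_neg] at *
  exact h3

theorem hasDerivAt_bil_tt (v : L2 n) (f) (s) :
    HasDerivAt (fun s => bil v (tt s (tst f))) (-bil v (tt s (tst (dd 0 f)))) s := by
  obtain ⟨R, hR⟩ := f.hasCompactSupport.isCompact.isBounded.exists_norm_le
  set S : Set (ST n) := univ ×ˢ Metric.closedBall 0 R
  haveI : IsFiniteMeasure ((ϖ).restrict S) := ⟨by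
    rw [Measure.restrict_apply_univ, slabMeasure_eq, Measure.prod_prod]
    exact ENNReal.mul_lt_top (by simp) measure_closedBall_lt_top⟩
  have e {χ : 𝓣} (hχ : ∀ z ∉ tsupport f, χ z = 0) s : bil v (tt s (tst χ)) =
      ∫ z in S, v z * (χ (z - (s, 0)) : ℂ) ∂ϖ := by
    rw [bil_eq, setIntegral_eq_integral_of_forall_compl_eq_zero fun z hz => ?_]
    · exact integral_congr_ae (by filter_upwards [tt_tst_ae s χ] with z h; rw [h])
    · rw [hχ _ fun h => hz ⟨mem_univ _, mem_closedBall_zero_iff.2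
        (by simpa using (norm_snd_le _).trans (hR _ h))⟩]; simp
  simp [e fun z => image_eq_zero_of_notMem_tsupport, e (χ := dd 0 f) fun z hz => by
    rw [dd_apply, pd, fderiv_of_notMem_tsupport _ hz]; rfl, ← integral_neg]
  obtain ⟨C, hC⟩ := (dd 0 f).continuous.bounded_above_of_compact_support (dd 0 f).hasCompactSupport
  obtain ⟨C', hC'⟩ := f.continuous.bounded_above_of_compact_support f.hasCompactSupport
  have hv : Integrable v ((ϖ).restrict S) := ((Lp.memLp v).restrict S).integrable one_le_two
  have hm (f : 𝓣) s : AEStronglyMeasurable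
      (fun z => v z * (f (z - (s, 0)) : ℂ)) ((ϖ).restrict S) :=
    hv.1.mul (Complex.continuous_ofReal.comp
      (f.continuous.comp (continuous_id.sub continuous_const))).aestronglyMeasurable
  refine (hasDerivAt_integral_of_dominated_loc_of_deriv_le
    (F' := fun s z => -(v z * (dd 0 f (z - (s, 0)) : ℂ))) univ_mem
    (.of_forall fun s => hm f s) ((hv.norm.const_mul C').mono' (hm f s) (.of_forall fun z => ?_))
    (hm (dd 0 f) s).neg (.of_forall fun z s _ => ?_) (hv.norm.const_mul C)
    (.of_forall fun z s _ => ?_)).2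
  · rw [norm_mul, norm_real, mul_comm]; gcongr; exact hC' _
  · rw [norm_neg, norm_mul, norm_real, mul_comm]; gcongr; exact hC _
  · simpa using (hasDerivAt_comp_time f z s).const_mul (v z)

open Classical in
def ttT (s : ℝ) (f : 𝓣) : 𝓣 :=
  if h : tsupport (fun z => f (z - (s, 0))) ⊆ (slab n : Set (ST n)) then
    ⟨fun z => f (z - (s, 0)), contDiff_comp_sub f _, hasCompactSupport_comp_sub f _, h⟩
  else 0

def TB (a b : ℝ) (f : ST n → ℝ) : Prop := ∀ z, f z ≠ 0 → z.1 ∈ Icc a b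

theorem ttT_apply {a b s} {f : 𝓣} (hf : TB a b f) (ha : -1 < a + s)
    (hb : b + s < 1) (z) : ttT s f z = f (z - (s, 0)) := by
  have h : tsupport (fun z => f (z - (s, 0))) ⊆ (slab n) := by
    have h1 : tsupport (fun z => f (z - (s, 0))) ⊆ {z : ST n | z.1 ∈ Icc (a + s) (b + s)} := by
      refine closure_minimal (fun z hz => ?_) (isClosed_Icc.preimage continuous_fst)
      have := hf _ hz
      simp [Prod.fst_sub, mem_Icc] at this
      exact ⟨by linarith, by linarith⟩
    exact h1.trans fun z hz => ⟨⟨by linarith [hz.1], by linarith [hz.2]⟩, mem_univ _⟩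
  rw [ttT, dif_pos h]; rfl

theorem tst_ttT {a b s : ℝ} {f : 𝓣} (hf : TB a b f) (ha : -1 < a + s)
    (hb : b + s < 1) : tst (ttT s f) = tt s (tst f) := by
  refine Lp.ext ?_
  filter_upwards [tt_tst_ae s f, coeFn_tst (ttT s f)] with z h1 h2
  rw [h1, h2, ttT_apply hf ha hb]

theorem TB.dd {a b : ℝ} {f : 𝓣} (hf : TB a b f) (i) :
    TB a b (dd i f) := fun z hz => by
  by_contra h
  refine hz ?_
  have h1 : tsupport f ⊆ {z : ST n | z.1 ∈ Icc a b} :=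
    closure_minimal (fun z hz => hf _ hz) (isClosed_Icc.preimage continuous_fst)
  rw [dd_apply, pd, fderiv_of_notMem_tsupport _ fun h' => h (h1 h')]; rfl

theorem dd_ttT {a b s : ℝ} {f : 𝓣} (hf : TB a b f) (ha : -1 < a + s)
    (hb : b + s < 1) (i) : dd i (ttT s f) = ttT s (dd i f) := by
  ext z
  rw [ttT_apply (hf.dd i) ha hb, dd_apply, dd_apply, pd, pd, funext (ttT_apply hf ha hb), fderiv_comp_sub]

theorem exists_TB (f : 𝓣) : ∃ r, 0 < r ∧ r < 1 ∧ TB (-r) r f := by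
  have hc : IsCompact ((fun z => |z.1|) '' tsupport f) :=
    f.hasCompactSupport.isCompact.image (by fun_prop)
  rcases (tsupport f).eq_empty_or_nonempty with h | h
  · refine ⟨1 / 2, by norm_num, by norm_num, fun z hz => ?_⟩
    have := subset_tsupport f hz
    rw [h] at this; exact this.elim
  · obtain ⟨_, ⟨z0, h0, rfl⟩, hz0⟩ := hc.exists_isGreatest (h.image _)
    have h1 : |z0.1| < 1 := abs_lt.2 (f.tsupport_subset h0).1
    refine ⟨(|z0.1| + 1) / 2, by positivity, by linarith, fun z hz => ?_⟩
    have := hz0 ⟨z, subset_tsupport f hz, rfl⟩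
    exact abs_le.1 (this.trans ✓)

theorem dd_add (i) (f g : 𝓣) : dd i (f + g) = dd i f + dd i g :=
  lineDerivOp_add _ _ _

theorem dd_smul (i : Λ) (c : ℝ) (f) : dd i (c • f) = c • dd i f :=
  lineDerivOp_smul _ _ _


theorem norm_deriv_le_of_eq {f f' h h' g : ℝ → ℂ} {e} (he : ‖e‖ = 1) {δ F H G} (hδ : 0 < δ)
    {f'' : ℝ → ℂ} (hf : ∀ s, HasDerivAt f (f' s) s) (hf' : ∀ s, HasDerivAt f' (f'' s) s)
    (hh : ∀ s, HasDerivAt h (h' s) s) (hF : ∀ s, ‖f s‖ ≤ F) (hH : ∀ s, ‖h s‖ ≤ H)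
    (hG : ∀ s, ‖g s‖ ≤ G) (heq : ∀ s ∈ Icc 0 δ, f'' s - e * h' s + g s = 0) :
    ‖f' 0‖ ≤ 2 * F / δ + 2 * H + δ * G := by
  have h1 : ∀ s ∈ Icc 0 δ, ‖(f' s - e * h s) - (f' 0 - e * h 0)‖ ≤ G * δ := fun s hs => by
    refine ((convex_Icc 0 δ).norm_image_sub_le_of_norm_hasDerivWithin_le
     
      (fun x _ => ((hf' x).sub ((hh x).const_mul e)).hasDerivWithinAt) (fun x hx => ?_)
      (left_mem_Icc.2 hδ.le) hs).trans (mul_le_l ?_ ((norm_nonneg _).trans (hG 0)))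
    · rw [show f'' x - e * h' x = -g x by linear_combination heq x hx, norm_neg]; exact hG x
    · rw [sub_zero, norm_of_nonneg hs.1]; exact hs.2
  have hH' (s) : ‖e * h s‖ ≤ H := by rw [norm_mul, he, one_mul]; exact hH s
  have h3 := (convex_Icc 0 δ).norm_image_sub_le_of_norm_hasDerivWithin_le
    (f := fun s => f s - s * f' 0) (f' := fun s => f' s - 1 * f' 0)
    (fun x _ => ((hf x).sub ((hasDerivAt_id x).ofReal_comp.mul_const (f' 0))).hasDerivWithinAt)
    (fun s hs => by
      change ‖f' s - 1 * f' 0‖ ≤ _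
      rw [show f' s - 1 * f' 0 = f' s - e * h s - (f' 0 - e * h 0) + (e * h s - e * h 0) by ring]
      exact norm_add_le_of_le (h1 s hs) (norm_sub_le_of_le (hH' s) (hH' 0)))
    (left_mem_Icc.2 hδ.le) (right_mem_Icc.2 hδ.le)
  have h4 := norm_sub_le_of_le (norm_sub_le_of_le (hF δ) (hF 0)) h3
  rw [show f δ - f 0 - (f δ - δ * f' 0 - (f 0 - (0 : ℝ) * f' 0)) = δ * f' 0 by push_cast; ring,
    sub_zero, norm_mul, norm_real, norm_of_nonneg hδ.le] at h4
  rw [show 2 * F / δ + 2 * H + δ * G = (2 * F + (2 * H + δ * G) * δ) / δ by field_simp; ring,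
    le_div_iff₀ hδ]
  linarith

theorem norm_bil_dd_le_of_TB {v A G : L2 n}
    (h : ∀ ψ : 𝓣, bil v (tst (dd 0 (dd 0 ψ))) + bil A (tst (dd 0 ψ)) + bil G (tst ψ) = 0)
    {ψ : 𝓣} {a b δ e : ℝ} (hδ : 0 < δ) (he : |e| = 1) (hψ : TB a b ψ)
    (ha : ∀ s ∈ Icc 0 δ, -1 < a + e * s) (hb : ∀ s ∈ Icc 0 δ, b + e * s < 1) :
    ‖bil v (tst (dd 0 ψ))‖ ≤ (2 * ‖v‖ / δ + 2 * ‖A‖ + δ * ‖G‖) * ‖tst ψ‖ := by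
  have hbd u s : ‖bil u (tt (e * s) (tst ψ))‖ ≤ ‖u‖ * ‖tst ψ‖ :=
    (norm_bil_le _ _).trans (mul_le_l (norm_tt_le _ _) (norm_nonneg _))
  have hd u (χ : 𝓣) s : HasDerivAt
      (fun s => bil u (tt (e * s) (tst χ))) (e * -bil u (tt (e * s) (tst (dd 0 χ)))) s := by
    have h1 : HasDerivAt (fun s => e * s) e s := by
      simpa using (hasDerivAt_id s).const_mul e
    have := (hasDerivAt_bil_tt u χ (e * s)).scomp s h1
    rw [mul_neg]
    simpa [Function.comp_def] using this
  have he2 : (e : ℂ) * e = 1 := by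
    have : e * e = 1 := by rw [← abs_mul_abs_self, he, one_mul]
    exact_mod_cast this
  have := norm_deriv_le_of_eq (e := e) (by simp [he]) hδ (hd v ψ)
    (fun s => ((hd v (dd 0 ψ) s).neg).const_mul (e : ℂ)) (hd A ψ)
    (hbd v) (hbd A) (hbd G) (fun s hs => by
      have h1 := h (ttT (e * s) ψ)
      rw [dd_ttT hψ (ha s hs) (hb s hs), dd_ttT (hψ.dd 0) (ha s hs) (hb s hs),
        tst_ttT hψ (ha s hs) (hb s hs), tst_ttT (hψ.dd 0) (ha s hs) (hb s hs),
        tst_ttT ((hψ.dd 0).dd 0) (ha s hs) (hb s hs)] at h1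
      linear_combination h1 + (bil v (tt (e * s) (tst (dd 0 (dd 0 ψ)))) +
        bil A (tt (e * s) (tst (dd 0 ψ)))) * he2)
  rw [mul_zero, tt_zero_tst, norm_mul, norm_neg, norm_real, norm_eq_abs, he,
    one_mul] at this
  refine this.trans (le_of_eq ?_)
  ring

theorem BM_of_le {b : ST n → ℝ} (hb : Continuous b) {C : ℝ} (hC : ∀ z, |b z| ≤ C) :
    BM (ℭ b) :=
  ⟨(Complex.continuous_ofReal.comp hb).measurable, C, fun z => by
    rw [norm_real]; exact hC z⟩

theorem norm_mulOp_real_le {b : ST n → ℝ} (hb : Continuous b) {B} (hB : ∀ z, |b z| ≤ B)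
    (u) : ‖mulOp (ℭ b) u‖ ≤ B * ‖u‖ :=
  norm_mulOp_le (BM_of_le hb hB) (fun z => by rw [norm_real]; exact hB z) u

def stepT (z : ST n) : ℝ := Real.smoothTransition (z.1 + 1 / 2)

theorem contDiff_stepT : ContDiff ℝ ∞ (stepT (n := n)) :=
  Real.smoothTransition.contDiff.comp (contDiff_fst.add contDiff_const)

theorem abs_stepT_le (z : ST n) : |stepT z| ≤ 1 := by
  rw [stepT, abs_of_nonneg (Real.smoothTransition.nonneg _)]
  exact Real.smoothTransition.le_one _

theorem abs_one_sub_stepT_le (z : ST n) : |1 - stepT z| ≤ 1 := by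
  rw [stepT, abs_of_nonneg (sub_nonneg.2 (Real.smoothTransition.le_one _))]
  exact sub_le_self _ (Real.smoothTransition.nonneg _)

theorem exists_WD_time {v A G}
    (h : ∀ ψ : 𝓣, bil v (tst (dd 0 (dd 0 ψ))) + bil A (tst (dd 0 ψ)) + bil G (tst ψ) = 0)
    {μ} (hμ : 1 ≤ μ) :
    ∃ v1, WD 0 v v1 ∧ ‖v1‖ ≤ 32 * (μ * ‖v‖ + ‖A‖ + μ⁻¹ * ‖G‖) := by
  have hμ0 : 0 < μ := by linarith
  set δ : ℝ := 1 / (4 * μ) with hδ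
  have hδ1 : δ ≤ 1 / 4 := by
    rw [hδ]; exact one_div_le_one_div_of_le ✓ ✓
  set C := 2 * ‖v‖ / δ + 2 * ‖A‖ + δ * ‖G‖ with hC
  have hs2 : ContDiff ℝ ∞ fun z : ST n => 1 - stepT z := contDiff_const.sub contDiff_stepT
  have hbound ψ : ‖bil v (tst (dd 0 ψ))‖ ≤ 2 * C * ‖tst ψ‖ := by
    obtain ⟨r, hr0, hr1, hr⟩ := exists_TB ψ
    have key {b : ST n → ℝ} (hb : ContDiff ℝ ∞ b) (hb1 : ∀ z, |b z| ≤ 1) {a a' e : ℝ}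
        (he : |e| = 1) (hT : TB a a' (mulT b ψ)) (ha : ∀ s ∈ Icc 0 δ, -1 < a + e * s)
        (ha' : ∀ s ∈ Icc 0 δ, a' + e * s < 1) :
        ‖bil v (tst (dd 0 (mulT b ψ)))‖ ≤ C * (1 * ‖tst ψ‖) := by
      refine (norm_bil_dd_le_of_TB h (by positivity : 0 < δ) he hT ha ha').trans (mul_le_l ?_ (by positivity : 0 ≤ C))
      rw [tst_mulT hb (BM_of_le hb.continuous hb1)]
      exact norm_mulOp_real_le hb.continuous hb1 _
    have h1 : TB (-1 / 2) r (mulT stepT ψ) := fun z hz => by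
      rw [mulT_apply contDiff_stepT] at hz
      refine ⟨?_, (hr z (right_ne_zero_of_mul hz)).2⟩
      by_contra hlt
      exact left_ne_zero_of_mul hz (Real.smoothTransition.zero_of_nonpos (by linarith))
    have h2 : TB (-r) (1 / 2) (mulT (fun z => 1 - stepT z) ψ) := fun z hz => by
      rw [mulT_apply hs2] at hz
      refine ⟨(hr z (right_ne_zero_of_mul hz)).1, ?_⟩
      by_contra hlt
      refine left_ne_zero_of_mul hz ?_
      rw [stepT, Real.smoothTransition.one_of_one_le ✓, sub_self]
    have e : ψ = mulT stepT ψ + mulT (fun z => 1 - stepT z) ψ := by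
      ext z
      change _ = mulT stepT ψ z + mulT (fun z => 1 - stepT z) ψ z
      rw [mulT_apply contDiff_stepT, mulT_apply hs2]; ring
    conv_lhs => rw [e, dd_add, map_add, map_add]
    refine (norm_add_le_of_le
      (key contDiff_stepT abs_stepT_le (e := -1) (by simp) h1
        (fun s hs => by linarith [hs.2]) fun s hs => by linarith [hs.1])
      (key hs2 abs_one_sub_stepT_le (e := 1) (by simp) h2
        (fun s hs => by linarith [hs.1]) fun s hs => by linarith [hs.2])).trans (le_of_eq (by ring))
  let T : 𝓣 →ₗ[ℝ] ℂ :=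
    { toFun := fun ψ => -bil v (tst (dd 0 ψ))
      map_add' := fun f g => by
        rw [dd_add, map_add, map_add]; ring
      map_smul' := fun c f => by
        rw [dd_smul, map_smul, RingHom.id_apply]
        simp [← Complex.coe_smul] }
  obtain ⟨q, hq, hq'⟩ := exists_of_bound_real (T := T)
    (fun ψ => by change ‖-_‖ ≤ _; rw [norm_neg]; exact hbound ψ) ✓
  refine ⟨q, fun ψ => ?_, hq.trans ?_⟩
  · rw [← hq' ψ]; exact (neg_neg _).symm
  · have h1 : 2 * ‖v‖ / δ = 8 * μ * ‖v‖ := by rw [hδ]; field_simp; ring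
    have h3 : 0 ≤ μ⁻¹ * ‖G‖ := by positivity
    rw [hC, h1, (by rw [hδ]; field_simp : δ * ‖G‖ = μ⁻¹ * ‖G‖ / 4)]
    nlinarith [norm_nonneg A, norm_nonneg v]

theorem tendsto_bil_tt (p w : L2 n) : Tendsto (fun s => bil p (tt s w)) (𝓝 0) (𝓝 (bil p w)) := by
  have h0 : tt 0 w = w := denseRange_tstC.induction_on w
    (isClosed_eq (by fun_prop) continuous_id) fun f => by
      rw [tstC_eq, map_add, map_smul, tt_zero_tst, tt_zero_tst]
  have hc : Continuous fun s => bil p (tt s w) := by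
    refine continuous_of_uniform_approx_of_continuous fun U hU => ?_
    obtain ⟨ε, hε, hU⟩ := Metric.mem_uniformity_dist.1 hU
    obtain ⟨f, hf⟩ := denseRange_tstC.exists_dist_lt w (ε := ε / (‖p‖ + 1)) ✓
    refine ⟨fun s => bil p (tt s (tstC f)), ?_, fun s => hU ?_⟩
    · simp [tstC_eq, map_add, map_smul, smul_eq_mul]
      have hd f : Continuous fun s => bil p (tt s (tst f)) :=
        continuous_iff_continuousAt.2 fun s => (hasDerivAt_bil_tt p f s).continuousAt
      exact (hd _).add (continuous_const.mul (hd _))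
    · rw [dist_eq_norm, ← map_sub, ← map_sub]
      rw [dist_eq_norm, lt_div_iff₀ ✓] at hf
      refine ((norm_bil_le _ _).trans (mul_le_l (norm_tt_le _ _) (norm_nonneg _))).trans_lt ?_
      linarith [norm_nonneg (w - tstC f)]
  simpa only [h0] using hc.tendsto 0

theorem tendsto_tt (w : L2 n) : Tendsto (fun s => tt s w) (𝓝 0) (𝓝 w) := by
  rw [tendsto_iff_norm_sub_tendsto_zero]
  have h1 : Tendsto (fun s => (inner ℂ w (tt s w)).re) (𝓝 0) (𝓝 (‖w‖ ^ 2)) := by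
    have := Complex.continuous_re.continuousAt.tendsto.comp (tendsto_bil_tt (cj w) w)
    rw [bil_cj_self, Complex.ofReal_re] at this
    refine this.congr fun s => ?_
    rw [inner_eq_bil]; rfl
  have h2 : Tendsto (fun s => sqrt (2 * ‖w‖ ^ 2 - 2 * (inner ℂ w (tt s w)).re)) (𝓝 0)
      (𝓝 0) := by
    have := (Real.continuous_sqrt.tendsto _).comp ((h1.const_mul 2).const_sub (2 * ‖w‖ ^ 2))
    rw [sub_self, Real.sqrt_zero] at this
    exact this
  refine squeeze_zero (fun s => norm_nonneg _) (fun s => Real.le_sqrt_of_sq_le ?_) h2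
  rw [← norm_neg, neg_sub, norm_sub_sq (𝕜 := ℂ) w (tt s w)]
  have := pow_le_pow_left₀ (norm_nonneg _) (norm_tt_le s w) 2
  have e : RCLike.re (inner ℂ w (tt s w)) = (inner ℂ w (tt s w)).re := rfl
  rw [e]
  linarith

theorem pd_comp_fst {a} (ha : ContDiff ℝ ∞ a) (i) (z) :
    pd i (fun z : ST n => a z.1) z = deriv a z.1 * (dir i).1 :=
  congrArg (fun L => L (dir i)) (((ha.differentiable (by simp)) z.1).hasDerivAt.comp_hasFDerivAt z
    (f' := ContinuousLinearMap.fst ℝ ℝ (Sp n)) hasFDerivAt_fst).fderiv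

theorem pd_time {a : ℝ → ℝ} (ha : ContDiff ℝ ∞ a) (z : ST n) :
    pd 0 (fun z : ST n => a z.1) z = deriv a z.1 := by
  simp [pd_comp_fst ha, dir]

theorem pd_space_time {a : ℝ → ℝ} (ha : ContDiff ℝ ∞ a) (j : Fin n) (z) :
    pd j.succ (fun z : ST n => a z.1) z = 0 := by
  simp [pd_comp_fst ha, dir]

theorem contDiff_time {a : ℝ → ℝ} (ha : ContDiff ℝ ∞ a) : ContDiff ℝ ∞ fun z : ST n => a z.1 :=
  ha.comp contDiff_fst

theorem BM_time {a : ℝ → ℝ} (ha : Continuous a) {r} (h : ∀ t, a t ≠ 0 → |t| ≤ r) :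
    BM (ℭₜ a) := by
  have hc : HasCompactSupport a := HasCompactSupport.intro (isCompact_Icc)
    fun t ht => by
      by_contra h'
      exact ht (abs_le.1 (h t h'))
  obtain ⟨C, hC⟩ := ha.bounded_above_of_compact_support hc
  exact BM_of_le (ha.comp continuous_fst) fun z => hC z.1

theorem hasDerivAt_bil_tt_cutoff {z z' : L2 n} (hz : WD 0 z z') {χ}
    (hχ : ContDiff ℝ ∞ χ) {r} (hr : ∀ t, χ t ≠ 0 → |t| ≤ r) (hr1 : r < 1) (u) :
    HasDerivAt (fun s => bil z (tt s (mulOp (ℭₜ χ) u))) (bil z' (mulOp (ℭₜ χ) u)) 0 := by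
  set M := mulOp (ℭₜ χ) with hM
  have hT ψ : M (tst ψ) = tst (mulT (fun z => χ z.1) ψ) :=
    (tst_mulT (contDiff_time hχ) (BM_time hχ.continuous hr) ψ).symm
  have hTB (ψ : 𝓣) : TB (-r) r (mulT (fun z => χ z.1) ψ) := fun z hz => by
    rw [mulT_apply (contDiff_time hχ)] at hz
    exact abs_le.1 (hr _ (left_ne_zero_of_mul hz))
  have hd ψ s (hs : |s| < 1 - r) : HasDerivAt (fun s => bil z (tt s (M (tst ψ))))
      (bil z' (tt s (M (tst ψ)))) s := by
    obtain ⟨h1, h2⟩ := abs_lt.1 hs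
    rw [hT]
    have := hasDerivAt_bil_tt z (mulT (fun z => χ z.1) ψ) s
    rwa [← tst_ttT ((hTB ψ).dd 0) ✓ ✓, ← dd_ttT (hTB ψ) ✓
      ✓, hz, neg_neg, tst_ttT (hTB ψ) ✓ ✓] at this
  rw [hasDerivAt_iff_isLittleO_nhds_zero, Asymptotics.isLittleO_iff]
  intro ε hε
  obtain ⟨δ, hδ, H⟩ := Metric.tendsto_nhds_nhds.1 (tendsto_tt z') (ε / (‖M u‖ + 1)) ✓
  filter_upwards [Metric.ball_mem_nhds 0 (lt_min hδ (sub_pos.2 hr1))] with h hh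
  rw [mem_ball_zero_iff, lt_min_iff, norm_eq_abs] at hh
  have hm {s} (hs : s ∈ uIcc 0 h) : |s| ≤ |h| := by
    simpa only [sub_zero] using abs_sub_left_of_mem_uIcc hs
  rw [zero_add]
  have key : ‖bil z (tt h (M u)) - bil z (tt 0 (M u)) - h • bil z' (M u)‖
      ≤ ε / (‖M u‖ + 1) * ‖M u‖ * ‖h‖ := by
    generalize ε / (‖M u‖ + 1) = ε at H
    refine denseRange_tstC.induction_on (p := fun u => ‖bil z (tt h (M u)) - bil z (tt 0 (M u))
      - h • bil z' (M u)‖ ≤ ε * ‖M u‖ * ‖h‖) u (isClosed_le (by fun_prop) (by fun_prop)) fun f => ?_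
    have := (convex_uIcc 0 h).norm_image_sub_le_of_norm_hasDerivWithin_le
      (f := fun s => bil z (tt s (M (tstC f))) - s * bil z' (M (tstC f)))
      (f' := fun s => bil z' (tt s (M (tstC f))) - 1 * bil z' (M (tstC f))) (C := ε * ‖M (tstC f)‖)
      (fun s hs => by
        have hs := (hm hs).trans_lt hh.2
        have := (hd (reT f) s hs).add ((hd (imT f) s hs).const_mul I)
        simp only [tstC_eq, map_add, map_smul, smul_eq_mul]
        exact (this.sub ((hasDerivAt_id s).ofReal_comp.mul_const _)).hasDerivWithinAt)
      (fun s hs => by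
        rw [one_mul, show bil z' (tt s (M (tstC f))) - bil z' (M (tstC f)) =
          bil (tt (-s) z' - z') (M (tstC f)) by rw [map_sub, sub_apply, bil_tt, neg_neg]]
        refine (norm_bil_le _ _).trans (mul_le_r ?_ (norm_nonneg _))
        rw [← dist_eq_norm]
        exact (H (by simpa using (hm hs).trans_lt hh.1)).le)
      left_mem_uIcc right_mem_uIcc
    rw [sub_zero] at this
    refine le_trans (le_of_eq ?_) this
    rw [real_smul]; congr 1; push_cast; ring
  refine key.trans (mul_le_r ?_ (norm_nonneg _))
  rw [div_mul_eq_mul_div, div_le_iff₀ ✓]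
  linarith

theorem green_time {a} (ha : ContDiff ℝ ∞ a) {r} (hr0 : 0 ≤ r) (hr1 : r < 1)
    (hr : ∀ t, a t ≠ 0 → |t| ≤ r) {w w' z z' : L2 n} (hw : WD 0 w w') (hz : WD 0 z z') :
    bil (mulOp (ℭₜ (deriv a)) w) z + bil (mulOp (ℭₜ a) w') z
      + bil (mulOp (ℭₜ a) w) z' = 0 := by
  have hda : ∀ t, deriv a t ≠ 0 → |t| ≤ r := fun t ht => by
    have h1 : tsupport a ⊆ Icc (-r) r :=
      closure_minimal (fun t ht => abs_le.1 (hr t ht)) isClosed_Icc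
    exact abs_le.2 (h1 (support_deriv_subset ht))
  have hBa := BM_time (n := n) ha.continuous hr
  have hBda := BM_time (n := n) (ha.continuous_deriv (by simp)) hda
  set W := mulOp (ℭₜ a) w with hW
  set W' := mulOp (ℭₜ (deriv a)) w + mulOp (ℭₜ a) w' with hW'
  have hWD : WD 0 W W' := by
    have hp : (fun z => ((pd 0 (fun z : ST n => a z.1) z : ℝ) : ℂ)) =
        fun z => ((deriv a z.1 : ℝ) : ℂ) := funext fun z => by rw [pd_time ha]
    have := hw.mulOp (contDiff_time ha) hBa (by rw [hp]; exact hBda)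
    rwa [hp] at this
  let B : ContDiffBump (0 : ℝ) := ⟨(1 + r) / 2, (3 + r) / 4, by linarith, by linarith⟩
  have hχ : ContDiff ℝ ∞ B := B.contDiff
  have hχr : ∀ t, B t ≠ 0 → |t| ≤ (3 + r) / 4 := fun t ht => by
    have : t ∈ Function.support B := ht
    rw [B.support_eq, mem_ball_zero_iff] at this
    exact this.le
  have hχ1 : ∀ t, |t| ≤ (1 + r) / 2 → B t = 1 := fun t ht =>
    B.one_of_mem_closedBall (by rw [mem_closedBall_zero_iff]; exact ht)
  have hBχ := BM_time (n := n) hχ.continuous hχr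
  set M := mulOp (ℭₜ B) with hM
  have hMa {b : ℝ → ℝ} (hbB : BM (ℭₜ b)) (hb : ∀ t, b t ≠ 0 → |t| ≤ r)
      u : M (mulOp (ℭₜ b) u) = mulOp (ℭₜ b) u := by
    rw [hM, mulOp_mulOp hBχ hbB]
    congr 2
    ext z
    by_cases h : b z.1 = 0
    · simp [h]
    · rw [hχ1 _ ((hb _ h).trans ✓)]; simp
  have e δ (hδ : |δ| < (1 - r) / 8) : M (tt δ W) = tt δ W := by
    refine Lp.ext ?_
    filter_upwards [coeFn_mulOp hBχ (tt δ W), (coeFn_tt δ W).trans (ttFun_ae_congr δ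
      (coeFn_mulOp hBa w))] with x h1 h2
    rw [h1, h2]
    simp [ttFun, indicator]
    split_ifs with h
    · by_cases h' : a (x.1 - δ) = 0
      · simp [h']
      · have h3 := abs_le.1 (hr _ h')
        have h4 := abs_lt.1 hδ
        rw [hχ1 _ (abs_le.2 ⟨by linarith, by linarith⟩), Complex.ofReal_one, one_mul]
    · simp
  have i1 := hasDerivAt_bil_tt_cutoff hz hχ hχr ✓ W
  rw [← hM, hMa hBa hr w] at i1
  have key := i1.unique (((hasDerivAt_bil_tt_cutoff hWD hχ hχr ✓ z).scomp_of_eq 0 (hasDerivAt_neg 0) neg_zero.symm).congr_of_eventuallyEq <| by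
    filter_upwards [Metric.ball_mem_nhds 0 (show 0 < (1 - r) / 8 by linarith)] with s hs
    rw [Function.comp_apply, ← bil_tt, ← bil_mulOp hBχ, ← hM, e s (by simpa using hs), bil_comm])
  rw [← bil_mulOp hBχ, ← hM, (by rw [hW', map_add, hMa hBda hda, hMa hBa hr] : M W' = W'), neg_one_smul] at key
  rw [bil_comm z', hW', map_add, add_apply] at key
  linear_combination key

section

section profile

theorem profile_left (h : IsLPProfile φ) {r} (hr : r ≤ 1 / 2) : φ r = 0 := by
  have h1 : Iio (1 / 2) ⊆ {r | φ r = 0} := fun r hr => by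
    by_contra h0
    exact absurd (h.supp h0).1 (not_le.2 hr)
  have := closure_minimal h1 (isClosed_eq h.smooth.continuous continuous_const)
  rw [closure_Iio] at this
  exact this hr

theorem profile_right (h : IsLPProfile φ) {r} (hr : 2 ≤ r) : φ r = 0 := by
  have h1 : Ioi 𝟚 ⊆ {r | φ r = 0} := fun r hr => by
    by_contra h0
    exact absurd (h.supp h0).2 (not_le.2 hr)
  have := closure_minimal h1 (isClosed_eq h.smooth.continuous continuous_const)
  rw [closure_Ioi] at this
  exact this hr

theorem profile_scale (h : IsLPProfile φ) {r} {K k} (hr : r ≤ 2 ^ K) (hk : K ≤ k) :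
    φ (r / 2 ^ (k + 1)) = 0 := by
  refine profile_left h ?_
  rw [div_le_iff₀ ✓]
  have : 𝟚 ^ K ≤ 2 ^ k := pow_le_pow_right₀ ✓ hk
  rw [pow_succ]; linarith

theorem lp0_eq (h : IsLPProfile φ) {r} {K} (hr : r ≤ 2 ^ K) :
    lpSymbol φ 0 r = 1 - ∑ k ∈ Finset.range K, φ (r / 2 ^ (k + 1)) := by
  rw [lpSymbol, tsum_eq_sum (s := Finset.range K) fun k hk => profile_scale h hr (by simpa using hk)]

theorem lp0_one (h : IsLPProfile φ) {r : ℝ} (hr : r ≤ 1) : lpSymbol φ 0 r = 1 := by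
  rw [lp0_eq h (K := 0) (by simpa using hr)]; simp

theorem exists_le_two_pow (r : ℝ) : ∃ K : ℕ, r < 2 ^ K := pow_unbounded_of_one_lt r ✓

theorem lp0_zero (h : IsLPProfile φ) {r} (hr : 2 ≤ r) : lpSymbol φ 0 r = 0 := by
  have h1 := h.sum_one r ✓
  have h2 : HasSum (fun k => φ (r / 2 ^ (k + 1))) 1 := by
    have hi : Function.Injective (fun k : ℕ => ((k : ℤ) + 1)) := fun a b hab => by
      simpa using hab
    rw [← hi.hasSum_iff] at h1
    · refine h1.congr_fun fun k => ?_
      simp only [Function.comp_apply]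
      congr 1
      rw [zpow_neg, div_eq_mul_inv, mul_comm]
      norm_cast
    · intro j hj
      have hj0 : j ≤ 0 := by
        by_contra hlt
        exact hj ⟨(j - 1).toNat, by simp; omega⟩
      refine profile_right h ?_
      have : (1 : ℝ) ≤ 2 ^ (-j) := one_le_zpow₀ ✓ ✓
      nlinarith
  rw [lpSymbol, h2.tsum_eq, sub_self]

theorem contDiff_lp0 (h : IsLPProfile φ) : ContDiff ℝ ∞ (lpSymbol φ 0) := by
  rw [contDiff_iff_contDiffAt]
  intro r
  obtain ⟨K, hK⟩ := exists_le_two_pow r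
  have e : lpSymbol φ 0 =ᶠ[𝓝 r] fun r => 1 - ∑ k ∈ Finset.range K, φ (r / 2 ^ (k + 1)) := by
    filter_upwards [Iio_mem_nhds hK] with x hx
    exact lp0_eq h (le_of_lt hx)
  exact ContDiffAt.congr_of_eventuallyEq (ContDiff.contDiffAt (contDiff_const.sub (ContDiff.sum fun k _ => h.smooth.comp (contDiff_id.div_const _)))) e

theorem lpSymbol_succ (h : IsLPProfile φ) (k) (r) :
    lpSymbol φ (k + 1) r = lpSymbol φ 0 (r / 2 ^ (k + 1)) - lpSymbol φ 0 (r / 2 ^ k) := by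
  obtain ⟨K, hK⟩ := exists_le_two_pow (r / 2 ^ (k + 1))
  have h2 : r / 2 ^ k ≤ 2 ^ (K + 1) := by
    have : r / 2 ^ k = r / 2 ^ (k + 1) * 2 := by rw [pow_succ]; field_simp
    rw [this, pow_succ _ K]; linarith
  rw [lp0_eq h hK.le, lp0_eq h h2, Finset.sum_range_succ']
  have e : ∀ j : ℕ, r / 2 ^ k / 2 ^ (j + 1 + 1) = r / 2 ^ (k + 1) / 2 ^ (j + 1) := fun j => by
    rw [div_div, div_div]; congr 1; ring
  simp only [e, (by rw [div_div]; congr 1; ring : r / 2 ^ k / 2 ^ (0 + 1) = r / 2 ^ (k + 1)), lpSymbol]; ring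

theorem sum_lpSymbol (h : IsLPProfile φ) (N) (r) :
    ∑ j ∈ Finset.range (N + 1), lpSymbol φ j r = lpSymbol φ 0 (r / 2 ^ N) := by
  induction N with
  | zero => simp
  | succ N ih => rw [sum_range_succ, ih, lpSymbol_succ h]; ring

theorem truncSymbol_eq (h : IsLPProfile φ) (k) (r) :
    truncSymbol φ k r = lpSymbol φ 0 (r / 2 ^ (max 1 (k / 2) - 1)) := by
  rw [truncSymbol, ← sum_lpSymbol h, Nat.sub_add_cancel (le_max_left _ _)]

variable {V : Type} [NormedAddCommGroup V] [InnerProductSpace ℝ V]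

theorem contDiff_radial {m} (hm : ContDiff ℝ ∞ m) {c : ℝ} (h1 : ∀ r ≤ 1 / 2, m r = c) :
    ContDiff ℝ ∞ fun η : V => (m (2 * π * ‖η‖) : ℂ) := by
  rw [contDiff_iff_contDiffAt]
  intro η
  by_cases h0 : η = 0
  · have e : (fun η => (m (2 * π * ‖η‖) : ℂ)) =ᶠ[𝓝 η] fun _ => c := by
      have : Tendsto (fun η => 2 * π * ‖η‖) (𝓝 η) (𝓝 0) := by
        have : Continuous fun η : V => 2 * π * ‖η‖ := by fun_prop
        simpa [h0] using this.tendsto η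
      filter_upwards [this.eventually (Iio_mem_nhds (by norm_num : (0 : ℝ) < 1 / 2))] with x hx
      rw [h1 _ (le_of_lt hx)]
    exact contDiffAt_const.congr_of_eventuallyEq e
  · exact (Complex.ofRealCLM.contDiff.comp hm).contDiffAt.comp η
      (contDiffAt_const.mul (contDiffAt_norm ℝ h0))

variable [FiniteDimensional ℝ V]

theorem hasCompactSupport_radial {m : ℝ → ℝ} (h2 : ∀ r, 4 ≤ r → m r = 0) :
    HasCompactSupport fun η : V => (m (2 * π * ‖η‖) : ℂ) := by
  refine HasCompactSupport.intro (isCompact_closedBall 0 1) fun η hη => ?_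
  rw [mem_closedBall_zero_iff, not_le] at hη
  rw [h2 _ (by nlinarith [Real.pi_gt_three]), ofReal_zero]

def lowS (V : Type) [NormedAddCommGroup V] [InnerProductSpace ℝ V] [FiniteDimensional ℝ V]
    (h : IsLPProfile φ) : 𝓢(V, ℂ) :=
  (hasCompactSupport_radial (V := V) fun _ hr => lp0_zero h (by linarith)).toSchwartzMap
    (contDiff_radial (contDiff_lp0 h) (c := 1) fun _ hr => lp0_one h (by linarith))

theorem lowS_apply (h : IsLPProfile φ) (η : V) :
    lowS V h η = (lpSymbol φ 0 (2 * π * ‖η‖) : ℂ) := rfl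

def bandS (V : Type) [NormedAddCommGroup V] [InnerProductSpace ℝ V] [FiniteDimensional ℝ V]
    (h : IsLPProfile φ) : 𝓢(V, ℂ) :=
  (hasCompactSupport_radial (V := V) fun _ hr => profile_right h (by linarith)).toSchwartzMap
    (contDiff_radial h.smooth (c := 0) fun _ hr => profile_left h hr)

theorem bandS_apply (h : IsLPProfile φ) (η : V) :
    bandS V h η = (φ (2 * π * ‖η‖) : ℂ) := rfl

end profile

section conv

variable {F : Type} [NormedAddCommGroup F] [NormedSpace ℝ F]

def cv (κ : 𝓢(ST n, F)) (g : ST n → ℝ) (z : ST n) : F := ∫ w, g w • κ (z - w)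

theorem integrable_cv (κ : 𝓢(ST n, F)) {g} (hg : Measurable g) {B : ℝ}
    (hB : ∀ z, |g z| ≤ B) (z) : Integrable fun w => g w • κ (z - w) :=
  (κ.integrable.comp_sub_left z).bdd_smul B hg.aestronglyMeasurable (.of_forall hB)

theorem cv_eq (κ : 𝓢(ST n, F)) (g) (z) :
    cv κ g z = ∫ w, g (z - w) • κ w := by
  rw [cv, ← integral_sub_left_eq_self (fun w => g w • κ (z - w)) _ z]
  simp

theorem exists_decay {V} [NormedAddCommGroup V] [NormedSpace ℝ V] (κ : 𝓢(V, F))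
    (N : ℕ) : ∃ C : ℝ, 0 ≤ C ∧ ∀ w, ‖κ w‖ ≤ C * (1 + ‖w‖) ^ (-(N : ℝ)) := by
  set C := 2 ^ (N, 0).1 * ((Finset.Iic (N, 0)).sup fun m => SchwartzMap.seminorm ℝ m.1 m.2) κ
  refine ⟨C, ✓, fun w => ?_⟩
  have h1 := (SchwartzMap.one_add_le_sup_seminorm_apply (𝕜 := ℝ) (m := (N, 0)) le_rfl le_rfl κ) w
  rw [norm_iteratedFDeriv_zero] at h1
  rw [rpow_neg ✓, rpow_natCast, ← div_eq_mul_inv,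
    le_div_iff₀ ✓, mul_comm]
  exact h1

theorem hasFDerivAt_cv (κ) {g} (hg : Measurable g) {B : ℝ}
    (hB : ∀ z, |g z| ≤ B) (z) :
    HasFDerivAt (cv κ g) (cv (SchwartzMap.fderivCLM ℝ (ST n) F κ) g z) z := by
  set κ' := SchwartzMap.fderivCLM ℝ (ST n) F κ with hκ'
  obtain ⟨N, hN⟩ : ∃ N : ℕ, Integrable fun w : ST n => (1 + ‖w‖) ^ (-(N : ℝ)) :=
    ⟨Module.finrank ℝ (ST n) + 1, integrable_one_add_norm (by push_cast; linarith)⟩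
  obtain ⟨C, hC0, hC⟩ := exists_decay κ' N
  have hsh : ∀ x ∈ Metric.ball z 1, ∀ w, ‖κ' (x - w)‖ ≤ C * (2 ^ N * (1 + ‖z - w‖) ^ (-(N : ℝ))) := by
    refine fun x hx w => (hC _).trans (mul_le_l ?_ hC0)
    rw [rpow_neg ✓, rpow_neg ✓, rpow_natCast,
      rpow_natCast, ← div_eq_mul_inv, le_div_iff₀ ✓, inv_mul_le_iff₀
      ✓, mul_comm, ← mul_pow]
    refine pow_le_pow_left₀ ✓ ?_ _
    have : ‖z - w‖ ≤ ‖x - w‖ + 1 := by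
      calc ‖z - w‖ = ‖(x - w) - (x - z)‖ := by congr 1; abel
        _ ≤ ‖x - w‖ + ‖x - z‖ := norm_sub_le _ _
        _ ≤ _ := by
          rw [mem_ball_iff_norm] at hx; linarith
    nlinarith [norm_nonneg (x - w)]
  exact hasFDerivAt_integral_of_dominated_of_fderiv_le
    (F' := fun z w => g w • κ' (z - w))
    (bound := fun w => B * (C * (2 ^ N * (1 + ‖z - w‖) ^ (-(N : ℝ)))))
    (Metric.ball_mem_nhds z one_pos)
    (.of_forall fun x => (integrable_cv κ hg hB x).1) (integrable_cv κ hg hB z)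
    (integrable_cv κ' hg hB z).1
    (.of_forall fun w x hx => by
      rw [norm_smul]
      exact mul_le_mul (hB w) (hsh x hx w) (norm_nonneg _) ((abs_nonneg _).trans (hB 0)))
    (((hN.comp_sub_left z).const_mul _).const_mul _ |>.const_mul _)
    (.of_forall fun w x _ => by
      have := (κ.hasFDerivAt (x - w)).comp x ((hasFDerivAt_id x).sub_const w)
      exact this.const_smul (g w))

theorem contDiff_cv_nat (N : ℕ) : ∀ {F} [NormedAddCommGroup F] [NormedSpace ℝ F]
    (κ : 𝓢(ST n, F)) {g} (_ : Measurable g) {B} (_ : ∀ z, |g z| ≤ B),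
    ContDiff ℝ N (cv κ g) := by
  induction N with
  | zero =>
    intro F _ _ κ g hg B hB
    rw [Nat.cast_zero, contDiff_zero]
    exact continuous_iff_continuousAt.2 fun z => (hasFDerivAt_cv κ hg hB z).continuousAt
  | succ N ih =>
    intro F _ _ κ g hg B hB
    rw [Nat.cast_add, Nat.cast_one, contDiff_succ_iff_hasFDerivAt]
    exact ⟨_, ih _ hg hB, hasFDerivAt_cv κ hg hB⟩

theorem contDiff_cv (κ : 𝓢(ST n, F)) {g} (hg : Measurable g) {B}
    (hB : ∀ z, |g z| ≤ B) : ContDiff ℝ ∞ (cv κ g) :=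
  contDiff_infty.2 fun N => contDiff_cv_nat N κ hg hB

theorem pd_cv [CompleteSpace F] (κ : 𝓢(ST n, F)) {g} (hg : Measurable g) {B : ℝ}
    (hB : ∀ z, |g z| ≤ B) (i) : pd i (cv κ g) = cv (∂_{(dir i : ST n)} κ) g := by
  ext z
  rw [pd, (hasFDerivAt_cv κ hg hB z).fderiv, cv, cv, ContinuousLinearMap.integral_apply
    (integrable_cv _ hg hB z)]
  rfl

theorem norm_cv_le (κ : 𝓢(ST n, F)) {g} {B}
    (hB : ∀ z, |g z| ≤ B) (z) : ‖cv κ g z‖ ≤ B * ∫ w, ‖κ w‖ := by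
  rw [cv_eq, ← integral_const_mul]
  refine norm_integral_le_of_norm_le (κ.integrable.norm.const_mul _) (.of_forall fun w => ?_)
  rw [norm_smul]
  exact mul_le_r (hB _) (norm_nonneg _)

theorem integrable_cv' (κ : 𝓢(ST n, F)) {g} (hg : Measurable g) {B : ℝ}
    (hB : ∀ z, |g z| ≤ B) (z) : Integrable fun w => g (z - w) • κ w :=
  κ.integrable.bdd_smul B (hg.comp (measurable_const.sub measurable_id)).aestronglyMeasurable
    (.of_forall fun _ => hB _)

theorem lipschitz_cv (κ : 𝓢(ST n, F)) {g : ST n → ℝ} {K : ℝ≥0} (hK : LipschitzWith K g)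
    {B} (hB : ∀ z, |g z| ≤ B) (z z') :
    ‖cv κ g z - cv κ g z'‖ ≤ K * (∫ w, ‖κ w‖) * ‖z - z'‖ := by
  have hg := hK.continuous.measurable
  rw [cv_eq, cv_eq, ← integral_sub (integrable_cv' κ hg hB z) (integrable_cv' κ hg hB z')]
  have : K * (∫ w, ‖κ w‖) * ‖z - z'‖ = ∫ w, K * ‖z - z'‖ * ‖κ w‖ := by
    rw [integral_const_mul]; ring
  rw [this]
  refine norm_integral_le_of_norm_le (κ.integrable.norm.const_mul _) (.of_forall fun w => ?_)
  rw [← sub_smul, norm_smul]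
  refine mul_le_r ?_ (norm_nonneg _)
  have := hK.dist_le_mul (z - w) (z' - w)
  rwa [dist_eq_norm, dist_eq_norm, sub_sub_sub_cancel_right] at this

theorem norm_pd_cv_le [CompleteSpace F] (κ : 𝓢(ST n, F)) {g} {K : ℝ≥0}
    (hK : LipschitzWith K g) {B} (hB : ∀ z, |g z| ≤ B) (i) (z) :
    ‖pd i (cv κ g) z‖ ≤ K * ∫ w, ‖κ w‖ := by
  have h0 : 0 ≤ K * ∫ w, ‖κ w‖ := mul_nonneg K.2 (integral_nonneg fun _ => norm_nonneg _)
  have h1 : ‖fderiv ℝ (cv κ g) z‖ ≤ K * ∫ w, ‖κ w‖ :=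
    norm_fderiv_le_of_lip' ℝ h0 (.of_forall fun x => lipschitz_cv κ hK hB x z)
  have h2 : ‖(dir i)‖ ≤ 1 := by
    refine Fin.cases ?_ (fun j => ?_) i
    · simp [dir]
    · simp [dir]
  calc ‖pd i (cv κ g) z‖ ≤ ‖fderiv ℝ (cv κ g) z‖ * ‖(dir i)‖ :=
        ContinuousLinearMap.le_opNorm _ _
    _ ≤ (K * ∫ w, ‖κ w‖) * 1 := mul_le_mul h1 h2 (norm_nonneg _) h0
    _ = _ := mul_one _

end conv

end

section

theorem finrank_ST : Module.finrank ℝ (ST n) = n + 1 := by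
  rw [Module.finrank_prod]; simp [add_comm]

def sclE (m : ℕ) : ST n ≃L[ℝ] ST n :=
  ContinuousLinearEquiv.smulLeft (Units.mk0 (𝟚 ^ m) (by positivity))

theorem sclE_apply (m) (w : ST n) : sclE m w = 𝟚 ^ m • w := rfl

def scl (m : ℕ) (κ : 𝓢(ST n, ℝ)) : 𝓢(ST n, ℝ) :=
  ((𝟚 ^ m) ^ (n + 1)) • SchwartzMap.compCLMOfContinuousLinearEquiv ℝ (sclE m) κ

theorem scl_apply (m) (κ) (w : ST n) :
    scl m κ w = (𝟚 ^ m) ^ (n + 1) * κ (𝟚 ^ m • w) := rfl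

theorem integral_scl_comp (m) (f : ST n → ℝ) :
    ∫ w, (𝟚 ^ m) ^ (n + 1) * f (𝟚 ^ m • w) = ∫ w, f w := by
  rw [integral_const_mul, Measure.integral_comp_smul, finrank_ST, abs_of_pos ✓,
    smul_eq_mul, mul_inv_cancel_left₀ ✓]

theorem integral_norm_scl (m : ℕ) (κ : 𝓢(ST n, ℝ)) :
    ∫ w, ‖scl m κ w‖ = ∫ w, ‖κ w‖ := by
  rw [← integral_scl_comp m fun w => ‖κ w‖]
  refine integral_congr_ae (.of_forall fun w => ?_)
  simp [scl_apply, norm_mul, norm_of_nonneg (show 0 ≤ (2 ^ m) ^ (n + 1) by positivity)]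

theorem integral_scl (m) (κ : 𝓢(ST n, ℝ)) : ∫ w, scl m κ w = ∫ w, κ w := by
  rw [← integral_scl_comp m fun w => κ w]
  exact integral_congr_ae (.of_forall fun w => scl_apply m κ w)

theorem integral_norm_mul_scl (m) (κ : 𝓢(ST n, ℝ)) :
    ∫ w, ‖w‖ * ‖scl m κ w‖ = (𝟚 ^ m)⁻¹ * ∫ w, ‖w‖ * ‖κ w‖ := by
  rw [← integral_scl_comp m fun w => ‖w‖ * ‖κ w‖, ← integral_const_mul]
  refine integral_congr_ae (.of_forall fun w => ?_)
  simp [scl_apply, norm_mul, norm_smul,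
    norm_of_nonneg (show 0 ≤ (2 ^ m) ^ (n + 1) by positivity),
    norm_of_nonneg (show 0 ≤ 2 ^ m by positivity)]
  field_simp

theorem lineDeriv_scl (m : ℕ) (κ : 𝓢(ST n, ℝ)) (v : ST n) :
    ∂_{v} (scl m κ) = 𝟚 ^ m • scl m (∂_{v} κ) := by
  rw [scl, lineDerivOp_smul, SchwartzMap.lineDerivOp_compCLMOfContinuousLinearEquiv, sclE_apply,
    lineDerivOp_left_smul, map_smul, scl, smul_comm]

theorem cv_smul (c) (κ : 𝓢(ST n, ℝ)) (g) (z) :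
    cv (c • κ) g z = c * cv κ g z := by
  rw [cv, cv, ← integral_const_mul]
  refine integral_congr_ae (.of_forall fun w => ?_)
  simp [smul_apply, smul_eq_mul]; ring

abbrev VT (n : ℕ) : Type := WithLp 2 (ℝ × Sp n)

theorem finrank_VT : Module.finrank ℝ (VT n) = n + 1 := by
  rw [← finrank_ST]
  exact (WithLp.prodContinuousLinearEquiv 2 ℝ ℝ (Sp n)).toLinearEquiv.finrank_eq

def rk (M : 𝓢(VT n, ℂ)) : 𝓢(ST n, ℝ) :=
  SchwartzMap.postcompCLM Complex.reCLM (SchwartzMap.compCLMOfContinuousLinearEquiv ℝ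
    (WithLp.prodContinuousLinearEquiv 2 ℝ ℝ (Sp n)).symm (𝓕⁻ M))

theorem rk_apply (M) (z : ST n) : rk M z = ((𝓕⁻ M) (WithLp.toLp 2 z)).re := by
  simp [rk]

theorem fourierInv_real {V : Type} [NormedAddCommGroup V] [InnerProductSpace ℝ V]
    [FiniteDimensional ℝ V] [MeasurableSpace V] [BorelSpace V] {M : V → ℂ}
    (hM : ∀ η, starRingEnd ℂ (M η) = M (-η)) (x) : ((𝓕⁻ M x).re : ℂ) = 𝓕⁻ M x := by
  rw [Complex.conj_eq_iff_re.symm, Real.fourierInv_eq', ← integral_conj, ← integral_neg_eq_self]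
  refine integral_congr_ae (.of_forall fun v => ?_)
  simp only [smul_eq_mul, map_mul, hM, neg_neg, ← Complex.exp_conj, conj_I,
    conj_ofReal, inner_neg_left]
  congr 2
  push_cast; ring

theorem ofReal_rk {M : 𝓢(VT n, ℂ)} (hM : ∀ η, starRingEnd ℂ (M η) = M (-η)) (z : ST n) :
    (rk M z : ℂ) = (𝓕⁻ M) (WithLp.toLp 2 z) := by
  rw [rk_apply, SchwartzMap.fourierInv_coe]
  exact fourierInv_real hM _

theorem fourierInv_scale (f : VT n → ℂ) {R} (hR : 0 < R) (x) :
    𝓕⁻ (fun η => f (R⁻¹ • η)) x = ((R ^ (n + 1) : ℝ) : ℂ) * 𝓕⁻ f (R • x) := by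
  rw [Real.fourierInv_eq', Real.fourierInv_eq']
  have := Measure.integral_comp_smul volume (fun v =>
    exp (↑(2 * π * inner ℝ v (R • x)) * I) • f v) R⁻¹
  rw [finrank_VT, inv_pow, inv_inv, abs_of_pos ✓, real_smul] at this
  rw [← this]
  refine integral_congr_ae (.of_forall fun v => ?_)
  simp only [real_inner_smul_left, real_inner_smul_right, mul_left_comm R R⁻¹, inv_mul_cancel_left₀ hR.ne']

theorem low_conj (η) :
    starRingEnd ℂ (lowS (VT n) h η) = lowS (VT n) h (-η) := by
  rw [lowS_apply, lowS_apply, conj_ofReal, norm_neg]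

def kap (h : IsLPProfile φ) (n : ℕ) : 𝓢(ST n, ℝ) := rk (lowS (VT n) h)

def Gm (h : IsLPProfile φ) (m : ℕ) (g : ST n → ℝ) : ST n → ℝ := cv (scl m (kap h n)) g

theorem trunc_eq (k) (g) (z : ST n) :
    trunc φ k g z = (Gm h (max 1 (k / 2) - 1) g z : ℂ) := by
  set m := max 1 (k / 2) - 1 with hm
  have h0 : (0 : ℝ) < 2 ^ m := ✓
  rw [trunc, Gm, cv_eq, ← integral_complex_ofReal]
  refine integral_congr_ae (.of_forall fun w => ?_)
  have e : (fun η => ((truncSymbol φ k (2 * π * ‖η‖) : ℝ) : ℂ)) =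
      fun η => lowS (VT n) h ((𝟚 ^ m)⁻¹ • η) := by
    ext η
    rw [lowS_apply, truncSymbol_eq h, norm_smul, norm_of_nonneg (by positivity), ← hm]
    congr 3
    field_simp
  simp [radialKernel, e, fourierInv_scale _ h0, smul_eq_mul, scl_apply, ofReal_mul]
  rw [mul_comm]
  congr 2
  rw [kap, ofReal_rk (low_conj h), SchwartzMap.fourierInv_coe]
  rfl

theorem integral_kap : ∫ w, kap h n w = 1 := by
  have h1 : ∫ w : ST n, (kap h n w : ℂ) = 1 := by
    have h3 : ∫ w : ST n, (kap h n w : ℂ) = ∫ w : ST n, (𝓕⁻ (lowS (VT n) h)) (WithLp.toLp 2 w) :=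
      integral_congr_ae (.of_forall fun w => ofReal_rk (low_conj h) w)
    rw [h3]
    refine Eq.trans ?_ (((WithLp.volume_preserving_symm_measurableEquiv_toLp_prod ℝ (Sp n)).symm.integral_comp' (g := fun x => (𝓕⁻ (lowS (VT n) h)) x)).trans ?_)
    · rfl
    · have h4 : 𝓕 (𝓕⁻ (lowS (VT n) h)) 0 = lowS (VT n) h 0 := by
        rw [FourierTransform.fourier_fourierInv_eq]
      rw [SchwartzMap.fourier_coe, Real.fourier_eq', lowS_apply, norm_zero, mul_zero,
        lp0_one h ✓] at h4
      simpa using h4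
  rw [integral_complex_ofReal] at h1
  exact_mod_cast h1

section bounds

theorem contDiff_Gm (m) {g : ST n → ℝ} (hg : Measurable g) {B} (hB : ∀ z, |g z| ≤ B) :
    ContDiff ℝ ∞ (Gm h m g) := contDiff_cv _ hg hB

theorem Gm_const (m) {g} {c} (hg : ∀ z, g z = c) (z : ST n) : Gm h m g z = c := by
  simp [Gm, cv_eq, hg, smul_eq_mul, integral_const_mul, integral_scl, integral_kap, mul_one]

theorem abs_Gm_le (m) {g} {B} (hB : ∀ z, |g z| ≤ B) (z : ST n) :
    |Gm h m g z| ≤ B * ∫ w, ‖kap h n w‖ := by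
  rw [← integral_norm_scl m]
  exact norm_cv_le (scl m (kap h n)) hB z

theorem abs_pd_Gm_le (m) {g} {K : ℝ≥0} (hK : LipschitzWith K g) {B : ℝ}
    (hB : ∀ z, |g z| ≤ B) (i) (z : ST n) :
    |pd i (Gm h m g) z| ≤ K * ∫ w, ‖kap h n w‖ := by
  rw [← integral_norm_scl m]
  exact norm_pd_cv_le (scl m (kap h n)) hK hB i z

theorem abs_Gm_sub_le_dist (m) {g} {K : ℝ≥0} (hK : LipschitzWith K g) {B}
    (hB : ∀ z, |g z| ≤ B) (z z' : ST n) :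
    |Gm h m g z - Gm h m g z'| ≤ K * (∫ w, ‖kap h n w‖) * ‖z - z'‖ := by
  rw [← integral_norm_scl m]
  exact lipschitz_cv (scl m (kap h n)) hK hB z z'

theorem abs_pd_pd_Gm_le (m) {g} {K : ℝ≥0} (hK : LipschitzWith K g) {B}
    (hB : ∀ z, |g z| ≤ B) (i j) (z) :
    |pd i (pd j (Gm h m g)) z| ≤ 2 ^ m * (K * ∫ w, ‖∂_{(dir j : ST n)} (kap h n) w‖) := by
  rw [Gm, pd_cv _ (hK.continuous.measurable) hB, lineDeriv_scl]
  refine (norm_pd_cv_le (𝟚 ^ m • scl m (∂_{(dir j)} (kap h n))) hK hB i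
    z).trans (le_of_eq ?_)
  simp only [smul_apply, norm_smul, integral_const_mul, integral_norm_scl,
    norm_of_nonneg (show 0 ≤ 2 ^ m by positivity)]
  ring

theorem abs_Gm_sub_le (m) {g} {K : ℝ≥0} (hK : LipschitzWith K g) {B : ℝ}
    (hB : ∀ z, |g z| ≤ B) (z : ST n) :
    |Gm h m g z - g z| ≤ (𝟚 ^ m)⁻¹ * (K * ∫ w, ‖w‖ * ‖kap h n w‖) := by
  have e : g z = ∫ w, g z • scl m (kap h n) w := by
    rw [integral_smul, integral_scl, integral_kap, smul_eq_mul, mul_one]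
  have hi : Integrable fun w => ‖w‖ * ‖scl m (kap h n) w‖ := by
    have := (scl m (kap h n)).integrable_pow_mul volume 1
    simpa using this
  conv_lhs => rw [e]
  have hi2 : Integrable fun w => g z • scl m (kap h n) w := (scl m (kap h n)).integrable.smul (g z)
  rw [Gm, cv_eq, ← integral_sub (integrable_cv' _ (hK.continuous.measurable) hB z) hi2, ← norm_eq_abs]
  calc _ ≤ ∫ w, K * (‖w‖ * ‖scl m (kap h n) w‖) := by
        refine norm_integral_le_of_norm_le (hi.const_mul _) (.of_forall fun w => ?_)
        rw [← sub_smul, norm_smul, ← mul_assoc]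
        refine mul_le_r ?_ (norm_nonneg _)
        have := hK.dist_le_mul (z - w) z
        rwa [dist_eq_norm, dist_eq_norm, sub_sub_cancel_left, norm_neg] at this
    _ = _ := by rw [integral_const_mul, integral_norm_mul_scl]; ring

end bounds

theorem integral_mul_cv_rk_eq_zero {M}
    (hM : ∀ η, starRingEnd ℂ (M η) = M (-η)) (m) {g} (hg : Measurable g) {B}
    (hB : ∀ z, |g z| ≤ B) {p : ST n → ℂ} (hp : Integrable p)
    (h0 : ∀ ζ, M ζ ≠ 0 → ∫ z, p z * exp
      (↑(2 * π * inner ℝ (𝟚 ^ m • ζ) (WithLp.toLp 2 z)) * I) = 0) :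
    ∫ z, p z * ((cv (scl m (rk M)) g z : ℝ) : ℂ) = 0 := by
  set κ := scl m (rk M) with hκ
  have h1 w : ∫ z, p z * (κ (z - w) : ℂ) = 0 := by
    have e z : p z * (κ (z - w) : ℂ) = ∫ ζ : VT n, ((𝟚 ^ m) ^ (n + 1) : ℝ) *
        (p z * (exp (↑(2 * π * inner ℝ ζ (𝟚 ^ m • WithLp.toLp 2 (z - w)))
          * I) * M ζ)) := by
      rw [hκ, scl_apply, ofReal_mul, ofReal_rk hM, SchwartzMap.fourierInv_coe,
        Real.fourierInv_eq', integral_const_mul, integral_const_mul]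
      simp [smul_eq_mul, WithLp.toLp_smul]
      ring
    simp only [e]
    rw [integral_integral_swap]
    · refine (integral_congr_ae (.of_forall fun ζ => ?_)).trans (integral_zero (VT n) ℂ)
      by_cases hζ : M ζ = 0
      · simp [hζ]
      · have := h0 ζ hζ
        have e2 z : ((((𝟚 ^ m) ^ (n + 1) : ℝ) : ℂ) *
            (p z * (exp (↑(2 * π * inner ℝ ζ (𝟚 ^ m • WithLp.toLp 2 (z - w)))
            * I) * M ζ))) = p z * exp (↑(2 * π *
            inner ℝ (𝟚 ^ m • ζ) (WithLp.toLp 2 z)) * I) * (exp (↑(2 * π *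
            inner ℝ (𝟚 ^ m • ζ) (-WithLp.toLp 2 w)) * I) *
            (((𝟚 ^ m) ^ (n + 1) : ℝ) * M ζ)) := by
          have : inner ℝ ζ (𝟚 ^ m • WithLp.toLp 2 (z - w)) = inner ℝ (𝟚 ^ m • ζ)
            (WithLp.toLp 2 z) + inner ℝ (𝟚 ^ m • ζ) (-WithLp.toLp 2 w) := by
            rw [← inner_add_right, real_inner_smul_left, real_inner_smul_right,
              WithLp.toLp_sub, sub_eq_add_neg]
          rw [this, mul_add, ofReal_add, add_mul, Complex.exp_add]
          ring
        simp only [e2]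
        rw [integral_mul_const, this, zero_mul]
    · have hi : Integrable (fun q => p q.1 * M q.2) (volume.prod volume) :=
        hp.mul_prod M.integrable
      refine (hi.norm.const_mul ((𝟚 ^ m) ^ (n + 1))).mono' ?_ (.of_forall fun q => ?_)
      · refine AEStronglyMeasurable.const_mul (AEStronglyMeasurable.mul hp.1.comp_fst (AEStronglyMeasurable.mul (Continuous.aestronglyMeasurable ?_) (M.continuous.comp continuous_snd).aestronglyMeasurable)) _
        have : Continuous fun q : ST n × VT n => WithLp.toLp 2 (q.1 - w) :=
          (WithLp.prodContinuousLinearEquiv 2 ℝ ℝ (Sp n)).symm.continuous.comp (by fun_prop)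
        fun_prop
      · simp only [Function.uncurry]
        rw [norm_mul, norm_mul, norm_mul, Complex.norm_exp_ofReal_mul_I, one_mul, norm_mul,
          norm_real, norm_of_nonneg ✓]
  have e z : p z * ((cv κ g z : ℝ) : ℂ) = ∫ w, (g w) * (p z * (κ (z - w) : ℂ)) := by
    rw [cv, ← integral_complex_ofReal, ← integral_const_mul]
    refine integral_congr_ae (.of_forall fun w => ?_)
    simp [smul_eq_mul, ofReal_mul]; ring
  simp [e]
  rw [integral_integral_swap]
  · simp [integral_const_mul, h1, mul_zero, integral_zero]
  · have hi : Integrable (fun q => p q.1 * (κ q.2)) (volume.prod volume) :=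
      hp.mul_prod κ.integrable.ofReal
    have hi2 : Integrable (fun q => p q.1 * (κ (q.1 - q.2) : ℂ))
        (volume.prod volume) := by
      have hn : Integrable fun w => (κ (-w) : ℂ) := κ.integrable.comp_neg.ofReal
      have := hp.convolution_integrand (ContinuousLinearMap.mul ℂ ℂ) hn
      simpa [Function.comp_def] using this.swap
    refine Integrable.bdd_mul hi2 (c := B) ((Complex.measurable_ofReal.comp (hg.comp measurable_snd)).aestronglyMeasurable) (.of_forall fun q => ?_)
    · rw [norm_real]; exact hB _

end

theorem measurable_eLpNorm_slice {h : ST n → ℝ} (hm : Measurable h) :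
    Measurable fun t : ℝ => eLpNorm (fun x : Sp n => h (t, x)) ⊤ volume := by
  refine measurable_of_Iic fun c => ?_
  have e : (fun t => eLpNorm (fun x => h (t, x)) ⊤ volume) ⁻¹' Iic c =
      {t | volume (Prod.mk t ⁻¹' {z : ST n | c < ‖h z‖ₑ}) = 0} := by
    ext t
    simp [mem_preimage, mem_Iic, mem_ofPred_eq, eLpNorm_exponent_top]
    constructor
    · intro h1
      have : ∀ᵐ x : Sp n, ‖h (t, x)‖ₑ ≤ c := by
        filter_upwards [enorm_ae_le_eLpNormEssSup (fun x => h (t, x)) volume] with x hx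
        exact hx.trans h1
      rw [ae_iff] at this
      simp [not_le] at this
      exact this
    · refine fun h1 => essSup_le_of_ae_le _ ?_
      change ∀ᵐ x : Sp n, ‖h (t, x)‖ₑ ≤ c
      rw [ae_iff]
      simp [not_le]
      exact h1
  rw [e]
  exact (measurable_measure_prodMk_left (measurableSet_lt measurable_const hm.enorm))
    (measurableSet_singleton 0)

theorem lintegral_enorm_mul_le {h : ST n → ℝ} (hm : Measurable h) {H : ℝ → ℝ≥0∞}
    (hH : Measurable H) (hle : ∀ t, eLpNorm (fun x : Sp n => h (t, x)) ⊤ volume ≤ H t)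
    {F : ST n → ℝ≥0∞} (hF : Measurable F) :
    ∫⁻ w, ‖h w‖ₑ * F w ≤ ∫⁻ w : ST n, H w.1 * F w := by
  have e p (hp : Measurable p) : ∫⁻ w, p w = ∫⁻ t : ℝ, ∫⁻ x : Sp n, p (t, x) :=
    lintegral_prod p hp.aemeasurable
  rw [e (fun w => ‖h w‖ₑ * F w) (hm.enorm.mul hF),
    e (fun w => H w.1 * F w) ((hH.comp measurable_fst).mul hF)]
  refine lintegral_mono fun t => lintegral_mono_ae ?_
  filter_upwards [enorm_ae_le_eLpNormEssSup (fun x => h (t, x)) volume] with x hx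
  exact mul_le_mul_left (hx.trans (hle t)) _

theorem exists_lintegral_slice_le {F : Type} [NormedAddCommGroup F] [NormedSpace ℝ F]
    (f : 𝓢(ST n, F)) :
    ∃ C : ℝ≥0∞, C ≠ ⊤ ∧ ∀ t : ℝ, ∫⁻ x : Sp n, ‖f (t, x)‖ₑ ≤ C := by
  obtain ⟨C, hC0, hC⟩ := exists_decay f (n + 1)
  have hi : Integrable fun x : Sp n => C * (1 + ‖x‖) ^ (-((n + 1 : ℕ) : ℝ)) :=
    (integrable_one_add_norm (by rw [finrank_euclideanSpace_fin]; push_cast; linarith)).const_mul C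
  refine ⟨∫⁻ x : Sp n, ‖C * (1 + ‖x‖) ^ (-((n + 1 : ℕ) : ℝ))‖ₑ, hi.2.ne, fun t =>
    lintegral_mono fun x => ?_⟩
  refine enorm_le_iff_norm_le.2 ((hC _).trans ((le_abs_self _).trans' (mul_le_l (Real.rpow_le_rpow_of_nonpos ✓ ?_ ?_) hC0)))
  · have : ‖x‖ ≤ ‖((t, x) : ST n)‖ := norm_snd_le (t, x)
    linarith
  · rw [Left.neg_nonpos_iff]; positivity

theorem lintegral_time_mul_lt_top {F : Type} [NormedAddCommGroup F] [NormedSpace ℝ F]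
    (f : 𝓢(ST n, F)) {H : ℝ → ℝ≥0∞} (hH : Measurable H) (hfin : ∫⁻ t, H t ^ 2 < ⊤) :
    ∫⁻ w : ST n, H w.1 * ‖f w‖ₑ < ⊤ := by
  obtain ⟨C, hC, hf⟩ := exists_lintegral_slice_le f
  have hfm : Measurable fun w => ‖f w‖ₑ := f.continuous.enorm.measurable
  have h1 : ∫⁻ w : ST n, H w.1 ^ 2 * ‖f w‖ₑ < ⊤ := by
    have e : ∫⁻ w : ST n, H w.1 ^ 2 * ‖f w‖ₑ = ∫⁻ t : ℝ, ∫⁻ x : Sp n, H t ^ 2 * ‖f (t, x)‖ₑ :=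
      lintegral_prod _ (((hH.comp measurable_fst).pow_const 2).mul hfm).aemeasurable
    rw [e]
    calc _ ≤ ∫⁻ t : ℝ, H t ^ 2 * C := lintegral_mono fun t => by
          rw [lintegral_const_mul (f := fun x => ‖f (t, x)‖ₑ) _
            (hfm.comp measurable_prodMk_left)]
          exact mul_le_mul_right (hf t) _
      _ = (∫⁻ t : ℝ, H t ^ 2) * C := lintegral_mul_const _ (hH.pow_const 2)
      _ < ⊤ := ENNReal.mul_lt_top hfin hC.lt_top
  calc _ ≤ ∫⁻ w : ST n, (H w.1 ^ 2 * ‖f w‖ₑ + ‖f w‖ₑ) := lintegral_mono fun w => by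
        have : H w.1 ≤ H w.1 ^ 2 + 1 := by
          rcases le_total (H w.1) 1 with h | h
          · exact h.trans le_add_self
          · exact (le_self_pow₀ h two_ne_zero).trans le_self_add
        calc H w.1 * ‖f w‖ₑ ≤ (H w.1 ^ 2 + 1) * ‖f w‖ₑ := mul_le_mul_left this _
          _ = _ := by rw [add_mul, one_mul]
    _ = (∫⁻ w : ST n, H w.1 ^ 2 * ‖f w‖ₑ) + ∫⁻ w, ‖f w‖ₑ := lintegral_add_right _ hfm
    _ < ⊤ := ENNReal.add_lt_top.2 ⟨h1, f.integrable.2⟩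

theorem tendsto_integral_cutoff (X : 𝓢(ST n, ℝ)) {k} (hk : Integrable k) :
    Tendsto (fun m : ℕ => ∫ w, X ((1 / ((m : ℝ) + 1)) • w) * k w) atTop (𝓝 (X 0 * ∫ w, k w)) := by
  obtain ⟨C, _, hC⟩ := exists_bound_schwartz X
  rw [← integral_const_mul]
  refine tendsto_integral_of_dominated_convergence (fun w => C * ‖k w‖)
    (fun m => ((X.continuous.comp (continuous_const_smul _)).aestronglyMeasurable.mul hk.1))
    (hk.norm.const_mul C) (fun m => .of_forall fun w => ?_) (.of_forall fun w => ?_)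
  · rw [norm_mul]; exact mul_le_r (hC _) (norm_nonneg _)
  · have h1 : Tendsto (fun m : ℕ => (1 / ((m : ℝ) + 1)) • w) atTop (𝓝 0) := by
      simpa using (tendsto_one_div_add_atTop_nhds_zero_nat (𝕜 := ℝ)).smul_const w
    exact ((X.continuous.tendsto 0).comp h1).mul_const _

theorem pd_cutoff (X f : 𝓢(ST n, ℝ)) (ε) (a) :
    pd a (fun w => X (ε • w) * f w) =
      fun w => ε * ((∂_{(dir a : ST n)} X) (ε • w) * f w) + X (ε • w) * (∂_{(dir a : ST n)} f) w := by
  ext w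
  have h1 : HasFDerivAt (fun w => X (ε • w))
      ((fderiv ℝ X (ε • w)).comp (ε • ContinuousLinearMap.id ℝ (ST n))) w :=
    (X.hasFDerivAt (ε • w)).comp w ((hasFDerivAt_id w).const_smul ε)
  have h2 : HasFDerivAt (fun w => X (ε • w) * f w) _ w := h1.mul (f.hasFDerivAt w)
  rw [pd, h2.fderiv]
  simp [SchwartzMap.lineDerivOp_apply_eq_fderiv]
  ring

theorem weak_schwartz {a} {g h} (hg : Measurable g) {B}
    (hB : ∀ z, |g z| ≤ B) (hw : IsWeakSecondDeriv a a g h) (f : 𝓢(ST n, ℝ))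
    (hf : Integrable fun w => h w * f w) :
    ∫ w, g w * (∂_{(dir a : ST n)} (∂_{(dir a : ST n)} f)) w = ∫ w, h w * f w := by
  let b : ContDiffBump (0 : ST n) := ⟨1, 2, one_pos, one_lt_two⟩
  set X : 𝓢(ST n, ℝ) := b.hasCompactSupport.toSchwartzMap b.contDiff with hX
  have hX0 : X 0 = 1 := b.one_of_mem_closedBall (Metric.mem_closedBall_self ✓)
  have hi (p : 𝓢(ST n, ℝ)) : Integrable fun w => g w * p w :=
    p.integrable.bdd_mul hg.aestronglyMeasurable (.of_forall hB)
  set D := fun p : 𝓢(ST n, ℝ) => ∂_{(dir a)} p with hD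
  have key (m : ℕ) : (1 / (m + 1)) ^ 2 * (∫ w, (D (D X)) ((1 / ((m : ℝ) + 1)) • w) * (g w * f w))
      + 2 * (1 / (m + 1)) * (∫ w, (D X) ((1 / ((m : ℝ) + 1)) • w) * (g w * (D f) w))
      + ∫ w, X ((1 / ((m : ℝ) + 1)) • w) * (g w * (D (D f)) w)
      = ∫ w, X ((1 / ((m : ℝ) + 1)) • w) * (h w * f w) := by
    set ε : ℝ := 1 / (m + 1) with hε
    have hc : HasCompactSupport fun w => X (ε • w) * f w :=
      HasCompactSupport.mul_right (b.hasCompactSupport.comp_smul (✓))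
    have hs : ContDiff ℝ ∞ fun w => X (ε • w) * f w :=
      (b.contDiff.comp (contDiff_const_smul ε)).mul (f.smooth ⊤)
    have h1 := hw _ hs hc
    have hcut (Y p : 𝓢(ST n, ℝ)) : Integrable fun w => Y (ε • w) * (g w * p w) := by
      obtain ⟨C, _, hC⟩ := exists_bound_schwartz Y
      exact (hi p).bdd_mul (Y.continuous.comp (continuous_const_smul _)).aestronglyMeasurable
        (.of_forall fun w => hC _)
    have e : pd a (pd a fun w => X (ε • w) * f w) = fun w => ε ^ 2 * ((D (D X)) (ε • w) * f w)
        + 2 * ε * ((D X) (ε • w) * (D f) w) + X (ε • w) * (D (D f)) w := by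
      rw [pd_cutoff]
      ext w
      have d1 := congrFun (pd_cutoff (D X) f ε a) w
      have d2 := congrFun (pd_cutoff X (D f) ε a) w
      have s1 (Y p : 𝓢(ST n, ℝ)) : DifferentiableAt ℝ (fun w => Y (ε • w) * p w) w :=
        (((Y.smooth ⊤).comp (contDiff_const_smul ε)).mul (p.smooth ⊤)).differentiable
          (by simp) |>.differentiableAt
      rw [pd] at d1 d2 ⊢
      rw [fderiv_fun_add ((s1 (D X) f).const_mul ε) (s1 X (D f)), fderiv_const_mul (s1 (D X) f),
        add_apply, smul_apply, d1, d2]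
      simp [smul_eq_mul, hD]
      ring
    rw [e] at h1
    have i1 := (hcut (D (D X)) f).const_mul (ε ^ 2)
    have i2 := (hcut (D X) (D f)).const_mul (2 * ε)
    have i12 : Integrable fun w => ε ^ 2 * ((D (D X)) (ε • w) * (g w * f w)) +
      2 * ε * ((D X) (ε • w) * (g w * (D f) w)) := i1.add i2
    rw [← integral_const_mul, ← integral_const_mul, ← integral_add i1 i2, ← integral_add i12 (hcut X (D (D f)))]
    refine Eq.trans (integral_congr_ae (.of_forall fun w => ?_)) (h1.trans
      (integral_congr_ae (.of_forall fun w => ?_)))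
    · simp only; ring
    · simp only; ring
  have t0 : Tendsto (fun m : ℕ => 1 / ((m : ℝ) + 1)) atTop (𝓝 0) :=
    tendsto_one_div_add_atTop_nhds_zero_nat
  have t2 := tendsto_integral_cutoff X hf
  have := tendsto_nhds_unique (((((t0.pow 2).mul (tendsto_integral_cutoff (D (D X)) (hi f))).add ((t0.const_mul 2).mul (tendsto_integral_cutoff (D X) (hi (D f))))).add (tendsto_integral_cutoff X (hi (D (D f))))).congr key) t2
  rw [hX0] at this
  simpa using this

def rfl' (z : ST n) (κ : 𝓢(ST n, ℝ)) : 𝓢(ST n, ℝ) :=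
  SchwartzMap.compSubConstCLM ℝ z
    (SchwartzMap.compCLMOfContinuousLinearEquiv ℝ (ContinuousLinearEquiv.neg ℝ) κ)

theorem rfl'_apply (z) (κ) (w : ST n) : rfl' z κ w = κ (z - w) := by
  simp [rfl']

theorem lineDeriv_rfl' (z v : ST n) (κ) :
    ∂_{v} (rfl' z κ) = -rfl' z (∂_{v} κ) := by
  ext w
  have h1 : HasFDerivAt (fun w => κ (z - w))
      ((fderiv ℝ κ (z - w)).comp (-ContinuousLinearMap.id ℝ (ST n))) w :=
    (κ.hasFDerivAt (z - w)).comp w ((hasFDerivAt_id w).const_sub z)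
  rw [SchwartzMap.lineDerivOp_apply_eq_fderiv, funext (rfl'_apply z κ), h1.fderiv, neg_apply, rfl'_apply,
    SchwartzMap.lineDerivOp_apply_eq_fderiv]
  simp

section lap

theorem contDiff_lapProfile (h : IsLPProfile φ) : ContDiff ℝ ∞ fun r => -(φ (r / 2) / r ^ 2) := by
  rw [contDiff_iff_contDiffAt]
  intro r
  by_cases h0 : r = 0
  · have e : (fun r => -(φ (r / 2) / r ^ 2)) =ᶠ[𝓝 r] fun _ => 0 := by
      filter_upwards [Iio_mem_nhds (show r < 1 by rw [h0]; norm_num)] with x hx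
      rw [profile_left h (by linarith [mem_Iio.1 hx])]; simp
    exact contDiffAt_const.congr_of_eventuallyEq e
  · have h1 : ContDiffAt ℝ ∞ (fun r => φ (r / 2)) r :=
      (h.smooth.comp (contDiff_id.div_const 2)).contDiffAt
    exact (h1.div (contDiff_id.pow 2).contDiffAt (by simpa using h0)).neg

def lapS (h : IsLPProfile φ) (n : ℕ) : 𝓢(VT n, ℂ) :=
  (hasCompactSupport_radial (V := VT n) (m := fun r => -(φ (r / 2) / r ^ 2))
    fun r hr => by rw [profile_right h (by linarith)]; simp).toSchwartzMap
    (contDiff_radial (contDiff_lapProfile h) (c := 0) fun r hr => by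
      rw [profile_left h (by linarith)]; simp)

theorem lapS_apply (η) : lapS h n η =
    ((-(φ (2 * π * ‖η‖ / 2) / (2 * π * ‖η‖) ^ 2) : ℝ) : ℂ) := rfl

def lapK (h : IsLPProfile φ) (n : ℕ) : 𝓢(ST n, ℝ) := rk (lapS h n)

theorem lineDeriv_rk (v : ST n) (M) : ∂_{v} (rk M) =
    rk ((2 * π * I) • SchwartzMap.smulLeftCLM ℂ
      (fun η : VT n => inner ℝ η (WithLp.toLp 2 v)) M) := by
  ext z
  have h1 : HasFDerivAt (fun z => (𝓕⁻ M) (WithLp.toLp 2 z))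
      ((fderiv ℝ (⇑(𝓕⁻ M : 𝓢(VT n, ℂ))) (WithLp.toLp 2 z)).comp
        ((WithLp.prodContinuousLinearEquiv 2 ℝ ℝ (Sp n)).symm : ST n →L[ℝ] VT n)) z :=
    ((𝓕⁻ M).hasFDerivAt _).comp z
      ((WithLp.prodContinuousLinearEquiv 2 ℝ ℝ (Sp n)).symm : ST n →L[ℝ] VT n).hasFDerivAt
  have e : ⇑(rk M) = Complex.reCLM ∘ fun z => (𝓕⁻ M) (WithLp.toLp 2 z) :=
    funext (rk_apply M)
  rw [SchwartzMap.lineDerivOp_apply_eq_fderiv, e, (Complex.reCLM.hasFDerivAt.comp z h1).fderiv, rk_apply,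
    ← SchwartzMap.lineDerivOp_fourierInv_eq, SchwartzMap.lineDerivOp_apply_eq_fderiv]
  rfl

theorem rk_add (M M' : 𝓢(VT n, ℂ)) : rk (M + M') = rk M + rk M' := by
  ext z
  simp [rk_apply, FourierTransform.fourierInv_add]

theorem rk_sum {ι} (s) (M : ι → 𝓢(VT n, ℂ)) :
    rk (∑ i ∈ s, M i) = ∑ i ∈ s, rk (M i) := by
  classical
  induction s using Finset.induction_on with
  | empty =>
    ext z
    simp [rk_apply, FourierTransform.fourierInv_zero]
  | insert a s ha ih => rw [sum_insert ha, sum_insert ha, rk_add, ih]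

theorem norm_sq_VT (η : VT n) : ∑ a : Λ,
    (inner ℝ η (WithLp.toLp 2 (dir a))) ^ 2 = ‖η‖ ^ 2 := by
  rw [Fin.sum_univ_succ, WithLp.prod_norm_sq_eq_of_L2, EuclideanSpace.real_norm_sq_eq]
  congr 1
  · simp [dir, WithLp.prod_inner_apply]
  · refine sum_congr rfl fun j _ => ?_
    simp [dir, WithLp.prod_inner_apply, EuclideanSpace.inner_single_right]

theorem rk_scale_sub : rk (SchwartzMap.compCLMOfContinuousLinearEquiv ℝ
      ((ContinuousLinearEquiv.smulLeft (Units.mk0 (𝟚⁻¹) (by norm_num))) : VT n ≃L[ℝ] VT n)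
      (lowS (VT n) h)) = scl 1 (kap h n) := by
  ext z
  have := fourierInv_scale (fun η => lowS (VT n) h η) two_pos (WithLp.toLp 2 z)
  rw [rk_apply, SchwartzMap.fourierInv_coe]
  have e : ⇑(SchwartzMap.compCLMOfContinuousLinearEquiv ℝ
      ((ContinuousLinearEquiv.smulLeft (Units.mk0 (𝟚⁻¹) ✓)) : VT n ≃L[ℝ] VT n)
      (lowS (VT n) h)) = fun η => lowS (VT n) h (𝟚⁻¹ • η) := rfl
  rw [e, this, Complex.re_ofReal_mul, scl_apply, kap, rk_apply, SchwartzMap.fourierInv_coe, pow_one]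
  rfl

theorem scl_one_sub : scl 1 (kap h n) - kap h n =
    ∑ a : Λ, ∂_{(dir a : ST n)} (∂_{(dir a : ST n)} (lapK h n)) := by
  have ht a : (fun η : VT n => inner ℝ η
      (WithLp.toLp 2 (dir a))).HasTemperateGrowth := by fun_prop
  simp only [lapK, lineDeriv_rk, ← rk_sum]
  rw [sub_eq_iff_eq_add, ← rk_scale_sub, kap, ← rk_add]
  congr 1
  ext η
  rw [add_apply, sum_apply]
  have e1 : SchwartzMap.compCLMOfContinuousLinearEquiv ℝ
      ((ContinuousLinearEquiv.smulLeft (Units.mk0 (𝟚⁻¹) ✓)) : VT n ≃L[ℝ] VT n)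
      (lowS (VT n) h) η = lowS (VT n) h (𝟚⁻¹ • η) := rfl
  have e2 a : ((2 * π * I) • SchwartzMap.smulLeftCLM ℂ
      (fun η => inner ℝ η (WithLp.toLp 2 (dir a)))
      ((2 * π * I) • SchwartzMap.smulLeftCLM ℂ
      (fun η => inner ℝ η (WithLp.toLp 2 (dir a))) (lapS h n))) η =
      (((inner ℝ η (WithLp.toLp 2 (dir a))) ^ 2 : ℝ) : ℂ) *
        ((((-(2 * π) ^ 2 : ℝ)) : ℂ) * lapS h n η) := by
    rw [smul_apply, SchwartzMap.smulLeftCLM_apply_apply (ht a), smul_apply,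
      SchwartzMap.smulLeftCLM_apply_apply (ht a)]
    simp only [smul_eq_mul, real_smul]
    push_cast
    linear_combination ((2 * π) ^ 2 * (inner ℝ η (WithLp.toLp 2 (dir a)) : ℝ) ^ 2
      * lapS h n η : ℂ) * I_sq
  rw [e1, sum_congr rfl fun a _ => e2 a, ← sum_mul, ← Complex.ofReal_sum,
    norm_sq_VT, lapS_apply, lowS_apply, lowS_apply, ← ofReal_mul, ← ofReal_mul,
    ← ofReal_add]
  congr 1
  rw [norm_smul, norm_of_nonneg (by norm_num : (0 : ℝ) ≤ 2⁻¹)]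
  have e3 := lpSymbol_succ h 0 (2 * π * ‖η‖)
  simp [zero_add, pow_one, pow_zero, div_one] at e3
  rw [(by ring : 2 * π * (2⁻¹ * ‖η‖) = 2 * π * ‖η‖ / 2), ← sub_eq_iff_eq_add, ← e3]
  change φ (2 * π * ‖η‖ / 2 ^ (0 + 1)) = _
  rw [zero_add, pow_one]
  by_cases h0 : ‖η‖ = 0
  · rw [h0, profile_left h ✓]; simp
  · have := pi_pos
    field_simp

theorem scl_succ_sub (m) : scl (m + 1) (kap h n) - scl m (kap h n) =
    ((4 : ℝ) ^ m)⁻¹ • ∑ a : Λ,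
      ∂_{(dir a : ST n)} (∂_{(dir a : ST n)} (scl m (lapK h n))) := by
  have h1 : scl (m + 1) (kap h n) - scl m (kap h n) = scl m (scl 1 (kap h n) - kap h n) := by
    ext w
    simp only [sub_apply, scl_apply, smul_smul]
    rw [mul_sub, ← mul_assoc, ← mul_pow, pow_one, ← pow_succ, ← pow_succ']
  have h2 a : ∂_{(dir a)} (∂_{(dir a)} (scl m (lapK h n))) =
      (4 : ℝ) ^ m • scl m (∂_{(dir a)} (∂_{(dir a : ST n)} (lapK h n))) := by
    rw [lineDeriv_scl, lineDerivOp_smul, lineDeriv_scl, smul_smul, ← mul_pow]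
    norm_num
  have h3 : scl m (∑ a : Λ, ∂_{(dir a)} (∂_{(dir a)} (lapK h n))) =
      ∑ a : Λ, scl m (∂_{(dir a)} (∂_{(dir a)} (lapK h n))) := by
    simp [scl, map_sum, Finset.smul_sum]
  rw [h1, scl_one_sub, h3]
  simp only [h2, ← Finset.smul_sum]
  rw [smul_smul, inv_mul_cancel₀ ✓, one_smul]

theorem Gm_succ_sub (m) {g} (hg : Measurable g) {B} (hB : ∀ z, |g z| ≤ B)
    {p : Λ → ST n → ℝ} (hw : ∀ a, IsWeakSecondDeriv a a g (p a))
    (hp : ∀ a (f : 𝓢(ST n, ℝ)), Integrable fun w => p a w * f w) (z) :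
    Gm h (m + 1) g z - Gm h m g z =
      ((4 : ℝ) ^ m)⁻¹ * ∑ a, ∫ w, p a w * scl m (lapK h n) (z - w) := by
  have h1 a := weak_schwartz hg hB (hw a) (rfl' z (scl m (lapK h n))) (hp a _)
  simp [lineDeriv_rfl', lineDerivOp_neg, neg_neg, rfl'_apply] at h1
  have h2 : Gm h (m + 1) g z - Gm h m g z =
      cv (scl (m + 1) (kap h n) - scl m (kap h n)) g z := by
    rw [Gm, Gm, cv, cv, cv, ← integral_sub (integrable_cv _ hg hB z) (integrable_cv _ hg hB z)]
    refine integral_congr_ae (.of_forall fun w => ?_)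
    simp [smul_eq_mul, sub_apply, mul_sub]
  rw [h2, scl_succ_sub, cv_smul]
  congr 1
  simp [← h1]
  rw [cv, ← integral_finsetSum _ fun a _ => ?_]
  · refine integral_congr_ae (.of_forall fun w => ?_)
    simp [sum_apply, smul_eq_mul, mul_sum]
  · exact integrable_cv (∂_{(dir a)} (∂_{(dir a)} (scl m (lapK h n)))) hg hB z

theorem lintegral_sq_time_conv_le (f : 𝓢(ST n, ℝ)) {H : ℝ → ℝ≥0∞} (hH : Measurable H) :
    ∫⁻ t : ℝ, (∫⁻ w : ST n, H (t - w.1) * ‖f w‖ₑ) ^ 2 ≤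
      (∫⁻ w, ‖f w‖ₑ) ^ 2 * ∫⁻ t : ℝ, H t ^ 2 := by
  have hfm : Measurable fun w => ‖f w‖ₑ := f.continuous.enorm.measurable
  have hHt t : Measurable fun w : ST n => H (t - w.1) :=
    hH.comp (measurable_const.sub measurable_fst)
  have cs t : (∫⁻ w : ST n, H (t - w.1) * ‖f w‖ₑ) ^ 2 ≤
      (∫⁻ w, ‖f w‖ₑ) * ∫⁻ w : ST n, H (t - w.1) ^ 2 * ‖f w‖ₑ := by
    have := ENNReal.lintegral_mul_le_Lp_mul_Lq (volume.withDensity fun w => ‖f w‖ₑ)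
      Real.HolderConjugate.two_two (hHt t).aemeasurable (g := 1) aemeasurable_const
    simp only [Pi.mul_apply, Pi.one_apply, mul_one, ENNReal.one_rpow, lintegral_one] at this
    rw [withDensity_apply _ MeasurableSet.univ, Measure.restrict_univ,
      lintegral_withDensity_eq_lintegral_mul _ hfm (hHt t),
      lintegral_withDensity_eq_lintegral_mul _ hfm ((hHt t).pow_const _)] at this
    have h2 := pow_le_pow_left₀ (zero_le) this 2
    rw [mul_pow, ← ENNReal.rpow_natCast, ← ENNReal.rpow_natCast, ← ENNReal.rpow_natCast,
      ← ENNReal.rpow_mul, ← ENNReal.rpow_mul] at h2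
    norm_num at h2
    simp [mul_comm (‖f _‖ₑ)] at h2
    rw [mul_comm (∫⁻ w, ‖f w‖ₑ)]
    exact h2
  calc _ ≤ ∫⁻ t : ℝ, (∫⁻ w, ‖f w‖ₑ) * ∫⁻ w : ST n, H (t - w.1) ^ 2 * ‖f w‖ₑ :=
        lintegral_mono cs
    _ = (∫⁻ w, ‖f w‖ₑ) * ∫⁻ t : ℝ, ∫⁻ w : ST n, H (t - w.1) ^ 2 * ‖f w‖ₑ :=
        lintegral_const_mul' _ _ f.integrable.2.ne
    _ = (∫⁻ w, ‖f w‖ₑ) * ∫⁻ w : ST n, ∫⁻ t : ℝ, H (t - w.1) ^ 2 * ‖f w‖ₑ := by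
        rw [lintegral_lintegral_swap]
        exact Measurable.aemeasurable (Measurable.mul (Measurable.pow_const (hH.comp (measurable_fst.sub (measurable_fst.comp measurable_snd))) 2) (hfm.comp measurable_snd))
    _ = (∫⁻ w, ‖f w‖ₑ) * ∫⁻ w : ST n, (∫⁻ t : ℝ, H t ^ 2) * ‖f w‖ₑ := by
        congr 1
        refine lintegral_congr fun w => ?_
        rw [lintegral_mul_const' _ _ enorm_ne_top,
          lintegral_sub_right_eq_self (fun t => H t ^ 2) w.1]
    _ = _ := by
        rw [lintegral_const_mul _ hfm]; ring

theorem exists_diff_majorant {g} (hg : Measurable g) {B} (hB : ∀ z, |g z| ≤ B)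
    (hsec : ∀ a : Λ, ∃ p : ST n → ℝ, Measurable p ∧ IsWeakSecondDeriv a a g p ∧
      ∫⁻ t : ℝ, (eLpNorm (fun x : Sp n => p (t, x)) ⊤ volume) ^ 2 < ⊤) :
    ∃ C : ℝ≥0∞, C ≠ ⊤ ∧ ∀ m : ℕ, ∃ Γ : ℝ → ℝ≥0∞, Measurable Γ ∧
      (∀ z, ‖Gm h (m + 1) g z - Gm h m g z‖ₑ ≤ ofReal ((4 : ℝ) ^ m)⁻¹ * Γ z.1) ∧
      ∫⁻ t, Γ t ^ 2 ≤ C := by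
  choose p hpm hpw hpf using hsec
  set H : ℝ → ℝ≥0∞ := fun t =>
    (∑ a, eLpNorm (fun x => p a (t, x)) ⊤ volume ^ 2) ^ (1 / 2 : ℝ) with hHdef
  have hHm : Measurable H := (Finset.measurable_sum _ fun a _ =>
    (measurable_eLpNorm_slice (hpm a)).pow_const 2).pow_const _
  have hHsq t : H t ^ 2 = ∑ a, eLpNorm (fun x => p a (t, x)) ⊤ volume ^ 2 := by
    rw [hHdef]
    simp only
    rw [← ENNReal.rpow_natCast, ← ENNReal.rpow_mul]; norm_num
  have hHfin : ∫⁻ t, H t ^ 2 < ⊤ := by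
    simp only [hHsq]
    rw [lintegral_finsetSum _ fun a _ => (measurable_eLpNorm_slice (hpm a)).pow_const 2]
    exact ENNReal.sum_lt_top.2 fun a _ => hpf a
  have hle a t : eLpNorm (fun x => p a (t, x)) ⊤ volume ≤ H t := by
    refine (ENNReal.pow_le_pow_left_iff two_ne_zero).1 ?_
    rw [hHsq]
    exact single_le_sum (f := fun a => eLpNorm (fun x => p a (t, x)) ⊤ volume ^ 2)
      (fun _ _ => zero_le) (Finset.mem_univ a)
  have hint a (f : 𝓢(ST n, ℝ)) : Integrable fun w => p a w * f w := by
    refine ⟨((hpm a).mul f.continuous.measurable).aestronglyMeasurable, ?_⟩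
    rw [HasFiniteIntegral]
    simp [enorm_mul]
    exact (lintegral_enorm_mul_le (hpm a) hHm (hle a) f.continuous.enorm.measurable).trans_lt
      (lintegral_time_mul_lt_top f hHm hHfin)
  refine ⟨((n + 1 : ℕ) * ∫⁻ w, ‖lapK h n w‖ₑ) ^ 2 * ∫⁻ t, H t ^ 2, ENNReal.mul_ne_top (ENNReal.pow_ne_top (ENNReal.mul_ne_top (by simp) (lapK h n).integrable.2.ne)) hHfin.ne, fun m => ?_⟩
  set f := scl m (lapK h n) with hf
  refine ⟨fun t => (n + 1 : ℕ) * ∫⁻ w : ST n, H (t - w.1) * ‖f w‖ₑ, ?_, fun z => ?_, ?_⟩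
  · refine Measurable.const_mul (Measurable.lintegral_prod_right' (f := fun q =>
      H (q.1 - q.2.1) * ‖f q.2‖ₑ) ?_) _
    exact (hHm.comp (measurable_fst.sub (measurable_fst.comp measurable_snd))).mul
      (f.continuous.enorm.measurable.comp measurable_snd)
  · rw [Gm_succ_sub h m hg hB hpw hint, enorm_mul,
      Real.enorm_of_nonneg (by positivity : (0 : ℝ) ≤ (4 ^ m)⁻¹)]
    refine mul_le_mul_right ?_ _
    have h1 a : ‖∫ w, p a w * f (z - w)‖ₑ ≤ ∫⁻ w : ST n, H (z.1 - w.1) * ‖f w‖ₑ := by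
      calc ‖∫ w, p a w * f (z - w)‖ₑ ≤ ∫⁻ w, ‖p a w * f (z - w)‖ₑ := enorm_integral_le_lintegral_enorm _
        _ = ∫⁻ w, ‖p a w‖ₑ * ‖f (z - w)‖ₑ := by simp [enorm_mul]
        _ ≤ ∫⁻ w : ST n, H w.1 * ‖f (z - w)‖ₑ := lintegral_enorm_mul_le (hpm a) hHm (hle a)
            (f.continuous.enorm.measurable.comp (measurable_const.sub measurable_id))
        _ = ∫⁻ w : ST n, H (z - w).1 * ‖f (z - (z - w))‖ₑ :=
            (lintegral_sub_left_eq_self (fun w => H w.1 * ‖f (z - w)‖ₑ) z).symm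
        _ = _ := by simp [sub_sub_cancel, Prod.fst_sub]
    calc _ ≤ ∑ a : Λ, ‖∫ w, p a w * f (z - w)‖ₑ := enorm_sum_le _ _
      _ ≤ ∑ a : Λ, ∫⁻ w : ST n, H (z.1 - w.1) * ‖f w‖ₑ := sum_le_sum fun a _ => h1 a
      _ = _ := by simp
  · have e : ∫⁻ w, ‖f w‖ₑ = ∫⁻ w, ‖lapK h n w‖ₑ := by
      have := integral_norm_scl m (lapK h n)
      rw [integral_norm_eq_lintegral_enorm f.continuous.aestronglyMeasurable,
        integral_norm_eq_lintegral_enorm (lapK h n).continuous.aestronglyMeasurable] at this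
      exact (ENNReal.toReal_eq_toReal_iff' f.integrable.2.ne (lapK h n).integrable.2.ne).1 this
    simp [mul_pow]
    rw [lintegral_const_mul' _ _ (by simp), mul_assoc, ← e]
    exact mul_le_mul_right (lintegral_sq_time_conv_le f hHm) _

end lap

def Band (k : ℕ) (b : ST n → ℝ) : Prop :=
  ∀ p q : Sp n → ℂ, BMs p → BMs q →
    (∀ η η', p η ≠ 0 → q η' ≠ 0 → 𝟚 ^ (max 1 (k / 2)) ≤ 2 * π * ‖η - η'‖) →
    ∀ u : L2 n, Mult p (mulOp (ℭ b) (Mult q u)) = 0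

structure Coef (G : ℕ → Λ → Λ → ST n → ℝ) (B c : ℝ) (k₀ : ℕ) (CΓ : ℝ≥0∞) :
    Prop where
  smooth : ∀ k i j, ContDiff ℝ ∞ (G k i j)
  symm : ∀ k i j z, G k i j z = G k j i z
  time : ∀ k z, G k 0 0 z = 1
  one_le : 1 ≤ B
  bound : ∀ k i j z, |G k i j z| ≤ B
  bound_pd : ∀ k i j a z, |pd a (G k i j) z| ≤ B
  lip : ∀ k i j z z', |G k i j z - G k i j z'| ≤ B * ‖z - z'‖
  bound_pd_pd : ∀ k i j a b z, |pd a (pd b (G k i j)) z| ≤ B * 2 ^ k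
  pos : 0 < c
  hyperbolic : ∀ k, k₀ ≤ k → ∀ (z : ST n) (ξ : Sp n),
    c * ‖ξ‖ ^ 2 ≤ (∑ j : Fin n, G k 0 j.succ z * ξ j) ^ 2
      - ∑ i : Fin n, ∑ j : Fin n, G k i.succ j.succ z * ξ i * ξ j
  fin : CΓ ≠ ⊤
  diff : ∀ k l, l ≤ k + 3 → k ≤ l + 3 → ∀ i j, ∃ Γ : ℝ → ℝ≥0∞, Measurable Γ ∧
    (∀ z, ‖G k i j z - G l i j z‖ₑ ≤ ofReal (𝟚 ^ k)⁻¹ * Γ z.1) ∧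
    ∫⁻ t, Γ t ^ 2 ≤ CΓ
  band : ∀ k i j, Band k (G k i j)
  band_pd : ∀ k i j a, Band k (pd a (G k i j))
  band_pd_pd : ∀ k i j a b, Band k (pd a (pd b (G k i j)))

section exists_coef

theorem BM_cv (κ) {g : ST n → ℝ} (hg : Measurable g) {B}
    (hB : ∀ z, |g z| ≤ B) : BM (ℭ (cv κ g)) :=
  BM_of_le (contDiff_cv κ hg hB).continuous (norm_cv_le κ hB)

theorem cv_band {M} (hM : ∀ η, starRingEnd ℂ (M η) = M (-η))
    (hM2 : ∀ η, M η ≠ 0 → 2 * π * ‖η‖ < 2) (m) {g} (hg : Measurable g)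
    {B} (hB : ∀ z, |g z| ≤ B) {p q} (hp : BMs p) (hq : BMs q)
    (hpq : ∀ η η', p η ≠ 0 → q η' ≠ 0 → 𝟚 ^ (m + 1) ≤ 2 * π * ‖η - η'‖) (u : L2 n) :
    Mult p (mulOp (ℭ (cv (scl m (rk M)) g)) (Mult q u)) = 0 := by
  refine eq_of_bil_eq fun w => ?_
  have hG : BM (ℭ (cv (scl m (rk M)) g)) := BM_cv _ hg hB
  rw [bil_Mult hp, bil_mulOp hG, bil_mulOp_eq hG, map_zero, zero_apply]
  set a := Mult q u
  set b := Mult (fun η => p (-η)) w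
  have hi : Integrable ((slab n : Set (ST n)).indicator fun z => a z * b z) := by
    rw [integrable_indicator_iff measurableSet_slab]
    exact integrable_mul_L2 a b
  have e : ∫ z, ((cv (scl m (rk M)) g z : ℝ) : ℂ) * (a z * b z) ∂ϖ =
      ∫ z, (slab n : Set (ST n)).indicator (fun z => a z * b z) z *
        ((cv (scl m (rk M)) g z : ℝ) : ℂ) := by
    change ∫ z in (slab n : Set (ST n)), _ = _
    rw [← integral_indicator measurableSet_slab]
    refine integral_congr_ae (.of_forall fun z => ?_)
    by_cases hz : z ∈ (slab n)
    · simp [indicator_of_mem hz]; rw [mul_comm]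
    · simp [indicator_of_notMem hz, zero_mul]
  rw [e]
  refine integral_mul_cv_rk_eq_zero hM m hg hB hi fun ζ hζ => ?_
  set A : ℝ → ℂ := fun t => exp (↑(2 * π * (2 ^ m * ζ.fst * t)) * I) with hA
  have hAB : BM fun z : ST n => A z.1 := by
    refine ⟨by fun_prop, 1, fun z => ?_⟩
    rw [hA, Complex.norm_exp_ofReal_mul_I]
  have hlt := hM2 ζ hζ
  have key := bil_chr_eq_zero hp.neg_arg hq hAB (𝟚 ^ m • ζ.snd)
    (fun η => by
      by_contra hne
      rw [neg_neg] at hne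
      have h1 := hpq η (η - 𝟚 ^ m • ζ.snd) (right_ne_zero_of_mul hne)
        (left_ne_zero_of_mul hne)
      rw [sub_sub_cancel, norm_smul, norm_of_nonneg ✓] at h1
      have h3 : 2 * π * (2 ^ m * ‖ζ.snd‖) < 2 ^ (m + 1) := by
        calc 2 * π * (2 ^ m * ‖ζ.snd‖) ≤ 2 ^ m * (2 * π * ‖ζ‖) := by
              have := pi_pos
              nlinarith [mul_le_l (WithLp.norm_snd_le (α := ℝ) ζ)
                (show 0 ≤ 2 * π * 2 ^ m by positivity)]
          _ < 2 ^ m * 2 := by gcongr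
          _ = _ := (pow_succ _ _).symm
      linarith) u w
  rw [bil_comm, bil_mulOp_eq hAB] at key
  rw [← key]
  change _ = ∫ z in (slab n : Set (ST n)), _
  rw [← integral_indicator measurableSet_slab]
  refine integral_congr_ae ?_
  filter_upwards [(ae_restrict_iff' measurableSet_slab).1 (coeFn_mulOp (BM_chr (𝟚 ^ m • ζ.snd)) a)] with z hz
  by_cases hzs : z ∈ (slab n)
  · simp only [indicator_of_mem hzs]
    rw [hz hzs, hA, chr]
    have : (2 * π * inner ℝ (𝟚 ^ m • ζ) (WithLp.toLp 2 z) : ℝ) =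
        2 * π * (2 ^ m * ζ.fst * z.1) +
        2 * π * inner ℝ (𝟚 ^ m • ζ.snd) z.2 := by
      rw [WithLp.prod_inner_apply]
      simp [inner_smul_left]
      ring
    rw [this]
    push_cast
    rw [add_mul, Complex.exp_add]
    ring
  · simp [indicator_of_notMem hzs, zero_mul]

theorem Band.const_mul {k} {b : ST n → ℝ} (h : Band k b) (hb : BM (ℭ b)) (c) :
    Band k fun z => c * b z := by
  intro p q hp hq hpq u
  have e : (fun z => ((c * b z : ℝ) : ℂ)) = fun z => c * (b z : ℂ) := by
    funext z; push_cast; rfl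
  rw [e, ← mulOp_mulOp (BM.const _) hb, mulOp_const, map_smul, h p q hp hq hpq, smul_zero]

def dM (v : ST n) (M : 𝓢(VT n, ℂ)) : 𝓢(VT n, ℂ) :=
  (2 * π * I) • SchwartzMap.smulLeftCLM ℂ
    (fun η : VT n => inner ℝ η (WithLp.toLp 2 v)) M

theorem dM_apply (v) (M) (η : VT n) :
    dM v M η = (2 * π * I) * ((inner ℝ η (WithLp.toLp 2 v) : ℝ) * M η) := by
  rw [dM, smul_apply, SchwartzMap.smulLeftCLM_apply_apply (by fun_prop)]
  simp

theorem dM_conj (v) {M} (hM : ∀ η, starRingEnd ℂ (M η) = M (-η))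
    (η : VT n) : starRingEnd ℂ (dM v M η) = dM v M (-η) := by
  rw [dM_apply, dM_apply, map_mul, map_mul, map_mul, map_mul, conj_I, conj_ofReal,
    conj_ofReal, hM, inner_neg_left, Complex.ofReal_neg, Complex.conj_ofNat]
  ring

theorem dM_supp (v) {M} (hM : ∀ η, M η ≠ 0 → 2 * π * ‖η‖ < 2)
    (η : VT n) (hη : dM v M η ≠ 0) : 2 * π * ‖η‖ < 2 := by
  rw [dM_apply] at hη
  exact hM η (right_ne_zero_of_mul (right_ne_zero_of_mul hη))

theorem pd_cv_scl (m) (M) {g} (hg : Measurable g) {B}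
    (hB : ∀ z, |g z| ≤ B) (i : Λ) : pd i (cv (scl m (rk M)) g) =
      fun z => 2 ^ m * cv (scl m (rk (dM (dir i) M))) g z := by
  rw [pd_cv _ hg hB, lineDeriv_scl, lineDeriv_rk]
  funext z
  exact cv_smul _ _ _ _

theorem exists_coef {g : Λ → Λ → ST n → ℝ} (hg : Admissible g) :
    ∃ (B c : ℝ) (k₀ : ℕ) (CΓ : ℝ≥0∞),
      Coef (fun k i j => Gm h (max 1 (k / 2) - 1) (g i j)) B c k₀ CΓ := by
  obtain ⟨B, hB⟩ := hg.bounded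
  obtain ⟨K, hK⟩ := hg.lipschitz
  obtain ⟨c, hc, hyp⟩ := hg.hyperbolic
  have hgm (i j) : Measurable (g i j) := (hK i j).continuous.measurable
  have hB0 : 0 ≤ B := (abs_nonneg _).trans (hB 0 0 0)
  set I := ∫ w, ‖kap h n w‖
  set I1 : ℝ := ∑ j : Λ, ∫ w, ‖∂_{(dir j)} (kap h n) w‖
  set I2 := ∫ w, ‖w‖ * ‖kap h n w‖
  have hI : 0 ≤ I := integral_nonneg fun _ => norm_nonneg _
  have hI2 : 0 ≤ I2 := integral_nonneg fun _ => by positivity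
  have hI1' j : 0 ≤ ∫ w, ‖∂_{(dir j : ST n)} (kap h n) w‖ :=
    integral_nonneg fun _ => norm_nonneg _
  have hI1 : 0 ≤ I1 := sum_nonneg fun j _ => hI1' j
  choose C hC Γ hΓm hΓ hΓC using fun i j => exists_diff_majorant h (hgm i j) (hB i j) fun a => hg.second i j a a
  set B' := 1 + B * I + K * I + K * I1 with hB'
  have b1 : B * I ≤ B' := by have := mul_nonneg K.2 hI; have := mul_nonneg K.2 hI1; simp [B'] at *; nlinarith
  have b2 : K * I ≤ B' := by
    have := mul_nonneg hB0 hI; have := mul_nonneg K.2 hI1; simp [B'] at *; nlinarith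
  have b3 j : K * ∫ w, ‖∂_{(dir j : ST n)} (kap h n) w‖ ≤ B' := by
    have : K * ∫ w, ‖∂_{(dir j)} (kap h n) w‖ ≤ K * I1 :=
      mul_le_l (single_le_sum (fun j _ => hI1' j) (Finset.mem_univ j)) K.2
    have := mul_nonneg hB0 hI; have := mul_nonneg K.2 hI; simp [B'] at *; nlinarith
  have hB1 : 1 ≤ B' := by
    have := mul_nonneg hB0 hI; have := mul_nonneg K.2 hI; have := mul_nonneg K.2 hI1
    simp [B'] at *; nlinarith
  set D : ℝ := n ^ 2 * (B' + B + 1) * (K * I2) with hD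
  have hD0 : 0 ≤ D := ✓
  obtain ⟨m₀, hm₀⟩ := exists_pow_lt_of_lt_one (show 0 < c / 2 / (D + 1) by positivity)
    (show (𝟚⁻¹) < 1 by norm_num)
  refine ⟨B', c / 2, 2 * (m₀ + 1), ∑ i, ∑ j, 128 ^ 2 * (4 * C i j), ?_⟩
  constructor
  · exact fun k i j => contDiff_Gm h _ (hgm i j) (hB i j)
  · intro k i j z
    rw [show g i j = g j i from funext (hg.symm i j)]
  · exact fun k z => Gm_const h _ hg.time z
  · exact hB1
  · exact fun k i j z => (abs_Gm_le h _ (hB i j) z).trans b1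
  · exact fun k i j a z => (abs_pd_Gm_le h _ (hK i j) (hB i j) a z).trans b2
  · exact fun k i j z z' => (abs_Gm_sub_le_dist h _ (hK i j) (hB i j) z z').trans
      (mul_le_r b2 (norm_nonneg _))
  · refine fun k i j a b z => (abs_pd_pd_Gm_le h _ (hK i j) (hB i j) a b z).trans ?_
    rw [mul_comm]
    exact mul_le_mul (b3 b) (pow_le_pow_right₀ ✓ ✓) ✓ (zero_le_one.trans hB1)
  · positivity
  · intro k hk z ξ
    set m := max 1 (k / 2) - 1
    set ε := (𝟚 ^ m)⁻¹ * (K * I2) with hε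
    have he (i j) : |Gm h m (g i j) z - g i j z| ≤ ε := abs_Gm_sub_le h m (hK i j) (hB i j) z
    have hε0 : 0 ≤ ε := (abs_nonneg _).trans (he 0 0)
    have hξ i : |ξ i| ≤ ‖ξ‖ := PiLp.norm_apply_le ξ i
    have s1 : |∑ j : Fin n, Gm h m (g 0 j.succ) z * ξ j - ∑ j : Fin n, g 0 j.succ z * ξ j|
        ≤ n * (ε * ‖ξ‖) := by
      rw [← sum_sub_distrib]
      refine (abs_sum_le_sum_abs _ _).trans ((sum_le_card_nsmul _ _ (ε * ‖ξ‖) fun j _ => ?_).trans (by simp))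
      rw [← sub_mul, abs_mul]
      exact mul_le_mul (he _ _) (hξ j) (abs_nonneg _) hε0
    have s2 : |∑ j : Fin n, Gm h m (g 0 j.succ) z * ξ j + ∑ j : Fin n, g 0 j.succ z * ξ j|
        ≤ n * ((B' + B) * ‖ξ‖) := by
      rw [← sum_add_distrib]
      refine (abs_sum_le_sum_abs _ _).trans ((sum_le_card_nsmul _ _ ((B' + B) * ‖ξ‖) fun j _ => ?_).trans (by simp))
      rw [← add_mul, abs_mul]
      exact mul_le_mul ((abs_add_le _ _).trans (add_le_add ((abs_Gm_le h m (hB _ _) z).trans b1) (hB _ _ _))) (hξ j) (abs_nonneg _) ✓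
    have s3 : |∑ i : Fin n, ∑ j : Fin n, Gm h m (g i.succ j.succ) z * ξ i * ξ j -
        ∑ i : Fin n, ∑ j : Fin n, g i.succ j.succ z * ξ i * ξ j| ≤ n * (n * (ε * ‖ξ‖ * ‖ξ‖)) := by
      rw [← sum_sub_distrib]
      refine (abs_sum_le_sum_abs _ _).trans ((sum_le_card_nsmul _ _ (n * (ε * ‖ξ‖ * ‖ξ‖)) fun i _ => ?_).trans (by simp))
      rw [← sum_sub_distrib]
      refine (abs_sum_le_sum_abs _ _).trans ((sum_le_card_nsmul _ _ (ε * ‖ξ‖ * ‖ξ‖) fun j _ => ?_).trans (by simp))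
      rw [← sub_mul, ← sub_mul, abs_mul, abs_mul]
      exact mul_le_mul (mul_le_mul (he _ _) (hξ i) (abs_nonneg _) hε0) (hξ j) (abs_nonneg _)
        ✓
    have s4 := hyp z ξ
    have s5 : |(∑ j : Fin n, Gm h m (g 0 j.succ) z * ξ j) ^ 2 -
        (∑ j : Fin n, g 0 j.succ z * ξ j) ^ 2| ≤ n * (ε * ‖ξ‖) * (n * ((B' + B) * ‖ξ‖)) := by
      rw [sq_sub_sq, mul_comm, abs_mul]
      exact mul_le_mul s1 s2 (abs_nonneg _) ✓
    have s6 : D * (𝟚 ^ m)⁻¹ ≤ c / 2 := by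
      have h1 : (𝟚 ^ m)⁻¹ ≤ c / 2 / (D + 1) := by
        rw [← inv_pow]
        exact (pow_le_pow_of_le_one ✓ ✓ (✓)).trans hm₀.le
      have h2 := (le_div_iff₀ ✓).1 h1
      have h3 : 0 < (𝟚 ^ m)⁻¹ := ✓
      nlinarith
    have s7 : n * (ε * ‖ξ‖) * (n * ((B' + B) * ‖ξ‖)) + n * (n * (ε * ‖ξ‖ * ‖ξ‖)) =
        D * (𝟚 ^ m)⁻¹ * ‖ξ‖ ^ 2 := by rw [hε, hD]; ring
    have s8 := mul_le_r s6 (sq_nonneg ‖ξ‖)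
    have s9 := (abs_le.1 s3).2
    have s10 := (abs_le.1 s5).1
    linarith
  · exact ENNReal.sum_ne_top.2 fun i _ => ENNReal.sum_ne_top.2 fun j _ => ENNReal.mul_ne_top (by simp) (ENNReal.mul_ne_top (by simp) (hC i j))
  · intro k l hlk hkl i j
    set mk := max 1 (k / 2) - 1
    set ml := max 1 (l / 2) - 1
    have main (a b) (hab : a ≤ b) (hb : b ≤ a + 2) (hka : k ≤ 2 * a + 7) z :
        ‖Gm h b (g i j) z - Gm h a (g i j) z‖ₑ ≤ ofReal (𝟚 ^ k)⁻¹ *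
          (128 * (Γ i j a z.1 + Γ i j (a + 1) z.1)) := by
      have hp : ofReal (4 ^ a)⁻¹ ≤ ofReal (𝟚 ^ k)⁻¹ * 128 := by
        rw [show 128 = ofReal 128 by norm_num, ← ENNReal.ofReal_mul ✓]
        refine ofReal_le_ofReal ?_
        rw [inv_mul_eq_div, le_div_iff₀ ✓, inv_mul_le_iff₀ ✓]
        calc 𝟚 ^ k ≤ 2 ^ (2 * a + 7) := pow_le_pow_right₀ ✓ hka
          _ = _ := by rw [pow_add, pow_mul]; norm_num
      have hp' : ofReal (4 ^ (a + 1))⁻¹ ≤ ofReal (𝟚 ^ k)⁻¹ * 128 := by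
        refine le_trans (ofReal_le_ofReal ?_) hp
        gcongr <;> simp
      have h1 := (hΓ i j a z).trans (mul_le_mul_left hp _)
      have h2 := (hΓ i j (a + 1) z).trans (mul_le_mul_left hp' _)
      rw [← mul_assoc, mul_add]
      obtain rfl | rfl | rfl : b = a ∨ b = a + 1 ∨ b = a + 2 := ✓
      · simp
      · exact h1.trans le_self_add
      · rw [show Gm h (a + 2) (g i j) z - Gm h a (g i j) z =
          (Gm h (a + 1) (g i j) z - Gm h a (g i j) z) +
          (Gm h (a + 1 + 1) (g i j) z - Gm h (a + 1) (g i j) z) by ring]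
        exact (enorm_add_le _ _).trans (add_le_add h1 h2)
    refine ⟨fun t => 128 * (Γ i j (min mk ml) t + Γ i j (min mk ml + 1) t),
      ((hΓm i j _).add (hΓm i j _)).const_mul _, fun z => ?_, ?_⟩
    · rcases le_total mk ml with hle | hle
      · rw [min_eq_left hle, ← enorm_neg, neg_sub]
        exact main mk ml hle ✓ ✓ z
      · rw [min_eq_right hle]
        exact main ml mk hle ✓ ✓ z
    · set a := min mk ml
      simp [mul_pow]
      rw [lintegral_const_mul' _ _ (by simp)]
      have h1 : ∫⁻ t, (Γ i j a t + Γ i j (a + 1) t) ^ 2 ≤ 4 * C i j := by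
        calc ∫⁻ t, (Γ i j a t + Γ i j (a + 1) t) ^ 2
            ≤ ∫⁻ t, 2 * (Γ i j a t ^ 2 + Γ i j (a + 1) t ^ 2) := by
              refine lintegral_mono fun t => ?_
              have := ENNReal.rpow_add_le_mul_rpow_add_rpow (Γ i j a t) (Γ i j (a + 1) t)
                one_le_two
              norm_num at this
              exact this
          _ = 2 * ((∫⁻ t, Γ i j a t ^ 2) + ∫⁻ t, Γ i j (a + 1) t ^ 2) := by
              rw [lintegral_const_mul' _ _ (by simp),
                lintegral_add_left ((hΓm i j a).pow_const 2)]
          _ ≤ 2 * (C i j + C i j) := by gcongr <;> exact hΓC i j _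
          _ = 4 * C i j := by ring
      refine (mul_le_mul_right h1 _).trans (le_trans ?_ (single_le_sum (fun _ _ => zero_le) (Finset.mem_univ i)))
      exact single_le_sum (f := fun j => 128 ^ 2 * (4 * C i j))
        (fun _ _ => zero_le) (Finset.mem_univ j)
  all_goals
    have cvb k (i j) {M : 𝓢(VT n, ℂ)}
        (hM : ∀ η, starRingEnd ℂ (M η) = M (-η)) (hM2 : ∀ η, M η ≠ 0 → 2 * π * ‖η‖ < 2) :
        Band k (cv (scl (max 1 (k / 2) - 1) (rk M)) (g i j)) := by
      refine fun p q hp hq hpq u => cv_band hM hM2 _ (hgm i j) (hB i j) hp hq (fun η η' h1 h2 => ?_) u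
      rw [show max 1 (k / 2) - 1 + 1 = max 1 (k / 2) by omega]
      exact hpq η η' h1 h2
    have hl η (hη : lowS (VT n) h η ≠ 0) : 2 * π * ‖η‖ < 2 := by
      by_contra! hc
      exact hη (by rw [lowS_apply, lp0_zero h hc]; simp)
  · exact fun k i j => cvb k i j (low_conj h) hl
  · intro k i j a
    simp [Gm, kap]
    rw [pd_cv_scl _ _ (hgm i j) (hB i j)]
    exact (cvb k i j (dM_conj _ (low_conj h)) (dM_supp _ hl)).const_mul
      (BM_cv _ (hgm i j) (hB i j)) _
  · intro k i j a b
    have e : pd a (pd b (Gm h (max 1 (k / 2) - 1) (g i j))) = fun z =>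
        (2 ^ (max 1 (k / 2) - 1) * 2 ^ (max 1 (k / 2) - 1)) *
        cv (scl (max 1 (k / 2) - 1) (rk (dM (dir a) (dM (dir b) (lowS (VT n) h))))) (g i j) z := by
      simp [Gm, kap]
      rw [pd_cv_scl _ _ (hgm i j) (hB i j)]
      funext z
      have := (contDiff_cv (scl (max 1 (k / 2) - 1) (rk (dM (dir b) (lowS (VT n) h)))) (hgm i j)
        (hB i j)).differentiable (by simp) z
      rw [pd, fderiv_const_mul this, smul_apply, smul_eq_mul, mul_assoc]
      congr 1
      exact congrFun (pd_cv_scl _ _ (hgm i j) (hB i j) a) z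
    simp [e]
    exact (cvb k i j (dM_conj _ (dM_conj _ (low_conj h))) (dM_supp _ (dM_supp _ hl))).const_mul
      (BM_cv _ (hgm i j) (hB i j)) _

end exists_coef

variable {G : ℕ → Fin (n + 1) → Fin (n + 1) → ST n → ℝ} {B c : ℝ} {k₀ : ℕ} {CΓ : ℝ≥0∞}
  (hG : Coef G B c k₀ CΓ)

theorem dd_comm (i j) (ψ : 𝓣) : dd i (dd j ψ) = dd j (dd i ψ) := by
  ext z
  have h (i j) : dd i (dd j ψ) z = (fderiv ℝ (fderiv ℝ ψ) z (dir i)) (dir j) := by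
    have hd : DifferentiableAt ℝ (fderiv ℝ ψ) z :=
      ((ψ.contDiff.fderiv_right (m := 1) (by norm_num; exact WithTop.coe_le_coe.2 (le_top : (2 : ℕ∞) ≤ ⊤))).differentiable ✓) z
    have e : ⇑(dd j ψ) = fun z => fderiv ℝ ψ z (dir j) := funext fun z => dd_apply j ψ z
    rw [dd_apply, pd, e, fderiv_clm_apply hd (by fun_prop)]
    simp
  rw [h, h]
  exact (ψ.contDiff.contDiffAt.isSymmSndFDerivAt (by simp; exact WithTop.coe_le_coe.2 (le_top : (2 : ℕ∞) ≤ ⊤))) _ _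

theorem bil_Mop_even {a} (ha : ∀ η, a (-η) = a η) (K) (u w : L2 n) :
    bil (Mop a K u) w = bil u (Mop a K w) := by
  rw [Mop, bil_Mult (BMs_scs a K)]
  congr 3
  funext η
  simp [scs, smul_neg, ha]

theorem bil_Mop_dd (a) (K) (j) (X) (ψ : 𝓣) :
    bil (Mop a K X) (tst (dd j.succ ψ)) =
      -((𝟚 ^ K : ℝ) : ℂ) * bil (Mop (dS j a) K X) (tst ψ) := by
  rw [WD_space j a K X ψ]
  simp

theorem sum_bil_Mop_eq_zero {ι} [Fintype ι] {a}
    (ha : ∀ η, a (-η) = a η) (K) {X : ι → L2 n} {T : ι → 𝓣 → 𝓣}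
    (hT : ∀ b y ψ, T b (trT y ψ) = trT y (T b ψ))
    (h : ∀ ψ, ∑ b, bil (X b) (tst (T b ψ)) = 0) (ψ) :
    ∑ b, bil (Mop a K (X b)) (tst (T b ψ)) = 0 := by
  have e b : bil (Mop a K (X b)) (tst (T b ψ)) =
      ∫ y, ker a K y * bil (tr y (tst (T b ψ))) (X b) := by
    rw [bil_Mop_even ha, bil_comm, bil_Mop]
  simp [e]
  rw [← integral_finsetSum _ fun b _ => integrable_ker_mul_bil a K _ _]
  refine integral_eq_zero_of_ae (.of_forall fun y => ?_)
  simp only [← mul_sum, Pi.zero_apply]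
  refine mul_eq_zero_of_right _ ?_
  rw [← h (trT y ψ)]
  refine sum_congr rfl fun b _ => ?_
  rw [tr_tst, hT, bil_comm]

def WeakEq (g : Λ → Λ → ST n → ℝ) (β : Λ → ST n → ℝ)
    (γ : ST n → ℝ) (V F : L2 n) : Prop :=
  ∀ ψ : 𝓣, ∑ i, ∑ j, bil (mulOp (ℭ (g i j)) V) (tst (dd i (dd j ψ)))
    + ∑ i, bil (mulOp (ℭ (β i)) V) (tst (dd i ψ))
    + bil (mulOp (ℭ γ) V) (tst ψ) = bil F (tst ψ)

theorem WeakEq.mop {g} {β}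
    {γ} {V F} (h : WeakEq g β γ V F) {a : 𝓢(Sp n, ℂ)}
    (ha : ∀ η, a (-η) = a η) (K) (ψ) :
    ∑ i, ∑ j, bil (Mop a K (mulOp (ℭ (g i j)) V)) (tst (dd i (dd j ψ)))
    + ∑ i, bil (Mop a K (mulOp (ℭ (β i)) V)) (tst (dd i ψ))
    + bil (Mop a K (mulOp (ℭ γ) V)) (tst ψ) = bil (Mop a K F) (tst ψ) := by
  have := sum_bil_Mop_eq_zero (ι := (Λ × Λ) ⊕ Λ ⊕ Unit ⊕ Unit) ha K
    (X := Sum.elim (fun p => mulOp (ℭ (g p.1 p.2)) V)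
      (Sum.elim (fun i => mulOp (ℭ (β i)) V)
      (Sum.elim (fun _ => mulOp (ℭ γ) V) fun _ => -F)))
    (T := Sum.elim (fun p ψ => dd p.1 (dd p.2 ψ)) (Sum.elim (fun i ψ => dd i ψ)
      (Sum.elim (fun _ ψ => ψ) fun _ ψ => ψ)))
    (by rintro (b | b | b | b) y ψ <;> simp [dd_trT])
    (fun ψ => by
      simp [Fintype.sum_sum_type, Sum.elim_inl, Sum.elim_inr, Fintype.sum_prod_type,
        Finset.univ_unique, Finset.sum_singleton, map_neg, neg_apply]
      linear_combination h ψ) ψ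
  simp [Fintype.sum_sum_type, Sum.elim_inl, Sum.elim_inr, Fintype.sum_prod_type,
    Finset.univ_unique, Finset.sum_singleton, map_neg, neg_apply] at this
  linear_combination this

structure Lower (β : Λ → ST n → ℝ) (γ : ST n → ℝ) (k : ℕ) (B : ℝ) : Prop where
  smooth : ContDiff ℝ ∞ (β 0)
  cont : ∀ i, Continuous (β i)
  cont' : Continuous γ
  bound : ∀ i z, |β i z| ≤ B
  bound_pd : ∀ z, |pd 0 (β 0) z| ≤ B * 2 ^ k
  bound' : ∀ z, |γ z| ≤ B * 2 ^ k
  band : ∀ i, Band k (β i)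
  band' : Band k γ

theorem exists_norm_Mop_dS_le (a : 𝓢(Sp n, ℂ)) : ∃ C : ℝ, 1 ≤ C ∧ ∀ k u,
    ‖Mop a k u‖ ≤ C * ‖u‖ ∧ (∀ j, ‖Mop (dS j a) k u‖ ≤ C * ‖u‖) ∧
    ∀ i j, ‖Mop (dS i (dS j a)) k u‖ ≤ C * ‖u‖ := by
  obtain ⟨C0, h0, hC0⟩ := exists_norm_Mop_le a
  choose C1 h1 hC1 using fun j => exists_norm_Mop_le (dS j a)
  choose C2 h2 hC2 using fun i j => exists_norm_Mop_le (dS i (dS j a))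
  have s1 : 0 ≤ ∑ j, C1 j := sum_nonneg fun j _ => h1 j
  have s2' (i) : 0 ≤ ∑ j, C2 i j := sum_nonneg fun j _ => h2 i j
  have s2 : 0 ≤ ∑ i, ∑ j, C2 i j := sum_nonneg fun i _ => s2' i
  refine ⟨1 + C0 + ∑ j, C1 j + ∑ i, ∑ j, C2 i j, ✓, fun k u => ⟨(hC0 k u).trans (mul_le_r ✓ (norm_nonneg _)), fun j => ?_, fun i j => ?_⟩⟩
  · refine (hC1 j k u).trans (mul_le_r ?_ (norm_nonneg _))
    have := single_le_sum (fun j _ => h1 j) (Finset.mem_univ j)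
    linarith
  · refine (hC2 i j k u).trans (mul_le_r ?_ (norm_nonneg _))
    have := single_le_sum (fun i _ => s2' i) (Finset.mem_univ i)
    have := single_le_sum (fun j _ => h2 i j) (Finset.mem_univ j)
    linarith

theorem norm_sum_le_card {ι} [Fintype ι] {X : ι → L2 n} {c} (h : ∀ i, ‖X i‖ ≤ c) :
    ‖∑ i, X i‖ ≤ Fintype.card ι * c :=
  (norm_sum_le _ _).trans ((sum_le_card_nsmul _ _ c fun i _ => h i).trans (by simp))

section reg

variable {g : Fin (n + 1) → Fin (n + 1) → ST n → ℝ} {β : Fin (n + 1) → ST n → ℝ} {γ : ST n → ℝ}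

def eqA (g : Λ → Λ → ST n → ℝ) (β : Λ → ST n → ℝ)
    (a : 𝓢(Sp n, ℂ)) (K : ℕ) (V : L2 n) : L2 n :=
  Mop a K (mulOp (ℭ (β 0)) V)
    - ∑ j : Fin n, (2 * (𝟚 ^ K : ℝ) : ℂ) •
      Mop (dS j a) K (mulOp (ℭ (g 0 j.succ)) V)

def eqG (g : Λ → Λ → ST n → ℝ) (β : Λ → ST n → ℝ)
    (γ : ST n → ℝ) (a : 𝓢(Sp n, ℂ)) (K : ℕ) (V : L2 n) : L2 n :=
  ∑ i : Fin n, ∑ j : Fin n, (((𝟚 ^ K : ℝ) : ℂ) ^ 2) •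
      Mop (dS j (dS i a)) K (mulOp (ℭ (g i.succ j.succ)) V)
    - ∑ j : Fin n, ((𝟚 ^ K : ℝ) : ℂ) • Mop (dS j a) K (mulOp (ℭ (β j.succ)) V)
    + Mop a K (mulOp (ℭ γ) V)

theorem WeakEq.time {V F : L2 n} (h : WeakEq g β γ V F) (hsymm : ∀ i j z, g i j z = g j i z)
    (htime : ∀ z, g 0 0 z = 1) {a} (ha : ∀ η, a (-η) = a η) (K)
    (ψ) :
    bil (Mop a K V) (tst (dd 0 (dd 0 ψ))) + bil (eqA g β a K V) (tst (dd 0 ψ))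
      + bil (eqG g β γ a K V - Mop a K F) (tst ψ) = 0 := by
  have h1 := h.mop ha K ψ
  rw [Fin.sum_univ_succ, Fin.sum_univ_succ, Fin.sum_univ_succ] at h1
  simp only [Fin.sum_univ_succ] at h1
  have e0 : (ℭ (g 0 0)) = fun _ => 1 := funext fun z => by rw [htime]; simp
  rw [e0, mulOp_const, one_smul] at h1
  simp [show ∀ i : Fin n, g i.succ 0 = g 0 i.succ from fun i => funext (hsymm _ _)] at h1
  simp only [fun i : Fin n => dd_comm 0 i.succ ψ, bil_Mop_dd] at h1
  rw [eqA, eqG]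
  simp [map_sub, map_add, map_sum, map_smul, sub_apply, add_apply, sum_apply,
    smul_apply, smul_eq_mul]
  simp [sum_add_distrib, neg_mul, mul_neg, neg_neg, Finset.sum_neg_distrib] at h1
  simp [sq, mul_assoc, ← mul_sum] at h1 ⊢
  linear_combination h1

theorem norm_eqA_le {k K} {B Ca} (hB : 0 ≤ B)
    (hgc : ∀ i j, Continuous (g i j)) (hg : ∀ i j z, |g i j z| ≤ B) (hl : Lower β γ k B)
    {a} (hCa : 1 ≤ Ca) (ha : ∀ k (u), ‖Mop a k u‖ ≤ Ca * ‖u‖ ∧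
      (∀ j, ‖Mop (dS j a) k u‖ ≤ Ca * ‖u‖) ∧ ∀ i j, ‖Mop (dS i (dS j a)) k u‖ ≤ Ca * ‖u‖)
    (V) : ‖eqA g β a K V‖ ≤ (2 * n + 1) * (Ca * B) * (2 ^ K * ‖V‖) := by
  have hm {b : ST n → ℝ} hb {c : ℝ} hc :
      ‖mulOp (ℭ b) V‖ ≤ c * ‖V‖ :=
    norm_mulOp_le (BM_of_le hb hc) (fun z => by simpa using hc z) V
  have e1 : ‖Mop a K (mulOp (ℭ (β 0)) V)‖ ≤ Ca * B * (2 ^ K * ‖V‖) := by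
    refine ((ha K _).1).trans ?_
    rw [mul_assoc]
    exact mul_le_l ((hm (hl.cont 0) (hl.bound 0)).trans (mul_le_l (le_mul_of_one_le_left (norm_nonneg _) (one_le_pow₀ ✓)) hB)) ✓
  have e2 : ‖∑ j : Fin n, (2 * (𝟚 ^ K : ℝ) : ℂ) •
      Mop (dS j a) K (mulOp (ℭ (g 0 j.succ)) V)‖ ≤
      n * (2 * (Ca * B * (2 ^ K * ‖V‖))) := by
    refine (norm_sum_le_card (c := 2 * (Ca * B * (2 ^ K * ‖V‖))) fun j => ?_).trans (by simp)
    rw [norm_smul]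
    have : ‖(2 * (𝟚 ^ K : ℝ) : ℂ)‖ = 2 * 2 ^ K := by simp
    rw [this]
    have := ((ha K (mulOp (ℭ (g 0 j.succ)) V)).2.1 j).trans
      (mul_le_l (hm (hgc 0 j.succ) (hg 0 j.succ)) ✓)
    calc _ ≤ 2 * 2 ^ K * (Ca * (B * ‖V‖)) := mul_le_l this ✓
      _ = _ := by ring
  rw [eqA]
  refine (norm_sub_le _ _).trans ((add_le_add e1 e2).trans (le_of_eq (by ring)))

theorem norm_eqG_le {k K} (hkK : k ≤ K) {B Ca} (hB : 0 ≤ B)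
    (hgc : ∀ i j, Continuous (g i j)) (hg : ∀ i j z, |g i j z| ≤ B) (hl : Lower β γ k B)
    {a} (hCa : 1 ≤ Ca) (ha : ∀ k (u), ‖Mop a k u‖ ≤ Ca * ‖u‖ ∧
      (∀ j, ‖Mop (dS j a) k u‖ ≤ Ca * ‖u‖) ∧ ∀ i j, ‖Mop (dS i (dS j a)) k u‖ ≤ Ca * ‖u‖)
    (V) : ‖eqG g β γ a K V‖ ≤ (n * n + n + 1) * (Ca * B) * ((2 ^ K) ^ 2 * ‖V‖) := by
  have h1 : (1 : ℝ) ≤ 2 ^ K := one_le_pow₀ ✓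
  have h2 : 𝟚 ^ K ≤ (2 ^ K) ^ 2 := by nlinarith
  have hm {b : ST n → ℝ} hb {c : ℝ} hc :
      ‖mulOp (ℭ b) V‖ ≤ c * ‖V‖ :=
    norm_mulOp_le (BM_of_le hb hc) (fun z => by simpa using hc z) V
  have e1 : ‖Mop a K (mulOp (ℭ γ) V)‖ ≤ Ca * B * ((2 ^ K) ^ 2 * ‖V‖) := by
    refine ((ha K _).1).trans ?_
    rw [mul_assoc]
    refine mul_le_l ((hm hl.cont' hl.bound').trans ?_) ✓
    rw [mul_assoc]
    exact mul_le_l (mul_le_r ((pow_le_pow_right₀ ✓ hkK).trans h2) (norm_nonneg _)) hB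
  have e2 : ‖∑ j : Fin n, ((𝟚 ^ K : ℝ) : ℂ) •
      Mop (dS j a) K (mulOp (ℭ (β j.succ)) V)‖ ≤
      n * (Ca * B * ((2 ^ K) ^ 2 * ‖V‖)) := by
    refine (norm_sum_le_card (c := Ca * B * ((2 ^ K) ^ 2 * ‖V‖)) fun j => ?_).trans (by simp)
    rw [norm_smul]
    have : ‖((𝟚 ^ K : ℝ) : ℂ)‖ = 2 ^ K := by simp
    rw [this]
    have := ((ha K (mulOp (ℭ (β j.succ)) V)).2.1 j).trans
      (mul_le_l (hm (hl.cont j.succ) (hl.bound j.succ)) ✓)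
    calc _ ≤ (2 ^ K) * (Ca * (B * ‖V‖)) := mul_le_l this ✓
      _ ≤ (2 ^ K) ^ 2 * (Ca * (B * ‖V‖)) := mul_le_r h2 ✓
      _ = _ := by ring
  have e3 : ‖∑ i : Fin n, ∑ j : Fin n, (((𝟚 ^ K : ℝ) : ℂ) ^ 2) •
      Mop (dS j (dS i a)) K (mulOp (ℭ (g i.succ j.succ)) V)‖ ≤
      n * (n * (Ca * B * ((2 ^ K) ^ 2 * ‖V‖))) := by
    refine (norm_sum_le_card (c := n * (Ca * B * ((2 ^ K) ^ 2 * ‖V‖))) fun i => (norm_sum_le_card (c := Ca * B * ((2 ^ K) ^ 2 * ‖V‖)) fun j => ?_).trans (by simp)).trans (by simp)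
    rw [norm_smul]
    have : ‖(((𝟚 ^ K : ℝ) : ℂ) ^ 2)‖ = (2 ^ K) ^ 2 := by simp
    rw [this]
    have := ((ha K (mulOp (ℭ (g i.succ j.succ)) V)).2.2 j i).trans
      (mul_le_l (hm (hgc i.succ j.succ) (hg i.succ j.succ)) ✓)
    calc _ ≤ (2 ^ K) ^ 2 * (Ca * (B * ‖V‖)) := mul_le_l this ✓
      _ = _ := by ring
  rw [eqG]
  exact (norm_add_le _ _).trans ((add_le_add (norm_sub_le_of_le e3 e2) e1).trans (le_of_eq (by ring)))

theorem exists_time_deriv {a} (ha : ∀ η, a (-η) = a η) {B}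
    (hB : 0 ≤ B) : ∃ C : ℝ, 0 ≤ C ∧ ∀ (g)
      (β) (γ) (k K) (V F : L2 n), k ≤ K →
      (∀ i j z, g i j z = g j i z) → (∀ z, g 0 0 z = 1) → (∀ i j, Continuous (g i j)) →
      (∀ i j z, |g i j z| ≤ B) → Lower β γ k B → WeakEq g β γ V F →
      ∃ v1, WD 0 (Mop a K V) v1 ∧ ‖v1‖ ≤ C * (2 ^ K * ‖V‖ + (2 ^ K)⁻¹ * ‖F‖) := by
  obtain ⟨Ca, hCa, hM⟩ := exists_norm_Mop_dS_le a
  refine ⟨32 * (Ca + (2 * n + 1) * (Ca * B) + (n * n + n + 1) * (Ca * B)), by positivity, ?_⟩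
  intro g β γ k K V F hkK hsymm htime hgc hg hl hV
  have h1 : (1 : ℝ) ≤ 2 ^ K := one_le_pow₀ ✓
  obtain ⟨v1, hv1, hn⟩ := exists_WD_time (fun ψ => hV.time hsymm htime ha K ψ) h1
  refine ⟨v1, hv1, hn.trans ?_⟩
  rw [mul_assoc]
  refine mul_le_l ?_ ✓
  have e2 := norm_eqA_le (K := K) hB hgc hg hl hCa hM V
  have e4 : ‖eqG g β γ a K V - Mop a K F‖ ≤
      (n * n + n + 1) * (Ca * B) * ((2 ^ K) ^ 2 * ‖V‖) + Ca * ‖F‖ :=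
    norm_sub_le_of_le (norm_eqG_le hkK hB hgc hg hl hCa hM V) (hM K F).1
  have e5 := mul_le_l e4 (show 0 ≤ (2 ^ K)⁻¹ by positivity)
  have e6 := mul_le_l ((hM K V).1) (show (0 : ℝ) ≤ (2 ^ K) by positivity)
  have e7 : (𝟚 ^ K)⁻¹ * ((n * n + n + 1) * (Ca * B) * ((2 ^ K) ^ 2 * ‖V‖) + Ca * ‖F‖) =
      (n * n + n + 1) * (Ca * B) * (2 ^ K * ‖V‖) + Ca * ((2 ^ K)⁻¹ * ‖F‖) := by
    field_simp
  rw [e7] at e5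
  have p1 : 0 ≤ 𝟚 ^ K * ‖V‖ := ✓
  have p2 : 0 ≤ (𝟚 ^ K)⁻¹ * ‖F‖ := ✓
  have p4 : 0 ≤ (n * n + n + 1) * (Ca * B) := ✓
  nlinarith [mul_nonneg (✓) p2, mul_nonneg p4 p2]

end reg

theorem scs_lowS (K) (η) :
    scs (lowS (Sp n) h) K η = (lpSymbol φ 0 (2 * π * ‖η‖ / 2 ^ K) : ℂ) := by
  rw [scs, lowS_apply, norm_smul, norm_inv, norm_pow, Real.norm_ofNat]
  congr 2
  ring

theorem scs_lowS_one {K} {η}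
    (hη : 2 * π * ‖η‖ ≤ 2 ^ K) : scs (lowS (Sp n) h) K η = 1 := by
  rw [scs_lowS, lp0_one h ((div_le_one ✓).2 hη), Complex.ofReal_one]

theorem lowS_even (η) :
    lowS (Sp n) h (-η) = lowS (Sp n) h η := by
  rw [lowS_apply, lowS_apply, norm_neg]

theorem Mop_lowS_Mult {K} {m} (hm : BMs m)
    (hs : ∀ η, m η ≠ 0 → 2 * π * ‖η‖ ≤ 2 ^ K) (u) :
    Mop (lowS (Sp n) h) K (Mult m u) = Mult m u := by
  rw [Mop, Mult_Mult (BMs_scs _ _) hm]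
  congr 2
  funext η
  by_cases h0 : m η = 0
  · rw [h0, mul_zero]
  · rw [scs_lowS_one h (hs η h0), one_mul]

theorem Mop_comm (a b) (k l) (u : L2 n) :
    Mop a k (Mop b l u) = Mop b l (Mop a k u) := Mult_comm (BMs_scs _ _) (BMs_scs _ _) u

theorem scs_supp {a} {r} (hs : ∀ η, a η ≠ 0 → 2 * π * ‖η‖ ≤ 2 ^ r)
    {k} {η : Sp n} (h : scs a k η ≠ 0) : 2 * π * ‖η‖ ≤ 2 ^ (k + r) := by
  have := hs _ h
  rw [norm_smul, norm_inv, norm_pow, Real.norm_ofNat] at this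
  rw [pow_add, ← inv_mul_le_iff₀ ✓]
  linarith

theorem Mop_lowS_Mop {a} {r}
    (hs : ∀ η, a η ≠ 0 → 2 * π * ‖η‖ ≤ 2 ^ r) {k K} (hK : k + r ≤ K) (u : L2 n) :
    Mop (lowS (Sp n) h) K (Mop a k u) = Mop a k u :=
  Mop_lowS_Mult h (BMs_scs a k) (fun η hη => (scs_supp hs hη).trans
    (pow_le_pow_right₀ ✓ hK)) u

theorem Mop_mulOp_lowS {a} {r}
    (hr : 1 ≤ r) (hs : ∀ η, a η ≠ 0 → 2 * π * ‖η‖ ≤ 2 ^ r) {k} {b}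
    (hb : Band k b) (V) :
    Mop a k (mulOp (ℭ b) (Mop (lowS (Sp n) h) (k + r + 1) V)) =
      Mop a k (mulOp (ℭ b) V) := by
  have e : V - Mop (lowS (Sp n) h) (k + r + 1) V =
      Mult (fun η => 1 - scs (lowS (Sp n) h) (k + r + 1) η) V := by
    rw [Mult_sub (BMs.const 1) (BMs_scs _ _), Mult_const, one_smul, Mop]
  refine (sub_eq_zero.1 ?_).symm
  rw [← map_sub, ← map_sub, e]
  refine hb _ _ (BMs_scs a k) ((BMs.const 1).sub (BMs_scs _ _)) (fun η η' h1 h2 => ?_) V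
  have h3 := scs_supp hs h1
  have h4 : 𝟚 ^ (k + r + 1) < 2 * π * ‖η'‖ := by
    by_contra! hc
    exact h2 (by rw [scs_lowS_one h hc, sub_self])
  have h5 : ‖η'‖ ≤ ‖η - η'‖ + ‖η‖ := by
    have := norm_sub_norm_le η' η
    rw [norm_sub_rev] at this
    linarith
  have h6 : 𝟚 ^ (max 1 (k / 2)) ≤ 2 ^ (k + r) := pow_le_pow_right₀ ✓ ✓
  have h7 := mul_le_l h5 Real.two_pi_pos.le
  rw [pow_succ] at h4
  linarith

structure Jet (v : L2 n) (d : Λ → L2 n) (e : Λ → Λ → L2 n) :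
    Prop where
  first : ∀ i, WD i v (d i)
  second : ∀ i j, WD i (d j) (e i j)

def Lop (g : Λ → Λ → ST n → ℝ) (e : Λ → Λ → L2 n) :
    L2 n := ∑ i, ∑ j, mulOp (ℭ (g i j)) (e i j)

structure Cf (g : Λ → Λ → ST n → ℝ) (k : ℕ) (B : ℝ) : Prop where
  smooth : ∀ i j, ContDiff ℝ ∞ (g i j)
  symm : ∀ i j z, g i j z = g j i z
  time : ∀ z, g 0 0 z = 1
  bound : ∀ i j z, |g i j z| ≤ B
  bound_pd : ∀ i j a z, |pd a (g i j) z| ≤ B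
  lip : ∀ i j z z', |g i j z - g i j z'| ≤ B * ‖z - z'‖
  band : ∀ i j, Band k (g i j)

theorem Coef.cf
    (h : Coef G B c k₀ CΓ) (k) {B'} (hB : B ≤ B') : Cf (G k) k B' where
  smooth := h.smooth k
  symm := h.symm k
  time := h.time k
  bound i j z := (h.bound k i j z).trans hB
  bound_pd i j a z := (h.bound_pd k i j a z).trans hB
  lip i j z z' := (h.lip k i j z z').trans (mul_le_r hB (norm_nonneg _))
  band := h.band k

theorem dS_comm (i j) (a : 𝓢(Sp n, ℂ)) : dS i (dS j a) = dS j (dS i a) := by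
  ext η
  simp [dS_apply]
  ring

theorem continuous_pd {b : ST n → ℝ} (h : ContDiff ℝ ∞ b) (i) :
    Continuous (pd i b) :=
  (h.continuous_fderiv (by simp)).clm_apply continuous_const

theorem BM_pd {b} (h : ContDiff ℝ ∞ b) {i : Λ} {C}
    (hC : ∀ z, |pd i b z| ≤ C) : BM (ℭ (pd i b)) :=
  BM_of_le (continuous_pd h i) hC

section

variable {g : Fin (n + 1) → Fin (n + 1) → ST n → ℝ} {β : Fin (n + 1) → ST n → ℝ} {γ : ST n → ℝ}

def eqA' (g : Λ → Λ → ST n → ℝ) (β : Λ → ST n → ℝ)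
    (a : 𝓢(Sp n, ℂ)) (K : ℕ) (W W1 : L2 n) : L2 n :=
  Mop a K (mulOp (ℭ (pd 0 (β 0))) W + mulOp (ℭ (β 0)) W1)
    - ∑ j : Fin n, (2 * (𝟚 ^ K : ℝ) : ℂ) • Mop (dS j a) K
      (mulOp (ℭ (pd 0 (g 0 j.succ))) W + mulOp (ℭ (g 0 j.succ)) W1)

theorem WD_eqA {k K} {B B'} (hg : Cf g k B) (hl : Lower β γ k B')
    (a) {W W1} (h : WD 0 W W1) :
    WD 0 (eqA g β a K W) (eqA' g β a K W W1) := by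
  refine WD.sub (WD_Mop (h.mulOp hl.smooth (BM_of_le (hl.cont 0) (hl.bound 0))
    (BM_pd hl.smooth hl.bound_pd)) a K) (WD.sum _ fun j _ => WD.smul _ (WD_Mop (h.mulOp
    (hg.smooth 0 j.succ) (BM_of_le (hg.smooth _ _).continuous (hg.bound _ _))
    (BM_pd (hg.smooth _ _) (hg.bound_pd 0 j.succ 0))) (dS j a) K))

def jetE (g : Λ → Λ → ST n → ℝ) (β : Λ → ST n → ℝ)
    (γ : ST n → ℝ) (a : 𝓢(Sp n, ℂ)) (k : ℕ) (W W1 F : L2 n)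
    (i j : Λ) : L2 n :=
  Fin.cases (Fin.cases (eqA' g β a k W W1 - (eqG g β γ a k W - Mop a k F))
      (fun j : Fin n => ((𝟚 ^ k : ℝ) : ℂ) • Mop (dS j a) k W1) j)
    (fun i : Fin n => Fin.cases (((𝟚 ^ k : ℝ) : ℂ) • Mop (dS i a) k W1)
      (fun j : Fin n => ((𝟚 ^ k : ℝ) : ℂ) • ((𝟚 ^ k : ℝ) : ℂ) •
        Mop (dS i (dS j a)) k W) j) i

def jetD (a : 𝓢(Sp n, ℂ)) (k : ℕ) (W W1 : L2 n) (i : Λ) : L2 n :=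
  Fin.cases (Mop a k W1) (fun j : Fin n => ((𝟚 ^ k : ℝ) : ℂ) • Mop (dS j a) k W) i

theorem dS_supp {a} {r} (hs : ∀ η, a η ≠ 0 → 2 * π * ‖η‖ ≤ 2 ^ r)
    (j) (η : Sp n) (h : dS j a η ≠ 0) : 2 * π * ‖η‖ ≤ 2 ^ r := by
  rw [dS_apply] at h
  exact hs η (right_ne_zero_of_mul h)

theorem jet_of_weakEq {a : 𝓢(Sp n, ℂ)}
    (ha : ∀ η, a (-η) = a η) {r : ℕ} (hr : 1 ≤ r)
    (hs : ∀ η, a η ≠ 0 → 2 * π * ‖η‖ ≤ 2 ^ r) {k} {B B'} (hg : Cf g k B)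
    (hl : Lower β γ k B') {V F W1} (hV : WeakEq g β γ V F)
    (hW : WD 0 (Mop (lowS (Sp n) h) (k + r + 1) V) W1) :
    Jet (Mop a k V) (jetD a k (Mop (lowS (Sp n) h) (k + r + 1) V) W1)
      (jetE g β γ a k (Mop (lowS (Sp n) h) (k + r + 1) V) W1 F) := by
  set W := Mop (lowS (Sp n) h) (k + r + 1) V with hWd
  have e0 : Mop a k W = Mop a k V := by
    rw [hWd, Mop_comm, Mop_lowS_Mop h hs (by omega)]
  have eA : eqA g β a k W = eqA g β a k V := by
    simp [eqA, hWd, Mop_mulOp_lowS h hr hs (hl.band 0),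
      fun j => Mop_mulOp_lowS h hr (dS_supp hs j) (hg.band 0 j.succ)]
  have eG : eqG g β γ a k W = eqG g β γ a k V := by
    simp [eqG, hWd, Mop_mulOp_lowS h hr hs hl.band',
      fun j => Mop_mulOp_lowS h hr (dS_supp hs j) (hl.band j.succ),
      fun i j => Mop_mulOp_lowS h hr (dS_supp (dS_supp hs i) j) (hg.band i.succ j.succ)]
  have hd0 : WD 0 (Mop a k W) (Mop a k W1) := WD_Mop hW a k
  refine ⟨fun i => ?_, fun i j => ?_⟩
  · rw [← e0]
    refine Fin.cases hd0 (fun j => ?_) i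
    exact WD_space j a k W
  · refine Fin.cases (Fin.cases ?_ (fun j => ?_) j) (fun i => Fin.cases ?_ (fun j => ?_) j) i
    · intro ψ
      have h1 := hV.time hg.symm hg.time ha k ψ
      rw [← e0, ← eA, ← eG] at h1
      have h2 := hd0 (dd 0 ψ)
      have h3 := WD_eqA (K := k) hg hl a hW ψ
      change bil (Mop a k W1) (tst (dd 0 ψ)) = -bil (eqA' g β a k W W1 - (eqG g β γ a k W - Mop a k F)) (tst ψ)
      rw [map_sub, sub_apply]
      linear_combination h2 + h3 - h1
    · exact WD.smul _ (WD_Mop hW (dS j a) k)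
    · exact WD_space i a k W1
    · exact WD.smul _ (WD_space i (dS j a) k W)

theorem exists_commutator_dS_le (a) : ∃ C : ℝ, 0 ≤ C ∧
    ∀ k (b : ST n → ℝ) (B L), 0 ≤ L → Continuous b → (∀ z, |b z| ≤ B) →
    (∀ z z', |b z - b z'| ≤ L * ‖z - z'‖) → ∀ u,
    (∀ j, ‖Mop (dS j a) k (mulOp (ℭ b) u) -
      mulOp (ℭ b) (Mop (dS j a) k u)‖ ≤ C * L * (𝟚 ^ k)⁻¹ * ‖u‖) ∧
    (∀ i j, ‖Mop (dS i (dS j a)) k (mulOp (ℭ b) u) -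
      mulOp (ℭ b) (Mop (dS i (dS j a)) k u)‖ ≤ C * L * (𝟚 ^ k)⁻¹ * ‖u‖) := by
  choose C1 h1 hC1 using fun j => exists_commutator_le (dS j a)
  choose C2 h2 hC2 using fun i j => exists_commutator_le (dS i (dS j a))
  have s1 : 0 ≤ ∑ j, C1 j := sum_nonneg fun j _ => h1 j
  have s2' (i) : 0 ≤ ∑ j, C2 i j := sum_nonneg fun j _ => h2 i j
  have s2 : 0 ≤ ∑ i, ∑ j, C2 i j := sum_nonneg fun i _ => s2' i
  refine ⟨∑ j, C1 j + ∑ i, ∑ j, C2 i j, ✓, fun k b B L hL hb hB hbL u => ?_⟩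
  have hl : ∀ t (x y), ‖(b (t, x - y) : ℂ) - (b (t, x) : ℂ)‖ ≤ L * ‖y‖ := by
    intro t x y
    rw [← Complex.ofReal_sub, norm_real]
    refine (hbL _ _).trans (le_of_eq ?_)
    congr 1
    simp [Prod.norm_def]
  refine ⟨fun j => ?_, fun i j => ?_⟩
  · refine (hC1 j k _ L hL (BM_of_le hb hB) hl u).trans ?_
    have := single_le_sum (fun j _ => h1 j) (Finset.mem_univ j)
    gcongr
    linarith
  · refine (hC2 i j k _ L hL (BM_of_le hb hB) hl u).trans ?_
    have := single_le_sum (fun i _ => s2' i) (Finset.mem_univ i)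
    have := single_le_sum (fun j _ => h2 i j) (Finset.mem_univ j)
    gcongr
    linarith

theorem Lop_jetE_sub {k} {B} (hg : Cf g k B) (a) (W W1 F) :
    Lop g (jetE g β γ a k W W1 F) - Mop a k F =
      Mop a k (mulOp (ℭ (pd 0 (β 0))) W + mulOp (ℭ (β 0)) W1)
      - ∑ j : Fin n, (2 * (𝟚 ^ k : ℝ) : ℂ) •
        (Mop (dS j a) k (mulOp (ℭ (pd 0 (g 0 j.succ))) W) +
          (Mop (dS j a) k (mulOp (ℭ (g 0 j.succ)) W1) -
            mulOp (ℭ (g 0 j.succ)) (Mop (dS j a) k W1)))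
      - ∑ i : Fin n, ∑ j : Fin n, (((𝟚 ^ k : ℝ) : ℂ) ^ 2) •
        (Mop (dS i (dS j a)) k (mulOp (ℭ (g i.succ j.succ)) W) -
          mulOp (ℭ (g i.succ j.succ)) (Mop (dS i (dS j a)) k W))
      + ∑ j : Fin n, ((𝟚 ^ k : ℝ) : ℂ) •
        Mop (dS j a) k (mulOp (ℭ (β j.succ)) W)
      - Mop a k (mulOp (ℭ γ) W) := by
  have e0 : (ℭ (g 0 0)) = fun _ => 1 := funext fun z => by rw [hg.time]; simp
  rw [Lop, Fin.sum_univ_succ, Fin.sum_univ_succ, e0, mulOp_const, one_smul]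
  simp only [Fin.sum_univ_succ, jetE, Fin.cases_zero, Fin.cases_succ]
  simp only [show ∀ i : Fin n, g i.succ 0 = g 0 i.succ from fun i => funext (hg.symm _ _)]
  rw [eqA', eqG]
  simp only [fun i j => dS_comm j i a, map_add, map_smul, smul_add, smul_sub,
    sum_add_distrib, sum_sub_distrib, smul_smul, ← sq]
  have e2 (x : Fin n → L2 n) : ∑ j, (2 * (𝟚 ^ k : ℝ) : ℂ) • x j =
      ∑ j, ((𝟚 ^ k : ℝ) : ℂ) • x j + ∑ j, ((𝟚 ^ k : ℝ) : ℂ) • x j := by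
    rw [← sum_add_distrib]
    exact sum_congr rfl fun j _ => by rw [← add_smul]; congr 1; ring
  rw [e2 fun j => mulOp (ℭ (g 0 j.succ)) (Mop (dS j a) k W1)]
  abel

end

theorem exists_jet (h : IsLPProfile φ) {a}
    (ha : ∀ η, a (-η) = a η) {r} (hr : 1 ≤ r)
    (hs : ∀ η, a η ≠ 0 → 2 * π * ‖η‖ ≤ 2 ^ r) {B} (hB : 0 ≤ B) :
    ∃ C : ℝ, 0 ≤ C ∧ ∀ (g)
      (β) (γ) (k) (V F : L2 n),
      Cf g k B → Lower β γ k B → WeakEq g β γ V F →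
      ∃ d e, Jet (Mop a k V) d e ∧ (∀ i, ‖d i‖ ≤ C * (2 ^ k * ‖V‖ + (2 ^ k)⁻¹ * ‖F‖)) ∧
        ‖Lop g e - Mop a k F‖ ≤ C * (2 ^ k * ‖V‖ + (2 ^ k)⁻¹ * ‖F‖) := by
  obtain ⟨Ca, hCa, hM⟩ := exists_norm_Mop_dS_le a
  obtain ⟨Cl, hCl0, hCl⟩ := exists_norm_Mop_le (lowS (Sp n) h)
  obtain ⟨Cc, hCc0, hCc⟩ := exists_commutator_dS_le a
  obtain ⟨C1, hC10, hC1⟩ := exists_time_deriv (lowS_even h) hB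
  set E := Cl + C1 * 2 ^ (r + 1) with hE
  have hE0 : 0 ≤ E := ✓
  set D := (Ca + Cc) * B with hD
  have hD0 : 0 ≤ D := ✓
  refine ⟨(Ca + D * (n * n + 5 * n + 3)) * E, by positivity, ?_⟩
  intro g β γ k V F hg hl hV
  set N := 2 ^ k * ‖V‖ + (2 ^ k)⁻¹ * ‖F‖ with hN
  have hN0 : 0 ≤ N := ✓
  obtain ⟨W1, hW, hW1⟩ := hC1 g β γ k (k + r + 1) V F (by omega) hg.symm hg.time
    (fun i j => (hg.smooth i j).continuous) hg.bound hl hV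
  set W := Mop (lowS (Sp n) h) (k + r + 1) V with hWd
  refine ⟨_, _, jet_of_weakEq h ha hr hs hg hl hV hW, ?_⟩
  rw [← hWd]
  have h1 : (1 : ℝ) ≤ 2 ^ k := one_le_pow₀ ✓
  have b1 : ‖W1‖ ≤ C1 * 2 ^ (r + 1) * N := by
    refine hW1.trans ?_
    rw [mul_assoc]
    refine mul_le_l ?_ hC10
    rw [hN, mul_add, ← mul_assoc, ← mul_assoc, ← pow_add, show k + r + 1 = r + 1 + k by ring]
    gcongr
    refine (inv_anti₀ (by positivity) (pow_le_pow_right₀ ✓ ✓)).trans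
      (le_mul_of_one_le_left ✓ (one_le_pow₀ ✓))
  have b2 : 2 ^ k * ‖W‖ ≤ Cl * N := by
    calc 2 ^ k * ‖W‖ ≤ 2 ^ k * (Cl * ‖V‖) := by gcongr; exact hCl _ _
      _ = Cl * (2 ^ k * ‖V‖) := by ring
      _ ≤ Cl * N := by
        refine mul_le_l ?_ hCl0
        rw [hN]
        have : 0 ≤ (𝟚 ^ k)⁻¹ * ‖F‖ := ✓
        linarith
  set M := 2 ^ k * ‖W‖ + ‖W1‖ with hMd
  have hM0 : 0 ≤ M := by positivity
  have bM : M ≤ E * N := by rw [hE, add_mul]; linarith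
  have kW : 2 ^ k * ‖W‖ ≤ M := by rw [hMd]; linarith [norm_nonneg W1]
  have kW1 : ‖W1‖ ≤ M := by rw [hMd]; have := norm_nonneg W; nlinarith
  have kW0 : ‖W‖ ≤ M := (le_mul_of_one_le_left (norm_nonneg _) h1).trans kW
  have nk : ‖((𝟚 ^ k : ℝ) : ℂ)‖ = 2 ^ k := by simp
  have nk2 : ‖(2 * (𝟚 ^ k : ℝ) : ℂ)‖ = 2 * 2 ^ k := by simp
  have hCaB : Ca * B ≤ D := by rw [hD]; nlinarith
  have hCcB : Cc * B ≤ D := by rw [hD]; nlinarith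
  constructor
  · intro i
    have hi : ‖jetD a k W W1 i‖ ≤ Ca * M := by
      refine Fin.cases ?_ (fun j => ?_) i
      · exact ((hM k W1).1).trans (mul_le_l kW1 ✓)
      · change ‖((𝟚 ^ k : ℝ) : ℂ) • Mop (dS j a) k W‖ ≤ _
        rw [norm_smul, nk]
        calc _ ≤ 2 ^ k * (Ca * ‖W‖) := by gcongr; exact (hM k W).2.1 j
          _ = Ca * (2 ^ k * ‖W‖) := by ring
          _ ≤ _ := mul_le_l kW ✓
    refine hi.trans ?_
    calc Ca * M ≤ Ca * (E * N) := mul_le_l bM ✓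
      _ = Ca * E * N := by ring
      _ ≤ _ := by gcongr; nlinarith [show 0 ≤ D * (n * n + 5 * n + 3) by positivity]
  · rw [Lop_jetE_sub hg]
    have t1 : ‖Mop a k (mulOp (ℭ (pd 0 (β 0))) W +
        mulOp (ℭ (β 0)) W1)‖ ≤ D * (2 * M) := by
      refine ((hM k _).1).trans ?_
      calc _ ≤ Ca * (B * 2 ^ k * ‖W‖ + B * ‖W1‖) := by
            refine mul_le_l (norm_add_le_of_le ?_ ?_)
              ✓
            · exact norm_mulOp_real_le (continuous_pd hl.smooth 0) hl.bound_pd W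
            · exact norm_mulOp_real_le (hl.cont 0) (hl.bound 0) W1
        _ = Ca * B * (2 ^ k * ‖W‖ + ‖W1‖) := by ring
        _ ≤ D * (2 * M) := mul_le_mul hCaB ✓ hM0 hD0
    have t2 : ‖∑ j : Fin n, (2 * (𝟚 ^ k : ℝ) : ℂ) •
        (Mop (dS j a) k (mulOp (ℭ (pd 0 (g 0 j.succ))) W) +
          (Mop (dS j a) k (mulOp (ℭ (g 0 j.succ)) W1) -
            mulOp (ℭ (g 0 j.succ)) (Mop (dS j a) k W1)))‖ ≤ n * (4 * (D * M)) := by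
      refine (norm_sum_le_card (c := 4 * (D * M)) fun j => ?_).trans (by simp)
      rw [norm_smul, nk2]
      have q1 : ‖Mop (dS j a) k (mulOp (ℭ (pd 0 (g 0 j.succ))) W)‖ ≤
          Ca * (B * ‖W‖) := ((hM k _).2.1 j).trans (mul_le_l
            (norm_mulOp_real_le (continuous_pd (hg.smooth _ _) 0) (hg.bound_pd _ _ _) W)
            ✓)
      have q2 := (hCc k (g 0 j.succ) B B hB (hg.smooth _ _).continuous (hg.bound _ _)
        (hg.lip _ _) W1).1 j
      calc _ ≤ 2 * 2 ^ k * (Ca * (B * ‖W‖) + Cc * B * (2 ^ k)⁻¹ * ‖W1‖) :=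
            mul_le_l (norm_add_le_of_le q1 q2) ✓
        _ = 2 * (Ca * B * (2 ^ k * ‖W‖) + Cc * B * ‖W1‖) := by field_simp
        _ ≤ 2 * (D * M + D * M) := by gcongr
        _ = _ := by ring
    have t3 : ‖∑ i : Fin n, ∑ j : Fin n, (((𝟚 ^ k : ℝ) : ℂ) ^ 2) •
        (Mop (dS i (dS j a)) k (mulOp (ℭ (g i.succ j.succ)) W) -
          mulOp (ℭ (g i.succ j.succ)) (Mop (dS i (dS j a)) k W))‖ ≤
          n * (n * (D * M)) := by
      refine (norm_sum_le_card (c := n * (D * M)) fun i => ?_).trans (by simp)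
      refine (norm_sum_le_card (c := D * M) fun j => ?_).trans (by simp)
      rw [norm_smul, norm_pow, nk]
      have q2 := (hCc k (g i.succ j.succ) B B hB (hg.smooth _ _).continuous (hg.bound _ _)
        (hg.lip _ _) W).2 i j
      calc _ ≤ (2 ^ k) ^ 2 * (Cc * B * (2 ^ k)⁻¹ * ‖W‖) :=
            mul_le_l q2 ✓
        _ = Cc * B * (2 ^ k * ‖W‖) := by field_simp
        _ ≤ D * M := mul_le_mul hCcB kW ✓ hD0
    have t4 : ‖∑ j : Fin n, ((𝟚 ^ k : ℝ) : ℂ) •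
        Mop (dS j a) k (mulOp (ℭ (β j.succ)) W)‖ ≤ n * (D * M) := by
      refine (norm_sum_le_card (c := D * M) fun j => ?_).trans (by simp)
      rw [norm_smul, nk]
      calc _ ≤ 2 ^ k * (Ca * (B * ‖W‖)) := mul_le_l (((hM k _).2.1 j).trans
            (mul_le_l (norm_mulOp_real_le (hl.cont _) (hl.bound _) W)
            ✓)) ✓
        _ = Ca * B * (2 ^ k * ‖W‖) := by ring
        _ ≤ D * M := mul_le_mul hCaB kW ✓ hD0
    have t5 : ‖Mop a k (mulOp (ℭ γ) W)‖ ≤ D * M := by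
      calc _ ≤ Ca * (B * 2 ^ k * ‖W‖) := ((hM k _).1).trans
            (mul_le_l (norm_mulOp_real_le hl.cont' hl.bound' W) ✓)
        _ = Ca * B * (2 ^ k * ‖W‖) := by ring
        _ ≤ D * M := mul_le_mul hCaB kW ✓ hD0
    have t6 : ‖_‖ ≤ _ := norm_sub_le_of_le (norm_add_le_of_le (norm_sub_le_of_le ((norm_sub_le _ _).trans
        (add_le_add t1 t2)) t3) t4) t5
    refine t6.trans ?_
    calc _ = D * (n * n + 5 * n + 3) * M := by ring
      _ ≤ D * (n * n + 5 * n + 3) * (E * N) := by gcongr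
      _ = D * (n * n + 5 * n + 3) * E * N := by ring
      _ ≤ _ := by gcongr; linarith

theorem mulOp_refl {Θ : ST n → ℂ} (h : BM Θ) (h' : BM fun z => Θ (z.1, -z.2)) (u : L2 n) :
    mulOp Θ (refl u) = refl (mulOp (fun z => Θ (z.1, -z.2)) u) := by
  refine Lp.ext ?_
  filter_upwards [coeFn_mulOp h (refl u), coeFn_refl u, coeFn_refl (mulOp (fun z => Θ (z.1, -z.2)) u),
    mp_neg.quasiMeasurePreserving.ae (coeFn_mulOp h' u)] with z h1 h2 h3 h4
  rw [h1, h2, h3, h4]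
  simp

theorem cj_Mult {m : Sp n → ℂ} (h : BMs m) (u : L2 n) :
    cj (Mult m u) = Mult (fun η => starRingEnd ℂ (m (-η))) (cj u) := by
  have hb : BM fun z : ST n => starRingEnd ℂ (m (-z.2)) := BM.conj h.neg_arg.bm
  have e1 : U0 (cj u) = refl (U1 (cj u)) := U0_eq_refl _
  have e2 (Y : L2 n) : U1 (refl Y) = U0 Y := by
    rw [U1_eq_refl, U0_refl, ← U0_eq_refl]
  have e3 := mulOp_refl (Θ := fun z => starRingEnd ℂ (m z.2)) (BM.conj h.bm) hb (U1 (cj u))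
  rw [Mult_apply, cj_U0, cj_mulOp h.bm, cj_U1, e1, e3, e2, Mult_apply]

theorem cj_Mop_lowS (K : ℕ) (u : L2 n) :
    cj (Mop (lowS (Sp n) h) K u) = Mop (lowS (Sp n) h) K (cj u) := by
  rw [Mop, cj_Mult (BMs_scs _ _)]
  congr 2
  funext η
  rw [scs_lowS, scs_lowS, norm_neg, conj_ofReal]

theorem Jet.loc {K : ℕ} {v : L2 n} {d : Λ → L2 n}
    {e : Λ → Λ → L2 n} (hj : Jet v d e)
    (hv : Mop (lowS (Sp n) h) K v = v) (i : Λ) : Mop (lowS (Sp n) h) K (d i) = d i := by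
  have := WD_Mop (hj.first i) (lowS (Sp n) h) K
  rw [hv] at this
  exact this.unique (hj.first i)

theorem Jet.comm {v : L2 n} {d : Λ → L2 n} {e : Λ → Λ → L2 n}
    (hj : Jet v d e) (i j : Λ) : e i j = e j i := by
  refine eq_of_bil_tst fun ψ => ?_
  have h1 := hj.second i j ψ
  have h2 := hj.first j (dd i ψ)
  have h3 := hj.second j i ψ
  have h4 := hj.first i (dd j ψ)
  rw [dd_comm] at h2
  linear_combination h1 - h3 - h2 + h4

theorem mulOp_zero_fun (u : L2 n) : mulOp (fun _ => (0 : ℂ)) u = 0 := by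
  rw [mulOp_const, zero_smul]

theorem green {K : ℕ} {i : Λ} {a : ℝ → ℝ}
    (ha : ContDiff ℝ ∞ a) {r : ℝ} (hr0 : 0 ≤ r) (hr1 : r < 1) (hr : ∀ t, a t ≠ 0 → |t| ≤ r)
    {W W' z z' : L2 n} (hW : WD i W W') (hz : WD i z z')
    (hloc : Mop (lowS (Sp n) h) K z = z) :
    bil (mulOp (fun z => ((if i = 0 then deriv a z.1 else 0 : ℝ) : ℂ)) W) z
      + bil (mulOp (ℭₜ a) W') z + bil (mulOp (ℭₜ a) W) z' = 0 := by
  revert hW hz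
  refine Fin.cases (fun hW hz => ?_) (fun j hW hz => ?_) i
  · simpa using green_time ha hr0 hr1 hr hW hz
  · have e0 : (fun z : ST n => ((if j.succ = 0 then deriv a z.1 else 0 : ℝ) : ℂ)) = fun _ => 0 := by
      funext z; simp [Fin.succ_ne_zero]
    have hb := BM_time (n := n) ha.continuous hr
    have e1 : (fun z : ST n => ((pd j.succ (fun z : ST n => a z.1) z : ℝ) : ℂ)) = fun _ => 0 := by
      funext z; rw [pd_space_time ha, ofReal_zero]
    have hW2 := hW.mulOp (contDiff_time ha) hb (by rw [e1]; exact BM.const 0)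
    rw [e1, mulOp_zero_fun, zero_add] at hW2
    rw [e0, mulOp_zero_fun, map_zero, zero_apply, zero_add]
    have ev := lowS_even (n := n) h
    have h1 : WD j.succ z (((𝟚 ^ K : ℝ) : ℂ) • Mop (dS j (lowS (Sp n) h)) K z) := by
      have := WD_space j (lowS (Sp n) h) K z
      rwa [hloc] at this
    have h2 := hz.unique h1
    have h3 : ∀ X : L2 n, bil (Mop (dS j (lowS (Sp n) h)) K X) z =
        - bil X (Mop (dS j (lowS (Sp n) h)) K z) := by
      intro X
      rw [Mop, bil_Mult (BMs_scs _ _), ← map_neg, ← neg_one_smul ℂ (Mult _ z),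
        ← Mult_const_mul (BMs_scs _ _)]
      congr 3
      funext η
      rw [scs, scs, smul_neg, dS_apply, dS_apply, ev]
      simp
    rw [← hloc, ← bil_Mop_even ev, Mop_deriv hW2, h2, map_smul, map_smul, smul_apply, h3]
    simp

theorem pd_mul {f g : ST n → ℝ} (hf : ContDiff ℝ ∞ f) (hg : ContDiff ℝ ∞ g) (i : Λ)
    (z : ST n) : pd i (fun z => f z * g z) z = pd i f z * g z + f z * pd i g z := by
  have := fderiv_fun_mul ((hf.differentiable (by simp)) z) ((hg.differentiable (by simp)) z)
  rw [pd, this]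
  simp [pd]
  ring

theorem pd_add {f g : ST n → ℝ} (hf : ContDiff ℝ ∞ f) (hg : ContDiff ℝ ∞ g) (i : Λ)
    (z : ST n) : pd i (fun z => f z + g z) z = pd i f z + pd i g z := by
  have := fderiv_fun_add ((hf.differentiable (by simp)) z) ((hg.differentiable (by simp)) z)
  rw [pd, this]
  simp [pd]

theorem pd_sub {f g : ST n → ℝ} (hf : ContDiff ℝ ∞ f) (hg : ContDiff ℝ ∞ g) (i : Λ)
    (z : ST n) : pd i (fun z => f z - g z) z = pd i f z - pd i g z := by
  have := fderiv_fun_sub ((hf.differentiable (by simp)) z) ((hg.differentiable (by simp)) z)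
  rw [pd, this]
  simp [pd]

def cE (g : Λ → Λ → ST n → ℝ) (i α β : Λ) (z : ST n) : ℝ :=
  g i α z * g 0 β z + g i β z * g 0 α z - g 0 i z * g α β z

theorem abs_mul_le' {x y b : ℝ} (hx : |x| ≤ b) (hy : |y| ≤ b) : |x * y| ≤ b * b := by
  rw [abs_mul]
  exact mul_le_mul hx hy (abs_nonneg _) ((abs_nonneg _).trans hx)

section cE

variable {g : Fin (n + 1) → Fin (n + 1) → ST n → ℝ} {k : ℕ} {B : ℝ} (hg : Cf g k B)
include hg

theorem Cf.nonneg : 0 ≤ B := (abs_nonneg _).trans (hg.bound 0 0 0)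

theorem contDiff_cE (i α β : Λ) : ContDiff ℝ ∞ (cE g i α β) :=
  (((hg.smooth _ _).mul (hg.smooth _ _)).add ((hg.smooth _ _).mul (hg.smooth _ _))).sub
    ((hg.smooth _ _).mul (hg.smooth _ _))

theorem abs_cE_le (i α β : Λ) (z : ST n) : |cE g i α β z| ≤ 3 * (B * B) := by
  have h1 := abs_mul_le' (hg.bound i α z) (hg.bound 0 β z)
  have h2 := abs_mul_le' (hg.bound i β z) (hg.bound 0 α z)
  have h3 := abs_mul_le' (hg.bound 0 i z) (hg.bound α β z)
  rw [cE]
  refine (abs_sub _ _).trans ((add_le_add ((abs_add_le _ _).trans (add_le_add h1 h2)) h3).trans ?_)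
  linarith

theorem abs_pd_cE_le (j i α β : Λ) (z : ST n) :
    |pd j (cE g i α β) z| ≤ 6 * (B * B) := by
  have s (i j) := hg.smooth i j
  have key (i j i' j' : Λ) (l : Λ) :
      |pd l (fun z => g i j z * g i' j' z) z| ≤ 2 * (B * B) := by
    rw [pd_mul (s _ _) (s _ _)]
    refine (abs_add_le _ _).trans ((add_le_add (abs_mul_le' (hg.bound_pd _ _ _ _)
      (hg.bound _ _ _)) (abs_mul_le' (hg.bound _ _ _) (hg.bound_pd _ _ _ _))).trans ?_)
    linarith
  have e : cE g i α β = fun z => (g i α z * g 0 β z + g i β z * g 0 α z) - g 0 i z * g α β z := rfl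
  rw [e, pd_sub (((s _ _).mul (s _ _)).add ((s _ _).mul (s _ _))) ((s _ _).mul (s _ _)),
    pd_add ((s _ _).mul (s _ _)) ((s _ _).mul (s _ _))]
  refine (abs_sub _ _).trans ((add_le_add ((abs_add_le _ _).trans (add_le_add (key _ _ _ _ _)
    (key _ _ _ _ _))) (key _ _ _ _ _)).trans ?_)
  linarith

end cE

def tri (a : ℝ → ℝ) (b : ST n → ℝ) (u w : L2 n) : ℂ :=
  bil (mulOp (ℭₜ a) (mulOp (ℭ b) u)) w

theorem norm_tri_le {a : ℝ → ℝ} (ha : Continuous a) {A : ℝ} (hA : ∀ t, |a t| ≤ A) {b : ST n → ℝ}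
    (hb : Continuous b) {B : ℝ} (hB : ∀ z, |b z| ≤ B) (u w : L2 n) :
    ‖tri a b u w‖ ≤ A * (B * (‖u‖ * ‖w‖)) := by
  have hA0 : 0 ≤ A := (abs_nonneg _).trans (hA 0)
  refine (norm_bil_le _ _).trans ?_
  have h1 := norm_mulOp_real_le (b := fun z : ST n => a z.1) (ha.comp continuous_fst)
    (fun z => hA z.1) (mulOp (ℭ b) u)
  have h2 := norm_mulOp_real_le hb hB u
  calc _ ≤ A * (B * ‖u‖) * ‖w‖ := mul_le_r
        (h1.trans (mul_le_l h2 hA0)) (norm_nonneg _)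
    _ = _ := by ring

theorem tri_cE {g : Λ → Λ → ST n → ℝ} {k : ℕ} {B : ℝ} (hg : Cf g k B)
    (a : ℝ → ℝ) (i α β : Λ) (u w : L2 n) :
    tri a (cE g i α β) u w = tri a (fun z => g i α z * g 0 β z) u w
      + tri a (fun z => g i β z * g 0 α z) u w - tri a (fun z => g 0 i z * g α β z) u w := by
  have hb (i j i' j') : BM fun z => ((g i j z * g i' j' z : ℝ) : ℂ) :=
    BM_of_le ((hg.smooth i j).continuous.mul (hg.smooth i' j').continuous)
      fun z => abs_mul_le' (hg.bound _ _ _) (hg.bound _ _ _)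
  have e : (ℭ (cE g i α β)) = fun z => (((g i α z * g 0 β z : ℝ) : ℂ) +
      ((g i β z * g 0 α z : ℝ) : ℂ)) - ((g 0 i z * g α β z : ℝ) : ℂ) := by
    funext z; rw [cE]; push_cast; ring
  simp only [tri, e]
  rw [mulOp_sub ((hb _ _ _ _).add (hb _ _ _ _)) (hb _ _ _ _), mulOp_add (hb _ _ _ _) (hb _ _ _ _)]
  simp

theorem sum_cE {g : Λ → Λ → ST n → ℝ} {k : ℕ} {B : ℝ} (hg : Cf g k B)
    {a : ℝ → ℝ} (ha : BM (ℭₜ a)) {v : L2 n} {d : Λ → L2 n}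
    {e : Λ → Λ → L2 n} (hj : Jet v d e) :
    ∑ i, ∑ α, ∑ β, (tri a (cE g i α β) (e i α) (cj (d β)) +
      tri a (cE g i α β) (d α) (cj (e i β))) =
    bil (mulOp (ℭₜ a) (Lop g e)) (cj (∑ β, mulOp (ℭ (g 0 β)) (d β))) +
    bil (mulOp (ℭₜ a) (∑ β, mulOp (ℭ (g 0 β)) (d β)))
      (cj (Lop g e)) := by
  have hgb (i j) : BM (ℭ (g i j)) := BM_of_le (hg.smooth i j).continuous (hg.bound i j)
  have hsym (i j) : g i j = g j i := funext (hg.symm i j)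
  have cjs (ι : Type) (s : Finset ι) (f : ι → L2 n) : cj (∑ x ∈ s, f x) = ∑ x ∈ s, cj (f x) := by
    classical
    induction s using Finset.induction_on with
    | empty => simpa using cj_smul (0 : ℂ) (0 : L2 n)
    | insert x s hx ih => rw [sum_insert hx, sum_insert hx, cj_add, ih]
  have hcg (i j) (u : L2 n) : cj (mulOp (ℭ (g i j)) u) =
      mulOp (ℭ (g i j)) (cj u) := by
    rw [cj_mulOp (hgb i j)]; simp only [conj_ofReal]
  have htri (i j i' j') (u w : L2 n) : bil (mulOp (ℭₜ a)
      (mulOp (ℭ (g i j)) u)) (mulOp (ℭ (g i' j')) w) =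
      tri a (fun z => g i j z * g i' j' z) u w := by
    rw [← bil_mulOp (hgb i' j'), mulOp_comm (hgb i' j') ha, mulOp_mulOp (hgb i' j') (hgb i j), tri]
    congr 5
    funext z
    push_cast
    ring
  have h1 : bil (mulOp (ℭₜ a) (Lop g e))
      (cj (∑ β, mulOp (ℭ (g 0 β)) (d β))) =
      ∑ i, ∑ α, ∑ β, tri a (fun z => g i α z * g 0 β z) (e i α) (cj (d β)) := by
    simp only [Lop, cjs, hcg, map_sum, sum_apply, htri]
    rw [sum_comm]
    refine sum_congr rfl fun i _ => ?_
    rw [sum_comm]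
  have h2 : bil (mulOp (ℭₜ a) (∑ β, mulOp (ℭ (g 0 β)) (d β)))
      (cj (Lop g e)) =
      ∑ i, ∑ α, ∑ β, tri a (fun z => g i β z * g 0 α z) (d α) (cj (e i β)) := by
    simp only [Lop, cjs, hcg, map_sum, sum_apply, htri]
    refine sum_congr rfl fun i _ => ?_
    rw [sum_comm]
    refine sum_congr rfl fun α _ => sum_congr rfl fun β _ => ?_
    simp only [mul_comm]
  have h3 : ∑ i, ∑ α, ∑ β, tri a (fun z => g i β z * g 0 α z) (e i α) (cj (d β)) =
      ∑ i, ∑ α, ∑ β, tri a (fun z => g 0 i z * g α β z) (e i α) (cj (d β)) := by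
    rw [sum_comm]
    refine sum_congr rfl fun i _ => sum_congr rfl fun α _ =>
      sum_congr rfl fun β _ => ?_
    rw [hj.comm]
    simp only [mul_comm]
  have h4 : ∑ i, ∑ α, ∑ β, tri a (fun z => g i α z * g 0 β z) (d α) (cj (e i β)) =
      ∑ i, ∑ α, ∑ β, tri a (fun z => g 0 i z * g α β z) (d α) (cj (e i β)) := by
    calc _ = ∑ α, ∑ i, ∑ β, tri a (fun z => g i α z * g 0 β z) (d α) (cj (e i β)) :=
          sum_comm
      _ = ∑ α, ∑ β, ∑ i, tri a (fun z => g i α z * g 0 β z) (d α) (cj (e i β)) :=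
          sum_congr rfl fun α _ => sum_comm
      _ = ∑ α, ∑ β, ∑ i, tri a (fun z => g 0 β z * g α i z) (d α) (cj (e β i)) := by
          refine sum_congr rfl fun α _ => sum_congr rfl fun β _ =>
            sum_congr rfl fun i _ => ?_
          rw [hj.comm, hsym i α]
          simp only [mul_comm]
      _ = _ := sum_comm
  rw [h1, h2]
  simp only [tri_cE hg, sum_add_distrib, sum_sub_distrib]
  rw [h3, h4]
  ring

theorem energy_identity {K : ℕ}
    {g : Λ → Λ → ST n → ℝ} {k : ℕ} {B : ℝ} (hg : Cf g k B)
    {a : ℝ → ℝ} (ha : ContDiff ℝ ∞ a) {r : ℝ} (hr0 : 0 ≤ r) (hr1 : r < 1)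
    (hr : ∀ t, a t ≠ 0 → |t| ≤ r) {v : L2 n} {d : Λ → L2 n}
    {e : Λ → Λ → L2 n} (hj : Jet v d e)
    (hv : Mop (lowS (Sp n) h) K v = v) :
    ∑ α, ∑ β, tri (deriv a) (cE g 0 α β) (d α) (cj (d β)) =
      -(∑ i, ∑ α, ∑ β, tri a (pd i (cE g i α β)) (d α) (cj (d β))) -
      (bil (mulOp (ℭₜ a) (Lop g e))
        (cj (∑ β, mulOp (ℭ (g 0 β)) (d β))) +
      bil (mulOp (ℭₜ a) (∑ β, mulOp (ℭ (g 0 β)) (d β)))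
        (cj (Lop g e))) := by
  have hab := BM_time (n := n) ha.continuous hr
  have key (i α β) := green h (K := K) (i := i) ha hr0 hr1 hr
    ((hj.second i α).mulOp (contDiff_cE hg i α β) (BM_of_le (contDiff_cE hg i α β).continuous
      (abs_cE_le hg i α β)) (BM_pd (contDiff_cE hg i α β) (abs_pd_cE_le hg i i α β)))
    (hj.second i β).cj (by rw [← cj_Mop_lowS, hj.loc h hv])
  have hsum : ∑ i, ∑ α, ∑ β, (bil (mulOp (fun z => ((if i = 0 then deriv a z.1 else 0 : ℝ) : ℂ))
      (mulOp (ℭ (cE g i α β)) (d α))) (cj (d β)) +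
      tri a (pd i (cE g i α β)) (d α) (cj (d β)) + (tri a (cE g i α β) (e i α) (cj (d β)) +
      tri a (cE g i α β) (d α) (cj (e i β)))) = 0 := by
    refine sum_eq_zero fun i _ => sum_eq_zero fun α _ => sum_eq_zero
      fun β _ => ?_
    have := key i α β
    rw [map_add, map_add, add_apply] at this
    simp only [tri]
    linear_combination this
  simp only [sum_add_distrib] at hsum
  have h0 := sum_cE hg hab hj
  simp only [sum_add_distrib] at h0
  have h1 : ∑ i, ∑ α, ∑ β, bil (mulOp (fun z => ((if i = 0 then deriv a z.1 else 0 : ℝ) : ℂ))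
      (mulOp (ℭ (cE g i α β)) (d α))) (cj (d β)) =
      ∑ α, ∑ β, tri (deriv a) (cE g 0 α β) (d α) (cj (d β)) := by
    rw [Fin.sum_univ_succ]
    simp only [Fin.succ_ne_zero, if_false, ofReal_zero, mulOp_zero_fun, map_zero,
      zero_apply, Finset.sum_const_zero, add_zero, if_true]
    rfl
  rw [h1] at hsum
  linear_combination hsum - h0

def tm (u : L2 n) : Measure ℝ :=
  ((ϖ).withDensity fun z => ‖u z‖ₑ ^ 2).map Prod.fst

theorem measurable_enorm_sq (u : L2 n) : Measurable fun z => ‖u z‖ₑ ^ 2 :=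
  (Lp.stronglyMeasurable u).measurable.enorm.pow_const 2

theorem lintegral_tm (u : L2 n) {w : ℝ → ℝ≥0∞} (hw : Measurable w) :
    ∫⁻ t, w t ∂(tm u) = ∫⁻ z, w z.1 * ‖u z‖ₑ ^ 2 ∂ϖ := by
  rw [tm, lintegral_map hw measurable_fst]
  refine (lintegral_withDensity_eq_lintegral_mul _ (measurable_enorm_sq u)
    (hw.comp measurable_fst)).trans (lintegral_congr fun z => ?_)
  simp [mul_comm]

theorem lintegral_enorm_sq (u : L2 n) : ∫⁻ z, ‖u z‖ₑ ^ 2 ∂ϖ = ‖u‖ₑ ^ 2 := by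
  have h := Lp.enorm_def u
  rw [eLpNorm_eq_lintegral_rpow_enorm_toReal two_ne_zero ENNReal.ofNat_ne_top] at h
  rw [h, ← ENNReal.rpow_natCast, ← ENNReal.rpow_mul]
  norm_num

theorem tm_univ (u : L2 n) : tm u univ = ‖u‖ₑ ^ 2 := by
  have := lintegral_tm u (w := fun _ => 1) measurable_const
  rw [lintegral_one] at this
  rw [this, ← lintegral_enorm_sq]
  simp

instance (u : L2 n) : IsFiniteMeasure (tm u) :=
  ⟨by rw [tm_univ]; exact ENNReal.pow_lt_top enorm_lt_top⟩

theorem tm_compl (u : L2 n) : tm u (Ioo (-1) 1)ᶜ = 0 := by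
  rw [tm, Measure.map_apply measurable_fst measurableSet_Ioo.compl]
  refine withDensity_absolutelyContinuous _ _ ?_
  change (volume.restrict (slab n : Set (ST n))) _ = 0
  rw [Measure.restrict_apply (measurable_fst measurableSet_Ioo.compl)]
  convert measure_empty (μ := (volume : Measure (ST n)))
  ext z
  simp [slab]

theorem measure_le_of_smooth {μ : Measure ℝ} [IsFiniteMeasure μ] (hμ : μ (Ioo (-1) 1)ᶜ = 0)
    {M : ℝ≥0∞} (hM : M ≠ ⊤) (h : ∀ ρ : ℝ → ℝ, ContDiff ℝ ∞ ρ → (∀ t, 0 ≤ ρ t) → ∀ r, 0 ≤ r → r < 1 →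
      (∀ t, ρ t ≠ 0 → |t| ≤ r) → ∫⁻ t, ofReal (ρ t) ∂μ ≤ M * ∫⁻ t, ofReal (ρ t)) :
    μ ≤ M • volume := by
  have step1 (K U : Set ℝ) (hK : IsCompact K) (hU : IsOpen U) (hKU : K ⊆ U)
      (hU1 : U ⊆ Ioo (-1) 1) : μ K ≤ M * volume U := by
    obtain ⟨T, hT, hKT, hTU⟩ := exists_compact_between hK hU hKU
    obtain ⟨f, h1, h0, h01⟩ := exists_contMDiffMap_one_nhds_of_subset_interior (n := ⊤)
      (modelWithCornersSelf ℝ ℝ) hK.isClosed hKT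
    obtain ⟨r, hr0, hr1, hr⟩ : ∃ r, 0 ≤ r ∧ r < 1 ∧ ∀ t ∈ T, |t| ≤ r := by
      rcases T.eq_empty_or_nonempty with rfl | hne
      · exact ⟨0, le_rfl, one_pos, by simp⟩
      · obtain ⟨x, hx, hmax⟩ := hT.exists_isMaxOn hne (continuous_abs.continuousOn (s := T))
        exact ⟨|x|, abs_nonneg _, abs_lt.2 (hU1 (hTU hx)), hmax⟩
    have hf := h f f.contMDiff.contDiff (fun t => (h01 t).1) r hr0 hr1 fun t ht =>
      hr t (not_imp_comm.1 (h0 t) ht)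
    calc μ K = ∫⁻ t, K.indicator 1 t ∂μ := by rw [lintegral_indicator_one hK.measurableSet]
      _ ≤ ∫⁻ t, ofReal (f t) ∂μ := by
        refine lintegral_mono fun t => ?_
        by_cases ht : t ∈ K
        · rw [indicator_of_mem ht, h1.self_of_nhdsSet t ht]; simp
        · rw [indicator_of_notMem ht]; exact zero_le
      _ ≤ M * ∫⁻ t, ofReal (f t) := hf
      _ ≤ M * ∫⁻ t, U.indicator 1 t := by
        refine mul_le_mul_right (lintegral_mono fun t => ?_) _
        by_cases ht : t ∈ U
        · rw [indicator_of_mem ht]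
          simpa using (h01 t).2
        · rw [h0 t fun hc => ht (hTU hc)]; simp
      _ = M * volume U := by rw [lintegral_indicator_one hU.measurableSet]
  have step2 (K : Set ℝ) (hK : IsCompact K) (hK1 : K ⊆ Ioo (-1) 1) : μ K ≤ M * volume K := by
    refine ENNReal.le_mul_of_forall_lt (.inr hK.measure_lt_top.ne) (.inl hM) fun a ha b hb => ?_
    obtain ⟨U, hKU, hU, hUb⟩ := K.exists_isOpen_lt_of_lt b hb
    exact (step1 K (U ∩ Ioo (-1) 1) hK (hU.inter isOpen_Ioo) (subset_inter hKU hK1)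
      inter_subset_right).trans (mul_le_mul' ha.le ((measure_mono inter_subset_left).trans hUb.le))
  refine Measure.le_iff.2 fun A hA => ?_
  have e : μ A ≤ μ (A ∩ Ioo (-1) 1) := (measure_le_inter_add_diff μ A _).trans
    (by rw [measure_mono_null (diff_subset_compl A (Ioo (-1) 1)) hμ, add_zero])
  refine e.trans ?_
  rw [(hA.inter measurableSet_Ioo).measure_eq_iSup_isCompact_of_ne_top (measure_ne_top _ _)]
  refine iSup₂_le fun K hK => iSup_le fun hKc => (step2 K hKc (hK.trans inter_subset_right)).trans ?_
  rw [Measure.smul_apply, smul_eq_mul]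
  exact mul_le_mul_right (measure_mono (hK.trans inter_subset_left)) _

theorem integrable_of_support {b : ℝ → ℝ} (hb : Continuous b) {r : ℝ} (hr : ∀ t, b t ≠ 0 → |t| ≤ r) :
    Integrable b :=
  hb.integrable_of_hasCompactSupport (HasCompactSupport.intro (isCompact_Icc (a := -r) (b := r))
    fun t ht => not_imp_comm.1 (fun hc => abs_le.1 (hr t hc)) ht)

theorem exists_primitive {b : ℝ → ℝ} (hb : ContDiff ℝ ∞ b) {r : ℝ} (hr : ∀ t, b t ≠ 0 → |t| ≤ r)
    (h0 : ∫ t, b t = 0) {A : ℝ} (hA : ∫ t, |b t| ≤ A) :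
    ∃ a : ℝ → ℝ, ContDiff ℝ ∞ a ∧ deriv a = b ∧ (∀ t, a t ≠ 0 → |t| ≤ r) ∧ ∀ t, |a t| ≤ A := by
  have hbi : Integrable b := integrable_of_support hb.continuous hr
  set a : ℝ → ℝ := fun t => ∫ s in Iic t, b s with ha
  have hd (t : ℝ) : HasDerivAt a (b t) t := by
    have e : a = fun t => (∫ s in (0 : ℝ)..t, b s) + ∫ s in Iic 0, b s := by
      funext t
      rw [ha, ← intervalIntegral.integral_Iic_sub_Iic hbi.integrableOn hbi.integrableOn]
      ring
    rw [e]
    exact (intervalIntegral.integral_hasDerivAt_right (hb.continuous.intervalIntegrable _ _)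
      hb.continuous.stronglyMeasurable.stronglyMeasurableAtFilter
      hb.continuous.continuousAt).add_const _
  have hda : deriv a = b := funext fun t => (hd t).deriv
  refine ⟨a, ?_, hda, fun t ht => ?_, fun t => ?_⟩
  · rw [contDiff_infty_iff_deriv, hda]
    exact ⟨fun t => (hd t).differentiableAt, hb⟩
  · by_contra! hc
    refine ht ?_
    rcases lt_abs.1 hc with h1 | h1
    · rw [ha]
      simp only
      rw [setIntegral_eq_integral_of_forall_compl_eq_zero fun s hs => ?_, h0]
      by_contra hne
      have := (abs_le.1 (hr s hne)).2
      exact hs (by simp; linarith)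
    · refine setIntegral_eq_zero_of_forall_eq_zero fun s hs => ?_
      by_contra hne
      have := (abs_le.1 (hr s hne)).1
      simp at hs
      linarith
  · refine (norm_integral_le_integral_norm b).trans (le_trans ?_ hA)
    exact setIntegral_le_integral hbi.norm (.of_forall fun t => norm_nonneg (b t))

theorem exists_eta : ∃ (η : ℝ → ℝ) (C : ℝ), ContDiff ℝ ∞ η ∧ (∀ t, 0 ≤ η t) ∧
    (∀ t, η t ≠ 0 → |t| ≤ 1 / 2) ∧ ∫ t, η t = 1 ∧ ∀ t, |η t| ≤ C := by
  let f : ContDiffBump (0 : ℝ) := ⟨1 / 4, 1 / 2, by norm_num, by norm_num⟩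
  obtain ⟨C, hC⟩ := (f.hasCompactSupport_normed (μ := volume)).exists_bound_of_continuous
    f.continuous_normed
  refine ⟨f.normed volume, C, f.contDiff_normed, fun t => f.nonneg_normed t, fun t ht => ?_,
    f.integral_normed, hC⟩
  have : t ∈ Function.support (f.normed volume) := ht
  rw [f.support_normed_eq, Metric.mem_ball, dist_zero_right] at this
  exact this.le

abbrev Hyp (g : Λ → Λ → ST n → ℝ) (c : ℝ) (z : ST n) : Prop := ∀ ξ : Sp n,
  c * ‖ξ‖ ^ 2 ≤ (∑ j : Fin n, g 0 j.succ z * ξ j) ^ 2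
    - ∑ i : Fin n, ∑ j : Fin n, g i.succ j.succ z * ξ i * ξ j

theorem cE_coercive {g : Λ → Λ → ST n → ℝ} {k : ℕ} {B c : ℝ} (hg : Cf g k B)
    (hc : 0 < c) (z : ST n)
    (hyp : Hyp g c z) (x : Λ → ℝ) :
    ∑ i, x i ^ 2 ≤ (2 + (2 * n * B ^ 2 + 1) / c) *
      ∑ α, ∑ β, cE g 0 α β z * (x α * x β) := by
  set y := ∑ j : Fin n, g 0 j.succ z * x j.succ with hy
  set S := ∑ i : Fin n, ∑ j : Fin n, g i.succ j.succ z * x i.succ * x j.succ with hS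
  set X := ∑ j : Fin n, x j.succ ^ 2 with hX
  have h1 : ∑ α, ∑ β, cE g 0 α β z * (x α * x β) = (x 0 + y) ^ 2 + (y ^ 2 - S) := by
    have e1 : ∑ α, ∑ β, (g 0 α z * x α) * (g 0 β z * x β) = (x 0 + y) ^ 2 := by
      rw [← Finset.sum_mul_sum, Fin.sum_univ_succ, hg.time, ← hy]
      ring
    have e2 : ∑ α, ∑ β, g α β z * x α * x β = x 0 ^ 2 + 2 * (x 0 * y) + S := by
      rw [Fin.sum_univ_succ, Fin.sum_univ_succ, hg.time]
      simp only [Fin.sum_univ_succ (n := n), sum_add_distrib, ← hS]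
      have e3 : ∑ j : Fin n, g 0 j.succ z * x 0 * x j.succ = x 0 * y := by
        rw [hy, mul_sum]
        exact sum_congr rfl fun j _ => by ring
      have e4 : ∑ j : Fin n, g j.succ 0 z * x j.succ * x 0 = x 0 * y := by
        rw [hy, mul_sum]
        exact sum_congr rfl fun j _ => by rw [hg.symm j.succ 0]; ring
      rw [e3, e4]
      ring
    have e5 : ∑ α, ∑ β, cE g 0 α β z * (x α * x β) =
        2 * ∑ α, ∑ β, (g 0 α z * x α) * (g 0 β z * x β) - ∑ α, ∑ β, g α β z * x α * x β := by
      rw [mul_sum, ← sum_sub_distrib]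
      refine sum_congr rfl fun α _ => ?_
      rw [mul_sum, ← sum_sub_distrib]
      refine sum_congr rfl fun β _ => ?_
      rw [cE, hg.time]
      ring
    rw [e5, e1, e2]
    ring
  have h2 : c * X ≤ y ^ 2 - S := by
    have := hyp (WithLp.toLp 2 fun j => x j.succ)
    rwa [EuclideanSpace.real_norm_sq_eq] at this
  have hX0 : 0 ≤ X := sum_nonneg fun j _ => sq_nonneg _
  have h3 : y ^ 2 ≤ n * B ^ 2 * X := by
    refine (Finset.sum_mul_sq_le_sq_mul_sq _ _ _).trans ?_
    refine mul_le_r ?_ hX0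
    refine (sum_le_card_nsmul _ _ (B ^ 2) fun j _ => ?_).trans (by simp)
    exact sq_le_sq' (abs_le.1 (hg.bound _ _ _)).1 (abs_le.1 (hg.bound _ _ _)).2
  rw [Fin.sum_univ_succ, h1, ← hX]
  set q := (2 * n * B ^ 2 + 1) / c
  have hq0 : 0 ≤ q := by positivity
  have hq : q * c = 2 * n * B ^ 2 + 1 := div_mul_cancel₀ _ hc.ne'
  have h4 : x 0 ^ 2 ≤ 2 * (x 0 + y) ^ 2 + 2 * y ^ 2 := by nlinarith [sq_nonneg (x 0 + 2 * y)]
  have h5 : q * (c * X) ≤ q * (y ^ 2 - S) := mul_le_l h2 hq0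
  have h6 : 0 ≤ y ^ 2 - S := (mul_nonneg hc.le hX0).trans h2
  have h7 : q * (c * X) = (2 * n * B ^ 2 + 1) * X := by rw [← mul_assoc, hq]
  nlinarith [mul_nonneg hq0 (sq_nonneg (x 0 + y))]

theorem energy_lower {g : Λ → Λ → ST n → ℝ} {k : ℕ} {B c : ℝ}
    (hg : Cf g k B) (hc : 0 < c) (hyp : ∀ z, Hyp g c z) {ρ : ℝ → ℝ} (hρ : Continuous ρ)
    {r : ℝ} (hr : ∀ t, ρ t ≠ 0 → |t| ≤ r) (h0 : ∀ t, 0 ≤ ρ t) (d : Λ → L2 n)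
    (i : Λ) :
    ∫ z, ρ z.1 * ‖d i z‖ ^ 2 ∂ϖ ≤ (2 + (2 * n * B ^ 2 + 1) / c) *
      (∑ α, ∑ β, tri ρ (cE g 0 α β) (d α) (cj (d β))).re := by
  have hb := BM_time (n := n) hρ hr
  have hcb (α β) : BM (ℭ (cE g 0 α β)) :=
    BM_of_le (contDiff_cE hg 0 α β).continuous (abs_cE_le hg 0 α β)
  set m : Λ → Λ → L2 n := fun α β => mulOp (ℭₜ ρ) (mulOp (ℭ (cE g 0 α β)) (d α)) with hm
  have hint (α β) : Integrable (fun z => m α β z * (cj (d β)) z) ϖ := integrable_mul_L2 _ _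
  have hint2 : Integrable (fun z => ∑ α, ∑ β, m α β z * (cj (d β)) z) ϖ :=
    integrable_finsetSum _ fun α _ => integrable_finsetSum _ fun β _ => hint α β
  have e1 : ∑ α, ∑ β, tri ρ (cE g 0 α β) (d α) (cj (d β)) = ∫ z, ∑ α, ∑ β, m α β z * (cj (d β)) z ∂ϖ := by
    rw [integral_finsetSum _ fun α _ => integrable_finsetSum _ fun β _ => hint α β]
    refine sum_congr rfl fun α _ => ?_
    rw [integral_finsetSum _ fun β _ => hint α β]
    exact sum_congr rfl fun β _ => bil_eq _ _
  have e2 := integral_re hint2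
  simp only [RCLike.re_eq_complex_re] at e2
  rw [e1, ← e2, ← integral_const_mul]
  refine integral_mono_of_nonneg (.of_forall fun z => mul_nonneg (h0 _) (by positivity))
    (hint2.re.const_mul _) ?_
  have h1 : ∀ᵐ z ∂ϖ, ∀ α β, m α β z = ρ z.1 * (cE g 0 α β z * d α z) := by
    simp only [ae_all_iff]; intro α β
    filter_upwards [coeFn_mulOp hb (mulOp (ℭ (cE g 0 α β)) (d α)),
      coeFn_mulOp (hcb α β) (d α)] with z e1 e2
    rw [hm, e1, e2]
  have h2 : ∀ᵐ z ∂ϖ, ∀ β, cj (d β) z = (starRingEnd ℂ) (d β z) := by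
    rw [ae_all_iff]; exact fun β => coeFn_cj (d β)
  filter_upwards [h1, h2] with z e1 e2
  simp only [e1, e2]
  have e3 : (∑ α, ∑ β, (ρ z.1 : ℂ) * (cE g 0 α β z * d α z) * (starRingEnd ℂ) (d β z)).re =
      ρ z.1 * (∑ α, ∑ β, cE g 0 α β z * ((d α z).re * (d β z).re) +
        ∑ α, ∑ β, cE g 0 α β z * ((d α z).im * (d β z).im)) := by
    rw [← sum_add_distrib, mul_sum, Complex.re_sum]
    refine sum_congr rfl fun α _ => ?_
    rw [← sum_add_distrib, mul_sum, Complex.re_sum]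
    refine sum_congr rfl fun β _ => ?_
    simp
    ring
  have h3 := cE_coercive hg hc z (hyp z) fun α => (d α z).re
  have h4 := cE_coercive hg hc z (hyp z) fun α => (d α z).im
  have h5 : ‖d i z‖ ^ 2 ≤ ∑ α, (d α z).re ^ 2 + ∑ α, (d α z).im ^ 2 := by
    rw [← sum_add_distrib, ← Complex.normSq_eq_norm_sq, Complex.normSq_apply, ← sq, ← sq]
    exact single_le_sum (f := fun α => (d α z).re ^ 2 + (d α z).im ^ 2)
      (fun α _ => by positivity) (Finset.mem_univ i)
  change _ ≤ _ * (∑ α, ∑ β, (ρ z.1 : ℂ) * (cE g 0 α β z * d α z) * (starRingEnd ℂ) (d β z)).re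
  rw [e3]
  calc ρ z.1 * ‖d i z‖ ^ 2 ≤ ρ z.1 * ((2 + (2 * n * B ^ 2 + 1) / c) *
        (∑ α, ∑ β, cE g 0 α β z * ((d α z).re * (d β z).re) +
        ∑ α, ∑ β, cE g 0 α β z * ((d α z).im * (d β z).im))) := by
        refine mul_le_l (h5.trans ?_) (h0 _)
        rw [mul_add]
        exact add_le_add h3 h4
    _ = _ := by ring

theorem norm_sum_le_card' {ι : Type*} [Fintype ι] {X : ι → ℂ} {c : ℝ} (h : ∀ i, ‖X i‖ ≤ c) :
    ‖∑ i, X i‖ ≤ Fintype.card ι * c :=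
  (norm_sum_le _ _).trans ((sum_le_card_nsmul _ _ c fun i _ => h i).trans (by simp))

variable (n) in
theorem exists_energy {B c : ℝ} (hB : 1 ≤ B)
    (hc : 0 < c) : ∃ C : ℝ, 0 ≤ C ∧ ∀ (g : Λ → Λ → ST n → ℝ) (k K : ℕ),
      Cf g k B → (∀ z, Hyp g c z) →
      ∀ (v : L2 n) d e, Jet v d e → Mop (lowS (Sp n) h) K v = v → ∀ D : ℝ, (∀ i, ‖d i‖ ≤ D) →
      ∀ i, tm (d i) ≤ ofReal (C * (D ^ 2 + D * ‖Lop g e‖)) • volume := by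
  obtain ⟨η, Cη, hη, hη0, hηr, hη1, hηC⟩ := exists_eta
  have hCη : 0 ≤ Cη := (abs_nonneg _).trans (hηC 0)
  set N : ℝ := n + 1 with hN
  set κ : ℝ := 2 + (2 * n * B ^ 2 + 1) / c with hκ
  have hκ0 : 0 ≤ κ := by positivity
  refine ⟨κ * (N * N * Cη * (3 * (B * B)) + 2 * N ^ 3 * (6 * (B * B)) + 4 * (N * B)), by positivity,
    ?_⟩
  intro g k K hg hyp v d e hj hv D hD i
  have hD0 : 0 ≤ D := (norm_nonneg _).trans (hD 0)
  set L := ‖Lop g e‖ with hL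
  refine measure_le_of_smooth (tm_compl _) ENNReal.ofReal_ne_top fun ρ hρ hρ0 r hr0 hr1 hr => ?_
  have hρi : Integrable ρ := integrable_of_support hρ.continuous hr
  have hηi : Integrable η := by
    by_contra hne
    rw [integral_undef hne] at hη1
    exact zero_ne_one hη1
  set I := ∫ t, ρ t with hI
  have hI0 : 0 ≤ I := integral_nonneg hρ0
  set R := max r (1 / 2) with hR
  have hbR (t) (ht : ρ t - I * η t ≠ 0) : |t| ≤ R := by
    by_cases h1 : ρ t = 0
    · exact (hηr t fun h2 => ht (by simp [h1, h2])).trans (le_max_right _ _)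
    · exact (hr t h1).trans (le_max_left _ _)
  obtain ⟨a, ha, hda, haR, haA⟩ := exists_primitive (b := fun t => ρ t - I * η t) (r := R)
    (hρ.sub (contDiff_const.mul hη)) hbR
    (by rw [integral_sub hρi (hηi.const_mul _), integral_const_mul, hη1, mul_one, sub_self])
    (A := 2 * I) (by
      calc ∫ t, |ρ t - I * η t| ≤ ∫ t, (ρ t + I * η t) := by
            refine integral_mono (hρi.sub (hηi.const_mul _)).abs (hρi.add (hηi.const_mul _))
              fun t => (abs_sub _ _).trans (le_of_eq ?_)
            rw [abs_of_nonneg (hρ0 t), abs_of_nonneg (mul_nonneg hI0 (hη0 t))]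
        _ = 2 * I := by
            rw [integral_add hρi (hηi.const_mul _), integral_const_mul, hη1]; ring)
  have hR1 : R < 1 := max_lt hr1 (by norm_num)
  have hid := energy_identity h hg ha (hr0.trans (le_max_left r (1 / 2))) hR1 haR hj hv
  set X := ∑ β, mulOp (ℭ (g 0 β)) (d β) with hX
  have hXn : ‖X‖ ≤ N * (B * D) := by
    refine (norm_sum_le_card (c := B * D) fun β => ?_).trans (by simp [hN])
    exact (norm_mulOp_real_le (hg.smooth 0 β).continuous (hg.bound 0 β) (d β)).trans
      (mul_le_l (hD β) (by linarith))
  have hc0 (i α β) := (contDiff_cE hg i α β)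
  have hDD (α β) : ‖d α‖ * ‖cj (d β)‖ ≤ D * D := by
    rw [norm_cj]; exact mul_le_mul (hD α) (hD β) (norm_nonneg _) hD0
  have n1 : ‖∑ i, ∑ α, ∑ β, tri a (pd i (cE g i α β)) (d α) (cj (d β))‖ ≤
      N * (N * (N * (2 * I * (6 * (B * B) * (D * D))))) := by
    simpa [hN] using norm_sum_le_card' fun i => norm_sum_le_card' fun α => norm_sum_le_card' fun β =>
      (norm_tri_le ha.continuous haA (continuous_pd (hc0 i α β) i)
        (abs_pd_cE_le hg i i α β) _ _).trans (mul_le_l (mul_le_l (hDD α β) ✓) ✓)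
  have n2 : ‖bil (mulOp (ℭₜ a) (Lop g e)) (cj X)‖ ≤ 2 * I * L * (N * (B * D)) := by
    refine (norm_bil_le _ _).trans ?_
    rw [norm_cj]
    exact mul_le_mul (norm_mulOp_real_le (b := fun z : ST n => a z.1)
      (ha.continuous.comp continuous_fst) (fun z => haA z.1) _) hXn (norm_nonneg _) (by positivity)
  have n3 : ‖bil (mulOp (ℭₜ a) X) (cj (Lop g e))‖ ≤
      2 * I * (N * (B * D)) * L := by
    refine (norm_bil_le _ _).trans ?_
    rw [norm_cj]
    refine mul_le_r ((norm_mulOp_real_le (b := fun z : ST n => a z.1)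
      (ha.continuous.comp continuous_fst) (fun z => haA z.1) X).trans ?_) (norm_nonneg _)
    exact mul_le_l hXn (by positivity)
  have n4 : ‖∑ α, ∑ β, tri (fun t => I * η t) (cE g 0 α β) (d α) (cj (d β))‖ ≤
      N * (N * (I * Cη * (3 * (B * B) * (D * D)))) := by
    simpa [hN] using norm_sum_le_card' fun α => norm_sum_le_card' fun β =>
      (norm_tri_le (contDiff_const.mul hη).continuous (A := I * Cη) (fun t => by
        rw [abs_mul, abs_of_nonneg hI0]; gcongr; exact hηC t) (hc0 0 α β).continuous
        (abs_cE_le hg 0 α β) _ _).trans (mul_le_l (mul_le_l (hDD α β) ✓) ✓)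
  have hsplit : ∑ α, ∑ β, tri ρ (cE g 0 α β) (d α) (cj (d β)) =
      ∑ α, ∑ β, tri (deriv a) (cE g 0 α β) (d α) (cj (d β)) +
      ∑ α, ∑ β, tri (fun t => I * η t) (cE g 0 α β) (d α) (cj (d β)) := by
    rw [← sum_add_distrib]
    refine sum_congr rfl fun α _ => ?_
    rw [← sum_add_distrib]
    refine sum_congr rfl fun β _ => ?_
    have b1 : BM (ℭₜ (deriv a)) :=
      hda ▸ BM_time (hρ.sub (contDiff_const.mul hη)).continuous hbR
    have b2 : BM fun z : ST n => ((I * η z.1 : ℝ) : ℂ) :=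
      BM_time (a := fun t => I * η t) (contDiff_const.mul hη).continuous fun t ht =>
        hηr t (right_ne_zero_of_mul ht)
    have e : (ℭₜ ρ) = fun z => ((deriv a z.1 : ℝ) : ℂ) +
        ((I * η z.1 : ℝ) : ℂ) := by
      funext z; rw [hda]; push_cast; ring
    rw [tri, e, mulOp_add b1 b2, map_add, add_apply]
    rfl
  have hlow := energy_lower hg hc hyp hρ.continuous hr hρ0 d i
  have hup : (∑ α, ∑ β, tri ρ (cE g 0 α β) (d α) (cj (d β))).re ≤
      I * ((N * N * Cη * (3 * (B * B)) + 2 * N ^ 3 * (6 * (B * B)) + 4 * (N * B)) *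
        (D ^ 2 + D * L)) := by
    refine (Complex.re_le_norm _).trans ?_
    rw [hsplit, hid]
    refine (norm_add_le_of_le ((norm_sub_le _ _).trans (add_le_add
      ((norm_neg _).trans_le n1) (norm_add_le_of_le n2 n3))) n4).trans ?_
    have q1 : 0 ≤ D * L := by positivity
    have q2 : 0 ≤ N * N * Cη * (3 * (B * B)) + 2 * N ^ 3 * (6 * (B * B)) := by positivity
    have q3 : 0 ≤ 4 * (N * B) * D ^ 2 := by positivity
    have q4 : N * (N * (N * (2 * I * (6 * (B * B) * (D * D))))) + (2 * I * L * (N * (B * D)) +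
        2 * I * (N * (B * D)) * L) + N * (N * (I * Cη * (3 * (B * B) * (D * D)))) =
        I * ((N * N * Cη * (3 * (B * B)) + 2 * N ^ 3 * (6 * (B * B))) * D ^ 2 +
        4 * (N * B) * (D * L)) := by ring
    rw [q4]
    refine mul_le_l ?_ hI0
    nlinarith [mul_nonneg q2 q1]
  have hfin : ∫ z, ρ z.1 * ‖d i z‖ ^ 2 ∂ϖ ≤
      κ * (N * N * Cη * (3 * (B * B)) + 2 * N ^ 3 * (6 * (B * B)) + 4 * (N * B)) *
        (D ^ 2 + D * L) * I :=
    hlow.trans ((mul_le_l hup hκ0).trans (le_of_eq (by ring)))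
  have hint : Integrable (fun z => ρ z.1 * ‖d i z‖ ^ 2) ϖ := by
    obtain ⟨Cρ, hCρ⟩ := (BM_time (n := n) hρ.continuous hr).2
    refine Integrable.bdd_mul (c := Cρ) ((Lp.memLp (d i)).integrable_norm_pow (by norm_num))
      (hρ.continuous.comp continuous_fst).aestronglyMeasurable (.of_forall fun z => ?_)
    have := hCρ z
    rwa [norm_real] at this
  rw [lintegral_tm _ hρ.continuous.measurable.ennreal_ofReal]
  have e1 : ∫⁻ z, ofReal (ρ z.1) * ‖d i z‖ₑ ^ 2 ∂ϖ =
      ofReal (∫ z, ρ z.1 * ‖d i z‖ ^ 2 ∂ϖ) := by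
    rw [ofReal_integral_eq_lintegral_ofReal hint
      (.of_forall fun z => mul_nonneg (hρ0 _) (by positivity))]
    refine lintegral_congr fun z => ?_
    rw [ENNReal.ofReal_mul (hρ0 _), ENNReal.ofReal_pow (norm_nonneg _), ofReal_norm]
  rw [e1, ← ofReal_integral_eq_lintegral_ofReal hρi (.of_forall hρ0), ← ENNReal.ofReal_mul
    (by positivity)]
  exact ofReal_le_ofReal hfin

theorem BM_indicator {A : Set ℝ} (hA : MeasurableSet A) :
    BM fun z : ST n => A.indicator (fun _ => (1 : ℂ)) z.1 := by
  refine ⟨(measurable_const.indicator hA).comp measurable_fst, 1, fun z => ?_⟩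
  by_cases h : z.1 ∈ A <;> simp [h]

theorem enorm_sq_mulOp {Θ : ST n → ℂ} (h : BM Θ) (u : L2 n) :
    ‖mulOp Θ u‖ₑ ^ 2 = ∫⁻ z, ‖Θ z‖ₑ ^ 2 * ‖u z‖ₑ ^ 2 ∂ϖ := by
  rw [← lintegral_enorm_sq]
  refine lintegral_congr_ae ?_
  filter_upwards [coeFn_mulOp h u] with z hz
  rw [hz, enorm_mul, mul_pow]

theorem tm_apply (u : L2 n) {A : Set ℝ} (hA : MeasurableSet A) :
    tm u A = ‖mulOp (fun z => A.indicator (fun _ => (1 : ℂ)) z.1) u‖ₑ ^ 2 := by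
  rw [enorm_sq_mulOp (BM_indicator hA), ← lintegral_indicator_one hA,
    lintegral_tm u (measurable_one.indicator hA)]
  refine lintegral_congr fun z => ?_
  by_cases h : z.1 ∈ A <;> simp [h]

theorem tm_le_of_commute {T : L2 n →L[ℂ] L2 n} {C : ℝ} (hC : 0 ≤ C) (hT : ∀ u, ‖T u‖ ≤ C * ‖u‖)
    (hc : ∀ {a : ℝ → ℂ}, (BM fun z : ST n => a z.1) → ∀ u,
      T (mulOp (fun z => a z.1) u) = mulOp (fun z => a z.1) (T u)) (u : L2 n) :
    tm (T u) ≤ ofReal (C ^ 2) • tm u := by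
  refine Measure.le_iff.2 fun A hA => ?_
  rw [Measure.smul_apply, tm_apply _ hA, tm_apply _ hA, ← hc (BM_indicator hA), smul_eq_mul,
    ENNReal.ofReal_pow hC, ← mul_pow]
  refine pow_le_pow_left₀ zero_le ?_ 2
  rw [← ofReal_norm, ← ofReal_norm, ← ENNReal.ofReal_mul hC]
  exact ofReal_le_ofReal (hT _)

theorem norm_sq_le_of_tm {θ : ST n → ℂ} (hθ : BM θ) {Γ : ℝ → ℝ≥0∞} (hΓ : Measurable Γ)
    (hle : ∀ z, ‖θ z‖ₑ ≤ Γ z.1) {u : L2 n} {M : ℝ≥0∞} (hu : tm u ≤ M • volume) :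
    ‖mulOp θ u‖ₑ ^ 2 ≤ M * ∫⁻ t, Γ t ^ 2 := by
  rw [enorm_sq_mulOp hθ]
  calc _ ≤ ∫⁻ z, Γ z.1 ^ 2 * ‖u z‖ₑ ^ 2 ∂ϖ := by
        refine lintegral_mono fun z => mul_le_mul_left ?_ _
        exact pow_le_pow_left₀ zero_le (hle z) 2
    _ = ∫⁻ t, Γ t ^ 2 ∂(tm u) := (lintegral_tm u (hΓ.pow_const 2)).symm
    _ ≤ ∫⁻ t, Γ t ^ 2 ∂(M • volume) := lintegral_mono' hu le_rfl
    _ = _ := by rw [lintegral_smul_measure, smul_eq_mul]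

theorem Jet.deriv_eq {K : ℕ} {v : L2 n} {d : Λ → L2 n}
    {e : Λ → Λ → L2 n} (hj : Jet v d e)
    (hv : Mop (lowS (Sp n) h) K v = v) (j : Fin n) (i : Λ) :
    e j.succ i = ((𝟚 ^ K : ℝ) : ℂ) • Mop (dS j (lowS (Sp n) h)) K (d i) := by
  have := WD_space j (lowS (Sp n) h) K (d i)
  rw [hj.loc h hv i] at this
  exact (hj.second j.succ i).unique this

theorem enorm_le_of_sq {x : L2 n} {a : ℝ} (ha : 0 ≤ a) (h : ‖x‖ₑ ^ 2 ≤ ofReal a) :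
    ‖x‖ ≤ sqrt a := by
  rw [← ofReal_norm, ← ENNReal.ofReal_pow (norm_nonneg _), ENNReal.ofReal_le_ofReal_iff ha] at h
  exact Real.le_sqrt_of_sq_le h

theorem exists_key
    (hG : Coef G B c k₀ CΓ) (r : ℕ) : ∃ C : ℝ, 0 ≤ C ∧ ∀ k l, l ≤ k + 3 → k ≤ l + 3 →
      ∀ (v : L2 n) d e, Jet v d e → Mop (lowS (Sp n) h) (k + r) v = v →
      ∀ D : ℝ, (∀ i, ‖d i‖ ≤ D) →
      ‖Lop (G k) e - Lop (G l) e‖ ≤ C * sqrt (D ^ 2 + D * ‖Lop (G k) e‖) := by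
  obtain ⟨Ce, hCe, hE⟩ := exists_energy n h hG.one_le hG.pos
  obtain ⟨Cm, hCm, hM⟩ := exists_norm_Mop_dS_le (lowS (Sp n) h)
  set A := 2 ^ (k₀ + r) * Cm * (2 * B) + sqrt ((2 ^ r * Cm) ^ 2 * Ce * CΓ.toReal) with hA
  have hB0 : (0 : ℝ) ≤ B := zero_le_one.trans hG.one_le
  have hA0 : 0 ≤ A := by positivity
  refine ⟨(n + 1) * ((n + 1) * A), by positivity, ?_⟩
  intro k l hlk hkl v d e hj hv D hD
  have hD0 : 0 ≤ D := (norm_nonneg _).trans (hD 0)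
  set M := D ^ 2 + D * ‖Lop (G k) e‖ with hMd
  have hM0 : 0 ≤ M := by positivity
  have hDM : D ≤ sqrt M := Real.le_sqrt_of_sq_le (by
    rw [hMd]; linarith [mul_nonneg hD0 (norm_nonneg (Lop (G k) e))])
  have hg (k i j) : BM (ℭ (G k i j)) :=
    BM_of_le (hG.smooth k i j).continuous (hG.bound k i j)
  let δ (i j) := fun z : ST n => (G k i j z : ℂ) - G l i j z
  have hb (i j) : BM (δ i j) := (hg k i j).sub (hg l i j)
  have single (i j : Λ) (a : Λ) (b : Fin n) :
      ‖mulOp (δ i j) (e b.succ a)‖ ≤ A * sqrt M := by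
    have hX := hj.deriv_eq h hv b a
    set S := Mop (dS b (lowS (Sp n) h)) (k + r) (d a) with hS
    have hSn : ‖S‖ ≤ Cm * D :=
      ((hM (k + r) (d a)).2.1 b).trans (mul_le_l (hD a) (by linarith))
    have n2 : ‖((𝟚 ^ (k + r) : ℝ) : ℂ)‖ = 2 ^ (k + r) := by simp
    rw [hX, map_smul, norm_smul, n2]
    by_cases hk : k₀ ≤ k
    · have h1 : tm S ≤ ofReal (Cm ^ 2 * (Ce * M)) • volume := by
        refine (tm_le_of_commute (zero_le_one.trans hCm) (fun u => (hM (k + r) u).2.1 b)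
          (fun ha u => Mult_mulOp_time (BMs_scs _ _) ha u) (d a)).trans ?_
        rw [ENNReal.ofReal_mul (by positivity), mul_smul]
        refine Measure.le_iff.2 fun s hs => ?_
        rw [Measure.smul_apply, Measure.smul_apply]
        exact mul_le_mul_right (hE (G k) k (k + r) (hG.cf k le_rfl) (hG.hyperbolic k hk) v d e hj hv
          D hD a s) _
      obtain ⟨Γ, hΓm, hΓ, hΓC⟩ := hG.diff k l hlk hkl i j
      have h2 := norm_sq_le_of_tm (hb i j) (Γ := fun t => ofReal (𝟚 ^ k)⁻¹ * Γ t)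
        (hΓm.const_mul _) (fun z => by
          refine le_trans (le_of_eq ?_) (hΓ z)
          simp only [δ, ← Complex.ofReal_sub, ← ofReal_norm, norm_real]) h1
      simp only [mul_pow] at h2
      rw [lintegral_const_mul' _ _ (ENNReal.pow_ne_top ENNReal.ofReal_ne_top)] at h2
      have h3 : ‖mulOp (δ i j) S‖ ≤
          sqrt (Cm ^ 2 * (Ce * M) * ((𝟚 ^ k)⁻¹ ^ 2 * CΓ.toReal)) := by
        refine enorm_le_of_sq (by positivity) (h2.trans ?_)
        rw [ENNReal.ofReal_mul (p := Cm ^ 2 * (Ce * M)) (by positivity),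
          ENNReal.ofReal_mul (p := (𝟚 ^ k)⁻¹ ^ 2) (by positivity),
          ENNReal.ofReal_pow (p := (𝟚 ^ k)⁻¹) (by positivity), ofReal_toReal hG.fin]
        gcongr
      calc _ ≤ 2 ^ (k + r) * sqrt (Cm ^ 2 * (Ce * M) * ((𝟚 ^ k)⁻¹ ^ 2 * CΓ.toReal)) :=
            mul_le_l h3 (by positivity)
        _ = sqrt ((2 ^ (k + r)) ^ 2 *
            (Cm ^ 2 * (Ce * M) * ((𝟚 ^ k)⁻¹ ^ 2 * CΓ.toReal))) := by
            rw [sqrt_mul (x := (2 ^ (k + r)) ^ 2) (by positivity), sqrt_sq (by positivity)]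
        _ = sqrt ((2 ^ r * Cm) ^ 2 * Ce * CΓ.toReal * M) := by
            congr 1
            rw [pow_add]
            field_simp
        _ = sqrt ((2 ^ r * Cm) ^ 2 * Ce * CΓ.toReal) * sqrt M :=
            sqrt_mul (by positivity) _
        _ ≤ A * sqrt M := by
            rw [hA]; gcongr; exact le_add_of_nonneg_left (by positivity)
    · have h1 : ‖mulOp (δ i j) S‖ ≤ 2 * B * ‖S‖ := by
        refine norm_mulOp_le (hb i j) (fun z => ?_) S
        refine (norm_sub_le _ _).trans ?_
        rw [norm_real, norm_real, norm_eq_abs, norm_eq_abs]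
        linarith [hG.bound k i j z, hG.bound l i j z]
      calc _ ≤ 2 ^ (k₀ + r) * (2 * B * (Cm * D)) := by
            refine mul_le_mul (pow_le_pow_right₀ (by norm_num) (by omega)) (h1.trans ?_)
              (norm_nonneg _) (by positivity)
            gcongr
        _ = 2 ^ (k₀ + r) * Cm * (2 * B) * D := by ring
        _ ≤ 2 ^ (k₀ + r) * Cm * (2 * B) * sqrt M := by gcongr
        _ ≤ A * sqrt M := by
            rw [hA]; gcongr; exact le_add_of_nonneg_right (sqrt_nonneg _)
  have e1 : Lop (G k) e - Lop (G l) e =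
      ∑ i, ∑ j, mulOp (δ i j) (e i j) := by
    rw [Lop, Lop, ← sum_sub_distrib]
    refine sum_congr rfl fun i _ => ?_
    rw [← sum_sub_distrib]
    exact sum_congr rfl fun j _ => (mulOp_sub (hg k i j) (hg l i j) _).symm
  rw [e1]
  have all (i j : Λ) :
      ‖mulOp (δ i j) (e i j)‖ ≤ A * sqrt M := by
    refine Fin.cases ?_ (fun j => ?_) j
    · refine Fin.cases ?_ (fun i => ?_) i
      · have : δ 0 0 = fun _ => 0 := by funext z; simp [δ, hG.time]
        rw [this, mulOp_zero_fun, norm_zero]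
        positivity
      · exact single i.succ 0 0 i
    · rw [hj.comm]
      exact single i j.succ i j
  refine (norm_sum_le_card fun i => norm_sum_le_card fun j => all i j).trans (le_of_eq ?_)
  simp
  ring

def boxD (g : Λ → Λ → ST n → ℝ) (ψ : 𝓣) : 𝓣 :=
  ∑ i, ∑ j, dd i (dd j (mulT (g i j) ψ))

def WBox (g : Λ → Λ → ST n → ℝ) (v F : L2 n) : Prop :=
  ∀ ψ : 𝓣, bil v (tst (boxD g ψ)) = bil F (tst ψ)

theorem ofReal_pd {f : ST n → ℝ} (hf : Differentiable ℝ f) (i : Λ) :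
    pd i (ℭ f) = fun z => ((pd i f z : ℝ) : ℂ) := by
  funext z
  have := (Complex.ofRealCLM.hasFDerivAt.comp z (hf z).hasFDerivAt).fderiv
  change fderiv ℝ (Complex.ofRealCLM ∘ f) z (dir i) = _
  rw [this]
  rfl

theorem boxT_eq {g : Λ → Λ → ST n → ℝ}
    {k : ℕ} (hs : ∀ i j, ContDiff ℝ ∞ (Gm h (max 1 (k / 2) - 1) (g i j))) (ψ : 𝓣) (z : ST n) :
    boxT φ g k ψ z = (boxD (fun i j => Gm h (max 1 (k / 2) - 1) (g i j)) ψ z : ℂ) := by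
  rw [boxT, boxD]
  push_cast
  simp only [Finset.sum_apply, Complex.ofReal_sum]
  refine sum_congr rfl fun i _ => ?_
  refine sum_congr rfl fun j _ => ?_
  have e : (fun w => trunc φ k (g i j) w * (ψ w : ℂ)) =
      fun w => ((mulT (Gm h (max 1 (k / 2) - 1) (g i j)) ψ w : ℝ) : ℂ) := by
    funext w
    rw [trunc_eq h, mulT_apply (hs i j), ofReal_mul]
  have hd (χ : 𝓣) : Differentiable ℝ χ :=
    (show ContDiff ℝ ∞ χ by simpa using χ.contDiff).differentiable (by simp)
  rw [e, ofReal_pd (hd _)]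
  have e2 : (fun z => ((pd j (mulT (Gm h (max 1 (k / 2) - 1) (g i j)) ψ) z : ℝ) : ℂ)) =
      fun z => ((dd j (mulT (Gm h (max 1 (k / 2) - 1) (g i j)) ψ) z : ℝ) : ℂ) := by
    funext z; rw [dd_apply]
  rw [e2, ofReal_pd (hd _), dd_apply]

theorem integral_mul_boxT
    {g : Λ → Λ → ST n → ℝ} {k : ℕ}
    (hs : ∀ i j, ContDiff ℝ ∞ (Gm h (max 1 (k / 2) - 1) (g i j))) (ψ : 𝓣) (v : ST n → ℂ) :
    ∫ z, v z * boxT φ g k ψ z ∂ϖ = ∫ z, v z * tst (boxD (fun i j => Gm h (max 1 (k / 2) - 1) (g i j)) ψ) z ∂ϖ := by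
  refine integral_congr_ae ?_
  filter_upwards [coeFn_tst (boxD (fun i j => Gm h (max 1 (k / 2) - 1) (g i j)) ψ)] with z hz
  rw [hz, boxT_eq h hs]

theorem hasWeakBox_iff
    {g : Λ → Λ → ST n → ℝ} {k : ℕ}
    (hs : ∀ i j, ContDiff ℝ ∞ (Gm h (max 1 (k / 2) - 1) (g i j))) (v F : L2 n) :
    HasWeakBox φ g k v F ↔ WBox (fun i j => Gm h (max 1 (k / 2) - 1) (g i j)) v F := by
  refine forall_congr' fun ψ => ?_
  rw [integral_mul_boxT h hs, bil_tst F, bil_eq]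

theorem WBox.sum {g : Λ → Λ → ST n → ℝ} {ι : Type*} (s : Finset ι)
    {v F : ι → L2 n} (h : ∀ a ∈ s, WBox g (v a) (F a)) : WBox g (∑ a ∈ s, v a) (∑ a ∈ s, F a) :=
  fun ψ => by
    simp only [map_sum, FunLike.coe_sum, Finset.sum_apply]
    exact sum_congr rfl fun a ha => h a ha ψ

theorem Band.add {k : ℕ} {b b' : ST n → ℝ} (h : Band k b) (h' : Band k b')
    (hb : BM (ℭ b)) (hb' : BM (ℭ b')) : Band k fun z => b z + b' z := by
  intro p q hp hq hpq u
  have e : (fun z => ((b z + b' z : ℝ) : ℂ)) = fun z => (b z : ℂ) + (b' z : ℂ) := by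
    funext z; push_cast; rfl
  rw [e, mulOp_add hb hb', map_add, h p q hp hq hpq, h' p q hp hq hpq, add_zero]

theorem Band.zero {k : ℕ} : Band k fun _ : ST n => 0 := fun p q _ _ _ u => by
  simp [mulOp_zero_fun]

theorem Band.mono {k l : ℕ} (hkl : k ≤ l) {b : ST n → ℝ} (h : Band k b) : Band l b :=
  fun p q hp hq hpq => h p q hp hq fun η η' a b => le_trans
    (pow_le_pow_right₀ one_le_two (max_le_max le_rfl (Nat.div_le_div_right hkl))) (hpq η η' a b)

theorem Cf.mono {g : Λ → Λ → ST n → ℝ} {k l : ℕ} {B B' : ℝ} (h : Cf g k B)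
    (hkl : k ≤ l) (hB : B ≤ B') : Cf g l B' where
  smooth := h.smooth
  symm := h.symm
  time := h.time
  bound i j z := (h.bound i j z).trans hB
  bound_pd i j a z := (h.bound_pd i j a z).trans hB
  lip i j z z' := (h.lip i j z z').trans (by gcongr)
  band i j := (h.band i j).mono hkl

theorem Lower.zero {k : ℕ} {B : ℝ} (hB : 0 ≤ B) : Lower (n := n) (fun _ _ => 0) (fun _ => 0) k B where
  smooth := contDiff_const
  cont _ := continuous_const
  cont' := continuous_const
  bound _ _ := by simpa
  bound_pd z := by simp [pd]; positivity
  bound' z := by simp; positivity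
  band _ := Band.zero
  band' := Band.zero

theorem sum_props {ι : Type*} [Fintype ι] {b : ι → ST n → ℝ} {k : ℕ} {A : ℝ}
    (hc : ∀ i, Continuous (b i)) (hA : ∀ i z, |b i z| ≤ A) (hb : ∀ i, Band k (b i)) :
    Continuous (fun z => ∑ i, b i z) ∧ (∀ z, |∑ i, b i z| ≤ Fintype.card ι * A) ∧
      Band k fun z => ∑ i, b i z := by
  refine ⟨by fun_prop, fun z => ?_, ?_⟩
  · refine (abs_sum_le_sum_abs _ _).trans ((sum_le_sum fun i _ => hA i z).trans ?_)
    simp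
  · have key (s : Finset ι) : BM (fun z => ((∑ i ∈ s, b i z : ℝ) : ℂ)) ∧
        Band k fun z => ∑ i ∈ s, b i z := by
      induction s using Finset.cons_induction with
      | empty => simpa using ⟨BM.const 0, Band.zero⟩
      | cons a s ha ih =>
        have h1 := BM_of_le (hc a) (hA a)
        simp only [Finset.sum_cons]
        refine ⟨by push_cast; push_cast at ih; exact h1.add ih.1, (hb a).add ih.2 h1 ih.1⟩
    exact (key _).2

def lowB (g : Λ → Λ → ST n → ℝ) (i : Λ) (z : ST n) : ℝ :=
  ∑ j, 2 * pd j (g i j) z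

def lowC (g : Λ → Λ → ST n → ℝ) (z : ST n) : ℝ :=
  ∑ p : Λ × Λ, pd p.1 (pd p.2 (g p.1 p.2)) z

theorem contDiff_pd {b : ST n → ℝ} (h : ContDiff ℝ ∞ b) (i : Λ) :
    ContDiff ℝ ∞ (pd i b) :=
  (h.fderiv_right (m := ∞) (by simp)).clm_apply contDiff_const

theorem Coef.lower
    (h : Coef G B c k₀ CΓ) (k : ℕ) :
    Lower (lowB (G k)) (lowC (G k)) k ((n + 1) * (n + 1) * (2 * B)) := by
  have hB := h.one_le
  have hn : (n + 1 : ℝ) * (2 * B) ≤ (n + 1) * (n + 1) * (2 * B) := by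
    have : (0 : ℝ) ≤ n := n.cast_nonneg
    nlinarith [mul_nonneg this (by positivity : (0 : ℝ) ≤ (n + 1) * (2 * B))]
  have hs (i j a) := contDiff_pd (h.smooth k i j) a
  have hb (i j z) : |2 * pd j (G k i j) z| ≤ 2 * B := by
    rw [abs_mul, abs_two]; have := h.bound_pd k i j j z; linarith
  have P (i) := sum_props (k := k) (b := fun j z => 2 * pd j (G k i j) z) (fun j => by
      have := (hs i j j).continuous; fun_prop) (hb i) fun j =>
    (h.band_pd k i j j).const_mul (BM_pd (h.smooth k i j) (h.bound_pd k i j j)) 2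
  have Q := sum_props (k := k) (b := fun (p : Λ × Λ) z =>
      pd p.1 (pd p.2 (G k p.1 p.2)) z) (fun p => (contDiff_pd (hs _ _ _) _).continuous)
      (fun p => h.bound_pd_pd k p.1 p.2 p.1 p.2) fun p => h.band_pd_pd k _ _ _ _
  have hsm (i) : ContDiff ℝ ∞ (lowB (G k) i) :=
    ContDiff.sum fun j _ => contDiff_const.mul (hs i j j)
  refine ⟨hsm 0, fun i => (P i).1, Q.1, fun i z => ((P i).2.1 z).trans ?_, fun z => ?_,
    fun z => (Q.2.1 z).trans ?_, fun i => (P i).2.2, Q.2.2⟩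
  · simpa using hn
  · have e : pd 0 (lowB (G k) 0) z = ∑ j, 2 * pd 0 (pd j (G k 0 j)) z := by
      have := (HasFDerivAt.fun_sum (u := Finset.univ) fun (j : Λ) _ =>
        (((hs 0 j j).differentiable (by simp)) z).hasFDerivAt.const_mul 2).fderiv
      rw [pd]
      change fderiv ℝ (fun z => ∑ j, 2 * pd j (G k 0 j) z) z _ = _
      rw [this]
      simp [pd]
    rw [e]
    refine (abs_sum_le_sum_abs _ _).trans ((sum_le_sum fun j _ =>
      show _ ≤ 2 * B * 2 ^ k from ?_).trans ?_)
    · rw [abs_mul, abs_two]; have := h.bound_pd_pd k 0 j 0 j z; linarith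
    · simp only [Finset.sum_const, Finset.card_univ, Fintype.card_fin, nsmul_eq_mul]
      push_cast
      nlinarith [pow_pos (two_pos : (0 : ℝ) < 2) k]
  · simp only [Fintype.card_prod, Fintype.card_fin]
    push_cast
    have : (0 : ℝ) ≤ (n + 1) * (n + 1) * B * 2 ^ k := by positivity
    linarith

theorem boxD_apply {g : Λ → Λ → ST n → ℝ} (hs : ∀ i j, ContDiff ℝ ∞ (g i j))
    (ψ : 𝓣) (i j : Λ) :
    dd i (dd j (mulT (g i j) ψ)) = mulT (pd i (pd j (g i j))) ψ + mulT (pd j (g i j)) (dd i ψ)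
      + mulT (pd i (g i j)) (dd j ψ) + mulT (g i j) (dd i (dd j ψ)) := by
  have e : dd j (mulT (g i j) ψ) = mulT (pd j (g i j)) ψ + mulT (g i j) (dd j ψ) := by
    ext z
    rw [dd_mulT (hs i j)]
    change _ = mulT (pd j (g i j)) ψ z + mulT (g i j) (dd j ψ) z
    rw [mulT_apply (contDiff_pd (hs i j) j), mulT_apply (hs i j)]
  rw [e, dd_add]
  ext z
  change dd i (mulT (pd j (g i j)) ψ) z + dd i (mulT (g i j) (dd j ψ)) z =
    mulT (pd i (pd j (g i j))) ψ z + mulT (pd j (g i j)) (dd i ψ) z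
      + mulT (pd i (g i j)) (dd j ψ) z + mulT (g i j) (dd i (dd j ψ)) z
  rw [dd_mulT (contDiff_pd (hs i j) j), dd_mulT (hs i j),
    mulT_apply (contDiff_pd (contDiff_pd (hs i j) j) i), mulT_apply (contDiff_pd (hs i j) j),
    mulT_apply (contDiff_pd (hs i j) i), mulT_apply (hs i j)]
  ring

theorem bil_tst_mulT {b : ST n → ℝ} (h : ContDiff ℝ ∞ b) {A : ℝ} (hA : ∀ z, |b z| ≤ A) (v : L2 n)
    (ψ : 𝓣) : bil v (tst (mulT b ψ)) = bil (mulOp (ℭ b) v) (tst ψ) := by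
  rw [tst_mulT h (BM_of_le h.continuous hA), bil_mulOp (BM_of_le h.continuous hA)]

theorem mulOp_sum {ι : Type*} [Fintype ι] {b : ι → ST n → ℂ} (hb : ∀ i, BM (b i)) (v : L2 n) :
    mulOp (fun z => ∑ i, b i z) v = ∑ i, mulOp (b i) v := by
  have key (s : Finset ι) : BM (fun z => ∑ i ∈ s, b i z) ∧
      mulOp (fun z => ∑ i ∈ s, b i z) v = ∑ i ∈ s, mulOp (b i) v := by
    induction s using Finset.cons_induction with
    | empty => simpa using ⟨BM.const 0, mulOp_zero_fun v⟩
    | cons a s ha ih =>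
      simp only [Finset.sum_cons]
      refine ⟨(hb a).add ih.1, ?_⟩
      rw [mulOp_add (hb a) ih.1, ih.2]
  exact (key _).2

theorem WBox.weakEq
    (h : Coef G B c k₀ CΓ) {k : ℕ} {v F : L2 n} (hv : WBox (G k) v F) :
    WeakEq (G k) (lowB (G k)) (lowC (G k)) v F := by
  intro ψ
  have hs (i j a) := contDiff_pd (h.smooth k i j) a
  rw [← hv ψ, boxD]
  simp only [boxD_apply (h.smooth k), map_sum, map_add]
  simp only [bil_tst_mulT (h.smooth k _ _) (h.bound k _ _), bil_tst_mulT (hs _ _ _)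
    (h.bound_pd k _ _ _), bil_tst_mulT (contDiff_pd (hs _ _ _) _) (h.bound_pd_pd k _ _ _ _)]
  have e1 (i : Λ) : mulOp (ℭ (lowB (G k) i)) v =
      ∑ j, (2 : ℂ) • mulOp (ℭ (pd j (G k i j))) v := by
    have hb (j) := BM_pd (h.smooth k i j) (h.bound_pd k i j j)
    simp only [lowB, Complex.ofReal_sum, ofReal_mul, Complex.ofReal_ofNat]
    rw [mulOp_sum fun j => (BM.const _).mul (hb j)]
    exact sum_congr rfl fun j _ => by rw [← mulOp_mulOp (BM.const _) (hb j), mulOp_const]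
  have e2 : mulOp (ℭ (lowC (G k))) v =
      ∑ i, ∑ j, mulOp (ℭ (pd i (pd j (G k i j)))) v := by
    simp only [lowC, Complex.ofReal_sum]
    rw [mulOp_sum fun p => BM_pd (hs _ _ _) (h.bound_pd_pd k _ _ _ _), Fintype.sum_prod_type]
  have e3 : ∑ i, ∑ j, bil (mulOp (ℭ (pd i (G k i j))) v) (tst (dd j ψ)) =
      ∑ i, ∑ j, bil (mulOp (ℭ (pd j (G k i j))) v) (tst (dd i ψ)) := by
    rw [sum_comm]
    refine sum_congr rfl fun i _ => sum_congr rfl fun j _ => ?_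
    rw [show G k j i = G k i j from funext fun z => h.symm k j i z]
  simp only [e1, e2, map_sum, FunLike.coe_sum, Finset.sum_apply, map_smul, FunLike.coe_smul,
    Pi.smul_apply, sum_add_distrib, e3, smul_eq_mul, ← mul_sum]
  ring

theorem Jet.wBox
    (h : Coef G B c k₀ CΓ) (k : ℕ) {v : L2 n} {d : Λ → L2 n}
    {e : Λ → Λ → L2 n} (hj : Jet v d e) : WBox (G k) v (Lop (G k) e) := by
  intro ψ
  simp only [boxD, Lop, map_sum, FunLike.coe_sum, Finset.sum_apply]
  refine sum_congr rfl fun i _ => sum_congr rfl fun j _ => ?_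
  rw [hj.first i, hj.second j i, neg_neg, hj.comm, bil_tst_mulT (h.smooth k _ _) (h.bound k _ _)]

theorem WD_tst (i : Λ) (ψ : 𝓣) : WD i (tst ψ) (tst (dd i ψ)) := by
  intro χ
  have hd (χ : 𝓣) : Differentiable ℝ χ :=
    (show ContDiff ℝ ∞ χ by simpa using χ.contDiff).differentiable (by simp)
  have hz (χ : 𝓣) {z : ST n} (hz : z ∉ (slab n : Set (ST n))) : χ z = 0 :=
    image_eq_zero_of_notMem_tsupport fun h => hz (χ.tsupport_subset h)
  have hc (χ : 𝓣) : Continuous χ := (hd χ).continuous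
  have hi (χ χ' : 𝓣) : Integrable fun z => χ z * χ' z :=
    ((hc χ).mul (hc χ')).integrable_of_hasCompactSupport χ'.hasCompactSupport.mul_left
  have hb (χ χ' : 𝓣) : bil (tst χ) (tst χ') = ((∫ z, χ z * χ' z : ℝ) : ℂ) := by
    rw [bil_tst, ← integral_complex_ofReal]
    refine (integral_congr_ae (g := fun z => ((χ z * χ' z : ℝ) : ℂ)) ?_).trans
      (setIntegral_eq_integral_of_forall_compl_eq_zero fun z h => by simp [hz χ h])
    filter_upwards [coeFn_tst χ] with z h
    rw [h, ofReal_mul]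
  have key := integral_mul_fderiv_eq_neg_fderiv_mul_of_integrable (μ := (volume : Measure (ST n)))
    (f := ψ) (g := χ) (v := dir i) ((hi (dd i ψ) χ).congr (.of_forall fun z => by
      simp only [dd_apply]; rfl)) ((hi ψ (dd i χ)).congr (.of_forall fun z => by
      simp only [dd_apply]; rfl)) (hi ψ χ) (fun z _ => hd ψ z) (fun z _ => hd χ z)
  rw [hb, hb, ← Complex.ofReal_neg]
  simp only [dd_apply, pd]
  rw [key]

theorem weakEq_of_dual (h : Coef G B c k₀ CΓ) {k : ℕ} {p q : L2 n}
    (hpq : ∀ v F, WBox (G k) v F → bil p F = bil q v) :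
    WeakEq (G k) (fun _ _ => 0) (fun _ => 0) p q := by
  intro ψ
  have hj : Jet (tst ψ) (fun i => tst (dd i ψ)) (fun i j => tst (dd i (dd j ψ))) :=
    ⟨fun i => WD_tst i ψ, fun i j => WD_tst i _⟩
  rw [← hpq _ _ (hj.wBox h k)]
  simp only [ofReal_zero, mulOp_zero_fun, map_zero, zero_apply, Finset.sum_const_zero,
    add_zero, Lop, map_sum]
  simp only [bil_mulOp (BM_of_le (h.smooth k _ _).continuous (h.bound k _ _))]

section pieces

def lpS (n : ℕ) (k : ℕ) : 𝓢(Sp n, ℂ) := if k = 0 then lowS (Sp n) h else bandS (Sp n) h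

def LP (k : ℕ) : L2 n →L[ℂ] L2 n := Mop (lpS h n k) k

theorem scs_lpS (k : ℕ) (η : Sp n) :
    scs (lpS h n k) k η = (lpSymbol φ k (2 * π * ‖η‖) : ℂ) := by
  rcases k with _ | k
  · rw [lpS, if_pos rfl, scs_lowS, pow_zero, div_one]
  · rw [lpS, if_neg k.succ_ne_zero, scs, bandS_apply, norm_smul, lpSymbol,
      norm_of_nonneg (by positivity)]
    congr 2
    field_simp

theorem lpS_even (k : ℕ) (η : Sp n) : lpS h n k (-η) = lpS h n k η := by
  rw [lpS]; split_ifs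
  · exact lowS_even h η
  · rw [bandS_apply, bandS_apply, norm_neg]

theorem lpS_supp (k : ℕ) (η : Sp n) (hη : lpS h n k η ≠ 0) : 2 * π * ‖η‖ ≤ 2 ^ 1 := by
  by_contra! hlt
  rw [pow_one] at hlt
  apply hη
  rw [lpS]; split_ifs
  · rw [lowS_apply, lp0_zero h hlt.le, ofReal_zero]
  · rw [bandS_apply, profile_right h hlt.le, ofReal_zero]

theorem scs_lpS_lower {k : ℕ} (hk : 1 ≤ k) {η : Sp n} (hη : scs (lpS h n k) k η ≠ 0) :
    𝟚 ^ k ≤ 2 * (2 * π * ‖η‖) := by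
  by_contra! hlt
  obtain ⟨k, rfl⟩ := Nat.exists_eq_add_of_le' hk
  refine hη ?_
  rw [scs_lpS, lpSymbol, profile_left h, ofReal_zero]
  rw [div_le_iff₀ (by positivity)]
  linarith

theorem LP_low (k : ℕ) {K : ℕ} (hK : k + 1 ≤ K) (u : L2 n) :
    Mop (lowS (Sp n) h) K (LP h k u) = LP h k u :=
  Mop_lowS_Mop h (lpS_supp h k) hK u

theorem lpS_min (k : ℕ) (C : ℕ → ℝ) :
    lpS h n k = lpS h n (min k 1) ∧ C (min k 1) ≤ max (C 0) (C 1) := by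
  rcases k with _ | k <;> simp [lpS]

theorem exists_norm_LP_le : ∃ C : ℝ, 1 ≤ C ∧ ∀ k (u : L2 n), ‖LP h k u‖ ≤ C * ‖u‖ := by
  choose C h1 hC using fun m => exists_norm_Mop_dS_le (lpS h n m)
  refine ⟨max (C 0) (C 1), le_max_of_le_left (h1 0), fun k u => ?_⟩
  obtain ⟨e, hle⟩ := lpS_min (n := n) h k C
  rw [LP, e]
  exact (hC _ k u).1.trans (by gcongr)

theorem radialKernel_eq (k : ℕ) (y : Sp n) :
    radialKernel (lpSymbol φ k) y = ker (lpS h n k) k y := by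
  have e : (fun η : Sp n => (lpSymbol φ k (2 * π * ‖η‖) : ℂ)) = 𝓕 (ker (lpS h n k) k) := by
    funext η
    rw [← fourier_ker, scs_lpS]
  have hi : Integrable (𝓕 (ker (lpS h n k) k)) := by
    have : scs (lpS h n k) k = 𝓕 (ker (lpS h n k) k) := funext (fourier_ker _ _)
    rw [← this]
    exact (lpS h n k).integrable.comp_smul (R := (𝟚 ^ k)⁻¹) (by positivity)
  rw [radialKernel, e, (continuous_ker _ _).fourierInv_fourier_eq (integrable_ker _ _) hi]

theorem integral_lpProj (k : ℕ) (v w : L2 n) :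
    ∫ z, lpProj φ k v z * w z ∂ϖ = bil (LP h k v) w := by
  have e : radialKernel (lpSymbol φ k) = ker (lpS h n k) k := funext (radialKernel_eq h k)
  simp only [lpProj, e]
  rw [integral_conv_mul (integrable_ker _ _) (continuous_ker _ _).measurable, LP, bil_Mop]

theorem WBox.unique {g : Λ → Λ → ST n → ℝ} {v F F' : L2 n} (h : WBox g v F)
    (h' : WBox g v F') : F = F' :=
  eq_of_bil_tst fun ψ => (h ψ).symm.trans (h' ψ)

include h in
theorem exists_piece (hG : Coef G B c k₀ CΓ) : ∃ C : ℝ, 0 ≤ C ∧ ∀ k (v F : L2 n), WBox (G k) v F →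
    ∃ d e, Jet (LP h k v) d e ∧ (∀ i, ‖d i‖ ≤ C * (2 ^ k * ‖v‖ + (2 ^ k)⁻¹ * ‖F‖)) ∧
      ‖Lop (G k) e - LP h k F‖ ≤ C * (2 ^ k * ‖v‖ + (2 ^ k)⁻¹ * ‖F‖) := by
  have hB := hG.one_le
  have hB' : B ≤ (n + 1) * (n + 1) * (2 * B) := by
    have : (0 : ℝ) ≤ n := n.cast_nonneg
    nlinarith [mul_nonneg this this, mul_nonneg (mul_nonneg this this) (by linarith : 0 ≤ B),
      mul_nonneg this (by linarith : 0 ≤ B)]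
  choose C h0 hC using fun m => exists_jet (n := n) h (lpS_even h m) le_rfl (lpS_supp h m)
    (B := (n + 1) * (n + 1) * (2 * B)) (by positivity)
  refine ⟨max (C 0) (C 1), le_max_of_le_left (h0 0), fun k v F hv => ?_⟩
  obtain ⟨e, hle⟩ := lpS_min (n := n) h k C
  rw [LP, e]
  obtain ⟨d, f, h1, h2, h3⟩ := hC _ (G k) _ _ k v F (hG.cf k hB') (hG.lower k) (hv.weakEq hG)
  exact ⟨d, f, h1, fun i => (h2 i).trans (by gcongr), h3.trans (by gcongr)⟩

theorem norm_mulOp_LP_le {l : ℕ} (hl : 1 ≤ l) {u : L2 n} {d : Λ → L2 n}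
    {e : Λ → Λ → L2 n} (hj : Jet (LP h l u) d e) {a : ℝ → ℂ}
    (ha : BM fun z : ST n => a z.1) {N : ℝ}
    (hN : ∀ i, ‖mulOp (fun z => a z.1) (d i)‖ ≤ N) :
    ‖mulOp (fun z => a z.1) (LP h l u)‖ ≤ n * (2 * (2 ^ l)⁻¹ * N) := by
  set S : Set (Sp n) := {η | 𝟚 ^ l ≤ 2 * (2 * π * ‖η‖)} with hS
  have hSm : MeasurableSet S := measurableSet_le measurable_const (by fun_prop)
  set m : Fin n → Sp n → ℂ := fun j => S.indicator fun η =>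
    -I * ((η j / (2 * π * ‖η‖ ^ 2) : ℝ) : ℂ) with hm
  have hco (η : Sp n) (j : Fin n) : |η j| ≤ ‖η‖ := by
    simpa using EuclideanSpace.norm_eq η ▸ PiLp.norm_apply_le η j
  have hpos {η : Sp n} (hη : η ∈ S) : 0 < ‖η‖ := by
    have h1 : (0 : ℝ) < 2 ^ l := by positivity
    have h2 : 𝟚 ^ l ≤ 2 * (2 * π * ‖η‖) := hη
    have := pi_pos
    by_contra! h3
    nlinarith [mul_nonneg this.le (norm_nonneg η), norm_nonneg η]
  have hmb (j) (η) : ‖m j η‖ ≤ 2 * (𝟚 ^ l)⁻¹ := by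
    by_cases hη : η ∈ S
    · have h1 := hpos hη
      have h2 : 𝟚 ^ l ≤ 2 * (2 * π * ‖η‖) := hη
      have := pi_pos
      simp only [hm, indicator_of_mem hη, norm_mul, norm_neg, Complex.norm_I, one_mul,
        norm_real, norm_eq_abs, abs_div]
      rw [abs_of_pos (a := 2 * π * ‖η‖ ^ 2) (by positivity), ← div_eq_mul_inv,
        div_le_div_iff₀ (by positivity) (by positivity)]
      calc |η j| * 2 ^ l ≤ ‖η‖ * (2 * (2 * π * ‖η‖)) := by
            gcongr; exact hco η j
        _ = _ := by ring
    · simp only [hm, indicator_of_notMem hη, norm_zero]; positivity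
  have hmm (j) : BMs (m j) := ⟨Measurable.indicator (by fun_prop) hSm, _, hmb j⟩
  have hb (j : Fin n) : BMs fun η : Sp n => ((𝟚 ^ l : ℝ) : ℂ) * scs (dS j (lpS h n l)) l η :=
    (BMs.const _).mul (BMs_scs _ _)
  have hw : LP h l u = ∑ j, Mult (m j) (d j.succ) := by
    have hd (j : Fin n) : Mult (m j) (d j.succ) =
        Mult (fun η => m j η * (((𝟚 ^ l : ℝ) : ℂ) * scs (dS j (lpS h n l)) l η)) u := by
      rw [(hj.first j.succ).unique (WD_space j _ l u), Mop, ← Mult_const_mul (BMs_scs _ _),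
        Mult_Mult (hmm j) (hb j)]
    simp only [hd, Mult_apply, ← map_sum]
    rw [← mulOp_sum fun j => ((hmm j).mul (hb j)).bm, LP, Mop, Mult_apply]
    congr 2
    refine congrArg mulOp (funext fun z => ?_)
    simp only [scs_dS]
    by_cases h0 : scs (lpS h n l) l z.2 = 0
    · simp [h0]
    · have hη : z.2 ∈ S := scs_lpS_lower h hl h0
      have h1 := hpos hη
      have h2 : (‖z.2‖ : ℂ) ≠ 0 := by exact_mod_cast h1.ne'
      have e (j : Fin n) : m j z.2 * (2 * π * I * z.2 j * scs (lpS h n l) l z.2) =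
          ((z.2 j ^ 2 / ‖z.2‖ ^ 2 : ℝ) : ℂ) * scs (lpS h n l) l z.2 := by
        simp only [hm, indicator_of_mem hη]
        push_cast
        field_simp
        linear_combination (-(z.2.ofLp j : ℂ) ^ 2) * I_sq
      have : ∑ j, z.2 j ^ 2 / ‖z.2‖ ^ 2 = 1 := by
        rw [← Finset.sum_div, div_eq_one_iff_eq (by positivity), EuclideanSpace.norm_sq_eq]
        simp
      rw [sum_congr rfl fun j _ => e j, ← sum_mul, ← Complex.ofReal_sum, this]
      simp
  rw [hw, map_sum]
  refine (norm_sum_le_card (c := 2 * (2 ^ l)⁻¹ * N) fun j => ?_).trans (by simp)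
  rw [← Mult_mulOp_time (hmm j) ha]
  exact (norm_Mult_le (hmm j) (hmb j) _).trans (by gcongr; exact hN _)

end pieces

theorem exists_cutoff : ∃ C : ℝ, 0 ≤ C ∧ ∀ i : ℕ, ∃ (a : ℝ → ℝ) (r : ℝ) (A : Set ℝ),
    ContDiff ℝ ∞ a ∧ 0 ≤ r ∧ r < 1 ∧ (∀ t, a t ≠ 0 → |t| ≤ r) ∧ (∀ t, 0 ≤ a t ∧ a t ≤ 1) ∧
    MeasurableSet A ∧ volume A ≤ ofReal (4 * (2 ^ i)⁻¹) ∧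
    (∀ t ∈ Ioo (-1 : ℝ) 1, t ∉ A → a t = 1 ∧ deriv a t = 0) ∧ ∀ t, |deriv a t| ≤ C * 2 ^ i := by
  set σ := Real.smoothTransition
  have hσ : ContDiff ℝ ∞ σ := Real.smoothTransition.contDiff
  obtain ⟨M, hM⟩ := isCompact_Icc (a := (0 : ℝ)) (b := 1) |>.exists_bound_of_continuousOn
    (hσ.continuous_deriv (by simp)).continuousOn
  have hM0 : 0 ≤ M := (norm_nonneg _).trans (hM 0 (by simp))
  have c0 {x : ℝ} (h : x < 0) : deriv σ x = 0 :=
    ((eventuallyEq_of_mem (Iio_mem_nhds h) fun y (hy : y < 0) =>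
      Real.smoothTransition.zero_of_nonpos hy.le).deriv_eq).trans (deriv_const x (0 : ℝ))
  have c1 {x : ℝ} (h : 1 < x) : deriv σ x = 0 :=
    ((eventuallyEq_of_mem (Ioi_mem_nhds h) fun y (hy : 1 < y) =>
      Real.smoothTransition.one_of_one_le hy.le).deriv_eq).trans (deriv_const x (1 : ℝ))
  refine ⟨M * 2, ✓, fun i => ?_⟩
  have hd : (1 : ℝ) ≤ 2 ^ i := one_le_pow₀ one_le_two
  generalize 𝟚 ^ i = d at *
  have hdi : d * d⁻¹ = 1 := mul_inv_cancel₀ ✓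
  have hdi0 : 0 < d⁻¹ := inv_pos.2 ✓
  have e (t : ℝ) : HasDerivAt (fun t => σ (d * (1 - t ^ 2) - 1))
      (deriv σ (d * (1 - t ^ 2) - 1) * (d * -(2 * t))) t := by
    simpa [Function.comp_def] using (hσ.differentiable (by simp) _).hasDerivAt.comp t
      ((((hasDerivAt_pow 2 t).const_sub 1).const_mul d).sub_const 1)
  refine ⟨fun t => σ (d * (1 - t ^ 2) - 1), √(1 - d⁻¹), Icc (-1) (-1 + 2 * d⁻¹) ∪ Icc (1 - 2 * d⁻¹) 1,
    by fun_prop, sqrt_nonneg _, (Real.sqrt_lt' one_pos).2 ✓, fun t ht => Real.abs_le_sqrt ?_,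
    fun t => ⟨Real.smoothTransition.nonneg _, Real.smoothTransition.le_one _⟩,
    measurableSet_Icc.union measurableSet_Icc, ?_, fun t ht htA => ?_, fun t => ?_⟩
  · by_contra! h
    exact ht (Real.smoothTransition.zero_of_nonpos (by nlinarith))
  · refine (measure_union_le _ _).trans ?_
    rw [Real.volume_Icc, Real.volume_Icc, ← ENNReal.ofReal_add ✓ ✓]
    exact ofReal_le_ofReal ✓
  · simp only [mem_union, mem_Icc, not_or, not_and_or, not_le] at htA
    have e1 := htA.1.resolve_left (by linarith [ht.1])
    have e2 := htA.2.resolve_right (by linarith [ht.2])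
    have e3 : 1 < d * (1 - t ^ 2) - 1 := by
      have : t ^ 2 < 1 - 2 * d⁻¹ := by
        rcases le_total 0 t with h | h <;> nlinarith [ht.1, ht.2]
      nlinarith
    exact ⟨Real.smoothTransition.one_of_one_le e3.le, by rw [(e t).deriv, c1 e3, zero_mul]⟩
  · rw [(e t).deriv]
    by_cases hx : d * (1 - t ^ 2) - 1 ∈ Icc (0 : ℝ) 1
    · rw [abs_mul, mul_assoc]
      refine mul_le_mul (hM _ hx) ?_ (abs_nonneg _) hM0
      have : |t| ≤ 1 := (sq_le_one_iff_abs_le_one t).1 (by nlinarith [hx.1])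
      rw [abs_mul, abs_neg, abs_mul, abs_two, abs_of_pos ✓]
      nlinarith
    · have : deriv σ (d * (1 - t ^ 2) - 1) = 0 := by
        rcases lt_or_ge (d * (1 - t ^ 2) - 1) 0 with h | h
        · exact c0 h
        · exact c1 (not_le.1 fun h' => hx ⟨h, h'⟩)
      rw [this, zero_mul, abs_zero]; positivity

theorem norm_bil_Lop_le {g : Λ → Λ → ST n → ℝ}
    {k K : ℕ} {B : ℝ} (hg : Cf g k B) {a : ℝ → ℝ} (ha : ContDiff ℝ ∞ a) {r : ℝ} (hr0 : 0 ≤ r)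
    (hr1 : r < 1) (hr : ∀ t, a t ≠ 0 → |t| ≤ r) (ha1 : ∀ t, |a t| ≤ 1) (hda : BM (ℭₜ (deriv a)))
    {v w : L2 n} {dv dw : Λ → L2 n} {ev ew : Λ → Λ → L2 n}
    (hv : Jet v dv ev) (hw : Jet w dw ew) (hloc : Mop (lowS (Sp n) h) K w = w)
    {V W N₀ N₁ : ℝ} (hV : ∀ i, ‖dv i‖ ≤ V) (hW : ∀ i, ‖dw i‖ ≤ W)
    (h0 : ‖mulOp (ℭₜ (deriv a)) w‖ ≤ N₀)
    (h1 : ∀ i, ‖mulOp (ℭₜ (deriv a)) (dw i)‖ ≤ N₁) :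
    ‖bil (mulOp (ℭₜ a) (Lop g ev)) w‖ ≤
      (n + 1) * (n + 1) * (B * (V * N₀ + V * ‖w‖ + ‖v‖ * N₁ + ‖v‖ * W)) + ‖v‖ * ‖Lop g ew‖ := by
  have hB := hg.nonneg
  have hV0 : 0 ≤ V := (norm_nonneg _).trans (hV 0)
  have ham := BM_time (n := n) ha.continuous hr
  have hgm (i j) := BM_of_le (hg.smooth i j).continuous (hg.bound i j)
  have hgd (i j a) := BM_pd (hg.smooth i j) (hg.bound_pd i j a)
  set M := mulOp (ℭₜ a)
  set Mi : Λ → L2 n →L[ℂ] L2 n := fun i =>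
    mulOp (fun z : ST n => ((if i = 0 then deriv a z.1 else 0 : ℝ) : ℂ)) with hMi
  have hMi' (i) (x y : L2 n) {N : ℝ} (hN : ‖mulOp (ℭₜ (deriv a)) y‖ ≤ N) :
      ‖bil (Mi i x) y‖ ≤ ‖x‖ * N := by
    have hN0 : 0 ≤ N := (norm_nonneg _).trans hN
    by_cases hi : i = 0
    · simp only [hMi, hi, if_true]
      rw [bil_mulOp hda]
      exact (norm_bil_le _ _).trans (by gcongr)
    · simp only [hMi, hi, if_false, ofReal_zero, mulOp_zero_fun, map_zero, zero_apply,
        norm_zero]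
      positivity
  have hMn (x y : L2 n) : ‖bil (M x) y‖ ≤ ‖x‖ * ‖y‖ := by
    refine (norm_bil_le _ _).trans ?_
    gcongr
    simpa using norm_mulOp_le ham (C := 1) (fun z => by simpa using ha1 z.1) x
  have hgn (i j) (x : L2 n) : ‖mulOp (ℭ (g i j)) x‖ ≤ B * ‖x‖ :=
    norm_mulOp_real_le (hg.smooth i j).continuous (hg.bound i j) x
  have hgn' (i j a) (x : L2 n) : ‖mulOp (ℭ (pd a (g i j))) x‖ ≤ B * ‖x‖ :=
    norm_mulOp_real_le (continuous_pd (hg.smooth i j) a) (hg.bound_pd i j a) x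
  have key (i j) : bil (M (mulOp (ℭ (g i j)) (ev i j))) w =
      (-bil (Mi i (mulOp (ℭ (g i j)) (dv j))) w
        - bil (M (mulOp (ℭ (pd i (g i j))) (dv j))) w
        + bil (Mi j (mulOp (ℭ (g i j)) v)) (dw i)
        + bil (M (mulOp (ℭ (pd j (g i j))) v)) (dw i))
        + bil (M v) (mulOp (ℭ (g i j)) (ew i j)) := by
    have g1 := green h ha hr0 hr1 hr ((hv.second i j).mulOp (hg.smooth i j) (hgm i j) (hgd i j i))
      (hw.first i) hloc
    have g2 := green h ha hr0 hr1 hr ((hv.first j).mulOp (hg.smooth i j) (hgm i j) (hgd i j j))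
      (hw.second j i) (hw.loc h hloc i)
    rw [map_add, map_add, add_apply] at g1 g2
    rw [← bil_mulOp (hgm i j), mulOp_comm (hgm i j) ham, hw.comm]
    linear_combination g1 - g2
  have e : bil (M (Lop g ev)) w = ∑ i, ∑ j,
      (-bil (Mi i (mulOp (ℭ (g i j)) (dv j))) w
        - bil (M (mulOp (ℭ (pd i (g i j))) (dv j))) w
        + bil (Mi j (mulOp (ℭ (g i j)) v)) (dw i)
        + bil (M (mulOp (ℭ (pd j (g i j))) v)) (dw i)) + bil (M v) (Lop g ew) := by
    simp only [Lop, map_sum, FunLike.coe_sum, Finset.sum_apply, key, sum_add_distrib]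
  rw [e]
  refine norm_add_le_of_le ?_ (hMn _ _)
  have hN0 : 0 ≤ N₀ := (norm_nonneg _).trans h0
  have hN1 : 0 ≤ N₁ := (norm_nonneg _).trans (h1 0)
  refine (norm_sum_le _ _).trans ((sum_le_card_nsmul _ _ _ fun i _ =>
    (norm_sum_le _ _).trans (sum_le_card_nsmul _ _
      (B * (V * N₀ + V * ‖w‖ + ‖v‖ * N₁ + ‖v‖ * W)) fun j _ => ?_)).trans ?_)
  · refine (norm_add_le _ _).trans ?_
    have t1 := (hMi' i (mulOp (ℭ (g i j)) (dv j)) w h0).trans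
      (mul_le_r ((hgn i j _).trans (mul_le_l (hV j) hB)) hN0)
    have t2 := (hMn (mulOp (ℭ (pd i (g i j))) (dv j)) w).trans
      (mul_le_r ((hgn' i j i _).trans (mul_le_l (hV j) hB))
        (norm_nonneg w))
    have t3 := (hMi' j (mulOp (ℭ (g i j)) v) (dw i) (h1 i)).trans
      (mul_le_r (hgn i j _) hN1)
    have t4 := (hMn (mulOp (ℭ (pd j (g i j))) v) (dw i)).trans
      (mul_le_mul (hgn' i j j _) (hW i) (norm_nonneg _) (by positivity))
    have t5 := norm_add_le (-bil (Mi i (mulOp (ℭ (g i j)) (dv j))) w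
        - bil (M (mulOp (ℭ (pd i (g i j))) (dv j))) w)
        (bil (Mi j (mulOp (ℭ (g i j)) v)) (dw i))
    have t6 := norm_sub_le (-bil (Mi i (mulOp (ℭ (g i j)) (dv j))) w)
        (bil (M (mulOp (ℭ (pd i (g i j))) (dv j))) w)
    rw [norm_neg] at t6
    linarith
  · simp only [Finset.card_univ, Fintype.card_fin, nsmul_eq_mul]
    push_cast
    exact le_of_eq (by ring)

set_option maxHeartbeats 1000000 in
theorem exists_pairing
    (hG : Coef G B c k₀ CΓ) : ∃ C : ℝ, 0 ≤ C ∧ ∀ k l i j, k ≤ l + 4 → (l ≠ 0 → k ≤ l + 3) → l ≤ k + 3 →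
      i ≤ k → j ≤ l →
      ∀ f F E u U : L2 n, WBox (G k) f F → WBox (G k) (LP h k f) E → WBox (G l) u U → ∀ X Y : ℝ,
      2 ^ k * 2 ^ i * ‖f‖ ≤ X → ‖F‖ ≤ X → ‖u‖ ≤ Y → ‖U‖ ≤ 2 ^ l * 2 ^ j * Y →
      ‖bil E (LP h l u)‖ ≤ C * (X * Y) ∧
      ‖bil E (LP h l u)‖ ≤ C * (√(2 ^ j) / √(2 ^ i) * (X * Y)) := by
  obtain ⟨C1, hC1, H1⟩ := exists_piece h hG
  obtain ⟨CP, hCP, HP⟩ := exists_norm_LP_le (n := n) h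
  obtain ⟨CE, hCE, HE⟩ := exists_energy n h hG.one_le hG.pos
  obtain ⟨CK, hCK, HK⟩ := exists_key h hG 1
  obtain ⟨Cχ, hCχ, Hχ⟩ := exists_cutoff
  have hB := hG.one_le
  set P := CP + 2 * C1 with hP
  have hP0 : 1 ≤ P := by linarith
  set Q := √(4 * CE) * (2 * P) with hQ
  have hQ0 : 0 ≤ Q := by positivity
  set T := P * (n * (2 * Q)) + (n + 1) * (n + 1) * (B * (2 * C1 * (Cχ * (n * (2 * Q)))
    + 2 * C1 * CP + 8 * CP * (Cχ * Q) + 8 * CP * (2 * C1))) + 8 * CP * (P + CK * (2 * P)) with hT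
  have hT0 : 0 ≤ T := by positivity
  clear_value P Q T
  refine ⟨P * CP * 2 ^ (k₀ + 4) + T, by positivity, ?_⟩
  intro k l i j hkl' hkl hlk hik hjl f F E u U hf hE hu X Y hfX hFX huY hUY
  obtain ⟨dv, ev, jv, hdv, hLv⟩ := H1 k f F hf
  obtain ⟨dw, ew, jw, hdw, hLw⟩ := H1 l u U hu
  obtain rfl : E = Lop (G k) ev := hE.unique (jv.wBox hG k)
  set w := LP h l u
  set v := LP h k f
  have hX : 0 ≤ X := (norm_nonneg _).trans hFX
  have hY : 0 ≤ Y := (norm_nonneg _).trans huY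
  set lam : ℝ := 2 ^ k with hlamd
  set mu : ℝ := 2 ^ l with hmud
  set α := √(𝟚 ^ i) with hα
  set β := √(𝟚 ^ j) with hβ
  have hα2 : α ^ 2 = 2 ^ i := sq_sqrt (by positivity)
  have hβ2 : β ^ 2 = 2 ^ j := sq_sqrt (by positivity)
  have hα1 : 1 ≤ α := Real.one_le_sqrt.2 (one_le_pow₀ one_le_two)
  have hβ1 : 1 ≤ β := Real.one_le_sqrt.2 (one_le_pow₀ one_le_two)
  rw [← hα2] at hfX
  rw [← hβ2] at hUY
  have hlam : 0 < lam := by positivity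
  have hmu : 0 < mu := by positivity
  have hal : α ^ 2 ≤ lam := hα2.trans_le (pow_le_pow_right₀ one_le_two hik)
  have hbm : β ^ 2 ≤ mu := hβ2.trans_le (pow_le_pow_right₀ one_le_two hjl)
  have hml : mu ≤ 8 * lam := by
    calc mu ≤ 2 ^ (k + 3) := pow_le_pow_right₀ one_le_two hlk
      _ = 8 * lam := by rw [pow_add]; ring
  have hα0 : 0 < α := by linarith
  clear_value lam mu α β
  obtain ⟨x, hXx⟩ : ∃ x, X = α ^ 2 * x := ⟨X / α ^ 2, by field_simp⟩
  obtain ⟨y, hYy⟩ : ∃ y, Y = α * y := ⟨Y / α, by field_simp⟩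
  have hx : 0 ≤ x := (mul_nonneg_iff_of_pos_left ✓).1 (hXx ▸ hX)
  have hy : 0 ≤ y := (mul_nonneg_iff_of_pos_left hα0).1 (hYy ▸ hY)
  have hfX' : lam * ‖f‖ ≤ x := le_of_mul_le_mul_left (by linarith) (by positivity : 0 < α ^ 2)
  set V := 2 * C1 * x with hV
  have hdv' : C1 * (lam * ‖f‖ + lam⁻¹ * ‖F‖) ≤ V := by
    have : lam⁻¹ * ‖F‖ ≤ x := (inv_mul_le_iff₀ hlam).2 (hFX.trans (by rw [hXx]; gcongr))
    calc _ ≤ C1 * (x + x) := by gcongr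
      _ = _ := by ring
  have hV0 : 0 ≤ V := ✓
  clear_value V
  have hEX : ‖Lop (G k) ev‖ ≤ P * X := by
    calc _ ≤ ‖Lop (G k) ev - LP h k F‖ + ‖LP h k F‖ := norm_le_norm_sub_add _ _
      _ ≤ V + CP * X := add_le_add (hLv.trans hdv') ((HP k F).trans (by gcongr))
      _ ≤ 2 * C1 * X + CP * X := by
        rw [hV, hXx]; gcongr; exact le_mul_of_one_le_left hx (one_le_pow₀ hα1)
      _ = _ := by rw [hP]; ring
  have hvX : ‖v‖ * mu ≤ 8 * CP * x := by
    calc _ ≤ CP * ‖f‖ * (8 * lam) := by gcongr; exact HP k f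
      _ = 8 * CP * (lam * ‖f‖) := by ring
      _ ≤ _ := by gcongr
  have hwY : ‖w‖ ≤ CP * Y := (HP l u).trans (by gcongr)
  set W := 2 * C1 * (mu * Y) with hW
  have hdw' : C1 * (mu * ‖u‖ + mu⁻¹ * ‖U‖) ≤ W := by
    have : mu⁻¹ * ‖U‖ ≤ mu * Y := by
      calc _ ≤ mu⁻¹ * (mu * β ^ 2 * Y) := by gcongr
        _ = β ^ 2 * Y := by field_simp
        _ ≤ _ := by gcongr
    calc _ ≤ C1 * (mu * Y + mu * Y) := by gcongr
      _ = _ := by ring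
  have hLY : ‖Lop (G l) ew‖ ≤ P * (mu * β ^ 2 * Y) := by
    have : mu * 1 * Y ≤ mu * β ^ 2 * Y := by gcongr; exact one_le_pow₀ hβ1
    calc _ ≤ ‖Lop (G l) ew - LP h l U‖ + ‖LP h l U‖ := norm_le_norm_sub_add _ _
      _ ≤ 2 * C1 * (mu * 1 * Y) + CP * (mu * β ^ 2 * Y) := add_le_add ((hLw.trans hdw').trans
        (by rw [hW, mul_one])) ((HP l U).trans (by gcongr))
      _ ≤ 2 * C1 * (mu * β ^ 2 * Y) + CP * (mu * β ^ 2 * Y) := by gcongr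
      _ = _ := by rw [hP]; ring
  have hW0 : 0 ≤ W := by positivity
  clear_value W
  have hKK : W ^ 2 + W * ‖Lop (G l) ew‖ ≤ (2 * P * (mu * β * Y)) ^ 2 := by
    have hWP : W ≤ P * (mu * Y) := by rw [hW]; gcongr; linarith
    have e1 : mu * Y ≤ mu * β * Y := by
      rw [mul_right_comm]; exact le_mul_of_one_le_right (by positivity) hβ1
    calc _ ≤ (P * (mu * Y)) ^ 2 + P * (mu * Y) * (P * (mu * β ^ 2 * Y)) := by gcongr
      _ = (P * (mu * Y)) ^ 2 + (P * (mu * β * Y)) ^ 2 := by ring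
      _ ≤ (P * (mu * β * Y)) ^ 2 + (P * (mu * β * Y)) ^ 2 := by gcongr
      _ ≤ 4 * (P * (mu * β * Y)) ^ 2 := by linarith [sq_nonneg (P * (mu * β * Y))]
      _ = _ := by ring
  have first : ‖bil (Lop (G k) ev) w‖ ≤ P * CP * (X * Y) := by
    refine (norm_bil_le _ _).trans ?_
    calc _ ≤ P * X * (CP * Y) := by gcongr
      _ = _ := by ring
  have h8 : (1 : ℝ) ≤ 2 ^ (k₀ + 4) := one_le_pow₀ one_le_two
  have hPC : 0 ≤ P * CP * (X * Y) := by positivity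
  have hβ0 : 0 < β := by linarith
  refine ⟨first.trans ?_, ?_⟩
  · exact mul_le_r (le_add_of_le_of_nonneg (le_mul_of_one_le_right
      (by positivity) h8) hT0) (by positivity)
  have hR0 : 0 ≤ β / α * (X * Y) := ✓
  by_cases hsmall : l < k₀ ∨ l = 0 ∨ α < β
  · have : 1 ≤ 2 ^ (k₀ + 4) * (β / α) := by
      rw [← mul_div_assoc, one_le_div hα0]
      have c1 (hs : l ≤ k₀) : α ≤ 2 ^ (k₀ + 4) * β := by
        calc α ≤ α ^ 2 := le_self_pow₀ hα1 two_ne_zero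
          _ = 2 ^ i := hα2
          _ ≤ 2 ^ (k₀ + 4) := pow_le_pow_right₀ one_le_two (by omega)
          _ ≤ _ := le_mul_of_one_le_right (by positivity) hβ1
      rcases hsmall with hs | hs | hs
      · exact c1 hs.le
      · exact c1 (hs ▸ k₀.zero_le)
      · exact hs.le.trans (le_mul_of_one_le_left hβ0.le h8)
    calc _ ≤ P * CP * (X * Y) * 1 := by rw [mul_one]; exact first
      _ ≤ P * CP * (X * Y) * (2 ^ (k₀ + 4) * (β / α)) := by gcongr
      _ = P * CP * 2 ^ (k₀ + 4) * (β / α * (X * Y)) := by ring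
      _ ≤ _ := by gcongr; linarith
  push Not at hsmall
  obtain ⟨hl0, hl1, hba⟩ := hsmall
  obtain ⟨a, r, A, ha, hr0, hr1, hr, ha1, hAm, hA, haA, hda⟩ := Hχ i
  have hloc : Mop (lowS (Sp n) h) (l + 1) w = w := LP_low h l le_rfl u
  have hdwW (i) : ‖dw i‖ ≤ W := (hdw i).trans hdw'
  set N := Q * (mu * β * y) with hN
  set I : L2 n →L[ℂ] L2 n := mulOp fun z : ST n => A.indicator (fun _ => (1 : ℂ)) z.1
  have hI (m) : ‖I (dw m)‖ ≤ N := by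
    have h1 : ‖I (dw m)‖ₑ ^ 2 ≤ ofReal (N ^ 2) := by
      rw [← tm_apply _ hAm]
      refine (HE (G l) l _ (hG.cf l le_rfl) (hG.hyperbolic l hl0) w dw ew jw hloc W hdwW m A).trans ?_
      rw [Measure.smul_apply, smul_eq_mul]
      refine (mul_le_mul' le_rfl hA).trans ?_
      rw [← ENNReal.ofReal_mul (by positivity)]
      refine ofReal_le_ofReal ?_
      calc _ ≤ CE * (2 * P * (mu * β * Y)) ^ 2 * (4 * (2 ^ i)⁻¹) := by gcongr
        _ = _ := by
          have hs := sq_sqrt (show 0 ≤ 4 * CE by positivity)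
          rw [hN, hQ, ← hα2, hYy, show (√(4 * CE) * (2 * P) * (mu * β * y)) ^ 2 =
            √(4 * CE) ^ 2 * (2 * P * (mu * β * y)) ^ 2 by ring, hs]
          field_simp
    exact (enorm_le_of_sq (sq_nonneg _) h1).trans (sqrt_sq (by positivity)).le
  have hIw : ‖I w‖ ≤ n * (2 * Q) * (β * y) := by
    refine (norm_mulOp_LP_le h (Nat.one_le_iff_ne_zero.2 hl1) jw (BM_indicator hAm) hI).trans
      (le_of_eq ?_)
    rw [hN, ← hmud]; field_simp
  have hslab : ∀ᵐ z ∂ϖ, z.1 ∈ Ioo (-1 : ℝ) 1 :=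
    (ae_restrict_mem measurableSet_slab).mono fun z hz => hz.1
  have hb (b : ℝ → ℝ) (hbm : BM (ℭₜ b)) (D : ℝ) (hD : ∀ t, |b t| ≤ D)
      (h0 : ∀ t ∈ Ioo (-1 : ℝ) 1, t ∉ A → b t = 0) (x : L2 n) :
      ‖mulOp (ℭₜ b) x‖ ≤ D * ‖I x‖ := by
    refine norm_mulOp_le_of_ae hbm ?_
    filter_upwards [hslab, coeFn_mulOp (BM_indicator hAm) x] with z hz hzI
    rw [hzI]
    by_cases hzA : z.1 ∈ A
    · rw [indicator_of_mem hzA, one_mul, norm_mul, norm_real]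
      gcongr; exact hD _
    · simp [h0 z.1 hz hzA, indicator_of_notMem hzA]
  have hdm : BM (ℭₜ (deriv a)) :=
    BM_of_le ((ha.continuous_deriv (by simp)).comp continuous_fst) fun z => hda z.1
  have ham := BM_time (n := n) ha.continuous hr
  have hI0 := hb (deriv a) hdm _ hda fun t ht htA => (haA t ht htA).2
  have key := norm_bil_Lop_le h (hG.cf k le_rfl) ha hr0 hr1 hr (fun t => abs_le.2
    ⟨by linarith [(ha1 t).1], (ha1 t).2⟩) hdm jv jw hloc (V := V) (W := W)
    (N₀ := Cχ * 2 ^ i * (n * (2 * Q) * (β * y))) (N₁ := Cχ * 2 ^ i * N)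
    (fun i => (hdv i).trans hdv') hdwW ((hI0 w).trans (by gcongr))
    fun m => (hI0 _).trans (by gcongr; exact hI m)
  have hone : BM fun z : ST n => ((1 - a z.1 : ℝ) : ℂ) := by
    push_cast; exact (BM.const 1).sub ham
  have hcut := hb (fun t => 1 - a t) hone 1 (fun t => abs_le.2
    ⟨by linarith [(ha1 t).2], by linarith [(ha1 t).1]⟩)
    (fun t ht htA => by rw [(haA t ht htA).1, sub_self]) w
  have hsplit : bil (Lop (G k) ev) w = bil (Lop (G k) ev) (mulOp (fun z : ST n => ((1 - a z.1 : ℝ) : ℂ)) w)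
      + bil (mulOp (ℭₜ a) (Lop (G k) ev)) w := by
    rw [bil_mulOp ham, ← map_add]
    congr 1
    have : (fun z : ST n => ((1 - a z.1 : ℝ) : ℂ)) = fun z => (1 : ℂ) - (a z.1 : ℂ) := by
      funext z; push_cast; rfl
    rw [this, mulOp_sub (BM.const 1) ham, mulOp_const, one_smul, sub_add_cancel]
  have hkey2 := HK l k (hkl hl1) hlk w dw ew jw hloc W hdwW
  have hLk : ‖Lop (G k) ew‖ ≤ (P + CK * (2 * P)) * (mu * (β ^ 2 * Y)) := by
    have e1 : sqrt (W ^ 2 + W * ‖Lop (G l) ew‖) ≤ 2 * P * (mu * β * Y) :=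
      (Real.sqrt_le_sqrt hKK).trans (sqrt_sq (by positivity)).le
    have e2 : ‖Lop (G k) ew‖ ≤ ‖Lop (G l) ew‖ + ‖Lop (G l) ew - Lop (G k) ew‖ := by
      have := norm_sub_norm_le (Lop (G k) ew) (Lop (G l) ew)
      rw [norm_sub_rev] at this; linarith
    have e3 : mu * β * Y ≤ mu * (β ^ 2 * Y) := by
      have : β ≤ β ^ 2 := le_self_pow₀ hβ1 two_ne_zero
      rw [mul_assoc]; gcongr
    calc _ ≤ P * (mu * β ^ 2 * Y) + CK * (2 * P * (mu * β * Y)) := by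
          refine e2.trans (add_le_add hLY (hkey2.trans ?_)); gcongr
      _ ≤ P * (mu * (β ^ 2 * Y)) + CK * (2 * P * (mu * (β ^ 2 * Y))) := by
          rw [mul_assoc mu]; gcongr
      _ = _ := by ring
  have hR : β / α * (X * Y) = α ^ 2 * β * (x * y) := by rw [hXx, hYy]; field_simp
  have hxy := mul_nonneg hx hy
  have q1 : α ≤ α ^ 2 * β := by
    linarith only [mul_le_l (one_le_mul_of_one_le_of_one_le hα1 hβ1) hα0.le]
  have q2 : β ^ 2 * α ≤ α ^ 2 * β := by linarith only [mul_le_l hba (mul_pos hα0 hβ0).le]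
  have s1 : V * ‖w‖ ≤ 2 * C1 * CP * (α ^ 2 * β * (x * y)) := by
    calc _ ≤ 2 * C1 * x * (CP * Y) := by rw [hV]; gcongr
      _ = 2 * C1 * CP * (α * (x * y)) := by rw [hYy]; ring
      _ ≤ _ := by gcongr
  have s2 : ‖v‖ * (Cχ * 2 ^ i * N) ≤ 8 * CP * (Cχ * Q) * (α ^ 2 * β * (x * y)) := by
    calc _ = ‖v‖ * mu * (Cχ * α ^ 2 * (Q * (β * y))) := by rw [hN, hα2]; ring
      _ ≤ 8 * CP * x * (Cχ * α ^ 2 * (Q * (β * y))) := by gcongr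
      _ = _ := by ring
  have s3 : ‖v‖ * W ≤ 8 * CP * (2 * C1) * (α ^ 2 * β * (x * y)) := by
    calc _ = ‖v‖ * mu * (2 * C1 * Y) := by rw [hW]; ring
      _ ≤ 8 * CP * x * (2 * C1 * Y) := by gcongr
      _ = 8 * CP * (2 * C1) * (α * (x * y)) := by rw [hYy]; ring
      _ ≤ _ := by gcongr
  have s4 : ‖v‖ * ‖Lop (G k) ew‖ ≤ 8 * CP * (P + CK * (2 * P)) * (α ^ 2 * β * (x * y)) := by
    calc _ ≤ ‖v‖ * ((P + CK * (2 * P)) * (mu * (β ^ 2 * Y))) := by gcongr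
      _ = ‖v‖ * mu * ((P + CK * (2 * P)) * (β ^ 2 * Y)) := by ring
      _ ≤ 8 * CP * x * ((P + CK * (2 * P)) * (β ^ 2 * Y)) := by gcongr
      _ = 8 * CP * (P + CK * (2 * P)) * (β ^ 2 * α * (x * y)) := by rw [hYy]; ring
      _ ≤ _ := by gcongr
  calc ‖bil (Lop (G k) ev) w‖ ≤ ‖Lop (G k) ev‖ * ‖I w‖ + _ := by
        rw [hsplit]
        refine norm_add_le_of_le ((norm_bil_le _ _).trans ?_) key
        rw [one_mul] at hcut
        gcongr
    _ ≤ P * X * (n * (2 * Q) * (β * y)) + ((n + 1) * (n + 1) * (B *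
      (2 * C1 * x * (Cχ * α ^ 2 * (n * (2 * Q) * (β * y))) + 2 * C1 * CP * (α ^ 2 * β * (x * y)) +
      8 * CP * (Cχ * Q) * (α ^ 2 * β * (x * y)) + 8 * CP * (2 * C1) * (α ^ 2 * β * (x * y)))) +
      8 * CP * (P + CK * (2 * P)) * (α ^ 2 * β * (x * y))) := by
        rw [hα2, ← hV]; rw [hα2] at s1 s2 s3 s4; gcongr
    _ = T * (β / α * (X * Y)) := by rw [hR, hT, hXx]; ring
    _ ≤ _ := by gcongr; exact le_add_of_nonneg_left ✓

def wt (z : ST n) : ℝ := 1 + (2 * π * ‖z.2‖) ^ 2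

theorem one_le_wt (z : ST n) : 1 ≤ wt z := le_add_of_nonneg_right (sq_nonneg _)

theorem wt_pos (z : ST n) : 0 < wt z := zero_lt_one.trans_le (one_le_wt z)

theorem measurable_wt_rpow (ρ : ℝ) : Measurable fun z : ST n => ((wt z ^ ρ : ℝ) : ℂ) :=
  Complex.measurable_ofReal.comp (Measurable.pow_const (by unfold wt; fun_prop) ρ)

def lap : 𝓣 →L[ℝ] 𝓣 :=
  ContinuousLinearMap.id ℝ _ - ∑ j : Fin n,
    (TestFunction.lineDerivCLM (n := ⊤) (k := ⊤) ℝ (dir j.succ : ST n)).comp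
    (TestFunction.lineDerivCLM (n := ⊤) (k := ⊤) ℝ (dir j.succ : ST n))

theorem lap_apply (ψ : 𝓣) : lap ψ = ψ - ∑ j : Fin n, dd j.succ (dd j.succ ψ) := by
  simp [lap]; rfl

theorem trT_lap (y : Sp n) (ψ : 𝓣) : lap (trT y ψ) = trT y (lap ψ) := by
  have hs : trT y (∑ j : Fin n, dd j.succ (dd j.succ ψ)) = ∑ j : Fin n, trT y (dd j.succ (dd j.succ ψ)) := by
    ext z
    simp [trT_apply]
  rw [lap_apply, lap_apply]
  simp only [dd_trT]
  rw [← hs]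
  ext z
  simp [trT_apply]

theorem ae_sum {ι : Type*} (s : Finset ι) {x : ι → L2 n} {f : ι → ST n → ℂ}
    (h : ∀ i, x i =ᵐ[ϖ] f i) : (∑ i ∈ s, x i : L2 n) =ᵐ[ϖ] fun z => ∑ i ∈ s, f i z := by
  induction s using Finset.cons_induction with
  | empty => exact (Lp.coeFn_zero ℂ 2 ϖ).trans (.of_forall fun z => by simp)
  | cons a s ha ih =>
    simp only [Finset.sum_cons]
    filter_upwards [Lp.coeFn_add (x a) (∑ i ∈ s, x i), ih, h a] with z h1 h2 h3
    rw [h1, Pi.add_apply, h2, h3]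

theorem U0_tst_lap (ψ : 𝓣) :
    U0 (tst (lap ψ)) =ᵐ[ϖ] fun z => (wt z : ℂ) * U0 (tst ψ) z := by
  rw [lap_apply, map_sub, map_sub, map_sum, map_sum]
  have h1 (j : Fin n) : U0 (tst (dd j.succ (dd j.succ ψ))) =ᵐ[ϖ]
      fun z => -((2 * π * z.2 j : ℝ) : ℂ) ^ 2 * U0 (tst ψ) z := by
    filter_upwards [U0_tst_dd j (dd j.succ ψ), U0_tst_dd j ψ] with z a b
    rw [a, b]
    push_cast
    linear_combination ((2 * π * z.2 j : ℂ) ^ 2 * U0 (tst ψ) z) * I_sq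
  filter_upwards [Lp.coeFn_sub (U0 (tst ψ)) (∑ j : Fin n, U0 (tst (dd j.succ (dd j.succ ψ)))),
    ae_sum Finset.univ h1] with z a b
  rw [a, Pi.sub_apply, b, ← sum_mul, Finset.sum_neg_distrib, wt]
  have : (2 * π * ‖z.2‖) ^ 2 = ∑ j, (2 * π * z.2 j) ^ 2 := by
    rw [mul_pow, EuclideanSpace.norm_sq_eq, mul_sum]
    simp [mul_pow]
  rw [this]
  push_cast
  ring

theorem U0_tst_lap_pow (N : ℕ) (ψ : 𝓣) :
    U0 (tst ((lap ^ N) ψ)) =ᵐ[ϖ] fun z => (wt z : ℂ) ^ N * U0 (tst ψ) z := by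
  induction N generalizing ψ with
  | zero => exact .of_forall fun z => by simp
  | succ N ih =>
    rw [pow_succ]
    filter_upwards [ih (lap ψ), U0_tst_lap ψ] with z a b
    change U0 (tst ((lap ^ N) (lap ψ))) z = _
    rw [a, b]; ring

theorem trT_lap_pow (y : Sp n) (N : ℕ) (ψ : 𝓣) :
    (lap ^ N) (trT y ψ) = trT y ((lap ^ N) ψ) := by
  induction N generalizing ψ with
  | zero => simp
  | succ N ih =>
    rw [pow_succ]
    change (lap ^ N) (lap (trT y ψ)) = trT y ((lap ^ N) (lap ψ))
    rw [trT_lap, ih]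

theorem norm_wt_rpow_le {ρ : ℝ} (h : ρ ≤ 0) (z : ST n) : ‖((wt z ^ ρ : ℝ) : ℂ)‖ ≤ 1 := by
  rw [norm_real, norm_of_nonneg (Real.rpow_nonneg (wt_pos z).le _)]
  exact Real.rpow_le_one_of_one_le_of_nonpos (one_le_wt z) h

theorem BM_wt {ρ : ℝ} (h : ρ ≤ 0) : BM fun z : ST n => ((wt z ^ ρ : ℝ) : ℂ) :=
  ⟨measurable_wt_rpow ρ, 1, norm_wt_rpow_le h⟩

def Wt (ρ : ℝ) (ψ : 𝓣) : L2 n :=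
  mulOp (fun z => ((wt z ^ (ρ - ⌈ρ⌉₊) : ℝ) : ℂ)) (U0 (tst ((lap ^ ⌈ρ⌉₊) ψ)))

theorem sub_ceil_nonpos (ρ : ℝ) : ρ - ⌈ρ⌉₊ ≤ 0 := sub_nonpos.2 (Nat.le_ceil ρ)

theorem coeFn_Wt (ρ : ℝ) (ψ : 𝓣) :
    Wt ρ ψ =ᵐ[ϖ] fun z => ((wt z ^ ρ : ℝ) : ℂ) * U0 (tst ψ) z := by
  filter_upwards [coeFn_mulOp (BM_wt (sub_ceil_nonpos ρ)) (U0 (tst ((lap ^ ⌈ρ⌉₊) ψ))),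
    U0_tst_lap_pow ⌈ρ⌉₊ ψ] with z a b
  rw [Wt, a, b, ← mul_assoc, ← Complex.ofReal_pow, ← ofReal_mul, ← rpow_natCast,
    ← rpow_add (wt_pos z), sub_add_cancel]

theorem bil_Wt {ρ : ℝ} {Θ : ST n → ℂ} (h : BM Θ) (h' : BM fun z => ((wt z ^ ρ : ℝ) : ℂ) * Θ z)
    (Y : L2 n) (ψ : 𝓣) : bil (mulOp Θ Y) (Wt ρ ψ) =
      bil (mulOp (fun z => ((wt z ^ ρ : ℝ) : ℂ) * Θ z) Y) (U0 (tst ψ)) := by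
  rw [bil_eq, bil_eq]
  refine integral_congr_ae ?_
  filter_upwards [coeFn_mulOp h Y, coeFn_mulOp h' Y, coeFn_Wt ρ ψ] with z a b c
  rw [a, b, c]; ring

theorem memLp_locallyIntegrableOn (u : L2 n) :
    LocallyIntegrableOn u (slab n : Set (ST n)) ϖ :=
  ((Lp.memLp u).locallyIntegrable (by norm_num)).locallyIntegrableOn _

def dist (ρ : ℝ) (W : L2 n) : 𝓣' :=
  ContinuousLinearMap.toUniformConvergenceCLM _ _ _ <|
  (TestFunction.integralAgainstBilinCLM (ContinuousLinearMap.lsmul ℝ ℝ) ϖ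
    (U0 (mulOp (fun z => ((wt z ^ (ρ - ⌈ρ⌉₊) : ℝ) : ℂ)) W))).comp (lap ^ ⌈ρ⌉₊)

theorem dist_apply (ρ : ℝ) (W : L2 n) (ψ : 𝓣) : dist ρ W ψ = bil W (Wt ρ ψ) := by
  change TestFunction.integralAgainstBilinCLM (ContinuousLinearMap.lsmul ℝ ℝ) ϖ
    (U0 (mulOp (fun z => ((wt z ^ (ρ - ⌈ρ⌉₊) : ℝ) : ℂ)) W)) ((lap ^ ⌈ρ⌉₊) ψ) = _
  rw [TestFunction.integralAgainstBilinCLM_eq_integral (memLp_locallyIntegrableOn _), Wt,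
    ← bil_mulOp (BM_wt (sub_ceil_nonpos ρ)), ← bil_U0, bil_tst]
  refine integral_congr_ae (.of_forall fun z => ?_)
  simp [mul_comm]

theorem eq_zero_of_Mop_lowS {u : L2 n} (hu : ∀ K, Mop (lowS (Sp n) h) K u = 0) : u = 0 := by
  have h1 : U1 u = 0 := by
    refine (Lp.eq_zero_iff_ae_eq_zero).2 ?_
    have h3 (k) : mulOp (fun z => scs (lowS (Sp n) h) k z.2) (U1 u) = 0 := by
      rw [← U1_Mult]
      change U1 (Mop _ _ _) = 0
      rw [hu, map_zero]
    filter_upwards [ae_all_iff.2 fun k => (Lp.eq_zero_iff_ae_eq_zero).1 (h3 k),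
      ae_all_iff.2 fun k => coeFn_mulOp (BMs_scs (lowS (Sp n) h) k).bm (U1 u)] with z a c
    obtain ⟨K, hK⟩ := exists_le_two_pow (2 * π * ‖z.2‖)
    have := a K
    rw [c K] at this
    simpa only [scs_lowS_one h hK.le, one_mul] using this
  rw [← U0_U1 u, h1, map_zero]

theorem eq_zero_of_bil_Wt (h : IsLPProfile φ) {ρ : ℝ} {W : L2 n}
    (hW : ∀ ψ, bil W (Wt ρ ψ) = 0) : W = 0 := by
  set b := fun z : ST n => ((wt z ^ (ρ - ⌈ρ⌉₊) : ℝ) : ℂ)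
  set N := ⌈ρ⌉₊
  have hb : BM b := BM_wt (sub_ceil_nonpos ρ)
  set w := U0 (mulOp b W)
  have h1 (ψ) : bil w (tst ((lap ^ N) ψ)) = 0 := by
    rw [← hW ψ, Wt, ← bil_mulOp hb, bil_U0]
  set p : ℕ → ST n → ℂ := fun k z => scs (lowS (Sp n) h) k z.2
  have hp (k) : BM (p k) := (BMs_scs _ k).bm
  have h2 (k) (ψ) : bil (Mop (lowS (Sp n) h) k w) (tst ((lap ^ N) ψ)) = 0 := by
    rw [bil_Mop_even (lowS_even h), bil_comm, bil_Mop]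
    refine integral_eq_zero_of_ae (.of_forall fun y => ?_)
    simp only [Pi.zero_apply]
    rw [tr_tst, ← trT_lap_pow, bil_comm, h1, mul_zero]
  have h3 (k) : Mop (lowS (Sp n) h) k w = 0 := by
    have hm : BM fun z => (wt z : ℂ) ^ N * p k z := by
      refine ⟨by have := measurable_wt_rpow (n := n) 1; simp only [rpow_one] at this; exact (this.pow_const N).mul (hp k).1, ?_⟩
      obtain ⟨C, hC⟩ := (hp k).2
      have hC0 := (norm_nonneg _).trans (hC 0)
      refine ⟨(1 + (2 ^ (k + 1)) ^ 2) ^ N * C, fun z => ?_⟩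
      by_cases hz : p k z = 0
      · simp only [hz, mul_zero, norm_zero]; positivity
      · rw [norm_mul, norm_pow, norm_real, norm_of_nonneg (wt_pos z).le, wt]
        have := scs_supp (lpS_supp h 0) hz
        have := pi_pos
        gcongr
        exact hC z
    have h4 : mulOp (fun z => (wt z : ℂ) ^ N * p k z) (U1 w) = 0 := by
      have : U0 (mulOp (fun z => (wt z : ℂ) ^ N * p k z) (U1 w)) = 0 := by
        refine eq_zero_of_bil_tst fun ψ => ?_
        rw [← h2 k ψ, bil_U0, ← bil_U1_U0 (Mop _ _ _), Mop, U1_Mult, bil_eq, bil_eq]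
        refine integral_congr_ae ?_
        filter_upwards [coeFn_mulOp hm (U1 w), coeFn_mulOp (hp k) (U1 w), U0_tst_lap_pow N ψ]
          with z a b c
        rw [a, b, c]; ring
      rw [← U1_U0 (mulOp _ _), this, map_zero]
    rw [← U0_U1 (Mop _ _ _), Mop, U1_Mult, ← map_zero U0]
    refine congrArg U0 ((Lp.eq_zero_iff_ae_eq_zero).2 ?_)
    filter_upwards [coeFn_mulOp hm (U1 w), coeFn_mulOp (hp k) (U1 w),
      (Lp.eq_zero_iff_ae_eq_zero).1 h4] with z a b c
    rw [a] at c
    rw [b]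
    have : (wt z : ℂ) ^ N ≠ 0 := pow_ne_zero _ (by exact_mod_cast (wt_pos z).ne')
    simpa [mul_assoc, this] using c
  have h5 : mulOp b W = 0 := by
    rw [← U1_U0 (mulOp b W), show U0 _ = 0 from eq_zero_of_Mop_lowS h h3, map_zero]
  refine (Lp.eq_zero_iff_ae_eq_zero).2 ?_
  filter_upwards [coeFn_mulOp hb W, (Lp.eq_zero_iff_ae_eq_zero).1 h5] with z a c
  rw [a] at c
  have : b z ≠ 0 := Complex.ofReal_ne_zero.2 (Real.rpow_pos_of_pos (wt_pos z) _).ne'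
  simpa [this] using c

theorem dist_add (ρ : ℝ) (W W' : L2 n) : dist ρ (W + W') = dist ρ W + dist ρ W' := by
  ext ψ
  change _ = dist ρ W ψ + dist ρ W' ψ
  simp [dist_apply]

theorem dist_smul (ρ : ℝ) (c : ℂ) (W : L2 n) : dist ρ (c • W) = c • dist ρ W := by
  ext ψ
  change _ = c • dist ρ W ψ
  simp [dist_apply]

theorem dist_injective (h : IsLPProfile φ) {ρ : ℝ} {W W' : L2 n}
    (e : dist ρ W = dist ρ W') : W = W' := by
  refine sub_eq_zero.1 (eq_zero_of_bil_Wt h (ρ := ρ) fun ψ => ?_)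
  rw [map_sub, sub_apply, ← dist_apply, ← dist_apply, e, sub_self]

theorem eq_dist_iff {σ : ℝ} {u : 𝓣'} {W : L2 n} : (∀ ψ : 𝓣, u ψ =
      ∫ z, (((1 + (2 * π * ‖z.2‖) ^ 2) ^ (-σ / 2) : ℝ) : ℂ)
      * W z * 𝓕⁻ (fun y : Sp n => (ψ (z.1, y) : ℂ)) z.2 ∂ϖ) ↔
    u = dist (-σ / 2) W := by
  have key (ψ : 𝓣) : dist (-σ / 2) W ψ =
      ∫ z, (((1 + (2 * π * ‖z.2‖) ^ 2) ^ (-σ / 2) : ℝ) : ℂ)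
      * W z * 𝓕⁻ (fun y : Sp n => (ψ (z.1, y) : ℂ)) z.2 ∂ϖ := by
    rw [dist_apply, bil_eq]
    refine integral_congr_ae ?_
    have h1 : U0 (tst ψ) =ᵐ[ϖ] pFi (toC ψ) := by
      rw [show tst ψ = tstC (toC ψ) from rfl, U0_tstC]; exact coeFn_pFiL _
    filter_upwards [coeFn_Wt (-σ / 2) ψ, h1] with z a b
    rw [a, b, wt, pFi]
    simp only [toC_apply]
    ring
  refine ⟨fun e => ?_, fun e ψ => by rw [e, key]⟩
  ext ψ
  rw [e, key]

theorem normL2H_dist (h : IsLPProfile φ) (σ : ℝ) (W : L2 n) :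
    normL2H σ (dist (-σ / 2) W) = ‖W‖ₑ := by
  simp only [normL2H, eq_dist_iff]
  refine le_antisymm (iInf₂_le_of_le W rfl le_rfl) (le_iInf₂ fun W' e => ?_)
  rw [dist_injective h e]

theorem exists_dist {σ : ℝ} {u : 𝓣'} (hu : normL2H σ u < ⊤) :
    ∃ W, u = dist (-σ / 2) W := by
  simp only [normL2H, eq_dist_iff] at hu
  by_contra! hne
  simp [hne] at hu

def shell (n k : ℕ) : Set (Sp n) :=
  {η | 2 * π * ‖η‖ ≤ 2 ^ (k + 3) ∧ (k ≤ 4 ∨ 2 ^ k ≤ 8 * (2 * π * ‖η‖))}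

theorem measurableSet_shell (k : ℕ) : MeasurableSet (shell n k) := by
  unfold shell
  measurability

def wS (k : ℕ) (ρ : ℝ) (z : ST n) : ℂ :=
  (shell n k).indicator (fun _ => 1) z.2 * ((wt z ^ ρ : ℝ) : ℂ)

theorem wt_rpow_le {k : ℕ} {z : ST n} (hz : z.2 ∈ shell n k) (ρ : ℝ) :
    wt z ^ ρ ≤ 2 ^ (8 * |ρ|) * (𝟚 ^ k) ^ (2 * ρ) := by
  have h4 : (𝟚 ^ k) ^ (2 * ρ) = (4 ^ k : ℝ) ^ ρ := by
    rw [rpow_mul (by positivity), Real.rpow_two, ← pow_mul, mul_comm k, pow_mul]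
    norm_num
  have h8 : 𝟚 ^ (8 * |ρ|) = 256 ^ |ρ| := by
    rw [rpow_mul (by norm_num)]; norm_num
  have h1 : wt z ≤ 256 * 4 ^ k := by
    have : (2 * π * ‖z.2‖) ^ 2 ≤ (2 ^ (k + 3)) ^ 2 := by
      have := pi_pos
      exact pow_le_pow_left₀ (by positivity) hz.1 2
    have e : (𝟚 ^ (k + 3)) ^ 2 = 64 * 4 ^ k := by
      rw [← pow_mul, mul_comm, pow_mul, pow_add]; norm_num; ring
    have : (1 : ℝ) ≤ 4 ^ k := one_le_pow₀ (by norm_num)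
    rw [wt]; linarith
  have h2 : 4 ^ k ≤ 256 * wt z := by
    rcases hz.2 with hk | hk
    · calc (4 : ℝ) ^ k ≤ 4 ^ 4 := pow_le_pow_right₀ (by norm_num) hk
        _ = 256 * 1 := by norm_num
        _ ≤ _ := by gcongr; exact one_le_wt z
    · have := pow_le_pow_left₀ (by positivity) hk 2
      rw [← pow_mul, mul_comm k, pow_mul, mul_pow] at this
      norm_num at this
      have h3 : wt z = 1 + (2 * π * ‖z.2‖) ^ 2 := rfl
      nlinarith [sq_nonneg (2 * π * ‖z.2‖)]
  rw [h4, h8]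
  have hw := wt_pos z
  rcases le_total 0 ρ with hρ | hρ
  · rw [abs_of_nonneg hρ, ← Real.mul_rpow (by norm_num) (by positivity)]
    exact Real.rpow_le_rpow hw.le h1 hρ
  · rw [abs_of_nonpos hρ, rpow_neg (by norm_num), ← Real.inv_rpow (by norm_num),
      ← Real.mul_rpow (by norm_num) (by positivity)]
    exact Real.rpow_le_rpow_of_nonpos (by positivity) (by linarith) hρ

theorem norm_wS_le (k : ℕ) (ρ : ℝ) (z : ST n) :
    ‖wS k ρ z‖ ≤ 2 ^ (8 * |ρ|) * (𝟚 ^ k) ^ (2 * ρ) := by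
  by_cases hz : z.2 ∈ shell n k
  · rw [wS, indicator_of_mem hz, one_mul, norm_real,
      norm_of_nonneg (Real.rpow_nonneg (wt_pos z).le _)]
    exact wt_rpow_le hz ρ
  · rw [wS, indicator_of_notMem hz, zero_mul, norm_zero]; positivity

theorem BM_wS (k : ℕ) (ρ : ℝ) : BM (wS (n := n) k ρ) :=
  ⟨((measurable_const.indicator (measurableSet_shell k)).comp measurable_snd).mul
    (measurable_wt_rpow ρ), _, norm_wS_le k ρ⟩

theorem wS_neg (k : ℕ) (ρ : ℝ) (z : ST n) : wS k ρ (z.1, -z.2) = wS k ρ z := by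
  have e : -z.2 ∈ shell n k ↔ z.2 ∈ shell n k := by simp [shell]
  have e' : wt (z.1, -z.2) = wt z := by simp [wt]
  by_cases hz : z.2 ∈ shell n k <;> simp [wS, e', e, hz]

theorem wS_mul (k : ℕ) (ρ ρ' : ℝ) (z : ST n) : wS k ρ z * wS k ρ' z = wS k (ρ + ρ') z := by
  by_cases hz : z.2 ∈ shell n k
  · simp only [wS, indicator_of_mem hz, one_mul]
    rw [rpow_add (wt_pos z), ofReal_mul]
  · simp [wS, indicator_of_notMem hz]

theorem mulOp_wS (k : ℕ) (ρ ρ' : ℝ) (u : L2 n) :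
    mulOp (wS k ρ) (mulOp (wS k ρ') u) = mulOp (wS k (ρ + ρ')) u := by
  rw [mulOp_mulOp (BM_wS k ρ) (BM_wS k ρ')]
  congr 1
  exact congrArg mulOp (funext (wS_mul k ρ ρ'))

def Loc (k : ℕ) (x : L2 n) : Prop := mulOp (wS k 0) (U1 x) = U1 x

def lift (ρ : ℝ) (k : ℕ) : L2 n →L[ℂ] L2 n := (mulOp (wS k ρ)).comp U1

theorem norm_lift_le (ρ : ℝ) (k : ℕ) (x : L2 n) :
    ‖lift ρ k x‖ ≤ 2 ^ (8 * |ρ|) * (𝟚 ^ k) ^ (2 * ρ) * ‖x‖ := by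
  rw [← norm_U1 x]
  exact norm_mulOp_le (BM_wS k ρ) (norm_wS_le k ρ) _

theorem mulOp_lift (ρ : ℝ) (k : ℕ) (x : L2 n) : mulOp (wS k 0) (lift ρ k x) = lift ρ k x := by
  change mulOp _ (mulOp _ _) = mulOp _ _
  rw [mulOp_wS, zero_add]

theorem dist_lift {ρ : ℝ} {k : ℕ} {x : L2 n} (hx : Loc k x) (ψ : 𝓣) :
    dist (-ρ) (lift ρ k x) ψ = bil x (tst ψ) := by
  have e : (fun z : ST n => ((wt z ^ (-ρ) : ℝ) : ℂ) * wS k ρ z) = wS k 0 := by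
    funext z
    rw [wS, wS, mul_left_comm, ← ofReal_mul, ← rpow_add (wt_pos z), neg_add_cancel]
  rw [dist_apply, lift, ContinuousLinearMap.comp_apply, bil_Wt (BM_wS k ρ) (e ▸ BM_wS k 0), e, hx,
    bil_U1_U0]

theorem mulOp_wS_refl (k : ℕ) (ρ : ℝ) (u : L2 n) :
    mulOp (wS k ρ) (refl u) = refl (mulOp (wS k ρ) u) := by
  have e : (fun z : ST n => wS k ρ (z.1, -z.2)) = wS k ρ := funext (wS_neg k ρ)
  rw [mulOp_refl (Θ := wS k ρ) (BM_wS k ρ) (by rw [e]; exact BM_wS k ρ), e]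

theorem bil_lift_lift {ρ : ℝ} {k l : ℕ} {x y : L2 n} (hx : Loc k x) (hy : Loc l y) :
    bil (lift (-ρ) k x) (refl (lift ρ l y)) = bil x y := by
  have e : (fun z : ST n => wS k (-ρ) z * wS l ρ z) = fun z => wS k 0 z * wS l 0 z := by
    funext z
    simp only [wS]
    rw [mul_mul_mul_comm, ← ofReal_mul, ← rpow_add (wt_pos z), neg_add_cancel,
      mul_mul_mul_comm, ← ofReal_mul, ← rpow_add (wt_pos z), add_zero]
  change bil (mulOp (wS k (-ρ)) (U1 x)) (refl (mulOp (wS l ρ) (U1 y))) = _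
  rw [← mulOp_wS_refl, bil_mulOp (BM_wS k _), mulOp_mulOp (BM_wS k _) (BM_wS l _), e,
    ← mulOp_mulOp (BM_wS k _) (BM_wS l _), mulOp_wS_refl, hy, ← bil_mulOp (BM_wS k _), hx,
    ← U0_eq_refl, bil_U1_U0]

theorem sum_norm_sq_shell_le (F : Finset ℕ) (W : L2 n) :
    ∑ k ∈ F, ‖mulOp (wS k 0) W‖ ^ 2 ≤ 7 * ‖W‖ ^ 2 := by
  have hcard (η : Sp n) : ∑ k ∈ F, (shell n k).indicator (fun _ => (1 : ℝ≥0∞)) η ≤ 7 := by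
    classical
    simp only [Set.indicator_apply]
    rw [Finset.sum_ite, Finset.sum_const_zero, add_zero, Finset.sum_const, nsmul_one]
    set S := F.filter fun k => η ∈ shell n k with hS
    rcases S.eq_empty_or_nonempty with h0 | hne
    · rw [h0]; simp
    have hsub : S ⊆ Finset.Ico (S.min' hne) (S.min' hne + 7) := fun k hk => by
      rw [Finset.mem_Ico]
      refine ⟨S.min'_le k hk, ?_⟩
      have h1 := (mem_filter.1 hk).2.2
      have h2 := (mem_filter.1 (S.min'_mem hne)).2.1
      rcases h1 with h1 | h1
      · omega
      · have : 𝟚 ^ k ≤ 2 ^ (S.min' hne + 6) := by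
          calc _ ≤ _ := h1
            _ ≤ 8 * 2 ^ (S.min' hne + 3) := by gcongr
            _ = _ := by rw [pow_add, pow_add]; ring
        have := (pow_le_pow_iff_right₀ (one_lt_two (α := ℝ))).1 this
        omega
    have := Finset.card_le_card hsub
    rw [Nat.card_Ico] at this
    exact_mod_cast (by omega : S.card ≤ 7)
  have key : ∑ k ∈ F, ‖mulOp (wS k 0) W‖ₑ ^ 2 ≤ 7 * ‖W‖ₑ ^ 2 := by
    have hm (k) : Measurable fun z : ST n => ‖wS k 0 z‖ₑ ^ 2 * ‖W z‖ₑ ^ 2 :=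
      ((BM_wS k 0).1.enorm.pow_const 2).mul (measurable_enorm_sq W)
    simp only [enorm_sq_mulOp (BM_wS _ 0)]
    rw [← lintegral_finsetSum _ fun k _ => hm k, ← lintegral_enorm_sq,
      ← lintegral_const_mul _ (measurable_enorm_sq W)]
    refine lintegral_mono fun z => ?_
    simp only
    rw [← sum_mul]
    gcongr
    refine le_trans (sum_le_sum fun k _ => ?_) (hcard z.2)
    by_cases hz : z.2 ∈ shell n k <;> simp [wS, hz]
  have e (x : L2 n) : ‖x‖ ^ 2 = (‖x‖ₑ ^ 2).toReal := by simp
  simp only [e]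
  rw [← ENNReal.toReal_sum fun k _ => by finiteness]
  refine (ENNReal.toReal_mono (by finiteness) key).trans ?_
  simp

theorem norm_sum_shell_le {x : ℕ → L2 n} (hx : ∀ k, mulOp (wS k 0) (x k) = x k) (F : Finset ℕ) :
    ‖∑ k ∈ F, x k‖ ^ 2 ≤ 7 * ∑ k ∈ F, ‖x k‖ ^ 2 := by
  set S := ∑ k ∈ F, ‖x k‖ ^ 2
  have hS : 0 ≤ S := sum_nonneg fun k _ => sq_nonneg _
  have key : ‖∑ k ∈ F, x k‖ ≤ √S * √7 := by
    refine norm_le_of_bil_le (by positivity) fun y => ?_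
    rw [map_sum, FunLike.coe_sum, Finset.sum_apply]
    calc _ ≤ ∑ k ∈ F, ‖x k‖ * ‖mulOp (wS k 0) y‖ := by
          refine (norm_sum_le _ _).trans (sum_le_sum fun k _ => ?_)
          rw [← hx k, bil_mulOp (BM_wS k 0), hx k]
          exact norm_bil_le _ _
      _ ≤ √S * √(∑ k ∈ F, ‖mulOp (wS k 0) y‖ ^ 2) := Real.sum_mul_le_sqrt_mul_sqrt _ _ _
      _ ≤ √S * √(7 * ‖y‖ ^ 2) := by gcongr; exact sum_norm_sq_shell_le F y
      _ = _ := by rw [sqrt_mul (by norm_num), sqrt_sq (norm_nonneg _), mul_assoc]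
  calc _ ≤ (√S * √7) ^ 2 := by gcongr
    _ = _ := by rw [mul_pow, sq_sqrt hS, sq_sqrt (by norm_num), mul_comm]

theorem summable_shell {x : ℕ → L2 n} (hx : ∀ k, mulOp (wS k 0) (x k) = x k)
    (hs : Summable fun k => ‖x k‖ ^ 2) :
    Summable x ∧ ‖∑' k, x k‖ ^ 2 ≤ 7 * ∑' k, ‖x k‖ ^ 2 := by
  have h1 : Summable x := by
    rw [summable_iff_vanishing_norm] at hs ⊢
    intro ε hε
    obtain ⟨s, h⟩ := hs (ε ^ 2 / 7) (by positivity)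
    refine ⟨s, fun t ht => ?_⟩
    have h2 := (Real.le_norm_self _).trans_lt (h t ht)
    refine lt_of_pow_lt_pow_left₀ 2 hε.le ((norm_sum_shell_le hx t).trans_lt ?_)
    linarith
  refine ⟨h1, le_of_tendsto ((h1.hasSum.norm).pow 2) (.of_forall fun F => ?_)⟩
  refine (norm_sum_shell_le hx F).trans ?_
  gcongr
  exact hs.sum_le_tsum _ fun k _ => sq_nonneg _

section Far

include h hG

theorem Mult_box_eq_zero {k : ℕ} {v F E : L2 n} (hv : WBox (G k) v F)
    (hE : WBox (G k) (LP h k v) E) {p : Sp n → ℂ} (hp : BMs p)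
    (hfar : ∀ η, p η ≠ 0 → 2 ^ (k + 3) ≤ 2 * π * ‖η‖ ∨
      5 ≤ k ∧ 8 * (2 * π * ‖η‖) ≤ 2 ^ k) : Mult p E = 0 := by
  obtain ⟨C, -, H⟩ := exists_piece h hG
  obtain ⟨d, e, hj, -, -⟩ := H k v F hv
  obtain rfl := hE.unique (hj.wBox hG k)
  have hpi := pi_pos
  have hres (q : Sp n → ℂ) (hq : BMs q) (hv : Mult q (LP h k v) = LP h k v)
      (hw : ∀ i w w', WD i w w' → WD i (Mult q w) (Mult q w'))
      (hq2 : ∀ η, q η ≠ 0 → 2 * π * ‖η‖ ≤ 2 ^ (k + 2) ∧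
        (5 ≤ k → 2 ^ k ≤ 4 * (2 * π * ‖η‖))) : Mult p (Lop (G k) e) = 0 := by
    have fix {i x y} (hx : Mult q x = x) (hxy : WD i x y) : Mult q y = y := by
      have := hw i x y hxy
      rw [hx] at this
      exact this.unique hxy
    rw [Lop, map_sum]
    refine sum_eq_zero fun i _ => ?_
    rw [map_sum]
    refine sum_eq_zero fun j _ => ?_
    rw [← fix (fix hv (hj.first j)) (hj.second i j)]
    refine hG.band k i j p q hp hq (fun η η' hη hη' => ?_) _
    obtain ⟨h1, h2⟩ := hq2 η' hη'
    have h3 : ‖η‖ ≤ ‖η - η'‖ + ‖η'‖ := by simpa using norm_add_le (η - η') η'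
    have h4 : ‖η'‖ ≤ ‖η - η'‖ + ‖η‖ := by
      simpa [norm_sub_rev] using norm_add_le (η' - η) η
    have h3' := mul_le_l h3 (by positivity : 0 ≤ 2 * π)
    have h4' := mul_le_l h4 (by positivity : 0 ≤ 2 * π)
    rw [mul_add] at h3' h4'
    rcases hfar η hη with h5 | ⟨h5, h6⟩
    · have : 𝟚 ^ (max 1 (k / 2)) ≤ 2 ^ (k + 2) :=
        pow_le_pow_right₀ (by norm_num) (by omega)
      have e1 : 𝟚 ^ (k + 3) = 2 * 2 ^ (k + 2) := by ring
      linarith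
    · have h7 := h2 h5
      have h8 : 𝟚 ^ (max 1 (k / 2)) * 8 ≤ 2 ^ k := by
        rw [show (8 : ℝ) = 2 ^ 3 by norm_num, ← pow_add]
        exact pow_le_pow_right₀ (by norm_num) (by omega)
      linarith
  have hhi := LP_low h k le_rfl v
  have hs (K : ℕ) := BMs_scs (lowS (Sp n) h) K
  have hsupp {K : ℕ} {η : Sp n} (hη : scs (lowS (Sp n) h) K η ≠ 0) :
      2 * π * ‖η‖ < 2 ^ (K + 1) := by
    by_contra! hc
    refine hη ?_
    rw [scs_lowS, lp0_zero h, ofReal_zero]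
    rw [le_div_iff₀ (by positivity), ← pow_succ']
    exact hc
  by_cases hk : 5 ≤ k
  · have h0 : Mult (scs (lowS (Sp n) h) (k - 2)) (LP h k v) = 0 := by
      rw [LP, Mop, Mult_Mult (hs _) (BMs_scs _ _)]
      have : (fun η => scs (lowS (Sp n) h) (k - 2) η * scs (lpS h n k) k η) = fun _ => 0 := by
        funext η
        by_contra hne
        have h1 := hsupp (left_ne_zero_of_mul hne)
        have h2 := scs_lpS_lower h (by omega) (right_ne_zero_of_mul hne)
        have e1 : 𝟚 ^ k = 2 * 2 ^ (k - 2 + 1) := by rw [← pow_succ']; congr 1; omega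
        linarith
      rw [this, Mult_const, zero_smul]
    have hb : BMs fun η => scs (lowS (Sp n) h) (k + 1) η - scs (lowS (Sp n) h) (k - 2) η := by
      obtain ⟨m1, C1, c1⟩ := hs (k + 1)
      obtain ⟨m2, C2, c2⟩ := hs (k - 2)
      exact ⟨m1.sub m2, C1 + C2, fun η => norm_sub_le_of_le (c1 η) (c2 η)⟩
    refine hres _ hb ?_ (fun i w w' hw => ?_) fun η hη => ⟨?_, fun _ => ?_⟩
    · rw [Mult_sub (hs _) (hs _), h0, sub_zero]
      exact hhi
    · simp only [Mult_sub (hs _) (hs _)]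
      exact (WD_Mop hw _ _).sub (WD_Mop hw _ _)
    · by_contra! hc
      have a1 (K) (hK : K ≤ k + 1) : scs (lowS (Sp n) h) K η = 0 := by
        by_contra hne
        have : 𝟚 ^ (K + 1) ≤ 2 ^ (k + 2) := pow_le_pow_right₀ (by norm_num) (by omega)
        linarith [hsupp hne]
      exact hη (by rw [a1 _ le_rfl, a1 _ (by omega), sub_zero])
    · by_contra! hc
      refine hη ?_
      have e1 : 𝟚 ^ k = 4 * 2 ^ (k - 2) := by
        rw [show (4 : ℝ) = 2 ^ 2 by norm_num, ← pow_add]; congr 1; omega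
      have h1 : 2 * π * ‖η‖ ≤ 2 ^ (k - 2) := by linarith
      have : 𝟚 ^ (k - 2) ≤ 2 ^ (k + 1) := pow_le_pow_right₀ (by norm_num) (by omega)
      rw [scs_lowS_one h h1, scs_lowS_one h (h1.trans this), sub_self]
  · exact hres _ (hs (k + 1)) hhi (fun i w w' hw => WD_Mop hw _ _)
      fun η hη => ⟨(hsupp hη).le, fun h5 => absurd h5 hk⟩

theorem bil_box_LP_eq_zero {k l : ℕ} {v F E : L2 n} (hv : WBox (G k) v F)
    (hE : WBox (G k) (LP h k v) E) (hkl : k + 4 ≤ l ∨ l + 4 ≤ k ∧ (l ≠ 0 ∨ 5 ≤ k)) (u : L2 n) :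
    bil E (LP h l u) = 0 := by
  rw [LP, ← bil_Mop_even (lpS_even h l), Mop,
    Mult_box_eq_zero h hG hv hE (BMs_scs _ _) fun η hη => ?_, map_zero, zero_apply]
  rcases hkl with hkl | ⟨hkl, h5⟩
  · left
    have h1 := scs_lpS_lower h (by omega) hη
    have : 𝟚 * 2 ^ (k + 3) ≤ 2 ^ l := by
      rw [← pow_succ']; exact pow_le_pow_right₀ (by norm_num) (by omega)
    linarith
  · right
    refine ⟨by omega, ?_⟩
    have h1 := scs_supp (lpS_supp h l) hη
    have : (8 : ℝ) * 2 ^ (l + 1) ≤ 2 ^ k := by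
      rw [show (8 : ℝ) = 2 ^ 3 by norm_num, ← pow_add]
      exact pow_le_pow_right₀ (by norm_num) (by omega)
    linarith

end Far

theorem Loc.of_Mult {k : ℕ} {x : L2 n}
    (hx : Mult (fun η => 1 - (shell n k).indicator (fun _ => 1) η) x = 0) : Loc k x := by
  have hb : BMs fun η : Sp n => (shell n k).indicator (fun _ => (1 : ℂ)) η :=
    ⟨measurable_const.indicator (measurableSet_shell k), 1, fun η => by
      by_cases hη : η ∈ shell n k <;> simp [hη]⟩
  have h1 : BMs fun _ : Sp n => (1 : ℂ) := ⟨measurable_const, 1, fun _ => by simp⟩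
  rw [Mult_sub h1 hb, Mult_const, one_smul, sub_eq_zero] at hx
  have e : (fun z : ST n => (shell n k).indicator (fun _ => (1 : ℂ)) z.2) = wS k 0 := by
    funext z; simp [wS]
  rw [Loc]
  nth_rw 2 [hx]
  rw [Mult_apply, U1_U0, e]

theorem BMs_compl_shell (k : ℕ) :
    BMs fun η : Sp n => 1 - (shell n k).indicator (fun _ => (1 : ℂ)) η :=
  ⟨measurable_const.sub (measurable_const.indicator (measurableSet_shell k)), 1, fun η => by
    by_cases hη : η ∈ shell n k <;> simp [hη]⟩

theorem mem_shell_of_scs_lpS {k : ℕ} {η : Sp n}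
    (hη : scs (lpS h n k) k η ≠ 0) : η ∈ shell n k := by
  refine ⟨(scs_supp (lpS_supp h k) hη).trans (pow_le_pow_right₀ (by norm_num) (by omega)), ?_⟩
  by_cases hk : k ≤ 4
  · exact .inl hk
  · have := scs_lpS_lower h (by omega) hη
    have := pi_pos
    have : 0 ≤ 2 * π * ‖η‖ := by positivity
    exact .inr (by linarith)

theorem Loc_LP (k : ℕ) (u : L2 n) : Loc k (LP h k u) := by
  refine Loc.of_Mult ?_
  rw [LP, Mop, Mult_Mult (BMs_compl_shell k) (BMs_scs _ _)]
  have : (fun η => (1 - (shell n k).indicator (fun _ => (1 : ℂ)) η) * scs (lpS h n k) k η) =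
      fun _ => 0 := by
    funext η
    by_contra hne
    exact left_ne_zero_of_mul hne
      (by simp [mem_shell_of_scs_lpS h (right_ne_zero_of_mul hne)])
  rw [this, Mult_const, zero_smul]

theorem Loc_box
    (hG : Coef G B c k₀ CΓ) {k : ℕ} {v F E : L2 n} (hv : WBox (G k) v F)
    (hE : WBox (G k) (LP h k v) E) : Loc k E := by
  refine Loc.of_Mult (Mult_box_eq_zero h hG hv hE (BMs_compl_shell k) fun η hη => ?_)
  have h1 : η ∉ shell n k := fun hη' => hη (by simp [hη'])
  simp only [shell, mem_ofPred_eq, not_and_or, not_or, not_le] at h1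
  rcases h1 with h1 | ⟨h1, h2⟩
  · exact .inl h1.le
  · exact .inr ⟨h1, h2.le⟩

theorem Loc.sum {k : ℕ} {ι : Type*} (s : Finset ι) {x : ι → L2 n} (hx : ∀ i ∈ s, Loc k (x i)) :
    Loc k (∑ i ∈ s, x i) := by
  rw [Loc, map_sum, map_sum]
  exact sum_congr rfl hx

def pN (s θ : ℝ) (k j : ℕ) (v F : L2 n) : ℝ :=
  √((𝟚 ^ k) ^ (2 * s) * (𝟚 ^ j) ^ (2 * θ) * ‖v‖ ^ 2
    + (𝟚 ^ k) ^ (2 * s - 2) * (𝟚 ^ j) ^ (2 * θ - 2) * ‖F‖ ^ 2)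

theorem sq_pN (s θ : ℝ) (k j : ℕ) (v F : L2 n) : pN s θ k j v F ^ 2 =
    ((𝟚 ^ k) ^ s * (𝟚 ^ j) ^ θ * ‖v‖) ^ 2 +
      ((𝟚 ^ k) ^ (s - 1) * (𝟚 ^ j) ^ (θ - 1) * ‖F‖) ^ 2 := by
  have e (x : ℝ) (hx : 0 < x) (r : ℝ) : x ^ (2 * r) = (x ^ r) ^ 2 := by
    rw [mul_comm, rpow_mul hx.le, Real.rpow_two]
  rw [pN, sq_sqrt (by positivity), show 2 * s - 2 = 2 * (s - 1) by ring,
    show 2 * θ - 2 = 2 * (θ - 1) by ring]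
  simp only [e _ (show (0 : ℝ) < 2 ^ k by positivity), e _ (show (0 : ℝ) < 2 ^ j by positivity),
    mul_pow]

theorem pN_nonneg (s θ : ℝ) (k j : ℕ) (v F : L2 n) : 0 ≤ pN s θ k j v F := sqrt_nonneg _

theorem pieceSq_eq (s θ : ℝ) (k j : ℕ) (v F : L2 n) :
    pieceSq s θ k j v F = ofReal (pN s θ k j v F ^ 2) := by
  rw [pieceSq, pN, sq_sqrt (by positivity)]

theorem le_pN_left (s θ : ℝ) (k j : ℕ) (v F : L2 n) :
    (𝟚 ^ k) ^ s * (𝟚 ^ j) ^ θ * ‖v‖ ≤ pN s θ k j v F := by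
  refine le_of_sq_le_sq ?_ (pN_nonneg ..)
  rw [sq_pN]
  linarith [sq_nonneg ((𝟚 ^ k) ^ (s - 1) * (𝟚 ^ j) ^ (θ - 1) * ‖F‖)]

theorem le_pN_right (s θ : ℝ) (k j : ℕ) (v F : L2 n) :
    (𝟚 ^ k) ^ (s - 1) * (𝟚 ^ j) ^ (θ - 1) * ‖F‖ ≤ pN s θ k j v F := by
  refine le_of_sq_le_sq ?_ (pN_nonneg ..)
  rw [sq_pN]
  linarith [sq_nonneg ((𝟚 ^ k) ^ s * (𝟚 ^ j) ^ θ * ‖v‖)]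

structure Dec (G : ℕ → Λ → Λ → ST n → ℝ) (s θ : ℝ) (v F : ℕ → ℕ → L2 n)
    (A : ℝ) : Prop where
  nonneg : 0 ≤ A
  box : ∀ k j, j ≤ k → WBox (G k) (v k j) (F k j)
  sum_le : ∀ K : Finset ℕ,
    ∑ k ∈ K, ∑ j ∈ Finset.range (k + 1), pN s θ k j (v k j) (F k j) ^ 2 ≤ A ^ 2

theorem totalSq_le_iff {s θ : ℝ} {v F : ℕ → ℕ → L2 n} {A : ℝ} :
    totalSq s θ v F ≤ ofReal (A ^ 2) ↔ ∀ K : Finset ℕ,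
      ∑ k ∈ K, ∑ j ∈ Finset.range (k + 1), pN s θ k j (v k j) (F k j) ^ 2 ≤ A ^ 2 := by
  have e (K : Finset ℕ) : ∑ k ∈ K, ∑ j ∈ Finset.range (k + 1), pieceSq s θ k j (v k j) (F k j) =
      ofReal (∑ k ∈ K, ∑ j ∈ Finset.range (k + 1), pN s θ k j (v k j) (F k j) ^ 2) := by
    rw [ENNReal.ofReal_sum_of_nonneg fun k _ => sum_nonneg fun j _ => sq_nonneg _]
    refine sum_congr rfl fun k _ => ?_
    rw [ENNReal.ofReal_sum_of_nonneg fun j _ => sq_nonneg _]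
    simp only [pieceSq_eq]
  rw [totalSq, ENNReal.tsum_eq_iSup_sum, iSup_le_iff]
  simp only [e]
  exact forall_congr' fun K => ENNReal.ofReal_le_ofReal_iff (sq_nonneg A)

theorem sum_schur_le {ι κ : Type*} (S : Finset ι) (T : Finset κ) {w : ι → κ → ℝ} {R : ℝ}
    (hw : ∀ i j, 0 ≤ w i j) (h1 : ∀ i, ∑ j ∈ T, w i j ≤ R) (h2 : ∀ j, ∑ i ∈ S, w i j ≤ R)
    (a : ι → ℝ) (b : κ → ℝ) : ∑ i ∈ S, ∑ j ∈ T, w i j * (a i * b j) ≤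
      R * (√(∑ i ∈ S, a i ^ 2) * √(∑ j ∈ T, b j ^ 2)) := by
  rcases S.eq_empty_or_nonempty with rfl | ⟨i₀, -⟩
  · simp
  have hR : 0 ≤ R := (sum_nonneg fun j _ => hw i₀ j).trans (h1 i₀)
  rw [← Finset.sum_product']
  have e : ∀ x ∈ S ×ˢ T, w x.1 x.2 * (a x.1 * b x.2) =
      (√(w x.1 x.2) * a x.1) * (√(w x.1 x.2) * b x.2) := fun x _ => by
    rw [mul_mul_mul_comm, Real.mul_self_sqrt (hw _ _)]
  rw [sum_congr rfl e]
  refine (Real.sum_mul_le_sqrt_mul_sqrt _ _ _).trans ?_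
  have f1 : ∑ x ∈ S ×ˢ T, (√(w x.1 x.2) * a x.1) ^ 2 ≤ R * ∑ i ∈ S, a i ^ 2 := by
    rw [Finset.sum_product, mul_sum]
    refine sum_le_sum fun i _ => ?_
    simp only [mul_pow, sq_sqrt (hw _ _), ← sum_mul]
    exact mul_le_r (h1 i) (sq_nonneg _)
  have f2 : ∑ x ∈ S ×ˢ T, (√(w x.1 x.2) * b x.2) ^ 2 ≤ R * ∑ j ∈ T, b j ^ 2 := by
    rw [Finset.sum_product_right, mul_sum]
    refine sum_le_sum fun j _ => ?_
    simp only [mul_pow, sq_sqrt (hw _ _), ← sum_mul]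
    exact mul_le_r (h2 j) (sq_nonneg _)
  calc _ ≤ √(R * ∑ i ∈ S, a i ^ 2) * √(R * ∑ j ∈ T, b j ^ 2) := by gcongr
    _ = √R * √R * (√(∑ i ∈ S, a i ^ 2) * √(∑ j ∈ T, b j ^ 2)) := by
      rw [sqrt_mul hR, sqrt_mul hR]; ring
    _ = _ := by rw [Real.mul_self_sqrt hR]

theorem sum_geom_le {r : ℝ} (h0 : 0 < r) (h1 : r < 1) {T : Finset ℕ} {g : ℕ → ℕ}
    (hg : Set.InjOn g T) : ∑ j ∈ T, r ^ g j ≤ (1 - r)⁻¹ := by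
  rw [← Finset.sum_image hg, ← tsum_geometric_of_lt_one h0.le h1]
  exact (summable_geometric_of_lt_one h0.le h1).sum_le_tsum _ fun _ _ => by positivity

theorem sum_pow_dist_le {r : ℝ} (h0 : 0 < r) (h1 : r < 1) (i : ℕ) (S : Finset ℕ) :
    ∑ j ∈ S, r ^ (i - j) * r ^ (j - i) ≤ 2 * (1 - r)⁻¹ := by
  rw [← Finset.sum_filter_add_sum_filter_not S (· ≤ i), two_mul]
  refine add_le_add (le_trans (sum_le_sum fun j hj => ?_) (sum_geom_le h0 h1 (g := (i - ·)) ?_))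
    (le_trans (sum_le_sum fun j hj => ?_) (sum_geom_le h0 h1 (g := (· - i)) ?_))
  · simp [Nat.sub_eq_zero_of_le (mem_filter.1 hj).2]
  · intro a ha b hb hab
    simp at ha hb hab
    omega
  · simp [Nat.sub_eq_zero_of_le (le_of_not_ge (mem_filter.1 hj).2)]
  · intro a ha b hb hab
    simp at ha hb hab
    omega

theorem two_pow_rpow (k : ℕ) (s : ℝ) : (𝟚 ^ k) ^ s = 2 ^ (k * s) := by
  rw [← rpow_natCast, ← rpow_mul (by norm_num)]

theorem sq_two_pow_rpow (i : ℕ) (θ : ℝ) : ((𝟚 ^ i) ^ θ) ^ 2 = (2 ^ (2 * θ)) ^ i := by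
  rw [two_pow_rpow, ← rpow_natCast, ← rpow_natCast, ← rpow_mul zero_le_two, ← rpow_mul zero_le_two]
  congr 1; push_cast; ring

theorem sqrt_two_pow (k : ℕ) : √(𝟚 ^ k) = 2 ^ ((k : ℝ) / 2) := by
  rw [sqrt_eq_rpow, two_pow_rpow]; ring_nf

theorem two_pow_rpow_ratio_le {k l : ℕ} (h1 : k ≤ l + 4) (h2 : l ≤ k + 4) (s : ℝ) :
    (𝟚 ^ k) ^ s * (𝟚 ^ l) ^ (-s) ≤ 2 ^ (4 * |s|) := by
  rw [two_pow_rpow, two_pow_rpow, ← rpow_add (by norm_num)]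
  refine Real.rpow_le_rpow_of_exponent_le (by norm_num) ?_
  have h1' : (k : ℝ) ≤ l + 4 := by exact_mod_cast h1
  have h2' : (l : ℝ) ≤ k + 4 := by exact_mod_cast h2
  calc (k : ℝ) * s + l * -s = (k - l) * s := by ring
    _ ≤ |((k : ℝ) - l)| * |s| := by rw [← abs_mul]; exact le_abs_self _
    _ ≤ _ := by gcongr; rw [abs_le]; constructor <;> linarith

theorem mul_norm_le_pN (s θ : ℝ) (k i : ℕ) (f F : L2 n) : 𝟚 ^ k * 2 ^ i * ‖f‖ ≤
    (2 ^ k) ^ s * (2 ^ i) ^ θ * pN (-s + 1) (-θ + 1) k i f F := by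
  have hk : (0 : ℝ) < 2 ^ k := by positivity
  have hi : (0 : ℝ) < 2 ^ i := by positivity
  calc 𝟚 ^ k * 2 ^ i * ‖f‖ = (2 ^ k) ^ s * (2 ^ i) ^ θ *
        ((2 ^ k) ^ (-s + 1) * (2 ^ i) ^ (-θ + 1) * ‖f‖) := by
        rw [rpow_add hk, rpow_add hi, rpow_one, rpow_one,
          rpow_neg hk.le, rpow_neg hi.le]
        field_simp
    _ ≤ _ := by gcongr; exact le_pN_left ..

theorem norm_le_pN (s θ : ℝ) (k i : ℕ) (f F : L2 n) : ‖F‖ ≤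
    (𝟚 ^ k) ^ s * (2 ^ i) ^ θ * pN (-s + 1) (-θ + 1) k i f F := by
  have hk : (0 : ℝ) < 2 ^ k := by positivity
  have hi : (0 : ℝ) < 2 ^ i := by positivity
  calc ‖F‖ = (2 ^ k) ^ s * (2 ^ i) ^ θ *
        ((2 ^ k) ^ (-s + 1 - 1) * (2 ^ i) ^ (-θ + 1 - 1) * ‖F‖) := by
        rw [add_sub_cancel_right, add_sub_cancel_right,
          rpow_neg hk.le, rpow_neg hi.le]
        field_simp
    _ ≤ _ := by gcongr; exact le_pN_right ..

theorem Dec.sqrt_le {s θ A : ℝ} {v F : ℕ → ℕ → L2 n} (hv : Dec G s θ v F A) (K : Finset ℕ) :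
    √(∑ k ∈ K, √(∑ j ∈ Finset.range (k + 1), pN s θ k j (v k j) (F k j) ^ 2) ^ 2) ≤ A := by
  refine Real.sqrt_le_iff.2 ⟨hv.nonneg, le_trans (le_of_eq ?_) (hv.sum_le K)⟩
  exact sum_congr rfl fun k _ => sq_sqrt (sum_nonneg fun _ _ => sq_nonneg _)

section Pairing

include hG

theorem exists_pairing_pN {s θ : ℝ} (hθ : 0 < θ) (hθ' : θ < 1 / 2) :
    ∃ C r : ℝ, 0 ≤ C ∧ 0 < r ∧ r < 1 ∧ ∀ k l i j, k ≤ l + 4 → l ≤ k + 4 → i ≤ k → j ≤ l →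
      ∀ f F E u U : L2 n, WBox (G k) f F → WBox (G k) (LP h k f) E → WBox (G l) u U →
      ‖bil E (LP h l u)‖ ≤ r ^ (i - j) * r ^ (j - i) *
        (C * pN (-s + 1) (-θ + 1) k i f F * pN s θ l j u U) := by
  obtain ⟨C, hC, H⟩ := exists_pairing h hG
  set ε := min θ (1 / 2 - θ) with hε
  have hε0 : 0 < ε := lt_min hθ (by linarith)
  refine ⟨C * 2 ^ (4 * |s|), 2 ^ (-ε), by positivity, by positivity,
    Real.rpow_lt_one_of_one_lt_of_neg (by norm_num) (by linarith), ?_⟩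
  intro k l i j hkl hlk hik hjl f F E u U hf hE hu
  by_cases hcase : k + 4 ≤ l ∨ l + 4 ≤ k ∧ (l ≠ 0 ∨ 5 ≤ k)
  · rw [bil_box_LP_eq_zero h hG hf hE hcase, norm_zero]
    have := pN_nonneg (-s + 1) (-θ + 1) k i f F
    have := pN_nonneg s θ l j u U
    positivity
  set a := pN (-s + 1) (-θ + 1) k i f F with ha
  set b := pN s θ l j u U with hb
  have ha0 : 0 ≤ a := pN_nonneg ..
  have hb0 : 0 ≤ b := pN_nonneg ..
  have hl : (0 : ℝ) < 2 ^ l := by positivity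
  have hj : (0 : ℝ) < 2 ^ j := by positivity
  have a1 := mul_norm_le_pN s θ k i f F
  have a2 := norm_le_pN s θ k i f F
  have b1 := le_pN_left s θ l j u U
  have b2 := le_pN_right s θ l j u U
  rw [← ha] at a1 a2
  rw [← hb] at b1 b2
  clear_value a b
  obtain ⟨P1, P2⟩ := H k l i j (by omega) (by omega) (by omega) hik hjl f F E u U hf hE hu
    ((2 ^ k) ^ s * (2 ^ i) ^ θ * a) ((2 ^ l) ^ (-s) * (2 ^ j) ^ (-θ) * b)
    a1 a2
    (by
      calc ‖u‖ = (2 ^ l) ^ (-s) * (2 ^ j) ^ (-θ) * ((2 ^ l) ^ s * (2 ^ j) ^ θ * ‖u‖) := by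
            rw [rpow_neg hl.le, rpow_neg hj.le]
            field_simp
        _ ≤ _ := by gcongr)
    (by
      calc ‖U‖ = 2 ^ l * 2 ^ j * ((2 ^ l) ^ (-s) * (2 ^ j) ^ (-θ) *
            ((2 ^ l) ^ (s - 1) * (2 ^ j) ^ (θ - 1) * ‖U‖)) := by
            rw [Real.rpow_sub hl, Real.rpow_sub hj, rpow_one, rpow_one,
              rpow_neg hl.le, rpow_neg hj.le]
            field_simp
        _ ≤ _ := by gcongr)
  have hr := two_pow_rpow_ratio_le hkl hlk s
  have hC' : 0 ≤ C * (a * b) := by positivity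
  rcases le_total i j with hij | hij
  · rw [Nat.sub_eq_zero_of_le hij, pow_zero, one_mul]
    have e1 : (𝟚 ^ i) ^ θ * (2 ^ j) ^ (-θ) ≤ (2 ^ (-ε)) ^ (j - i) := by
      rw [two_pow_rpow, two_pow_rpow, ← rpow_add (by norm_num), ← rpow_natCast,
        ← rpow_mul (by norm_num), Nat.cast_sub hij]
      refine Real.rpow_le_rpow_of_exponent_le (by norm_num) ?_
      have : (i : ℝ) ≤ j := by exact_mod_cast hij
      nlinarith [min_le_left θ (1 / 2 - θ)]
    calc _ ≤ _ := P1
      _ = (2 ^ k) ^ s * (2 ^ l) ^ (-s) * ((2 ^ i) ^ θ * (2 ^ j) ^ (-θ)) * (C * (a * b)) := by ring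
      _ ≤ 2 ^ (4 * |s|) * (2 ^ (-ε)) ^ (j - i) * (C * (a * b)) := by gcongr
      _ = _ := by ring
  · rw [Nat.sub_eq_zero_of_le hij, pow_zero, mul_one]
    have e1 : √(𝟚 ^ j) / √(2 ^ i) * ((2 ^ i) ^ θ * (2 ^ j) ^ (-θ)) ≤ (2 ^ (-ε)) ^ (i - j) := by
      rw [sqrt_two_pow, sqrt_two_pow, two_pow_rpow, two_pow_rpow, ← rpow_add (by norm_num),
        ← Real.rpow_sub (by norm_num), ← rpow_add (by norm_num),
        ← rpow_natCast (𝟚 ^ (-ε)), ← rpow_mul (by norm_num), Nat.cast_sub hij]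
      refine Real.rpow_le_rpow_of_exponent_le (by norm_num) ?_
      have : (j : ℝ) ≤ i := by exact_mod_cast hij
      nlinarith [min_le_right θ (1 / 2 - θ)]
    calc _ ≤ _ := P2
      _ = (2 ^ k) ^ s * (2 ^ l) ^ (-s) * (√(2 ^ j) / √(2 ^ i) * ((2 ^ i) ^ θ * (2 ^ j) ^ (-θ)))
          * (C * (a * b)) := by ring
      _ ≤ 2 ^ (4 * |s|) * (2 ^ (-ε)) ^ (i - j) * (C * (a * b)) := by gcongr
      _ = _ := by ring

def partSum (x : ℕ → ℕ → L2 n) (k : ℕ) : L2 n := ∑ j ∈ Finset.range (k + 1), x k j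

theorem exists_pairing_sum {s θ : ℝ} (hθ : 0 < θ) (hθ' : θ < 1 / 2) :
    ∃ C : ℝ, 0 ≤ C ∧ ∀ (f F E v U : ℕ → ℕ → L2 n) (A A' : ℝ), Dec G (-s + 1) (-θ + 1) f F A →
      (∀ k j, j ≤ k → WBox (G k) (LP h k (f k j)) (E k j)) → Dec G s θ v U A' →
      ∀ K L : Finset ℕ, ∑ k ∈ K, ∑ l ∈ L,
        ‖bil (partSum E k) (partSum (fun l j => LP h l (v l j)) l)‖ ≤ C * (A * A') := by
  obtain ⟨C, r, hC, hr0, hr1, H⟩ := exists_pairing_pN h hG hθ hθ' (s := s)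
  have hR : 0 ≤ 2 * (1 - r)⁻¹ := mul_nonneg zero_le_two (inv_nonneg.2 (by linarith))
  refine ⟨C * (2 * (1 - r)⁻¹) * 9, by positivity, ?_⟩
  intro f F E v U A A' hf hE hv K L
  set a := fun k => √(∑ i ∈ Finset.range (k + 1),
    pN (-s + 1) (-θ + 1) k i (f k i) (F k i) ^ 2) with ha
  set b := fun l => √(∑ j ∈ Finset.range (l + 1), pN s θ l j (v l j) (U l j) ^ 2) with hb
  set w := fun k l : ℕ => if k ≤ l + 4 ∧ l ≤ k + 4 then (1 : ℝ) else 0 with hw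
  have hw9 (k : ℕ) (T : Finset ℕ) : ∑ l ∈ T, w k l ≤ 9 := by
    simp only [hw, Finset.sum_boole]
    have : T.filter (fun l => k ≤ l + 4 ∧ l ≤ k + 4) ⊆ Finset.Icc (k - 4) (k + 4) := fun l hl => by
      have := (mem_filter.1 hl).2
      rw [Finset.mem_Icc]; omega
    have := Finset.card_le_card this
    rw [Nat.card_Icc] at this
    exact_mod_cast (by omega : _ ≤ 9)
  have hwc (k l : ℕ) : w k l = w l k := by simp only [hw, and_comm]
  have key (k l : ℕ) : ‖bil (partSum E k) (partSum (fun l j => LP h l (v l j)) l)‖ ≤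
      C * (2 * (1 - r)⁻¹) * (w k l * (a k * b l)) := by
    have e : bil (partSum E k) (partSum (fun l j => LP h l (v l j)) l) =
        ∑ i ∈ Finset.range (k + 1), ∑ j ∈ Finset.range (l + 1),
          bil (E k i) (LP h l (v l j)) := by
      rw [partSum, map_sum, FunLike.coe_sum, Finset.sum_apply]
      exact sum_congr rfl fun i _ => by rw [partSum, map_sum]
    rw [e]
    by_cases hkl : k ≤ l + 4 ∧ l ≤ k + 4
    · have h1 := sum_schur_le (Finset.range (k + 1)) (Finset.range (l + 1))
        (w := fun i j => r ^ (i - j) * r ^ (j - i)) (fun i j => by positivity)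
        (fun i => sum_pow_dist_le hr0 hr1 i _)
        (fun j => by simpa only [mul_comm] using sum_pow_dist_le hr0 hr1 j (Finset.range (k + 1)))
        (fun i => pN (-s + 1) (-θ + 1) k i (f k i) (F k i))
        (fun j => pN s θ l j (v l j) (U l j))
      calc _ ≤ ∑ i ∈ Finset.range (k + 1), ∑ j ∈ Finset.range (l + 1),
            C * (r ^ (i - j) * r ^ (j - i) * (pN (-s + 1) (-θ + 1) k i (f k i) (F k i) *
              pN s θ l j (v l j) (U l j))) := by
            refine norm_sum_le_of_le _ fun i hi => norm_sum_le_of_le _ fun j hj => ?_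
            have hi := mem_range_succ_iff.1 hi
            have hj := mem_range_succ_iff.1 hj
            refine (H k l i j hkl.1 hkl.2 hi hj _ _ _ _ _ (hf.box k i hi) (hE k i hi)
              (hv.box l j hj)).trans (le_of_eq (by ring))
        _ ≤ C * (2 * (1 - r)⁻¹ * (a k * b l)) := by
            simp only [← mul_sum]
            exact mul_le_l h1 hC
        _ = _ := by simp only [hw, if_pos hkl]; ring
    · rw [sum_eq_zero, norm_zero]
      · simp only [hw, if_neg hkl]; simp
      · intro i hi
        refine sum_eq_zero fun j _ => ?_
        have hi := mem_range_succ_iff.1 hi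
        exact bil_box_LP_eq_zero h hG (hf.box k i hi) (hE k i hi) (by omega) _
  have h2 := sum_schur_le K L (w := w) (R := 9) (fun k l => by simp only [hw]; positivity)
    (fun k => hw9 k L) (fun l => by simpa only [hwc] using hw9 l K) a b
  calc _ ≤ ∑ k ∈ K, ∑ l ∈ L, C * (2 * (1 - r)⁻¹) * (w k l * (a k * b l)) :=
        sum_le_sum fun k _ => sum_le_sum fun l _ => key k l
    _ ≤ C * (2 * (1 - r)⁻¹) * (9 * (√(∑ k ∈ K, a k ^ 2) * √(∑ l ∈ L, b l ^ 2))) := by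
        simp only [← mul_sum]
        gcongr
    _ ≤ C * (2 * (1 - r)⁻¹) * (9 * (A * A')) := by
        gcongr
        · exact hf.nonneg
        · exact hf.sqrt_le K
        · exact hv.sqrt_le L
    _ = _ := by ring

theorem exists_norm_box_le (s : ℝ) {θ : ℝ} (hθ : 0 < θ) :
    ∃ C : ℝ, 0 ≤ C ∧ ∀ (f F E : ℕ → ℕ → L2 n) (A : ℝ), Dec G (-s + 1) (-θ + 1) f F A →
      (∀ k j, j ≤ k → WBox (G k) (LP h k (f k j)) (E k j)) → ∀ k, ‖partSum E k‖ ≤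
        C * (𝟚 ^ k) ^ (s + θ) * √(∑ i ∈ Finset.range (k + 1),
          pN (-s + 1) (-θ + 1) k i (f k i) (F k i) ^ 2) := by
  obtain ⟨C, hC, H⟩ := exists_piece h hG
  obtain ⟨C', hC', H'⟩ := exists_norm_LP_le (n := n) h
  set x : ℝ := 2 ^ (2 * θ) with hx
  have hx1 : 1 < x := Real.one_lt_rpow (by norm_num) (by linarith)
  have hx2 : 0 ≤ x / (x - 1) := div_nonneg (by linarith) (by linarith)
  refine ⟨(C * 2 + C') * √(x / (x - 1)), by positivity, ?_⟩
  intro f F E A hf hE k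
  set p := fun i => pN (-s + 1) (-θ + 1) k i (f k i) (F k i) with hp
  have hgeo : ∑ i ∈ Finset.range (k + 1), ((𝟚 ^ i) ^ θ) ^ 2 ≤
      x / (x - 1) * ((𝟚 ^ k) ^ θ) ^ 2 := by
    simp only [sq_two_pow_rpow]
    rw [geom_sum_eq hx1.ne', div_mul_eq_mul_div, ← pow_succ']
    have : 0 < x - 1 := by linarith
    gcongr; linarith
  have hpiece (i : ℕ) (hi : i ≤ k) :
      ‖E k i‖ ≤ (C * 2 + C') * (2 ^ k) ^ s * ((2 ^ i) ^ θ * p i) := by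
    obtain ⟨d, e, hj, -, h1⟩ := H k _ _ (hf.box k i hi)
    rw [(hE k i hi).unique (hj.wBox hG k)]
    set X : ℝ := (2 ^ k) ^ s * (2 ^ i) ^ θ * p i with hX
    have a1 : 𝟚 ^ k * 2 ^ i * ‖f k i‖ ≤ X := mul_norm_le_pN ..
    have a2 : ‖F k i‖ ≤ X := norm_le_pN ..
    have h2 : 𝟚 ^ k * ‖f k i‖ ≤ X := le_trans (by
      rw [mul_right_comm]
      exact le_mul_of_one_le_right (by positivity) (one_le_pow₀ (by norm_num))) a1
    have h3 : (𝟚 ^ k)⁻¹ * ‖F k i‖ ≤ X := le_trans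
      (mul_le_of_le_one_left (norm_nonneg _) (inv_le_one_of_one_le₀ (one_le_pow₀ (by norm_num)))) a2
    calc _ ≤ ‖Lop (G k) e - LP h k (F k i)‖ + ‖LP h k (F k i)‖ := by
          simpa using norm_add_le (Lop (G k) e - LP h k (F k i)) (LP h k (F k i))
      _ ≤ C * (X + X) + C' * X := by
          refine add_le_add (h1.trans (by gcongr)) ((H' k _).trans (by gcongr))
      _ = _ := by rw [hX]; ring
  calc _ ≤ ∑ i ∈ Finset.range (k + 1), (C * 2 + C') * (2 ^ k) ^ s * ((2 ^ i) ^ θ * p i) :=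
        norm_sum_le_of_le _ fun i hi => hpiece i (mem_range_succ_iff.1 hi)
    _ ≤ (C * 2 + C') * (2 ^ k) ^ s * (√(x / (x - 1) * ((𝟚 ^ k) ^ θ) ^ 2) *
          √(∑ i ∈ Finset.range (k + 1), p i ^ 2)) := by
        rw [← mul_sum]
        gcongr
        refine (Real.sum_mul_le_sqrt_mul_sqrt _ _ _).trans ?_
        gcongr
    _ = _ := by
        rw [sqrt_mul hx2, sqrt_sq (by positivity), rpow_add (by positivity)]
        ring

end Pairing

theorem mulOp_wt_refl {ρ : ℝ} (hρ : ρ ≤ 0) (u : L2 n) :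
    mulOp (fun z => ((wt z ^ ρ : ℝ) : ℂ)) (refl u) =
      refl (mulOp (fun z => ((wt z ^ ρ : ℝ) : ℂ)) u) := by
  have e : (fun z : ST n => ((wt (z.1, -z.2) ^ ρ : ℝ) : ℂ)) = fun z => ((wt z ^ ρ : ℝ) : ℂ) := by
    simp [wt]
  rw [mulOp_refl (Θ := fun z => ((wt z ^ ρ : ℝ) : ℂ)) (BM_wt hρ) (by rw [e]; exact BM_wt hρ), e]

theorem norm_mulOp_wt_le {ρ : ℝ} (hρ : ρ ≤ 0) (u : L2 n) :
    ‖mulOp (fun z => ((wt z ^ ρ : ℝ) : ℂ)) u‖ ≤ ‖u‖ := by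
  rw [← one_mul ‖u‖]
  exact norm_mulOp_le (BM_wt hρ) (norm_wt_rpow_le hρ) u

theorem dist_mulOp_wt (ρ : ℝ) {ρ' : ℝ} (hρ : ρ' ≤ 0) (W : L2 n) :
    dist ρ (mulOp (fun z => ((wt z ^ ρ' : ℝ) : ℂ)) W) = dist (ρ + ρ') W := by
  ext ψ
  rw [dist_apply, dist_apply, bil_eq, bil_eq]
  refine integral_congr_ae ?_
  filter_upwards [coeFn_mulOp (BM_wt hρ) W, coeFn_Wt ρ ψ, coeFn_Wt (ρ + ρ') ψ] with z a b c
  rw [a, b, c, rpow_add (wt_pos z), ofReal_mul]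
  ring

theorem bil_lift_mulOp_wt (ρ : ℝ) {ρ' : ℝ} (hρ : ρ' ≤ 0) (k : ℕ) (x W : L2 n) :
    bil (lift ρ k x) (refl (mulOp (fun z => ((wt z ^ ρ' : ℝ) : ℂ)) W)) =
      bil (lift (ρ + ρ') k x) (refl (mulOp (wS k 0) W)) := by
  have e : (fun z : ST n => ((wt z ^ ρ' : ℝ) : ℂ) * wS k ρ z) =
      fun z => wS k 0 z * wS k (ρ + ρ') z := by
    funext z
    rw [wS_mul, zero_add, wS, wS, rpow_add (wt_pos z), ofReal_mul]
    ring
  change bil (mulOp (wS k ρ) (U1 x)) _ = bil (mulOp (wS k (ρ + ρ')) (U1 x)) _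
  rw [← mulOp_wt_refl hρ, ← bil_mulOp (BM_wt hρ), mulOp_mulOp (BM_wt hρ) (BM_wS k ρ), e,
    ← mulOp_mulOp (BM_wS k 0) (BM_wS k _), bil_mulOp (BM_wS k 0), mulOp_wS_refl]

section Sum

def liftLP (s : ℝ) (v : ℕ → ℕ → L2 n) (k : ℕ) : L2 n :=
  lift (s / 2) k (partSum (fun k j => LP h k (v k j)) k)

theorem Loc_partSum_LP (v : ℕ → ℕ → L2 n) (k : ℕ) :
    Loc k (partSum (fun k j => LP h k (v k j)) k) :=
  Loc.sum _ fun _ _ => Loc_LP h k _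

theorem exists_summable_liftLP (s : ℝ) {θ : ℝ} (hθ : 0 < θ) : ∃ C : ℝ, 0 ≤ C ∧
    ∀ (v U : ℕ → ℕ → L2 n) (A : ℝ), Dec G s θ v U A →
      Summable (liftLP h s v) ∧ ‖∑' k, liftLP h s v k‖ ≤ C * A := by
  obtain ⟨C', hC', H'⟩ := exists_norm_LP_le (n := n) h
  set x : ℝ := 2 ^ (2 * -θ)
  have hx0 : 0 < x := by positivity
  have hx1 : x < 1 := Real.rpow_lt_one_of_one_lt_of_neg (by norm_num) (by linarith)
  have hR : 0 ≤ (1 - x)⁻¹ := inv_nonneg.2 (by linarith [hx1])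
  set C := 𝟚 ^ (8 * |s / 2|) * C' * √((1 - x)⁻¹) with hC
  have hC0 : 0 ≤ C := by positivity
  refine ⟨√7 * C, by positivity, fun v U A hv => ?_⟩
  set p := fun k j => pN s θ k j (v k j) (U k j)
  have hgeo (k : ℕ) : ∑ j ∈ Finset.range (k + 1), ((𝟚 ^ j) ^ (-θ)) ^ 2 ≤ (1 - x)⁻¹ := by
    simp only [sq_two_pow_rpow]
    exact sum_geom_le hx0 hx1 (Set.injOn_id _)
  have key (k : ℕ) : ‖liftLP h s v k‖ ≤ C * √(∑ j ∈ Finset.range (k + 1), p k j ^ 2) := by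
    have hy : (𝟚 ^ k) ^ s * ‖partSum (fun k j => LP h k (v k j)) k‖ ≤
        C' * (√((1 - x)⁻¹) * √(∑ j ∈ Finset.range (k + 1), p k j ^ 2)) := by
      calc _ ≤ (2 ^ k) ^ s * ∑ j ∈ Finset.range (k + 1), C' * ‖v k j‖ := by
            gcongr; exact norm_sum_le_of_le _ fun j _ => H' k _
        _ = C' * ∑ j ∈ Finset.range (k + 1), (2 ^ k) ^ s * ‖v k j‖ := by
            rw [← mul_sum, ← mul_sum]; ring
        _ ≤ C' * ∑ j ∈ Finset.range (k + 1), (2 ^ j) ^ (-θ) * p k j := by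
            refine mul_le_l (sum_le_sum fun j _ => ?_) (by positivity)
            have hj : (0 : ℝ) < 2 ^ j := by positivity
            calc (2 ^ k) ^ s * ‖v k j‖ = (2 ^ j) ^ (-θ) * ((2 ^ k) ^ s * (2 ^ j) ^ θ * ‖v k j‖) := by
                  rw [rpow_neg hj.le]; field_simp
              _ ≤ _ := mul_le_l (le_pN_left ..) (by positivity)
        _ ≤ C' * (√(∑ j ∈ Finset.range (k + 1), ((𝟚 ^ j) ^ (-θ)) ^ 2) *
              √(∑ j ∈ Finset.range (k + 1), p k j ^ 2)) := by
            gcongr; exact Real.sum_mul_le_sqrt_mul_sqrt _ _ _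
        _ ≤ _ := by gcongr; exact hgeo k
    refine (norm_lift_le _ _ _).trans ?_
    rw [mul_div_cancel₀ s two_ne_zero, mul_assoc]
    exact (mul_le_l hy (by positivity)).trans (le_of_eq (by rw [hC]; ring))
  have hsq (k : ℕ) : ‖liftLP h s v k‖ ^ 2 ≤ C ^ 2 * ∑ j ∈ Finset.range (k + 1), p k j ^ 2 := by
    refine (pow_le_pow_left₀ (norm_nonneg _) (key k) 2).trans (le_of_eq ?_)
    rw [mul_pow, sq_sqrt (sum_nonneg fun _ _ => sq_nonneg _)]
  have hsum (K : Finset ℕ) : ∑ k ∈ K, ‖liftLP h s v k‖ ^ 2 ≤ C ^ 2 * A ^ 2 := by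
    refine (sum_le_sum fun k _ => hsq k).trans ?_
    rw [← mul_sum]
    exact mul_le_l (hv.sum_le K) (sq_nonneg C)
  have hs := summable_of_sum_le (fun k => sq_nonneg ‖liftLP h s v k‖) hsum
  obtain ⟨h1, h2⟩ := summable_shell (fun k => mulOp_lift _ k _) hs
  refine ⟨h1, le_of_sq_le_sq (h2.trans ?_) (mul_nonneg (by positivity) hv.nonneg)⟩
  calc _ ≤ 7 * (C ^ 2 * A ^ 2) := by
        gcongr
        exact hs.tsum_le_of_sum_le hsum
    _ = √7 ^ 2 * (C ^ 2 * A ^ 2) := by rw [sq_sqrt (by norm_num)]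
    _ = _ := by ring

include hG

theorem Loc_partSum_box {s θ A : ℝ} {f F E : ℕ → ℕ → L2 n} (hf : Dec G s θ f F A)
    (hE : ∀ k j, j ≤ k → WBox (G k) (LP h k (f k j)) (E k j)) (k : ℕ) : Loc k (partSum E k) :=
  Loc.sum _ fun i hi => by
    have hi := mem_range_succ_iff.1 hi
    exact Loc_box h hG (hf.box k i hi) (hE k i hi)

theorem exists_sum_bil_le (s : ℝ) {θ : ℝ} (hθ : 0 < θ) (hθ' : θ < 1 / 2) : ∃ C : ℝ, 0 ≤ C ∧
    ∀ (f F E : ℕ → ℕ → L2 n) (A : ℝ), Dec G (-s + 1) (-θ + 1) f F A →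
      (∀ k j, j ≤ k → WBox (G k) (LP h k (f k j)) (E k j)) →
      (∀ (v U : ℕ → ℕ → L2 n) (A' : ℝ), Dec G s θ v U A' → ∀ W, HasSum (liftLP h s v) W →
        ∀ K : Finset ℕ, ∑ k ∈ K, ‖bil (lift (-(s / 2)) k (partSum E k)) (refl W)‖ ≤
          C * (A * A')) ∧
      ∀ (W : L2 n) (K : Finset ℕ), ∑ k ∈ K, ‖bil (lift (-(s / 2)) k (partSum E k))
        (refl (mulOp (fun z => ((wt z ^ (-θ / 2) : ℝ) : ℂ)) W))‖ ≤ C * (A * ‖W‖) := by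
  obtain ⟨C1, hC1, H1⟩ := exists_pairing_sum h hG (s := s) hθ hθ'
  obtain ⟨C2, hC2, H2⟩ := exists_norm_box_le h hG s hθ
  set D := 𝟚 ^ (8 * |-(s / 2) + -θ / 2|) * C2 with hD
  have hD0 : 0 ≤ D := by positivity
  refine ⟨max C1 (D * √7), le_max_of_le_left hC1, fun f F E A hf hE => ⟨?_, ?_⟩⟩
  · intro v U A' hv W hW K
    have hA := mul_nonneg hf.nonneg hv.nonneg
    refine le_trans ?_ (mul_le_r (le_max_left _ _) hA)
    have hlim (k : ℕ) : HasSum (fun l => bil (partSum E k) (partSum (fun l j => LP h l (v l j)) l))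
        (bil (lift (-(s / 2)) k (partSum E k)) (refl W)) := by
      refine ((hW.mapL refl.toContinuousLinearMap).mapL
        (bil (lift (-(s / 2)) k (partSum E k)))).congr_fun ?_
      intro l
      exact (bil_lift_lift (Loc_partSum_box h hG hf hE k) (Loc_partSum_LP h v l)).symm
    refine le_of_tendsto (tendsto_finsetSum K fun k _ => (hlim k).norm) (.of_forall fun L => ?_)
    exact (sum_le_sum fun k _ => norm_sum_le _ _).trans (H1 f F E v U A A' hf hE hv K L)
  · intro W K
    refine le_trans ?_ (mul_le_r (le_max_right _ _)
      (mul_nonneg hf.nonneg (norm_nonneg W)))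
    set a := fun k => √(∑ i ∈ Finset.range (k + 1),
      pN (-s + 1) (-θ + 1) k i (f k i) (F k i) ^ 2) with ha
    have key (k : ℕ) : ‖bil (lift (-(s / 2)) k (partSum E k))
        (refl (mulOp (fun z => ((wt z ^ (-θ / 2) : ℝ) : ℂ)) W))‖ ≤
        D * (a k * ‖mulOp (wS k 0) W‖) := by
      rw [bil_lift_mulOp_wt _ (by linarith)]
      have hk : (0 : ℝ) < 2 ^ k := by positivity
      have e : (𝟚 ^ k) ^ (2 * (-(s / 2) + -θ / 2)) * (2 ^ k) ^ (s + θ) = 1 := by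
        rw [← rpow_add hk]
        ring_nf
        exact Real.rpow_zero _
      calc _ ≤ ‖lift (-(s / 2) + -θ / 2) k (partSum E k)‖ * ‖refl (mulOp (wS k 0) W)‖ :=
            norm_bil_le _ _
        _ ≤ (2 ^ (8 * |-(s / 2) + -θ / 2|) * (2 ^ k) ^ (2 * (-(s / 2) + -θ / 2)) *
            (C2 * (2 ^ k) ^ (s + θ) * a k)) * ‖mulOp (wS k 0) W‖ := by
            rw [LinearIsometry.norm_map]
            gcongr
            refine (norm_lift_le _ _ _).trans ?_
            gcongr
            exact H2 f F E A hf hE k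
        _ = D * (a k * ‖mulOp (wS k 0) W‖) * ((2 ^ k) ^ (2 * (-(s / 2) + -θ / 2)) *
            (2 ^ k) ^ (s + θ)) := by rw [hD]; ring
        _ = _ := by rw [e, mul_one]
    calc _ ≤ ∑ k ∈ K, D * (a k * ‖mulOp (wS k 0) W‖) := sum_le_sum fun k _ => key k
      _ ≤ D * (√(∑ k ∈ K, a k ^ 2) * √(∑ k ∈ K, ‖mulOp (wS k 0) W‖ ^ 2)) := by
          rw [← mul_sum]
          gcongr
          exact Real.sum_mul_le_sqrt_mul_sqrt _ _ _
      _ ≤ D * (A * √(7 * ‖W‖ ^ 2)) := by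
          gcongr
          · exact hf.nonneg
          · exact hf.sqrt_le K
          · exact sum_norm_sq_shell_le K W
      _ = _ := by rw [sqrt_mul (by norm_num), sqrt_sq (norm_nonneg _)]; ring

end Sum

theorem ofReal_sq_rpow {M : ℝ} (hM : 0 ≤ M) : ofReal (M ^ 2) ^ (1 / 2 : ℝ) = ofReal M := by
  rw [ENNReal.ofReal_rpow_of_nonneg (sq_nonneg M) ✓, ← sqrt_eq_rpow, sqrt_sq hM]

theorem le_ofReal_mul_of_forall_lt {Q : ℝ} (hQ : 0 < Q) {x N : ℝ≥0∞}
    (H : ∀ M : ℝ, N < ofReal M → x ≤ ofReal (Q * M)) : x ≤ ofReal Q * N := by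
  refine ENNReal.le_mul_of_forall_lt (.inl (ENNReal.ofReal_pos.2 hQ).ne') (.inl ENNReal.ofReal_ne_top)
    fun a ha b hb => ?_
  rcases eq_or_ne b ⊤ with rfl | hb'
  · rw [ENNReal.mul_top (pos_of_gt ha).ne']; exact le_top
  have := H b.toReal (by rwa [ofReal_toReal hb'])
  rw [ENNReal.ofReal_mul hQ.le, ofReal_toReal hb'] at this
  exact this.trans (mul_le_mul_left ha.le _)

theorem dist_zero (ρ : ℝ) : dist ρ (0 : L2 n) = 0 := by
  ext ψ
  rw [dist_apply, map_zero]
  rfl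

theorem coeFn_refl_Wt (ρ : ℝ) (ψ : 𝓣) :
    refl (Wt ρ ψ) =ᵐ[ϖ] fun z => ((wt z ^ ρ : ℝ) : ℂ) * U1 (tst ψ) z := by
  rw [← refl_refl (U1 (tst ψ)), ← U0_eq_refl]
  filter_upwards [coeFn_refl (Wt ρ ψ), coeFn_refl (U0 (tst ψ)),
    mp_neg.quasiMeasurePreserving.ae (coeFn_Wt ρ ψ)] with z a b d
  have e : wt (z.1, -z.2) = wt z := by simp [wt]
  rw [a, b, d, e]

theorem bil_refl_Wt (ρ : ℝ) (ψ χ : 𝓣) :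
    bil (refl (Wt ρ ψ)) (Wt (-ρ) χ) = bil (tst ψ) (tst χ) := by
  rw [← bil_U1_U0 (tst ψ), bil_eq, bil_eq]
  refine integral_congr_ae ?_
  filter_upwards [coeFn_refl_Wt ρ ψ, coeFn_Wt (-ρ) χ] with z a c
  rw [a, c, mul_mul_mul_comm, ← ofReal_mul, ← rpow_add (wt_pos z),
    add_neg_cancel, Real.rpow_zero, Complex.ofReal_one, one_mul]

def tD (ψ : 𝓣) : 𝓣' := dist 0 (refl (Wt 0 ψ))

theorem tD_apply (ψ χ : 𝓣) : tD ψ χ = bil (tst ψ) (tst χ) := by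
  rw [tD, dist_apply, ← bil_refl_Wt 0, neg_zero]

theorem tD_eq (ρ : ℝ) (ψ : 𝓣) : tD ψ = dist (-ρ) (refl (Wt ρ ψ)) := by
  ext χ
  rw [tD_apply, dist_apply, bil_refl_Wt]

theorem exists_functional (h : IsLPProfile φ) {Y : Submodule ℂ 𝓣'} {ρ : ℝ}
    (W₀ : L2 n) {F : ℕ → L2 n}
    (hY : ∀ u ∈ Y, ∃ W, u = dist ρ W ∧ Summable fun k => bil (F k) (refl W)) :
    ∃ T : Y →ₗ[ℂ] ℂ, ∀ (u : Y) (W : L2 n), (u : 𝓣') = dist ρ W →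
      T u = bil W₀ (refl W) + ∑' k, bil (F k) (refl W) := by
  choose w hw hs using fun u : Y => hY u u.2
  have hadd (u v : Y) : w (u + v) = w u + w v := dist_injective h (ρ := ρ) <| by
    rw [dist_add, ← hw, ← hw, ← hw]; rfl
  have hsmul (a : ℂ) (u : Y) : w (a • u) = a • w u := dist_injective h (ρ := ρ) <| by
    rw [dist_smul, ← hw, ← hw]; rfl
  refine ⟨⟨⟨fun u => bil W₀ (refl (w u)) + ∑' k, bil (F k) (refl (w u)), fun u v => ?_⟩,
    fun a u => ?_⟩, fun u W e => ?_⟩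
  · simp only [hadd, map_add]
    rw [(hs u).tsum_add (hs v)]
    ring
  · simp only [hsmul, map_smul, smul_eq_mul, RingHom.id_apply]
    rw [tsum_mul_left]
    ring
  · rw [hw u] at e
    rw [← dist_injective h e]
    rfl

section Norms

abbrev GT (g : Λ → Λ → ST n → ℝ) (k : ℕ) :
    Λ → Λ → ST n → ℝ :=
  fun i j => Gm h (max 1 (k / 2) - 1) (g i j)

variable {g : Fin (n + 1) → Fin (n + 1) → ST n → ℝ} (hγ : Coef (GT h g) B c k₀ CΓ)

theorem sum_integral_lpProj (v : ℕ → ℕ → L2 n) (k : ℕ) (ψ : 𝓣) :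
    ∑ j ∈ Finset.range (k + 1), ∫ z, lpProj φ k (v k j) z * (ψ z : ℂ) ∂ϖ =
      bil (partSum (fun k j => LP h k (v k j)) k) (tst ψ) := by
  rw [partSum, map_sum, FunLike.coe_sum, Finset.sum_apply]
  refine sum_congr rfl fun j _ => ?_
  rw [← integral_lpProj h]
  refine integral_congr_ae ?_
  filter_upwards [coeFn_tst ψ] with z hz
  rw [hz]

theorem dist_liftLP (s : ℝ) (v : ℕ → ℕ → L2 n) (k : ℕ) (ψ : 𝓣) :
    dist (-s / 2) (liftLP h s v k) ψ = bil (partSum (fun k j => LP h k (v k j)) k) (tst ψ) := by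
  rw [neg_div]
  exact dist_lift (Loc_partSum_LP h v k) ψ

theorem Dec.zero (s θ : ℝ) : Dec (GT h g) s θ (fun _ _ => 0) (fun _ _ => 0) 0 where
  nonneg := le_rfl
  box k j _ ψ := by simp
  sum_le K := by simp [sq_pN]

include hγ

theorem sum_integral_boxT {v E : ℕ → ℕ → L2 n}
    (hE : ∀ k j, j ≤ k → WBox (GT h g k) (LP h k (v k j)) (E k j)) (k : ℕ) (ψ : 𝓣) :
    ∑ j ∈ Finset.range (k + 1), ∫ z, lpProj φ k (v k j) z * boxT φ g k ψ z ∂ϖ =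
      bil (partSum E k) (tst ψ) := by
  rw [partSum, map_sum, FunLike.coe_sum, Finset.sum_apply]
  refine sum_congr rfl fun j hj => ?_
  rw [integral_mul_boxT h (hγ.smooth k), integral_lpProj h,
    hE k j (mem_range_succ_iff.1 hj) ψ]

theorem normXPos_dist_le {s θ A : ℝ} {v U : ℕ → ℕ → L2 n} (hv : Dec (GT h g) s θ v U A) {W : L2 n}
    (hW : HasSum (liftLP h s v) W) :
    normXPos φ g s θ (dist (-s / 2) W) ≤ ofReal A := by
  have h1 : normL2H s (dist (-s / 2) W) < ⊤ := by
    rw [normL2H_dist h]; exact enorm_lt_top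
  have h2 (k j) (hj : j ≤ k) : HasWeakBox φ g k (v k j) (U k j) :=
    (hasWeakBox_iff h (hγ.smooth k) _ _).2 (hv.box k j hj)
  have h3 (ψ : 𝓣) : HasSum (fun k : ℕ => ∑ j ∈ Finset.range (k + 1),
      ∫ z, lpProj φ k (v k j) z * (ψ z : ℂ) ∂ϖ) (dist (-s / 2) W ψ) := by
    simp only [sum_integral_lpProj h, ← dist_liftLP h s v, dist_apply]
    exact hW.mapL (bil.flip (Wt (-s / 2) ψ))
  calc _ ≤ totalSq s θ v U ^ (1 / 2 : ℝ) := by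
        rw [normXPos]
        gcongr
        exact iInf_le_of_le v <| iInf_le_of_le U <| iInf_le_of_le h1 <| iInf_le_of_le h2 <|
          iInf_le _ h3
    _ ≤ ofReal (A ^ 2) ^ (1 / 2 : ℝ) := by
        gcongr; exact totalSq_le_iff.2 hv.sum_le
    _ = _ := ofReal_sq_rpow hv.nonneg

theorem exists_dec_of_normXPos_lt {s θ : ℝ} (hθ : 0 < θ) {u : 𝓣'} {M : ℝ}
    (hu : normXPos φ g s θ u < ofReal M) : ∃ v U W, Dec (GT h g) s θ v U M ∧
      HasSum (liftLP h s v) W ∧ u = dist (-s / 2) W := by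
  have hM : 0 < M := ENNReal.ofReal_pos.1 (bot_le.trans_lt hu)
  rw [normXPos, ← ofReal_sq_rpow hM.le, ENNReal.rpow_lt_rpow_iff ✓] at hu
  simp only [iInf_lt_iff] at hu
  obtain ⟨v, U, h1, h2, h3, h4⟩ := hu
  have hv : Dec (GT h g) s θ v U M :=
    ⟨hM.le, fun k j hj => (hasWeakBox_iff h (hγ.smooth k) _ _).1 (h2 k j hj),
      totalSq_le_iff.1 h4.le⟩
  obtain ⟨C, -, H⟩ := exists_summable_liftLP (n := n) h s hθ (G := GT h g)
  have hs := (H v U M hv).1.hasSum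
  refine ⟨v, U, _, hv, hs, ?_⟩
  ext ψ
  have := h3 ψ
  simp only [sum_integral_lpProj h, ← dist_liftLP h s v, dist_apply] at this
  rw [dist_apply]
  exact this.unique (hs.mapL (bil.flip (Wt (-s / 2) ψ)))

theorem exists_split {s θ : ℝ} (hθ : 0 < θ) {u : 𝓣'} {M : ℝ}
    (hu : normSum φ g s θ u < ofReal M) : ∃ v U W₁ W₂, Dec (GT h g) s θ v U M ∧
      HasSum (liftLP h s v) W₁ ∧ ‖W₂‖ ≤ M ∧
      u = dist (-s / 2) (W₁ + mulOp (fun z => ((wt z ^ (-θ / 2) : ℝ) : ℂ)) W₂) := by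
  simp only [normSum, iInf_lt_iff] at hu
  obtain ⟨u₁, u₂, rfl, hu⟩ := hu
  obtain ⟨v, U, W, h1, h2, rfl⟩ :=
    exists_dec_of_normXPos_lt h hγ hθ ((le_self_add).trans_lt hu)
  have h3 : normL2H (s + θ) u₂ < ofReal M :=
    (le_add_self).trans_lt hu
  obtain ⟨W₂, rfl⟩ := exists_dist (h3.trans_le le_top)
  rw [normL2H_dist h, ← ofReal_norm,
    ENNReal.ofReal_lt_ofReal_iff_of_nonneg (norm_nonneg _)] at h3
  refine ⟨v, U, W, W₂, h1, h2, h3.le, ?_⟩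
  rw [dist_add, dist_mulOp_wt _ (by linarith)]
  congr 2
  ring

theorem normSum_dist_le {s θ A : ℝ} {v U : ℕ → ℕ → L2 n} (hv : Dec (GT h g) s θ v U A) {W : L2 n}
    (hW : HasSum (liftLP h s v) W) :
    normSum φ g s θ (dist (-s / 2) W) ≤ ofReal A := by
  have e : normL2H (s + θ) (0 : 𝓣') = 0 := by
    rw [← dist_zero (-(s + θ) / 2), normL2H_dist h, enorm_zero]
  refine iInf_le_of_le (dist (-s / 2) W) <| iInf_le_of_le 0 <| iInf_le_of_le (add_zero _).symm ?_
  rw [e, add_zero]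
  exact normXPos_dist_le h hγ hv hW

theorem normSum_dist_add_le (s θ : ℝ) (W : L2 n) :
    normSum φ g s θ (dist (-(s + θ) / 2) W) ≤ ‖W‖ₑ := by
  have e : normXPos φ g s θ (dist (-s / 2) 0) ≤ 0 := by
    have := normXPos_dist_le h hγ (Dec.zero h s θ) (W := 0) (by
      have e : liftLP h s (fun _ _ => 0) = fun _ => (0 : L2 n) := by
        funext k; simp [liftLP, partSum]
      rw [e]; exact hasSum_zero)
    rwa [ENNReal.ofReal_zero] at this
  refine iInf_le_of_le (dist (-s / 2) 0) <| iInf_le_of_le (dist (-(s + θ) / 2) W) <|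
    iInf_le_of_le (by rw [dist_zero, zero_add]) ?_
  rw [normL2H_dist h, nonpos_iff_eq_zero.1 e, zero_add]

theorem mem_XSum (s θ : ℝ) (W : L2 n) : dist (-(s + θ) / 2) W ∈ XSum φ g s θ :=
  Submodule.subset_span ((normSum_dist_add_le h hγ s θ W).trans_lt enorm_lt_top)

theorem tD_mem (s θ : ℝ) (ψ : 𝓣) : tD ψ ∈ XSum φ g s θ := by
  rw [tD_eq ((s + θ) / 2), ← neg_div]
  exact mem_XSum h hγ s θ _

theorem exists_dec_of_normXNeg_lt {s θ : ℝ} {f : 𝓣'} {M : ℝ}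
    (hf : normXNeg φ g (-s) (-θ) f < ofReal M) : ∃ W₀ v F E, ‖W₀‖ ≤ M ∧
      Dec (GT h g) (-s + 1) (-θ + 1) v F M ∧
      (∀ k j, j ≤ k → WBox (GT h g k) (LP h k (v k j)) (E k j)) ∧
      ∀ ψ, HasSum (fun k => bil (partSum E k) (tst ψ)) (f ψ - dist (s / 2) W₀ ψ) := by
  have hM : 0 < M := ENNReal.ofReal_pos.1 (bot_le.trans_lt hf)
  rw [normXNeg, ← ofReal_sq_rpow hM.le, ENNReal.rpow_lt_rpow_iff ✓] at hf
  simp only [iInf_lt_iff] at hf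
  obtain ⟨f₀, v, F, h2, h3, h4⟩ := hf
  have hv : Dec (GT h g) (-s + 1) (-θ + 1) v F M :=
    ⟨hM.le, fun k j hj => (hasWeakBox_iff h (hγ.smooth k) _ _).1 (h2 k j hj),
      totalSq_le_iff.1 ((le_add_self).trans h4.le)⟩
  have h5 : normL2H (-s) f₀ < ofReal M := by
    have := (le_self_add).trans_lt h4
    rw [ENNReal.ofReal_pow hM.le] at this
    exact lt_of_not_ge fun hc => absurd this (not_lt.2 (pow_le_pow_left' hc 2))
  obtain ⟨W₀, rfl⟩ := exists_dist (h5.trans_le le_top)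
  rw [normL2H_dist h, ← ofReal_norm,
    ENNReal.ofReal_lt_ofReal_iff_of_nonneg (norm_nonneg _)] at h5
  obtain ⟨C, -, H⟩ := exists_piece h hγ
  have hE (k j : ℕ) : ∃ E, j ≤ k → WBox (GT h g k) (LP h k (v k j)) E := by
    by_cases hj : j ≤ k
    · obtain ⟨d, e, hj', -⟩ := H k _ _ (hv.box k j hj)
      exact ⟨_, fun _ => hj'.wBox hγ k⟩
    · simp_all
  choose E hE using hE
  refine ⟨W₀, v, F, E, h5.le, hv, hE, fun ψ => ?_⟩
  have := h3 ψ
  simp only [sum_integral_boxT h hγ hE, neg_neg] at this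
  exact this

theorem normXNeg_le {s θ M : ℝ} {f : 𝓣'} {W₀ : L2 n} {v F E : ℕ → ℕ → L2 n}
    (hW : ‖W₀‖ ≤ M) (hv : Dec (GT h g) (-s + 1) (-θ + 1) v F M)
    (hE : ∀ k j, j ≤ k → WBox (GT h g k) (LP h k (v k j)) (E k j))
    (hs : ∀ ψ, HasSum (fun k => bil (partSum E k) (tst ψ)) (f ψ - dist (s / 2) W₀ ψ)) :
    normXNeg φ g (-s) (-θ) f ≤ ofReal (2 * M) := by
  have h2 (k j) (hj : j ≤ k) : HasWeakBox φ g k (v k j) (F k j) :=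
    (hasWeakBox_iff h (hγ.smooth k) _ _).2 (hv.box k j hj)
  have h3 (ψ : 𝓣) : HasSum (fun k : ℕ => ∑ j ∈ Finset.range (k + 1),
      ∫ z, lpProj φ k (v k j) z * boxT φ g k ψ z ∂ϖ)
      (f ψ - dist (- -s / 2) W₀ ψ) := by
    simp only [sum_integral_boxT h hγ hE, neg_neg]
    exact hs ψ
  have hM := hv.nonneg
  calc _ ≤ (normL2H (-s) (dist (- -s / 2) W₀) ^ 2 + totalSq (-s + 1) (-θ + 1) v F)
        ^ (1 / 2 : ℝ) := by
        rw [normXNeg]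
        gcongr
        exact iInf_le_of_le _ <| iInf_le_of_le v <| iInf_le_of_le F <| iInf_le_of_le h2 <|
          iInf_le _ h3
    _ ≤ ofReal ((2 * M) ^ 2) ^ (1 / 2 : ℝ) := by
        gcongr
        calc _ ≤ ofReal (M ^ 2) + ofReal (M ^ 2) := by
              refine add_le_add ?_ (totalSq_le_iff.2 hv.sum_le)
              rw [normL2H_dist h, ← ofReal_norm, ENNReal.ofReal_pow hM]
              gcongr
          _ ≤ _ := by
              rw [← ENNReal.ofReal_add (sq_nonneg M) (sq_nonneg M)]
              exact ofReal_le_ofReal (by nlinarith)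
    _ = _ := ofReal_sq_rpow ✓

theorem exists_functional_of_normXNeg (s : ℝ) {θ : ℝ} (hθ : 0 < θ) (hθ' : θ < 1 / 2) :
    ∃ C : ℝ, 0 < C ∧ ∀ (f : 𝓣') (M : ℝ), normXNeg φ g (-s) (-θ) f < ofReal M →
      ∃ T : XSum φ g s θ →ₗ[ℂ] ℂ, (∀ ψ, T ⟨tD ψ, tD_mem h hγ s θ ψ⟩ = f ψ) ∧
        ∀ u : XSum φ g s θ, ‖T u‖ₑ ≤ ofReal (C * M) * normSum φ g s θ u := by
  obtain ⟨C1, hC1, H1⟩ := exists_sum_bil_le h hγ s hθ hθ'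
  obtain ⟨C2, hC2, H2⟩ := exists_summable_liftLP (n := n) h s hθ (G := GT h g)
  refine ⟨C2 + 1 + 2 * C1, by positivity, fun f M hf => ?_⟩
  have hM : 0 < M := ENNReal.ofReal_pos.1 (bot_le.trans_lt hf)
  obtain ⟨W₀, v, F, E, hW₀, hv, hE, hsum⟩ := exists_dec_of_normXNeg_lt h hγ hf
  obtain ⟨P1, P2⟩ := H1 v F E M hv hE
  set X := fun k => lift (-(s / 2)) k (partSum E k) with hX
  have hsm (W : L2 n) {A : ℝ} (hA : ∀ K : Finset ℕ, ∑ k ∈ K, ‖bil (X k) (refl W)‖ ≤ A) :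
      Summable (fun k => bil (X k) (refl W)) ∧ ‖∑' k, bil (X k) (refl W)‖ ≤ A := by
    have := summable_of_sum_le (fun k => norm_nonneg (bil (X k) (refl W))) hA
    exact ⟨this.of_norm, (norm_tsum_le_tsum_norm this).trans (this.tsum_le_of_sum_le hA)⟩
  have hY (u) (hu : u ∈ XSum φ g s θ) : ∃ W, u = dist (-s / 2) W ∧
      Summable fun k => bil (X k) (refl W) := by
    induction hu using Submodule.span_induction with
    | mem u hu =>
      obtain ⟨M', hM', -⟩ := ENNReal.lt_iff_exists_nnreal_btwn.1 hu
      rw [← ENNReal.ofReal_coe_nnreal] at hM'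
      obtain ⟨v', U, W₁, W₂, d1, d2, d3, rfl⟩ := exists_split h hγ hθ hM'
      refine ⟨_, rfl, ?_⟩
      simp only [map_add]
      exact (hsm W₁ (P1 v' U _ d1 W₁ d2)).1.add (hsm _ (P2 W₂)).1
    | zero =>
      exact ⟨0, (dist_zero _).symm, by simp⟩
    | add u v _ _ hu hv =>
      obtain ⟨W, rfl, hW⟩ := hu
      obtain ⟨W', rfl, hW'⟩ := hv
      refine ⟨W + W', (dist_add ..).symm, ?_⟩
      simpa only [map_add] using hW.add hW'
    | smul a u _ hu =>
      obtain ⟨W, rfl, hW⟩ := hu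
      refine ⟨a • W, (dist_smul ..).symm, ?_⟩
      simpa only [map_smul] using hW.const_smul a
  obtain ⟨T, hT⟩ := exists_functional h W₀ hY
  refine ⟨T, fun ψ => ?_, fun u => ?_⟩
  · rw [hT _ (refl (Wt (s / 2) ψ)) (by rw [neg_div]; exact tD_eq _ ψ), refl_refl]
    have e (k : ℕ) : bil (X k) (Wt (s / 2) ψ) = bil (partSum E k) (tst ψ) := by
      rw [← dist_lift (Loc_partSum_box h hγ hv hE k) (ρ := -(s / 2)), neg_neg, dist_apply]
    simp only [e]
    rw [(hsum ψ).tsum_eq, dist_apply]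
    ring
  · rw [← ofReal_norm]
    refine le_ofReal_mul_of_forall_lt ✓ fun M' hM' => ofReal_le_ofReal ?_
    have hM0 : 0 < M' := ENNReal.ofReal_pos.1 (bot_le.trans_lt hM')
    obtain ⟨v', U, W₁, W₂, d1, d2, d3, d4⟩ := exists_split h hγ hθ hM'
    obtain ⟨s1, b1⟩ := hsm W₁ (P1 v' U _ d1 W₁ d2)
    obtain ⟨s2, b2⟩ := hsm _ (P2 W₂)
    rw [hT u _ d4]
    simp only [map_add]
    rw [s1.tsum_add s2]
    have e1 : ‖W₁‖ ≤ C2 * M' := d2.tsum_eq ▸ (H2 v' U M' d1).2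
    have e2 := (norm_mulOp_wt_le (by linarith : -θ / 2 ≤ 0) W₂).trans d3
    have e3 : ‖bil W₀ (refl W₁)‖ ≤ M * (C2 * M') :=
      (norm_bil_le _ _).trans (by rw [LinearIsometry.norm_map]; gcongr)
    have e4 : ‖bil W₀ (refl (mulOp (fun z => ((wt z ^ (-θ / 2) : ℝ) : ℂ)) W₂))‖ ≤ M * M' :=
      (norm_bil_le _ _).trans (by rw [LinearIsometry.norm_map]; gcongr)
    have e5 : C1 * (M * ‖W₂‖) ≤ C1 * (M * M') := by gcongr
    refine (norm_add_le _ _).trans ((add_le_add (norm_add_le _ _) (norm_add_le _ _)).trans ?_)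
    linarith

end Norms

section LPSum

theorem LP_succ (k : ℕ) (u : L2 n) :
    LP h (k + 1) u = Mop (lowS (Sp n) h) (k + 1) u - Mop (lowS (Sp n) h) k u := by
  rw [LP, Mop, Mop, Mop, ← Mult_sub (BMs_scs _ _) (BMs_scs _ _)]
  congr 2
  funext η
  rw [scs_lpS, scs_lowS, scs_lowS, ← sum_lpSymbol h, ← sum_lpSymbol h, sum_range_succ _ (k + 1)]
  push_cast
  ring

theorem sum_LP (N : ℕ) (u : L2 n) :
    ∑ k ∈ Finset.range (N + 1), LP h k u = Mop (lowS (Sp n) h) N u := by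
  induction N with
  | zero => simp [LP, lpS]
  | succ N ih => rw [sum_range_succ, ih, LP_succ, add_sub_cancel]

theorem U1_LP (k : ℕ) (u : L2 n) :
    U1 (LP h k u) = mulOp (fun z => scs (lpS h n k) k z.2) (U1 u) := U1_Mult _ _

theorem U1_LP_shell (k : ℕ) (u : L2 n) : U1 (LP h k u) = U1 (LP h k (U0 (mulOp (wS k 0) (U1 u)))) := by
  rw [← Loc_LP h k u, U1_LP, U1_LP, U1_U0, mulOp_comm (BM_wS k 0) (BMs_scs _ _).bm]

theorem exists_sum_norm_LP_le : ∃ C : ℝ, 0 ≤ C ∧ ∀ (u : L2 n) (K : Finset ℕ),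
    ∑ k ∈ K, ‖LP h k u‖ ^ 2 ≤ C * ‖u‖ ^ 2 := by
  obtain ⟨C, hC, H⟩ := exists_norm_LP_le (n := n) h
  refine ⟨C ^ 2 * 7, by positivity, fun u K => ?_⟩
  calc _ ≤ ∑ k ∈ K, C ^ 2 * ‖mulOp (wS k 0) (U1 u)‖ ^ 2 := by
        refine sum_le_sum fun k _ => ?_
        rw [← mul_pow, ← norm_U1 (LP h k u), U1_LP_shell, norm_U1, ← norm_U0 (mulOp _ _)]
        gcongr
        exact H k _
    _ ≤ C ^ 2 * (7 * ‖U1 u‖ ^ 2) := by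
        rw [← mul_sum]
        gcongr
        exact sum_norm_sq_shell_le K _
    _ = _ := by rw [norm_U1]; ring

theorem hasSum_LP (u : L2 n) : HasSum (fun k => LP h k u) u := by
  obtain ⟨C, -, H⟩ := exists_sum_norm_LP_le (n := n) h
  have h1 : Summable fun k => U1 (LP h k u) := by
    refine (summable_shell (fun k => Loc_LP h k u) ?_).1
    simp only [norm_U1]
    exact summable_of_sum_le (fun k => sq_nonneg _) (H u)
  have h2 : Summable fun k => LP h k u := by
    have := h1.mapL U0
    simpa only [U0_U1] using this
  have h3 : ∑' k, LP h k u - u = 0 := eq_zero_of_Mop_lowS h fun M => by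
    rw [map_sub, sub_eq_zero]
    have h4 := (Mop (lowS (Sp n) h) M).continuous.continuousAt.tendsto.comp
      (h2.hasSum.tendsto_sum_nat.comp (tendsto_add_atTop_nat 1))
    refine tendsto_nhds_unique h4 (tendsto_const_nhds.congr' ?_)
    filter_upwards [eventually_ge_atTop (M + 1)] with N hN
    simp only [Function.comp]
    rw [sum_LP, Mop_comm]
    exact (Mop_lowS_Mop h (lpS_supp h 0) hN u).symm
  have := h2.hasSum
  rwa [sub_eq_zero.1 h3] at this

theorem scs_lpS_upper {k : ℕ} {η : Sp n} (hη : scs (lpS h n k) k η ≠ 0) :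
    2 * π * ‖η‖ < 2 * 2 ^ k := by
  by_contra! hc
  refine hη ?_
  rw [scs_lpS]
  cases k with
  | zero => rw [lp0_zero h (by simpa using hc), ofReal_zero]
  | succ k =>
    rw [lpSymbol, profile_right h, ofReal_zero]
    rwa [le_div_iff₀ (by positivity)]

theorem LP_LP_eq_zero {k l : ℕ} (hkl : l + 2 ≤ k) (u : L2 n) : LP h k (LP h l u) = 0 := by
  rw [LP, LP, Mop, Mop, Mult_Mult (BMs_scs _ _) (BMs_scs _ _)]
  have : (fun η => scs (lpS h n k) k η * scs (lpS h n l) l η) = fun _ => 0 := by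
    funext η
    by_contra hne
    have h1 := scs_lpS_lower h (by omega) (left_ne_zero_of_mul hne)
    have h2 := scs_lpS_upper h (right_ne_zero_of_mul hne)
    have : 𝟚 ^ 2 * 2 ^ l ≤ 2 ^ k := by
      rw [← pow_add]; exact pow_le_pow_right₀ (by norm_num) (by omega)
    linarith
  rw [this, Mult_const, zero_smul]

theorem LP_comm (k l : ℕ) (u : L2 n) : LP h k (LP h l u) = LP h l (LP h k u) := Mop_comm _ _ _ _ _

def near (l : ℕ) : Finset ℕ := Finset.Icc (l - 1) (l + 1)

theorem sum_near_LP (l : ℕ) (u : L2 n) : ∑ k ∈ near l, LP h k (LP h l u) = LP h l u := by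
  refine (hasSum_sum_of_ne_finset_zero fun k hk => ?_).unique (hasSum_LP h (LP h l u))
  rw [near, Finset.mem_Icc, not_and_or, not_le, not_le] at hk
  rcases hk with hk | hk
  · rw [LP_comm, LP_LP_eq_zero h (by omega)]
  · exact LP_LP_eq_zero h (by omega) u

theorem bil_LP (k : ℕ) (u w : L2 n) : bil (LP h k u) w = bil u (LP h k w) :=
  bil_Mop_even (lpS_even h k) k u w

theorem lift_LP_tst (ρ : ℝ) (k : ℕ) (ψ : 𝓣) :
    lift ρ k (LP h k (tst ψ)) = U1 (LP h k (U0 (refl (Wt ρ ψ)))) := by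
  rw [U1_LP, U1_U0]
  change mulOp (wS k ρ) (U1 (LP h k (tst ψ))) = _
  rw [U1_LP]
  refine Lp.ext ?_
  have hb := (BMs_scs (lpS h n k) k).bm
  filter_upwards [coeFn_mulOp (BM_wS k ρ) (mulOp (fun z => scs (lpS h n k) k z.2) (U1 (tst ψ))),
    coeFn_mulOp hb (U1 (tst ψ)), coeFn_mulOp hb (refl (Wt ρ ψ)), coeFn_refl_Wt ρ ψ] with z a b c d
  rw [a, b, c, d]
  by_cases hz : scs (lpS h n k) k z.2 = 0
  · simp [hz]
  · rw [wS, indicator_of_mem (mem_shell_of_scs_lpS h hz)]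
    ring

theorem lift_eq_lift {ρ : ℝ} {k l : ℕ} {x : L2 n} (hk : Loc k x) (hl : Loc l x) :
    lift ρ k x = lift ρ l x := by
  have e : (fun z : ST n => wS k ρ z * wS l 0 z) = fun z => wS l ρ z * wS k 0 z := by
    funext z; simp only [wS, Real.rpow_zero]; push_cast; ring
  change mulOp (wS k ρ) (U1 x) = mulOp (wS l ρ) (U1 x)
  nth_rw 1 [← hl]
  nth_rw 2 [← hk]
  rw [mulOp_mulOp (BM_wS k ρ) (BM_wS l 0), e, mulOp_mulOp (BM_wS l ρ) (BM_wS k 0)]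

theorem exists_pieces (ρ : ℝ) : ∃ C : ℝ, 0 ≤ C ∧ ∀ q : L2 n, ∃ η : ℕ → L2 n,
    (∀ k v, bil (η k) v = bil q (lift ρ k (LP h k v))) ∧
    (∀ K : Finset ℕ, ∑ k ∈ K, ((𝟚 ^ k) ^ (-(2 * ρ)) * ‖η k‖) ^ 2 ≤ C * ‖q‖ ^ 2) ∧
    (∀ l, η l = LP h l (∑ k ∈ near l, η k)) ∧
    ∀ ψ, HasSum (fun k => bil (η k) (tst ψ)) (bil q (refl (Wt ρ ψ))) := by
  obtain ⟨C, hC, H⟩ := exists_norm_LP_le (n := n) h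
  set D := 𝟚 ^ (8 * |ρ|) * C with hD
  have hD0 : 0 ≤ D := by positivity
  refine ⟨D ^ 2 * 7, by positivity, fun q => ?_⟩
  choose η _ hη using fun k => exists_bil_eq ((bil q).comp ((lift ρ k).comp (LP h k)))
  have hη (k v) : bil (η k) v = bil q (lift ρ k (LP h k v)) := (hη k v).symm
  refine ⟨η, hη, fun K => ?_, fun l => eq_of_bil_eq fun v => ?_, fun ψ => ?_⟩
  · have key (k : ℕ) : (𝟚 ^ k) ^ (-(2 * ρ)) * ‖η k‖ ≤ D * ‖mulOp (wS k 0) q‖ := by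
      have hk : (0 : ℝ) < 2 ^ k := by positivity
      rw [rpow_neg hk.le, inv_mul_le_iff₀ (by positivity)]
      refine norm_le_of_bil_le (by positivity) fun v => ?_
      rw [hη, ← mulOp_lift, ← bil_mulOp (BM_wS k 0)]
      calc _ ≤ ‖mulOp (wS k 0) q‖ * (2 ^ (8 * |ρ|) * (2 ^ k) ^ (2 * ρ) * (C * ‖v‖)) := by
            refine (norm_bil_le _ _).trans ?_
            gcongr
            refine (norm_lift_le _ _ _).trans ?_
            gcongr
            exact H k v
        _ = _ := by rw [hD]; ring
    calc _ ≤ ∑ k ∈ K, D ^ 2 * ‖mulOp (wS k 0) q‖ ^ 2 := by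
          refine sum_le_sum fun k _ => ?_
          rw [← mul_pow]
          exact pow_le_pow_left₀ (by positivity) (key k) 2
      _ ≤ D ^ 2 * (7 * ‖q‖ ^ 2) := by
          rw [← mul_sum]
          gcongr
          exact sum_norm_sq_shell_le K q
      _ = _ := by ring
  · rw [bil_LP, map_sum, FunLike.coe_sum, Finset.sum_apply]
    simp only [hη]
    nth_rw 1 [← sum_near_LP h l v]
    rw [map_sum, map_sum]
    refine sum_congr rfl fun k _ => ?_
    rw [lift_eq_lift (Loc_LP h k _) (LP_comm h k l v ▸ Loc_LP h l _)]
  · simp only [hη, lift_LP_tst]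
    have := ((hasSum_LP h (U0 (refl (Wt ρ ψ)))).mapL U1).mapL (bil q)
    rwa [U1_U0] at this

end LPSum

section Functional

variable {g : Fin (n + 1) → Fin (n + 1) → ST n → ℝ} (hγ : Coef (GT h g) B c k₀ CΓ)

include hγ

theorem exists_rep {s θ : ℝ} {T : XSum φ g s θ →ₗ[ℂ] ℂ} {M : ℝ≥0}
    (hT : ∀ u : XSum φ g s θ, ‖T u‖ₑ ≤ M * normSum φ g s θ u) :
    ∃ q : L2 n, ‖q‖ ≤ M ∧ ∀ W, T ⟨_, mem_XSum h hγ s θ W⟩ = bil q W := by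
  have hadd (W W' : L2 n) : (⟨_, mem_XSum h hγ s θ (W + W')⟩ : XSum φ g s θ) =
      ⟨_, mem_XSum h hγ s θ W⟩ + ⟨_, mem_XSum h hγ s θ W'⟩ := Subtype.ext (dist_add ..)
  have hsmul (a : ℂ) (W : L2 n) : (⟨_, mem_XSum h hγ s θ (a • W)⟩ : XSum φ g s θ) =
      a • ⟨_, mem_XSum h hγ s θ W⟩ := Subtype.ext (dist_smul ..)
  let L : L2 n →ₗ[ℂ] ℂ := ⟨⟨fun W => T ⟨_, mem_XSum h hγ s θ W⟩, fun W W' => by rw [hadd, map_add]⟩,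
    fun a W => (congrArg T (hsmul a W)).trans (map_smul T a _)⟩
  have hL (W : L2 n) : ‖L W‖ ≤ M * ‖W‖ := by
    have h1 : ‖L W‖ₑ ≤ M * ‖W‖ₑ := (hT _).trans (by gcongr; exact normSum_dist_add_le h hγ s θ W)
    rw [← ofReal_norm, ← ofReal_norm, ← ENNReal.ofReal_coe_nnreal, ← ENNReal.ofReal_mul M.coe_nonneg] at h1
    exact (ENNReal.ofReal_le_ofReal_iff (by positivity)).1 h1
  obtain ⟨q, hq, H⟩ := exists_bil_eq (L.mkContinuous M hL)
  exact ⟨q, hq ▸ L.mkContinuous_norm_le M.coe_nonneg hL, fun W => H W⟩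

theorem rep_tD {s θ : ℝ} {T : XSum φ g s θ →ₗ[ℂ] ℂ} {q : L2 n}
    (hq : ∀ W, T ⟨_, mem_XSum h hγ s θ W⟩ = bil q W) (ψ : 𝓣) :
    T ⟨tD ψ, tD_mem h hγ s θ ψ⟩ = bil q (refl (Wt ((s + θ) / 2) ψ)) := by
  rw [← hq]
  congr 2
  rw [neg_div]
  exact tD_eq _ ψ

omit hγ in
theorem dist_sum_liftLP (s σ : ℝ) (v : ℕ → ℕ → L2 n) (K : Finset ℕ) :
    dist (-s / 2) (∑ k ∈ K, liftLP h s v k) = dist (-σ / 2) (∑ k ∈ K, liftLP h σ v k) := by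
  ext ψ
  rw [dist_apply, dist_apply, map_sum, map_sum, FunLike.coe_sum, FunLike.coe_sum, Finset.sum_apply,
    Finset.sum_apply]
  refine sum_congr rfl fun k _ => ?_
  rw [← dist_apply, ← dist_apply, dist_liftLP, dist_liftLP]

omit hγ in
theorem hasSum_liftLP_restrict (s : ℝ) (v : ℕ → ℕ → L2 n) (K : Finset ℕ) :
    HasSum (liftLP h s fun k j => if k ∈ K then v k j else 0) (∑ k ∈ K, liftLP h s v k) := by
  have e (k : ℕ) (hk : k ∈ K) : liftLP h s v k =
      liftLP h s (fun k j => if k ∈ K then v k j else 0) k := by simp [liftLP, partSum, hk]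
  rw [sum_congr rfl e]
  exact hasSum_sum_of_ne_finset_zero fun k hk => by simp [liftLP, partSum, hk]

omit hγ in
theorem liftLP_sub (s : ℝ) (v w : ℕ → ℕ → L2 n) (k : ℕ) :
    liftLP h s v k - liftLP h s w k = liftLP h s (fun k j => v k j - w k j) k := by
  simp only [liftLP, partSum, map_sub, sum_sub_distrib]

omit hγ in
theorem Dec.restrict {s θ A : ℝ} {v U : ℕ → ℕ → L2 n} (hv : Dec (GT h g) s θ v U A) (P : Set ℕ)
    {A' : ℝ} (hA' : 0 ≤ A') (hA : ∀ K : Finset ℕ, (∀ k ∈ K, k ∈ P) →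
      ∑ k ∈ K, ∑ j ∈ Finset.range (k + 1), pN s θ k j (v k j) (U k j) ^ 2 ≤ A' ^ 2)
    [DecidablePred (· ∈ P)] : Dec (GT h g) s θ (fun k j => if k ∈ P then v k j else 0)
      (fun k j => if k ∈ P then U k j else 0) A' where
  nonneg := hA'
  box k j hj := by
    by_cases hk : k ∈ P
    · simpa [hk] using hv.box k j hj
    · simpa [hk] using (Dec.zero h (g := g) s θ).box k j hj
  sum_le K := by
    refine le_trans (le_of_eq ?_) (hA (K.filter (· ∈ P)) fun k hk => (mem_filter.1 hk).2)
    rw [sum_filter]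
    refine sum_congr rfl fun k _ => ?_
    by_cases hk : k ∈ P <;> simp [hk, sq_pN]

theorem eq_zero_of_tD {s θ : ℝ} (hθ : 0 < θ) {T : XSum φ g s θ →ₗ[ℂ] ℂ} {M : ℝ≥0}
    (hT : ∀ u : XSum φ g s θ, ‖T u‖ₑ ≤ M * normSum φ g s θ u)
    (h0 : ∀ ψ, T ⟨tD ψ, tD_mem h hγ s θ ψ⟩ = 0) : T = 0 := by
  obtain ⟨q, -, hq⟩ := exists_rep h hγ hT
  have hq0 : q = 0 := by
    rw [← refl_refl q, eq_zero_of_bil_Wt h (ρ := (s + θ) / 2) (W := refl q) fun ψ => ?_, map_zero]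
    rw [bil_refl, ← rep_tD h hγ hq, h0]
  have hL (W) : T ⟨_, mem_XSum h hγ s θ W⟩ = 0 := by rw [hq, hq0, map_zero, zero_apply]
  have hX {v U : ℕ → ℕ → L2 n} {A : ℝ} (hv : Dec (GT h g) s θ v U A) {W : L2 n}
      (hW : HasSum (liftLP h s v) W) (hm : dist (-s / 2) W ∈ XSum φ g s θ) : T ⟨_, hm⟩ = 0 := by
    have hsm := summable_of_sum_le (fun k => sum_nonneg fun j _ => sq_nonneg _) hv.sum_le
    rw [summable_iff_vanishing_norm] at hsm
    refine norm_le_zero_iff.1 (le_of_forall_pos_le_add fun ε hε => ?_)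
    set δ := ε / (M + 1) with hδ
    have hM : (0 : ℝ) < M + 1 := by positivity
    have hδ0 : 0 < δ := by positivity
    obtain ⟨K, hK⟩ := hsm (δ ^ 2) (by positivity)
    have hd := hv.restrict h {k | k ∉ K} hδ0.le fun t ht =>
      ((Real.le_norm_self _).trans_lt (hK t (Finset.disjoint_left.2 ht))).le
    have hs : HasSum (liftLP h s fun k j => if k ∈ {k | k ∉ K} then v k j else 0)
        (W - ∑ k ∈ K, liftLP h s v k) := by
      refine (hW.sub (hasSum_liftLP_restrict h s v K)).congr_fun fun k => ?_
      rw [liftLP_sub]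
      simp only [liftLP, partSum]
      congr 1
      refine sum_congr rfl fun j _ => ?_
      by_cases hk : k ∈ K <;> simp [hk]
    have hmem : dist (-s / 2) (W - ∑ k ∈ K, liftLP h s v k) ∈ XSum φ g s θ :=
      Submodule.subset_span ((normSum_dist_le h hγ hd hs).trans_lt ENNReal.ofReal_lt_top)
    have e : (⟨_, hm⟩ : XSum φ g s θ) =
        ⟨_, hmem⟩ + ⟨_, mem_XSum h hγ s θ (∑ k ∈ K, liftLP h (s + θ) v k)⟩ := by
      refine Subtype.ext ?_
      change dist (-s / 2) W = dist (-s / 2) _ + dist (-(s + θ) / 2) _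
      rw [← dist_sum_liftLP h s (s + θ), ← dist_add, sub_add_cancel]
    rw [e, map_add, hL, add_zero, zero_add]
    have h1 : ‖T ⟨_, hmem⟩‖ₑ ≤ ofReal (M * δ) := by
      refine (hT _).trans ?_
      rw [ENNReal.ofReal_mul M.coe_nonneg, ENNReal.ofReal_coe_nnreal]
      gcongr
      exact normSum_dist_le h hγ hd hs
    rw [← ofReal_norm, ENNReal.ofReal_le_ofReal_iff (by positivity)] at h1
    refine h1.trans ?_
    calc (M : ℝ) * δ ≤ (M + 1) * δ := by gcongr; linarith
      _ = ε := by rw [hδ]; field_simp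
  have key (u) (hu : u ∈ XSum φ g s θ) : T ⟨u, hu⟩ = 0 := by
    induction hu using Submodule.span_induction with
    | mem u hu =>
      have hu' : normSum φ g s θ u < ofReal ((normSum φ g s θ u).toReal + 1) := by
        nth_rw 1 [← ofReal_toReal (ne_of_lt hu)]
        exact (ENNReal.ofReal_lt_ofReal_iff (by positivity)).2 (by linarith)
      obtain ⟨v, U, W₁, W₂, d1, d2, -, rfl⟩ := exists_split h hγ hθ hu'
      have hm : dist (-s / 2) W₁ ∈ XSum φ g s θ :=
        Submodule.subset_span ((normSum_dist_le h hγ d1 d2).trans_lt ENNReal.ofReal_lt_top)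
      refine Eq.trans (b := T ⟨_, hm⟩ + T ⟨_, mem_XSum h hγ s θ W₂⟩) ?_
        (by rw [hX d1 d2 hm, hL, add_zero])
      rw [← map_add]
      congr 1
      refine Subtype.ext ?_
      change dist (-s / 2) _ = dist (-s / 2) W₁ + dist (-(s + θ) / 2) W₂
      rw [dist_add, dist_mulOp_wt _ (by linarith)]
      congr 2
      ring
    | zero => exact map_zero T
    | add u v hu hv h1 h2 =>
      have := map_add T ⟨u, hu⟩ ⟨v, hv⟩
      rwa [h1, h2, add_zero] at this
    | smul a u hu h1 =>
      have := map_smul T a ⟨u, hu⟩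
      rwa [h1, smul_zero] at this
  exact LinearMap.ext fun u => key u u.2

theorem norm_sum_bil_pieces_le {s θ : ℝ} {T : XSum φ g s θ →ₗ[ℂ] ℂ} {M : ℝ≥0}
    (hT : ∀ u : XSum φ g s θ, ‖T u‖ₑ ≤ M * normSum φ g s θ u) {q : L2 n}
    (hq : ∀ W, T ⟨_, mem_XSum h hγ s θ W⟩ = bil q W) {η : ℕ → L2 n}
    (hη : ∀ k v, bil (η k) v = bil q (lift ((s + θ) / 2) k (LP h k v))) {v U : ℕ → ℕ → L2 n} {A : ℝ}
    (hv : Dec (GT h g) s θ v U A) (K : Finset ℕ) :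
    ‖∑ k ∈ K, ∑ j ∈ Finset.range (k + 1), bil (η k) (v k j)‖ ≤ M * A := by
  have e : ∑ k ∈ K, ∑ j ∈ Finset.range (k + 1), bil (η k) (v k j) =
      bil q (∑ k ∈ K, liftLP h (s + θ) v k) := by
    simp only [map_sum, liftLP, partSum, hη]
  have hd := hv.restrict h (K : Set ℕ) hv.nonneg fun t _ => hv.sum_le t
  have h1 : ‖bil q (∑ k ∈ K, liftLP h (s + θ) v k)‖ₑ ≤ ofReal (M * A) := by
    rw [← hq]
    refine (hT _).trans ?_
    rw [ENNReal.ofReal_mul M.coe_nonneg, ENNReal.ofReal_coe_nnreal]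
    gcongr
    simp only
    rw [← dist_sum_liftLP h s (s + θ)]
    exact normSum_dist_le h hγ hd (hasSum_liftLP_restrict h s v K)
  rw [e]
  rwa [← ofReal_norm, ENNReal.ofReal_le_ofReal_iff (mul_nonneg M.coe_nonneg hv.nonneg)] at h1

end Functional

theorem exists_representer (g : Λ → Λ → ST n → ℝ) (η : L2 n) {α β : ℝ}
    (hα : 0 < α) (hβ : 0 < β) : ∃ v U : L2 n, WBox g v U ∧ ∀ v' U', WBox g v' U' →
      bil η v' = bil (((α ^ 2 : ℝ) : ℂ) • cj v) v' + bil (((β ^ 2 : ℝ) : ℂ) • cj U) U' := by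
  let K : Submodule ℂ (WithLp 2 (L2 n × L2 n)) :=
    { carrier := {x | ∀ ψ, bil ((α : ℂ)⁻¹ • x.fst) (tst (boxD g ψ)) =
        bil ((β : ℂ)⁻¹ • x.snd) (tst ψ)}
      zero_mem' := fun ψ => by simp
      add_mem' := fun {x y} hx hy ψ => by simp_all
      smul_mem' := fun a x hx ψ => by
        have h1 := hx ψ
        simp only [WithLp.smul_fst, WithLp.smul_snd, map_smul, smul_apply] at h1 ⊢
        rw [smul_comm, h1, smul_comm] }
  have hK : IsClosed (K : Set (WithLp 2 (L2 n × L2 n))) := by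
    simp only [K, Submodule.coe_set_mk, AddSubmonoid.coe_set_mk, AddSubsemigroup.coe_set_mk, setOf_forall]
    exact isClosed_iInter fun ψ => isClosed_eq (by fun_prop) (by fun_prop)
  have : CompleteSpace K := hK.completeSpace_coe
  set u : WithLp 2 (L2 n × L2 n) := WithLp.toLp 2 ((α : ℂ)⁻¹ • cj η, 0)
  set y := K.starProjection u with hy
  have hα' : (α : ℂ) ≠ 0 := Complex.ofReal_ne_zero.2 hα.ne'
  have hβ' : (β : ℂ) ≠ 0 := Complex.ofReal_ne_zero.2 hβ.ne'
  refine ⟨(α : ℂ)⁻¹ • y.fst, (β : ℂ)⁻¹ • y.snd, K.starProjection_apply_mem u, fun v' U' hv => ?_⟩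
  have hx : WithLp.toLp 2 ((α : ℂ) • v', (β : ℂ) • U') ∈ K := fun ψ => by
    change bil ((α : ℂ)⁻¹ • ((α : ℂ) • v')) _ = bil ((β : ℂ)⁻¹ • ((β : ℂ) • U')) _
    rw [inv_smul_smul₀ hα', inv_smul_smul₀ hβ', hv ψ]
  have h1 := K.starProjection_inner_eq_zero u _ hx
  rw [inner_sub_left, ← hy, sub_eq_zero, WithLp.prod_inner_apply, WithLp.prod_inner_apply] at h1
  simp only [u, inner_zero_left, inner_smul_left, inner_smul_right, inner_eq_bil, cj_cj,
    map_inv₀, conj_ofReal] at h1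
  rw [mul_inv_cancel_left₀ hα', mul_zero, add_zero] at h1
  change _ = (α : ℂ) * bil (cj y.fst) v' + (β : ℂ) * bil (cj y.snd) U' at h1
  rw [h1, cj_smul, cj_smul]
  simp only [map_smul, smul_apply, smul_eq_mul, map_inv₀, conj_ofReal]
  push_cast
  field_simp

theorem pN_le {s θ : ℝ} {l j : ℕ} {f F : L2 n} {b : ℝ} (hb : 0 ≤ b)
    (h1 : 2 ^ l * 2 ^ j * ‖f‖ ≤ (𝟚 ^ l) ^ s * (2 ^ j) ^ θ * b)
    (h2 : ‖F‖ ≤ (𝟚 ^ l) ^ s * (2 ^ j) ^ θ * b) : pN (-s + 1) (-θ + 1) l j f F ≤ 2 * b := by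
  have hl : (0 : ℝ) < 2 ^ l := by positivity
  have hj : (0 : ℝ) < 2 ^ j := by positivity
  refine le_of_sq_le_sq ?_ (by positivity)
  rw [sq_pN]
  have e1 : (𝟚 ^ l) ^ (-s + 1) * (2 ^ j) ^ (-θ + 1) * ‖f‖ ≤ b := by
    rw [rpow_add hl, rpow_add hj, rpow_one, rpow_one, rpow_neg hl.le,
      rpow_neg hj.le]
    calc _ = ((𝟚 ^ l) ^ s * (2 ^ j) ^ θ)⁻¹ * (2 ^ l * 2 ^ j * ‖f‖) := by field_simp
      _ ≤ _ := by rwa [inv_mul_le_iff₀ (by positivity)]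
  have e2 : (𝟚 ^ l) ^ (-s + 1 - 1) * (2 ^ j) ^ (-θ + 1 - 1) * ‖F‖ ≤ b := by
    rwa [add_sub_cancel_right, add_sub_cancel_right, rpow_neg hl.le, rpow_neg hj.le,
      ← mul_inv, inv_mul_le_iff₀ ✓]
  have := pow_le_pow_left₀ (by positivity) e1 2
  have := pow_le_pow_left₀ (by positivity) e2 2
  nlinarith [sq_nonneg b]

structure Chain (G : ℕ → Λ → Λ → ST n → ℝ) (s θ : ℝ) (η h₀ : ℕ → L2 n)
    (p q : ℕ → ℕ → L2 n) (b : ℕ → ℕ → ℝ) (S : ℕ → ℝ) : Prop where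
  dual : ∀ k j v F, WBox (G k) v F → bil (p k j) F = bil (q k j) v
  nonneg : ∀ k j, 0 ≤ b k j
  norm_p : ∀ k j, 2 ^ k * 2 ^ j * ‖p k j‖ ≤ (𝟚 ^ k) ^ s * (2 ^ j) ^ θ * b k j
  norm_q : ∀ k j, ‖q k j‖ ≤ (𝟚 ^ k) ^ s * (2 ^ j) ^ θ * b k j
  sum_b : ∀ k m, ∑ j ∈ Finset.range m, b k j ^ 2 ≤ S k
  norm_h : ∀ k, ‖h₀ k‖ ≤ (𝟚 ^ k) ^ s * √(S k)
  eq : ∀ k m, k ≤ m → η k = h₀ k + ∑ j ∈ Finset.range m, q k j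

theorem exists_chain {G : ℕ → Λ → Λ → ST n → ℝ} {s θ : ℝ}
    (hθ' : θ < 1) {η : ℕ → L2 n} {M N : ℝ} (hM : 0 ≤ M)
    (H : ∀ (v U : ℕ → ℕ → L2 n) (A : ℝ), Dec G s θ v U A → ∀ K : Finset ℕ,
      ‖∑ k ∈ K, ∑ j ∈ Finset.range (k + 1), bil (η k) (v k j)‖ ≤ M * A)
    (H' : ∀ K : Finset ℕ, ∑ k ∈ K, ((𝟚 ^ k) ^ (-(s + θ)) * ‖η k‖) ^ 2 ≤ N) :
    ∃ h₀ p q b S, Chain G s θ η h₀ p q b S ∧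
      ∀ K : Finset ℕ, ∑ k ∈ K, S k ≤ 16 * (M ^ 2 + N) := by
  have hk (k : ℕ) : (0 : ℝ) < 2 ^ k := by positivity
  choose V U hV hη using fun k j : ℕ => exists_representer (G k) (η k)
    (α := (𝟚 ^ k) ^ s * (2 ^ j) ^ θ) (β := (𝟚 ^ k) ^ (s - 1) * (2 ^ j) ^ (θ - 1))
    (by positivity) (by positivity)
  set x := fun k j => pN s θ k j (V k j) (U k j) with hx
  have hself (k j : ℕ) : bil (η k) (V k j) = ((x k j ^ 2 : ℝ) : ℂ) := by
    rw [hη k j _ _ (hV k j)]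
    simp only [map_smul, smul_apply, bil_cj_self, smul_eq_mul, hx, sq_pN]
    push_cast
    ring
  have hxM (K : Finset ℕ) : ∑ k ∈ K, ∑ j ∈ Finset.range k, x k j ^ 2 ≤ M ^ 2 := by
    set Q := ∑ k ∈ K, ∑ j ∈ Finset.range k, x k j ^ 2 with hQ
    have hQ0 : 0 ≤ Q := sum_nonneg fun _ _ => sum_nonneg fun _ _ => sq_nonneg _
    have hp (k j : ℕ) : pN s θ k j (if k ∈ K ∧ j < k then V k j else 0)
        (if k ∈ K ∧ j < k then U k j else 0) ^ 2 = if k ∈ K ∧ j < k then x k j ^ 2 else 0 := by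
      split_ifs <;> simp [hx, sq_pN]
    have hd : Dec G s θ (fun k j => if k ∈ K ∧ j < k then V k j else 0)
        (fun k j => if k ∈ K ∧ j < k then U k j else 0) √Q := by
      refine ⟨sqrt_nonneg _, fun k j _ => ?_, fun L => ?_⟩
      · by_cases hc : k ∈ K ∧ j < k
        · simpa [hc] using hV k j
        · intro ψ; simp [hc]
      · rw [sq_sqrt hQ0]
        simp only [hp]
        calc _ ≤ ∑ k ∈ L.filter (· ∈ K), ∑ j ∈ Finset.range k, x k j ^ 2 := by
              rw [sum_filter]
              refine sum_le_sum fun k _ => ?_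
              by_cases hc : k ∈ K
              · simp only [hc, true_and, if_true, ← sum_filter]
                exact Finset.sum_le_sum_of_subset_of_nonneg
                  (fun j hj => Finset.mem_range.2 (mem_filter.1 hj).2)
                  fun _ _ _ => sq_nonneg _
              · simp [hc]
          _ ≤ _ := Finset.sum_le_sum_of_subset_of_nonneg
              (fun k hk => (mem_filter.1 hk).2)
              fun _ _ _ => sum_nonneg fun _ _ => sq_nonneg _
    have h1 := H _ _ _ hd K
    have e : ∑ k ∈ K, ∑ j ∈ Finset.range (k + 1), bil (η k) (if k ∈ K ∧ j < k then V k j else 0) =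
        ((Q : ℝ) : ℂ) := by
      rw [hQ]
      push_cast
      refine sum_congr rfl fun k hkK => ?_
      rw [sum_range_succ]
      simp only [lt_irrefl, and_false, if_false, map_zero, add_zero]
      refine sum_congr rfl fun j hj => ?_
      simp_all
    rw [e, norm_real, norm_of_nonneg hQ0] at h1
    have h2 : √Q ≤ M := by
      rcases (sqrt_nonneg Q).eq_or_lt with h0 | h0
      · rw [← h0]; exact hM
      · refine le_of_mul_le_mul_right ?_ h0
        rwa [Real.mul_self_sqrt hQ0]
    nlinarith
  set a : ℕ → ℕ → ℝ := fun k j => if j < k then x k j else (𝟚 ^ k) ^ (-(s + θ)) * ‖η k‖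
    with ha
  have ha0 (k j) : 0 ≤ a k j := by
    simp only [ha]; split_ifs
    · exact pN_nonneg ..
    · positivity
  have haS (K : Finset ℕ) : ∑ k ∈ K, ∑ j ∈ Finset.range (k + 1), a k j ^ 2 ≤ M ^ 2 + N := by
    refine le_trans (le_of_eq ?_) (add_le_add (hxM K) (H' K))
    rw [← sum_add_distrib]
    refine sum_congr rfl fun k _ => ?_
    rw [sum_range_succ]
    congr 1
    · exact sum_congr rfl fun j hj => by simp_all
    · simp_all
  set hh : ℕ → ℕ → L2 n := fun k j => if j < k then
    ((((𝟚 ^ k) ^ s * (2 ^ j) ^ θ) ^ 2 : ℝ) : ℂ) • cj (V k j) else η k with hhh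
  set f : ℕ → ℕ → L2 n := fun k j => if j < k then
    ((((𝟚 ^ k) ^ (s - 1) * (2 ^ j) ^ (θ - 1)) ^ 2 : ℝ) : ℂ) • cj (U k j) else 0 with hf
  have hrep (k j v F) (hv : WBox (G k) v F) : bil (η k) v = bil (hh k j) v + bil (f k j) F := by
    by_cases hj : j < k
    · simp only [hhh, hf, if_pos hj]; exact hη k j v F hv
    · simp only [hhh, hf, if_neg hj, map_zero, zero_apply, add_zero]
  have hnh (k j) (hj : j ≤ k) : ‖hh k j‖ ≤ (𝟚 ^ k) ^ s * (2 ^ j) ^ θ * a k j := by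
    rcases hj.lt_or_eq with hj | rfl
    · simp only [hhh, ha, if_pos hj]
      rw [norm_smul, norm_cj, norm_real, norm_of_nonneg (sq_nonneg _), pow_two, mul_assoc]
      gcongr
      exact le_pN_left ..
    · simp only [hhh, ha, lt_irrefl, if_false]
      rw [← rpow_add (hk j), ← mul_assoc, ← rpow_add (hk j), add_neg_cancel,
        Real.rpow_zero, one_mul]
  have hnf (k j) (hj : j ≤ k) :
      2 ^ k * 2 ^ j * ‖f k j‖ ≤ (𝟚 ^ k) ^ s * (2 ^ j) ^ θ * a k j := by
    rcases hj.lt_or_eq with hj | rfl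
    · simp only [hf, ha, if_pos hj]
      rw [norm_smul, norm_cj, norm_real, norm_of_nonneg (sq_nonneg _)]
      calc _ = (2 ^ k) ^ s * (2 ^ j) ^ θ *
            ((𝟚 ^ k) ^ (s - 1) * (2 ^ j) ^ (θ - 1) * ‖U k j‖) := by
            rw [Real.rpow_sub_one (hk k).ne', Real.rpow_sub_one (hk j).ne']
            field_simp
        _ ≤ _ := by gcongr; exact le_pN_right ..
    · simp only [hf, lt_irrefl, if_false, norm_zero, mul_zero]
      have := ha0 j j
      positivity
  have hpow (j : ℕ) : (𝟚 ^ (j + 1)) ^ θ ≤ 2 * (2 ^ j) ^ θ := by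
    rw [pow_succ, Real.mul_rpow (by positivity) (by norm_num), mul_comm]
    gcongr
    exact (Real.rpow_le_rpow_of_exponent_le (by norm_num) hθ'.le).trans (rpow_one 2).le
  refine ⟨fun k => hh k 0, fun k j => f k j - f k (j + 1), fun k j => hh k (j + 1) - hh k j,
    fun k j => if j < k then 2 * (a k j + a k (j + 1)) else 0,
    fun k => 16 * ∑ j ∈ Finset.range (k + 1), a k j ^ 2,
    ⟨fun k j v F hv => ?_, fun k j => ?_, fun k j => ?_, fun k j => ?_, fun k m => ?_, fun k => ?_,
      fun k m hm => ?_⟩, fun K => ?_⟩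
  · have h1 := hrep k j v F hv
    rw [hrep k (j + 1) v F hv] at h1
    rw [map_sub, map_sub, sub_apply, sub_apply]
    linear_combination -h1
  · split_ifs
    · have := ha0 k j
      have := ha0 k (j + 1)
      positivity
    · exact le_rfl
  · split_ifs with hj
    · have h1 := hnf k j hj.le
      have h2 := hnf k (j + 1) hj
      have a1 := ha0 k (j + 1)
      have a0 := ha0 k j
      calc _ ≤ 2 ^ k * 2 ^ j * (‖f k j‖ + ‖f k (j + 1)‖) := by gcongr; exact norm_sub_le _ _
        _ ≤ (2 ^ k) ^ s * (2 ^ j) ^ θ * a k j + (2 ^ k) ^ s * (2 * (2 ^ j) ^ θ) * a k (j + 1) := by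
            rw [mul_add]
            refine add_le_add h1 (le_trans ?_ (h2.trans (by gcongr; exact hpow j)))
            gcongr
            · norm_num
            · omega
        _ ≤ _ := by
            have : 0 ≤ (2 ^ k) ^ s * (𝟚 ^ j) ^ θ * a k j := by positivity
            linarith
    · simp [hf, if_neg hj, if_neg (by omega : ¬j + 1 < k)]
  · split_ifs with hj
    · have h1 := hnh k j hj.le
      have h2 := hnh k (j + 1) hj
      have a1 := ha0 k (j + 1)
      have a0 := ha0 k j
      calc _ ≤ ‖hh k (j + 1)‖ + ‖hh k j‖ := norm_sub_le _ _
        _ ≤ (2 ^ k) ^ s * (2 * (2 ^ j) ^ θ) * a k (j + 1) + (2 ^ k) ^ s * (2 ^ j) ^ θ * a k j :=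
            add_le_add (h2.trans (by gcongr; exact hpow j)) h1
        _ ≤ _ := by
            have : 0 ≤ (2 ^ k) ^ s * (𝟚 ^ j) ^ θ * a k j := by positivity
            linarith
    · simp [hhh, if_neg hj, if_neg (by omega : ¬j + 1 < k)]
  · calc ∑ j ∈ Finset.range m, (if j < k then 2 * (a k j + a k (j + 1)) else 0) ^ 2
        ≤ ∑ j ∈ (Finset.range m).filter (· < k), (8 * a k j ^ 2 + 8 * a k (j + 1) ^ 2) := by
          rw [sum_filter]
          refine sum_le_sum fun j _ => ?_
          split_ifs
          · nlinarith [sq_nonneg (a k j - a k (j + 1))]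
          · simp
      _ ≤ ∑ j ∈ Finset.range k, (8 * a k j ^ 2 + 8 * a k (j + 1) ^ 2) :=
          Finset.sum_le_sum_of_subset_of_nonneg
            (fun j hj => Finset.mem_range.2 (mem_filter.1 hj).2) fun _ _ _ => by positivity
      _ ≤ _ := by
          rw [sum_add_distrib, ← mul_sum, ← mul_sum]
          have h1 := sum_range_succ (fun j => a k j ^ 2) k
          have h2 := Finset.sum_range_succ' (fun j => a k j ^ 2) k
          nlinarith
  · refine (hnh k 0 (Nat.zero_le k)).trans ?_
    rw [pow_zero, Real.one_rpow, mul_one]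
    gcongr
    refine Real.le_sqrt_of_sq_le ?_
    have := single_le_sum (f := fun j => a k j ^ 2) (fun j _ => sq_nonneg _)
      (Finset.mem_range.2 (Nat.succ_pos k))
    nlinarith [sq_nonneg (a k 0)]
  · rw [Finset.sum_range_sub, add_sub_cancel]
    simp [hhh, hm]
  · rw [← mul_sum]
    exact mul_le_l (haS K) (by norm_num)

theorem two_pow_rpow_le {k l : ℕ} (h1 : k ≤ l + 4) (h2 : l ≤ k + 4) (s : ℝ) :
    (𝟚 ^ k) ^ s ≤ 2 ^ (4 * |s|) * (2 ^ l) ^ s := by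
  have := two_pow_rpow_ratio_le h1 h2 s
  rwa [rpow_neg (by positivity), ← div_eq_mul_inv, div_le_iff₀ (by positivity)] at this

theorem sum_near_le {c : ℕ → ℝ} (hc : ∀ k, 0 ≤ c k) {N : ℝ} (hN : ∀ K : Finset ℕ, ∑ k ∈ K, c k ≤ N)
    (L : Finset ℕ) : ∑ l ∈ L, ∑ k ∈ near l, c k ≤ 3 * N := by
  rw [Finset.sum_comm' (t' := L.biUnion near) (s' := fun k => L.filter (k ∈ near ·))
    (fun l k => by simp only [Finset.mem_biUnion, mem_filter]; tauto)]
  calc _ ≤ ∑ k ∈ L.biUnion near, 3 * c k := by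
        refine sum_le_sum fun k _ => ?_
        rw [Finset.sum_const, nsmul_eq_mul]
        refine mul_le_r ?_ (hc k)
        have : L.filter (k ∈ near ·) ⊆ near k := fun l hl => by
          have := (mem_filter.1 hl).2
          simp only [near, Finset.mem_Icc] at this ⊢
          omega
        have := Finset.card_le_card this
        rw [near, Nat.card_Icc] at this
        exact_mod_cast (by omega : _ ≤ 3)
    _ ≤ _ := by rw [← mul_sum]; simp_all

theorem sq_sum_near_le (l : ℕ) (c : ℕ → ℝ) : (∑ k ∈ near l, c k) ^ 2 ≤ 3 * ∑ k ∈ near l, c k ^ 2 := by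
  refine sq_sum_le_card_mul_sum_sq.trans ?_
  gcongr
  rw [near, Nat.card_Icc]
  exact_mod_cast (by omega : _ ≤ 3)

theorem LP_Mop_lowS {l K : ℕ} (hK : l + 1 ≤ K) (u : L2 n) :
    LP h l (Mop (lowS (Sp n) h) K u) = LP h l u :=
  (Mop_comm _ _ _ _ _).trans (Mop_lowS_Mop h (lpS_supp h l) hK u)

section Decomp

include hG

set_option maxHeartbeats 600000 in
theorem exists_transfer (s θ : ℝ) : ∃ C : ℝ, 0 ≤ C ∧ ∀ k l j, k ≤ l + 1 → l ≤ k + 1 → j ≤ l →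
    ∀ (p q : L2 n) (b : ℝ), (∀ v F, WBox (G k) v F → bil p F = bil q v) →
      2 ^ k * 2 ^ j * ‖p‖ ≤ (𝟚 ^ k) ^ s * (2 ^ j) ^ θ * b →
      ‖q‖ ≤ (𝟚 ^ k) ^ s * (2 ^ j) ^ θ * b → 0 ≤ b →
      ∃ P L, WBox (G l) P L ∧ 2 ^ l * 2 ^ j * ‖P‖ ≤ (𝟚 ^ l) ^ s * (2 ^ j) ^ θ * (C * b) ∧
        ‖L‖ ≤ (𝟚 ^ l) ^ s * (2 ^ j) ^ θ * (C * b) ∧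
        √(2 ^ j) * ‖LP h l L - LP h l q‖ ≤ (𝟚 ^ l) ^ s * (2 ^ j) ^ θ * (C * b) := by
  have hB : 0 ≤ B := zero_le_one.trans hG.one_le
  obtain ⟨C1, hC1, H1⟩ := exists_jet (n := n) h (lowS_even h) le_rfl (lpS_supp h 0) hB
  obtain ⟨C2, hC2, H2⟩ := exists_key h hG 4
  obtain ⟨Cm, hCm, Hm⟩ := exists_norm_Mop_le (lowS (Sp n) h)
  obtain ⟨Cp, hCp, Hp⟩ := exists_norm_LP_le (n := n) h
  set R : ℝ := 2 ^ (4 * |s|) with hR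
  have hR0 : 0 < R := by positivity
  set C3 := √((10 * C1) ^ 2 + 10 * C1 * (10 * C1 + Cm)) with hC3
  set C4 := 10 * C1 + C2 * C3 with hC4
  have hC40 : 0 ≤ C4 := by positivity
  clear_value R C3 C4
  have hpC := mul_nonneg (zero_le_one.trans hCp) hC40
  refine ⟨(2 * Cm + (C4 + Cm) + Cp * C4) * R, by positivity, ?_⟩
  intro k l j hkl hlk hjl p q b hpq hp hq hb
  set X := (𝟚 ^ k) ^ s * (2 ^ j) ^ θ * b with hX
  set X' := (𝟚 ^ l) ^ s * (2 ^ j) ^ θ * b with hX'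
  have hX0 : 0 ≤ X := by positivity
  have hXX : X ≤ R * X' := by
    rw [hX, hX', ← mul_assoc, ← mul_assoc, hR]
    gcongr
    exact two_pow_rpow_le (by omega) (by omega) s
  have hj0 : (0 : ℝ) < 2 ^ j := by positivity
  have hk0 : (0 : ℝ) < 2 ^ k := by positivity
  have hj1 : (1 : ℝ) ≤ 2 ^ j := one_le_pow₀ (by norm_num)
  have hjk : 𝟚 ^ j ≤ 2 * 2 ^ k := by
    rw [← pow_succ']; exact pow_le_pow_right₀ (by norm_num) (by omega)
  have hlk' : 𝟚 ^ l ≤ 2 * 2 ^ k := by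
    rw [← pow_succ']; exact pow_le_pow_right₀ (by norm_num) (by omega)
  have goal (D : ℝ) (hD : 0 ≤ D) (hD' : D ≤ 2 * Cm + (C4 + Cm) + Cp * C4) :
      D * X ≤ (𝟚 ^ l) ^ s * (2 ^ j) ^ θ * ((2 * Cm + (C4 + Cm) + Cp * C4) * R * b) := by
    calc _ ≤ (2 * Cm + (C4 + Cm) + Cp * C4) * (R * X') := by gcongr
      _ = _ := by rw [hX']; ring
  clear_value X X'
  set Y := X / 2 ^ j with hY
  have hYX : Y ≤ X := div_le_self hX0 hj1
  have hY0 : 0 ≤ Y := by positivity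
  set Z := X / √(2 ^ j) with hZ
  have hZ0 : 0 ≤ Z := by positivity
  have hZsq : Z ^ 2 = X * Y := by rw [hZ, hY, div_pow, sq_sqrt hj0.le]; ring
  have hYZ : Y ≤ Z := le_of_sq_le_sq (by rw [hZsq, pow_two]; gcongr) hZ0
  have hZX : Z ≤ X := le_of_sq_le_sq (by rw [hZsq, pow_two]; gcongr) hX0
  have hweak := weakEq_of_dual hG hpq
  obtain ⟨d, e, hjet, hd, he⟩ := H1 (G k) _ _ (k + 3) p q ((hG.cf k le_rfl).mono (by omega) le_rfl)
    (Lower.zero hB) hweak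
  have hsmall : C1 * (2 ^ (k + 3) * ‖p‖ + (2 ^ (k + 3))⁻¹ * ‖q‖) ≤ 10 * C1 * Y := by
    have a1 : 2 ^ (k + 3) * ‖p‖ ≤ 8 * Y := by
      rw [hY, ← mul_div_assoc, le_div_iff₀ hj0, pow_add]
      linarith
    have a2 : (𝟚 ^ (k + 3))⁻¹ * ‖q‖ ≤ 2 * Y := by
      rw [inv_mul_le_iff₀ (by positivity), hY, ← mul_div_assoc, ← mul_div_assoc, le_div_iff₀ hj0,
        pow_add]
      calc ‖q‖ * 2 ^ j ≤ X * (2 * 2 ^ k) := by gcongr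
        _ ≤ _ := by nlinarith [mul_nonneg hk0.le hX0]
    calc _ ≤ C1 * (8 * Y + 2 * Y) := by gcongr
      _ = _ := by ring
  have hloc : Mop (lowS (Sp n) h) (k + 4) (Mop (lowS (Sp n) h) (k + 3) p) =
      Mop (lowS (Sp n) h) (k + 3) p := Mop_lowS_Mop h (lpS_supp h 0) (by omega) p
  have hkey := H2 k l (by omega) (by omega) _ d e hjet hloc _ fun i => (hd i).trans hsmall
  have he' := he.trans hsmall
  have hMq : ‖Mop (lowS (Sp n) h) (k + 3) q‖ ≤ Cm * X := (Hm _ _).trans (by gcongr)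
  have hLk : ‖Lop (G k) e‖ ≤ (10 * C1 + Cm) * X := by
    have := norm_add_le (Lop (G k) e - Mop (lowS (Sp n) h) (k + 3) q) (Mop (lowS (Sp n) h) (k + 3) q)
    rw [sub_add_cancel] at this
    nlinarith
  have herr : ‖Lop (G l) e - Mop (lowS (Sp n) h) (k + 3) q‖ ≤ C4 * Z := by
    have a1 : √((10 * C1 * Y) ^ 2 + 10 * C1 * Y * ‖Lop (G k) e‖) ≤ C3 * Z := by
      rw [hC3, ← sqrt_sq hZ0, ← sqrt_mul (by positivity), hZsq]
      refine Real.sqrt_le_sqrt ?_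
      calc _ ≤ (10 * C1) ^ 2 * (X * Y) + 10 * C1 * Y * ((10 * C1 + Cm) * X) := by
            rw [mul_pow, pow_two Y]; gcongr
        _ = _ := by ring
    have a2 := norm_sub_le (Lop (G k) e - Mop (lowS (Sp n) h) (k + 3) q)
      (Lop (G k) e - Lop (G l) e)
    rw [sub_sub_sub_cancel_left] at a2
    rw [← neg_sub, norm_neg, ← norm_neg, neg_sub] at a2
    calc _ ≤ 10 * C1 * Y + C2 * (C3 * Z) := a2.trans (add_le_add he' (hkey.trans (by gcongr)))
      _ ≤ 10 * C1 * Z + C2 * (C3 * Z) := by gcongr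
      _ = _ := by rw [hC4]; ring
  refine ⟨_, _, hjet.wBox hG l, ?_, ?_, ?_⟩
  · refine le_trans ?_ (goal (2 * Cm) (by positivity) (by linarith))
    calc _ ≤ 2 * 2 ^ k * 2 ^ j * (Cm * ‖p‖) := by gcongr; exact Hm _ _
      _ = 2 * Cm * (2 ^ k * 2 ^ j * ‖p‖) := by ring
      _ ≤ _ := by gcongr
  · refine le_trans ?_ (goal (C4 + Cm) (by positivity) (by linarith))
    have := norm_add_le (Lop (G l) e - Mop (lowS (Sp n) h) (k + 3) q) (Mop (lowS (Sp n) h) (k + 3) q)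
    rw [sub_add_cancel] at this
    nlinarith
  · refine le_trans ?_ (goal (Cp * C4) (by positivity) (by linarith))
    rw [← LP_Mop_lowS h (by omega : l + 1 ≤ k + 3) q, ← map_sub]
    calc _ ≤ √(2 ^ j) * (Cp * (C4 * Z)) := by
          gcongr; exact (Hp _ _).trans (by gcongr)
      _ = Cp * C4 * X := by rw [hZ]; field_simp

set_option maxHeartbeats 600000 in
theorem exists_decomp (s : ℝ) {θ : ℝ} (hθ' : θ < 1 / 2) : ∃ C : ℝ, 0 ≤ C ∧ ∀ η h₀ p q b S,
    Chain G s θ η h₀ p q b S → (∀ l, η l = LP h l (∑ k ∈ near l, η k)) →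
    ∀ N : ℝ, (∀ K : Finset ℕ, ∑ k ∈ K, S k ≤ N) → ∃ f F E, Dec G (-s + 1) (-θ + 1) f F (C * √N) ∧
      (∀ l j, j ≤ l → WBox (G l) (LP h l (f l j)) (E l j)) ∧
      (∀ l, Loc l (η l - partSum E l)) ∧
      ∀ K : Finset ℕ, ∑ l ∈ K, ((𝟚 ^ l) ^ (-s) * ‖η l - partSum E l‖) ^ 2 ≤ C ^ 2 * N := by
  obtain ⟨C1, hC1, H1⟩ := exists_transfer h hG s θ
  obtain ⟨C2, hC2, H2⟩ := exists_piece h hG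
  obtain ⟨Cp, hCp, Hp⟩ := exists_norm_LP_le (n := n) h
  set R : ℝ := 2 ^ (4 * |s|) with hR
  have hR0 : 0 < R := by positivity
  set x : ℝ := 2 ^ (2 * θ - 1) with hx
  have hx0 : 0 < x := by positivity
  have hx1 : x < 1 := Real.rpow_lt_one_of_one_lt_of_neg (by norm_num) (by linarith)
  have hR1 : 0 ≤ (1 - x)⁻¹ := inv_nonneg.2 (by linarith [hx1])
  set D := (1 + 2 * C2) * C1 with hD
  have hD0 : 0 ≤ D := by positivity
  set K0 := Cp * R + D * √(1 - x)⁻¹ with hK0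
  have hK00 : 0 ≤ K0 := by positivity
  refine ⟨6 * C1 + 3 * K0, by positivity, ?_⟩
  intro η h₀ p q b S hc hη N hN
  have hN0 : 0 ≤ N := by simpa using hN ∅
  have hS0 (k) : 0 ≤ S k := by simpa using hc.sum_b k 0
  have hS3 (L) := sum_near_le hS0 hN L
  have near_iff {k l : ℕ} : k ∈ near l ↔ k ≤ l + 1 ∧ l ≤ k + 1 := by
    rw [near, Finset.mem_Icc]; omega
  have hPL (k l j : ℕ) : ∃ P L : L2 n, k ∈ near l → j ≤ l → WBox (G l) P L ∧
      2 ^ l * 2 ^ j * ‖P‖ ≤ (𝟚 ^ l) ^ s * (2 ^ j) ^ θ * (C1 * b k j) ∧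
      ‖L‖ ≤ (𝟚 ^ l) ^ s * (2 ^ j) ^ θ * (C1 * b k j) ∧
      √(2 ^ j) * ‖LP h l L - LP h l (q k j)‖ ≤ (𝟚 ^ l) ^ s * (2 ^ j) ^ θ * (C1 * b k j) := by
    by_cases hk : k ∈ near l ∧ j ≤ l
    · obtain ⟨P, L, hP⟩ := H1 k l j (near_iff.1 hk.1).1 (near_iff.1 hk.1).2 hk.2 _ _ _ (hc.dual k j)
        (hc.norm_p k j) (hc.norm_q k j) (hc.nonneg k j)
      exact ⟨P, L, fun _ _ => hP⟩
    · exact ⟨0, 0, fun h1 h2 => absurd ⟨h1, h2⟩ hk⟩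
  choose P L hPL using hPL
  set f : ℕ → ℕ → L2 n := fun l j => ∑ k ∈ near l, P k l j with hf
  set F : ℕ → ℕ → L2 n := fun l j => ∑ k ∈ near l, L k l j with hF
  set β : ℕ → ℕ → ℝ := fun l j => ∑ k ∈ near l, b k j with hβ
  have hβ0 (l j) : 0 ≤ β l j := sum_nonneg fun k _ => hc.nonneg k j
  have hsumX (l j : ℕ) : ∑ k ∈ near l, (𝟚 ^ l) ^ s * (2 ^ j) ^ θ * (C1 * b k j) =
      (𝟚 ^ l) ^ s * (2 ^ j) ^ θ * (C1 * β l j) := by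
    rw [hβ, mul_sum, mul_sum]
  have hf1 (l j) (hj : j ≤ l) :
      2 ^ l * 2 ^ j * ‖f l j‖ ≤ (𝟚 ^ l) ^ s * (2 ^ j) ^ θ * (C1 * β l j) := by
    calc _ ≤ 2 ^ l * 2 ^ j * ∑ k ∈ near l, ‖P k l j‖ := by gcongr; exact norm_sum_le _ _
      _ ≤ _ := by
        rw [mul_sum, ← hsumX]
        exact sum_le_sum fun k hk => (hPL k l j hk hj).2.1
  have hF1 (l j) (hj : j ≤ l) :
      ‖F l j‖ ≤ (𝟚 ^ l) ^ s * (2 ^ j) ^ θ * (C1 * β l j) := by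
    rw [← hsumX]
    exact norm_sum_le_of_le _ fun k hk => (hPL k l j hk hj).2.2.1
  have hbox (l j) (hj : j ≤ l) : WBox (G l) (f l j) (F l j) :=
    WBox.sum _ fun k hk => (hPL k l j hk hj).1
  have hβsq (l : ℕ) : ∑ j ∈ Finset.range (l + 1), β l j ^ 2 ≤ 3 * ∑ k ∈ near l, S k := by
    calc _ ≤ ∑ j ∈ Finset.range (l + 1), 3 * ∑ k ∈ near l, b k j ^ 2 :=
          sum_le_sum fun j _ => sq_sum_near_le l _
      _ ≤ _ := by
        rw [← mul_sum, sum_comm]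
        gcongr with k
        exact hc.sum_b k _
  have hE (l j : ℕ) : ∃ E : L2 n, j ≤ l → WBox (G l) (LP h l (f l j)) E ∧
      ‖E - LP h l (F l j)‖ ≤ C2 * (2 ^ l * ‖f l j‖ + (2 ^ l)⁻¹ * ‖F l j‖) := by
    by_cases hj : j ≤ l
    · obtain ⟨d, e, hj', -, h1⟩ := H2 l _ _ (hbox l j hj)
      exact ⟨_, fun _ => ⟨hj'.wBox hG l, h1⟩⟩
    · exact ⟨0, fun hj' => absurd hj' hj⟩
  choose E hE using hE
  have hd : Dec G (-s + 1) (-θ + 1) f F ((6 * C1 + 3 * K0) * √N) := by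
    refine ⟨by positivity, hbox, fun K => ?_⟩
    calc _ ≤ ∑ l ∈ K, ∑ j ∈ Finset.range (l + 1), (2 * (C1 * β l j)) ^ 2 := by
          refine sum_le_sum fun l _ => sum_le_sum fun j hj => ?_
          have hj := mem_range_succ_iff.1 hj
          exact pow_le_pow_left₀ (pN_nonneg ..) (pN_le (mul_nonneg hC1 (hβ0 l j)) (hf1 l j hj) (hF1 l j hj)) 2
      _ = (2 * C1) ^ 2 * ∑ l ∈ K, ∑ j ∈ Finset.range (l + 1), β l j ^ 2 := by
          simp only [mul_sum, ← mul_assoc, mul_pow]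
      _ ≤ (2 * C1) ^ 2 * (3 * (3 * N)) := by
          gcongr
          refine (sum_le_sum fun l _ => hβsq l).trans ?_
          rw [← mul_sum]
          gcongr
          exact hS3 K
      _ = (6 * C1) ^ 2 * N := by ring
      _ ≤ (6 * C1 + 3 * K0) ^ 2 * N := by gcongr; linarith
      _ = _ := by rw [mul_pow, sq_sqrt hN0]
  refine ⟨f, F, E, hd, fun l j hj => (hE l j hj).1, fun l => ?_, fun K => ?_⟩
  · have h1 := Loc_partSum_box h hG hd (fun l j hj => (hE l j hj).1) l
    have h2 : Loc l (η l) := by rw [hη]; exact Loc_LP h l _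
    rw [Loc, map_sub, map_sub, h1, h2]
  have hy (l : ℕ) : (𝟚 ^ l) ^ (-s) * ‖η l - partSum E l‖ ≤
      K0 * √(3 * ∑ k ∈ near l, S k) := by
    have hl0 : (0 : ℝ) < 2 ^ l := by positivity
    have e1 : η l - partSum E l = LP h l (∑ k ∈ near l, h₀ k) +
        ∑ j ∈ Finset.range (l + 1), (∑ k ∈ near l, LP h l (q k j) - E l j) := by
      have : ∑ k ∈ near l, η k = ∑ k ∈ near l, h₀ k +
          ∑ j ∈ Finset.range (l + 1), ∑ k ∈ near l, q k j := by
        rw [sum_comm, ← sum_add_distrib]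
        exact sum_congr rfl fun k hk => hc.eq k (l + 1) (near_iff.1 hk).1
      rw [hη l, this, map_add, sum_sub_distrib, partSum, add_sub_assoc]
      simp only [map_sum]
    have b1 : (𝟚 ^ l) ^ (-s) * ‖LP h l (∑ k ∈ near l, h₀ k)‖ ≤
        Cp * R * √(3 * ∑ k ∈ near l, S k) := by
      calc _ ≤ (𝟚 ^ l) ^ (-s) * (Cp * ∑ k ∈ near l, R * (2 ^ l) ^ s * √(S k)) := by
            gcongr
            refine (Hp _ _).trans ?_
            gcongr
            refine norm_sum_le_of_le _ fun k hk => (hc.norm_h k).trans ?_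
            have := near_iff.1 hk
            gcongr
            exact two_pow_rpow_le (by omega) (by omega) s
        _ = Cp * R * ∑ k ∈ near l, √(S k) := by
            rw [← mul_sum, rpow_neg hl0.le]; field_simp
        _ ≤ _ := by
            gcongr
            refine Real.le_sqrt_of_sq_le ((sq_sum_near_le l _).trans (le_of_eq ?_))
            simp only [sq_sqrt (hS0 _)]
    have b2 (j : ℕ) (hj : j ≤ l) : (𝟚 ^ l) ^ (-s) * ‖∑ k ∈ near l, LP h l (q k j) - E l j‖ ≤
        D * ((2 ^ j) ^ θ / √(2 ^ j) * β l j) := by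
      set X := (𝟚 ^ l) ^ s * (2 ^ j) ^ θ * (C1 * β l j) with hX
      have hj0 : (0 : ℝ) < 2 ^ j := by positivity
      have hj1 : (1 : ℝ) ≤ 2 ^ j := one_le_pow₀ (by norm_num)
      have hsj : √(𝟚 ^ j) ≤ 2 ^ j :=
        Real.sqrt_le_iff.2 ⟨hj0.le, by rw [pow_two]; exact le_mul_of_one_le_right hj0.le hj1⟩
      have hjl : 𝟚 ^ j ≤ 2 ^ l := pow_le_pow_right₀ (by norm_num) hj
      have hX0 : 0 ≤ X := (norm_nonneg _).trans (hF1 l j hj)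
      have c1 : √(2 ^ j) * ‖∑ k ∈ near l, LP h l (q k j) - LP h l (F l j)‖ ≤ X := by
        rw [hF, map_sum, ← sum_sub_distrib, hX, ← hsumX]
        refine (mul_le_l (norm_sum_le _ _) (sqrt_nonneg _)).trans ?_
        rw [mul_sum]
        refine sum_le_sum fun k hk => ?_
        rw [norm_sub_rev]
        exact (hPL k l j hk hj).2.2.2
      have c2 : √(2 ^ j) * ‖LP h l (F l j) - E l j‖ ≤ 2 * C2 * X := by
        rw [norm_sub_rev]
        have d1 : √(2 ^ j) * (2 ^ l * ‖f l j‖) ≤ X := by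
          refine le_trans ?_ (hf1 l j hj)
          calc _ ≤ 2 ^ j * (2 ^ l * ‖f l j‖) := by gcongr
            _ = _ := by ring
        have d2 : √(2 ^ j) * ((2 ^ l)⁻¹ * ‖F l j‖) ≤ X := by
          rw [mul_left_comm, inv_mul_le_iff₀ hl0]
          exact mul_le_mul (hsj.trans hjl) (hF1 l j hj) (norm_nonneg _) hl0.le
        calc _ ≤ √(2 ^ j) * (C2 * (2 ^ l * ‖f l j‖ + (2 ^ l)⁻¹ * ‖F l j‖)) := by
              gcongr; exact (hE l j hj).2
          _ = C2 * (√(2 ^ j) * (2 ^ l * ‖f l j‖) + √(2 ^ j) * ((2 ^ l)⁻¹ * ‖F l j‖)) := by ring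
          _ ≤ C2 * (X + X) := by gcongr
          _ = _ := by ring
      have c3 : √(2 ^ j) * ‖∑ k ∈ near l, LP h l (q k j) - E l j‖ ≤ (1 + 2 * C2) * X := by
        have := norm_sub_le_norm_sub_add_norm_sub (∑ k ∈ near l, LP h l (q k j)) (LP h l (F l j)) (E l j)
        have := mul_le_l this (sqrt_nonneg (𝟚 ^ j))
        linarith
      rw [rpow_neg hl0.le, inv_mul_le_iff₀ (by positivity)]
      have hs0 : 0 < √(𝟚 ^ j) := Real.sqrt_pos.2 hj0
      rw [← le_div_iff₀' hs0] at c3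
      refine c3.trans (le_of_eq ?_)
      rw [hX, hD]
      field_simp
    have hgeo : ∑ j ∈ Finset.range (l + 1), ((𝟚 ^ j) ^ θ / √(2 ^ j)) ^ 2 ≤ (1 - x)⁻¹ := by
      have e (i : ℕ) : ((𝟚 ^ i) ^ θ / √(2 ^ i)) ^ 2 = x ^ i := by
        rw [sqrt_eq_rpow, ← Real.rpow_sub (by positivity), sq_two_pow_rpow, hx]; ring_nf
      simp only [e]
      exact sum_geom_le hx0 hx1 (Set.injOn_id _)
    calc _ ≤ (𝟚 ^ l) ^ (-s) * (‖LP h l (∑ k ∈ near l, h₀ k)‖ +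
            ∑ j ∈ Finset.range (l + 1), ‖∑ k ∈ near l, LP h l (q k j) - E l j‖) := by
          rw [e1]; gcongr; exact norm_add_le_of_le le_rfl (norm_sum_le _ _)
      _ ≤ Cp * R * √(3 * ∑ k ∈ near l, S k) +
            D * ∑ j ∈ Finset.range (l + 1), (2 ^ j) ^ θ / √(2 ^ j) * β l j := by
          rw [mul_add, mul_sum, mul_sum _ _ D]
          exact add_le_add b1 (sum_le_sum fun j hj => b2 j (mem_range_succ_iff.1 hj))
      _ ≤ Cp * R * √(3 * ∑ k ∈ near l, S k) +
            D * (√(1 - x)⁻¹ * √(3 * ∑ k ∈ near l, S k)) := by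
          gcongr
          refine (Real.sum_mul_le_sqrt_mul_sqrt _ _ _).trans ?_
          gcongr
          exact hβsq l
      _ = _ := by rw [hK0]; ring
  calc _ ≤ ∑ l ∈ K, K0 ^ 2 * (3 * ∑ k ∈ near l, S k) := by
        refine sum_le_sum fun l _ => (pow_le_pow_left₀ (by positivity) (hy l) 2).trans (le_of_eq ?_)
        rw [mul_pow, sq_sqrt (mul_nonneg (by norm_num) (sum_nonneg fun k _ => hS0 k))]
    _ ≤ K0 ^ 2 * (3 * (3 * N)) := by
        rw [← mul_sum, ← mul_sum]
        gcongr
        exact hS3 K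
    _ = (3 * K0) ^ 2 * N := by ring
    _ ≤ _ := by gcongr; linarith

end Decomp

section Main

variable {g : Fin (n + 1) → Fin (n + 1) → ST n → ℝ} (hγ : Coef (GT h g) B c k₀ CΓ)

theorem Dec.mono {G : ℕ → Λ → Λ → ST n → ℝ} {s θ A A' : ℝ}
    {v U : ℕ → ℕ → L2 n} (hv : Dec G s θ v U A) (hA : A ≤ A') : Dec G s θ v U A' :=
  ⟨hv.nonneg.trans hA, hv.box, fun K => (hv.sum_le K).trans (pow_le_pow_left₀ hv.nonneg hA 2)⟩

include hγ

theorem exists_normXNeg_le (s : ℝ) {θ : ℝ} (hθ' : θ < 1 / 2) : ∃ C : ℝ, 0 ≤ C ∧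
    ∀ (T : XSum φ g s θ →ₗ[ℂ] ℂ) (M : ℝ≥0),
      (∀ u : XSum φ g s θ, ‖T u‖ₑ ≤ M * normSum φ g s θ u) → ∃ f : 𝓣',
        (∀ ψ, f ψ = T ⟨tD ψ, tD_mem h hγ s θ ψ⟩) ∧
        normXNeg φ g (-s) (-θ) f ≤ ofReal (C * M) := by
  obtain ⟨C1, hC1, H1⟩ := exists_pieces (n := n) h ((s + θ) / 2)
  obtain ⟨C2, hC2, H2⟩ := exists_decomp h hγ s hθ'
  set R : ℝ := 2 ^ (8 * |-(s / 2)|) with hR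
  have hR0 : 0 < R := by positivity
  set K0 := √(16 * (1 + C1)) with hK0
  refine ⟨2 * ((C2 + √7 * R * C2) * K0), by positivity, fun T M hT => ?_⟩
  have hM := M.coe_nonneg
  obtain ⟨q, hqM, hq⟩ := exists_rep h hγ hT
  obtain ⟨η, hη, hη2, hη3, hη4⟩ := H1 q
  obtain ⟨h₀, p, q', b, S, hc, hS⟩ := exists_chain (s := s) (θ := θ) (by linarith) hM
    (fun v U A hv K => norm_sum_bil_pieces_le h hγ hT hq hη hv K) (N := C1 * M ^ 2) fun K => by
      have := hη2 K
      rw [mul_div_cancel₀ _ two_ne_zero] at this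
      exact this.trans (by gcongr)
  obtain ⟨f, F, E, hd, hE, hloc, hsum⟩ := H2 η h₀ p q' b S hc hη3 _ hS
  have hN : √(16 * ((M : ℝ) ^ 2 + C1 * M ^ 2)) = K0 * M := by
    rw [show 16 * ((M : ℝ) ^ 2 + C1 * M ^ 2) = 16 * (1 + C1) * M ^ 2 by ring,
      sqrt_mul (by positivity), sqrt_sq hM]
  have hN' : 16 * ((M : ℝ) ^ 2 + C1 * M ^ 2) = (K0 * M) ^ 2 := by
    rw [← hN, sq_sqrt (by positivity)]
  rw [hN] at hd
  clear_value K0 R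
  set y := fun l => η l - partSum E l with hy
  have hsq (K : Finset ℕ) : ∑ l ∈ K, ‖lift (-(s / 2)) l (y l)‖ ^ 2 ≤ (R * C2 * (K0 * M)) ^ 2 := by
    calc _ ≤ ∑ l ∈ K, R ^ 2 * ((𝟚 ^ l) ^ (-s) * ‖y l‖) ^ 2 := by
          refine sum_le_sum fun l _ => ?_
          rw [← mul_pow]
          refine pow_le_pow_left₀ (norm_nonneg _) ((norm_lift_le _ _ _).trans (le_of_eq ?_)) 2
          rw [← hR, mul_neg, mul_div_cancel₀ _ two_ne_zero, mul_assoc]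
      _ ≤ R ^ 2 * (C2 ^ 2 * (K0 * M) ^ 2) := by
          rw [← mul_sum, ← hN']
          exact mul_le_l (hsum K) (by positivity)
      _ = _ := by ring
  have hsm := summable_of_sum_le (fun l => sq_nonneg ‖lift (-(s / 2)) l (y l)‖) hsq
  obtain ⟨w1, w2⟩ := summable_shell (fun l => mulOp_lift _ l (y l)) hsm
  set W₀ := ∑' l, lift (-(s / 2)) l (y l) with hW₀
  have hK0' : 0 ≤ K0 := by rw [hK0]; positivity
  have hWn : ‖W₀‖ ≤ √7 * R * C2 * (K0 * M) := by
    refine le_of_sq_le_sq (w2.trans ?_) (by positivity)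
    calc _ ≤ 7 * (R * C2 * (K0 * M)) ^ 2 := by gcongr; exact hsm.tsum_le_of_sum_le hsq
      _ = √7 ^ 2 * (R * C2 * (K0 * M)) ^ 2 := by rw [sq_sqrt (by norm_num)]
      _ = _ := by ring
  refine ⟨dist ((s + θ) / 2) (refl q), fun ψ => ?_, ?_⟩
  · rw [rep_tD h hγ hq, dist_apply, bil_refl]
  have hs0 : 0 ≤ √7 * R * C2 := by positivity
  have hKM : 0 ≤ K0 * M := by positivity
  have := normXNeg_le (M := (C2 + √7 * R * C2) * K0 * M) h hγ (f := dist ((s + θ) / 2) (refl q))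
    (hWn.trans (by nlinarith)) (hd.mono (by nlinarith)) hE fun ψ => by
      have e (l : ℕ) : bil (partSum E l) (tst ψ) =
          bil (η l) (tst ψ) - bil (lift (-(s / 2)) l (y l)) (Wt (s / 2) ψ) := by
        have := dist_lift (ρ := -(s / 2)) (hloc l) ψ
        rw [neg_neg, dist_apply] at this
        rw [this, map_sub, sub_apply, sub_sub_cancel]
      simp only [e]
      rw [dist_apply, dist_apply, bil_refl]
      exact (hη4 ψ).sub (w1.hasSum.mapL (bil.flip (Wt (s / 2) ψ)))
  rwa [mul_assoc 2, mul_assoc _ K0, ← mul_assoc _ K0]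

end Main

theorem exists_equiv_boundedDual {N N' : 𝓣' → ℝ≥0∞} {X : Submodule ℂ 𝓣'}
    {t : 𝓣 → X} {C₁ C₂ : ℝ} (hC₁ : 0 < C₁) (hC₂ : 0 ≤ C₂)
    (H₁ : ∀ (f : 𝓣') (M : ℝ), N' f < ofReal M → ∃ T : X →ₗ[ℂ] ℂ,
      (∀ ψ, T (t ψ) = f ψ) ∧ ∀ u : X, ‖T u‖ₑ ≤ ofReal (C₁ * M) * N u)
    (H₂ : ∀ (T : X →ₗ[ℂ] ℂ) (M : ℝ≥0), (∀ u : X, ‖T u‖ₑ ≤ M * N u) →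
      ∃ f : 𝓣', (∀ ψ, f ψ = T (t ψ)) ∧ N' f ≤ ofReal (C₂ * M))
    (H₀ : ∀ {T : X →ₗ[ℂ] ℂ} {M : ℝ≥0}, (∀ u : X, ‖T u‖ₑ ≤ M * N u) → (∀ ψ, T (t ψ) = 0) → T = 0) :
    ∃ Φ : finiteSpace N' ≃ₗ[ℂ] boundedDual N X,
      (∀ ψ f, (Φ f : X →ₗ[ℂ] ℂ) (t ψ) = (f : 𝓣') ψ) ∧
      ∃ C : ℝ≥0, ∀ f : finiteSpace N', dualNorm N (Φ f : X →ₗ[ℂ] ℂ) ≤ C * N' f ∧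
        N' f ≤ C * dualNorm N (Φ f : X →ₗ[ℂ] ℂ) := by
  have hex (T : boundedDual N X) : ∃ f : finiteSpace N', ∀ ψ, (f : 𝓣') ψ =
      (T : X →ₗ[ℂ] ℂ) (t ψ) := by
    obtain ⟨M, hM⟩ := T.2
    obtain ⟨f, h1, h2⟩ := H₂ T M hM
    exact ⟨⟨f, Submodule.subset_span (h2.trans_lt ENNReal.ofReal_lt_top)⟩, h1⟩
  choose Ψ₀ hΨ₀ using hex
  let Ψ : boundedDual N X →ₗ[ℂ] finiteSpace N' :=
    { toFun := Ψ₀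
      map_add' := fun T T' => by
        refine Subtype.ext (DFunLike.ext _ _ fun ψ => ?_)
        change _ = (Ψ₀ T : 𝓣') ψ + (Ψ₀ T' : 𝓣') ψ
        rw [hΨ₀, hΨ₀, hΨ₀]
        rfl
      map_smul' := fun a T => by
        refine Subtype.ext (DFunLike.ext _ _ fun ψ => ?_)
        change _ = a • (Ψ₀ T : 𝓣') ψ
        rw [hΨ₀, hΨ₀]
        rfl }
  have hinj : Function.Injective Ψ := (injective_iff_map_eq_zero Ψ).2 fun T hT => by
    obtain ⟨M, hM⟩ := T.2
    refine Subtype.ext (H₀ hM fun ψ => ?_)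
    rw [← hΨ₀ T ψ]
    exact DFunLike.congr_fun (congrArg Subtype.val hT) ψ
  have hgen (f : finiteSpace N') (M : ℝ) (hf : N' f < ofReal M) : ∃ T : boundedDual N X, Ψ T = f ∧
      ∀ u : X, ‖(T : X →ₗ[ℂ] ℂ) u‖ₑ ≤ ofReal (C₁ * M) * N u := by
    obtain ⟨T, h1, h2⟩ := H₁ f M hf
    refine ⟨⟨T, (C₁ * M).toNNReal, h2⟩, Subtype.ext (DFunLike.ext _ _ fun ψ => ?_), h2⟩
    exact (hΨ₀ _ ψ).trans (h1 ψ)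
  have hsurj : Function.Surjective Ψ := fun f => by
    have key : finiteSpace N' ≤
        (LinearMap.range Ψ).map (finiteSpace N').subtype := by
      refine Submodule.span_le.2 fun f hf => ?_
      have hf' : f ∈ finiteSpace N' := Submodule.subset_span hf
      obtain ⟨T, hT, -⟩ := hgen ⟨f, hf'⟩ ((N' f).toReal + 1) (by
        nth_rw 1 [← ofReal_toReal (ne_of_lt hf)]
        exact (ENNReal.ofReal_lt_ofReal_iff ✓).2 ✓)
      exact ⟨_, ⟨T, hT⟩, rfl⟩
    obtain ⟨_, ⟨T, rfl⟩, hT⟩ := key f.2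
    exact ⟨T, Subtype.ext hT⟩
  let e := LinearEquiv.ofBijective Ψ ⟨hinj, hsurj⟩
  have he (f) : Ψ (e.symm f) = f := e.apply_symm_apply f
  refine ⟨e.symm, fun ψ f => ?_, (C₁ + C₂ + 1).toNNReal, fun f => ⟨?_, ?_⟩⟩
  · rw [← hΨ₀, ← he f]
    change _ = (Ψ₀ _ : 𝓣') ψ
    rw [he f]
  · refine (le_ofReal_mul_of_forall_lt hC₁ fun M hM => ?_).trans
      (mul_le_mul_left (ofReal_le_ofReal ✓) _)
    obtain ⟨T, hT, h2⟩ := hgen f M hM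
    rw [← hT, show e.symm (Ψ T) = T from e.symm_apply_apply T]
    exact iInf₂_le (C₁ * M).toNNReal h2
  · change _ ≤ ofReal (C₁ + C₂ + 1) * _
    rw [← ENNReal.div_le_iff' (ENNReal.ofReal_pos.2 (by linarith)).ne' ENNReal.ofReal_ne_top]
    refine le_iInf₂ fun M hM => ?_
    rw [ENNReal.div_le_iff' (ENNReal.ofReal_pos.2 (by linarith)).ne' ENNReal.ofReal_ne_top]
    obtain ⟨f', h1, h2⟩ := H₂ _ M hM
    have : f' = f := DFunLike.ext _ _ fun ψ => by
      rw [h1, ← hΨ₀ (e.symm f) ψ]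
      exact DFunLike.congr_fun (congrArg Subtype.val (he f)) ψ
    rw [← this]
    refine h2.trans ?_
    rw [ENNReal.ofReal_mul hC₂, ENNReal.ofReal_coe_nnreal]
    exact mul_le_mul_left (ofReal_le_ofReal (by linarith)) _

end WaveX

end

theorem mainTheorem7 (n : ℕ) (hn : 0 < n) (φ : ℝ → ℝ) (hφ : WaveX.IsLPProfile φ)
    (g : Fin (n + 1) → Fin (n + 1) → WaveX.ST n → ℝ) (hg : WaveX.Admissible g)
    (s θ : ℝ) (hθ : 0 < θ) (hθ' : θ < 1 / 2) :
    ∃ Φ : WaveX.XNeg φ g (-s) (-θ) ≃ₗ[ℂ]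
        WaveX.boundedDual (WaveX.normSum φ g s θ) (WaveX.XSum φ g s θ),
      (∀ ψ : 𝓓(WaveX.slab n, ℝ), ∃ u : WaveX.XSum φ g s θ,
        (∀ χ : 𝓓(WaveX.slab n, ℝ),
          (u : 𝓓'(WaveX.slab n, ℂ)) χ = ∫ z, (ψ z : ℂ) * (χ z : ℂ) ∂(WaveX.slabMeasure n)) ∧
        ∀ f : WaveX.XNeg φ g (-s) (-θ),
          (Φ f : WaveX.XSum φ g s θ →ₗ[ℂ] ℂ) u = (f : 𝓓'(WaveX.slab n, ℂ)) ψ) ∧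
      ∃ C : ℝ≥0, ∀ f : WaveX.XNeg φ g (-s) (-θ),
        WaveX.dualNorm (WaveX.normSum φ g s θ) (Φ f : WaveX.XSum φ g s θ →ₗ[ℂ] ℂ)
          ≤ C * WaveX.normXNeg φ g (-s) (-θ) f ∧
        WaveX.normXNeg φ g (-s) (-θ) f
          ≤ C * WaveX.dualNorm (WaveX.normSum φ g s θ) (Φ f : WaveX.XSum φ g s θ →ₗ[ℂ] ℂ) := by
  obtain ⟨B, c, k₀, CΓ, hG⟩ := WaveX.exists_coef hφ hg
  obtain ⟨C₁, hC₁, H₁⟩ := WaveX.exists_functional_of_normXNeg hφ hG s hθ hθ'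
  obtain ⟨C₂, hC₂, H₂⟩ := WaveX.exists_normXNeg_le hφ hG s hθ'
  obtain ⟨Φ, h1, h2⟩ := WaveX.exists_equiv_boundedDual hC₁ hC₂ H₁ H₂ (WaveX.eq_zero_of_tD hφ hG hθ)
  refine ⟨Φ, fun ψ => ⟨⟨WaveX.tD ψ, WaveX.tD_mem hφ hG s θ ψ⟩, fun χ => ?_, h1 ψ⟩, h2⟩
  refine (WaveX.tD_apply ψ χ).trans ?_
  rw [WaveX.bil_tst]
  refine integral_congr_ae ?_
  filter_upwards [WaveX.coeFn_tst ψ] with z hz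
  rw [hz]
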